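/- Let $K$ be a field of characteristic $\ne 2$ with an involution $a\mapsto\bar a$ (an additive and multiplicative bijection with $\bar{\bar a}=a$, possibly the identity). For a matrix $A=[a_{ij}]$ put $A^*=[\bar a_{ji}]$; for $f=a_0x^n+\dots+a_n\in K[x]$ put $\bar f=\bar a_0x^n+\dots+\bar a_n$ and, if $a_n\ne0$, $f^\vee(x)=\bar a_n^{-1}(\bar a_nx^n+\dots+\bar a_1x+\bar a_0)$. A sesquilinear form is additive in both arguments, with $A(va,u)=\bar a A(v,u)$ and $A(v,ua)=A(v,u)a$; its matrix in a basis $(e_i)$ is $[A(e_i,e_j)]$. A Frobenius block $\Phi$ is the companion matrix $$\Phi=\begin{bmatrix}0&&0&-c_n\\1&\ddots&&\vdots\\&\ddots&0&-c_2\\0&&1&-c_1\end{bmatrix}$$ whose characteristic polynomial $\chi_\Phi=x^n+c_1x^{n-1}+\dots+c_n$ equals $p_\Phi^s$ with $s\ge1$ and $p_\Phi$ monic irreducible over $K$. For every Frobenius block $\Phi$ for which there is a nonsingular matrix $X$ with $X=X^*\Phi$, fix one such matrix and denote it by $\sqrt[*]{\Phi}$; otherwise we say that $\sqrt[*]{\Phi}$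 does not exist. If $\sqrt[*]{\Phi}$ exists, then $p_\Phi=p_\Phi^\vee$, and the field $K[\kappa]=K[x]/p_\Phi K[x]$ (where $\kappa$ is the class of $x$) has the involution $f(\kappa)^\circ=\bar f(\kappa^{-1})$. Let $\deg p_\Phi$ be $2r$ or $2r+1$. We say that $q$ is an admissible function for $\Phi$ if $$q(x)=\bar a_rx^{-r}+\dots+\bar a_1x^{-1}+a_0+a_1x+\dots+a_rx^r\ne0,\qquad a_0=\bar a_0,\ a_1,\dots,a_r\in K,$$ and if, when $\deg p_\Phi=2r$: (a) $a_r=0$ if the involution on $K$ is the identity; (b) $a_r=\bar a_r$ if the involution is not the identity and $p_\Phi(0)\ne1$; (c) $a_r=-\bar a_r$ if the involution is not the identity and $p_\Phi(0)=1$. **Theorem 3.** For every sesquilinear form on a finite-dimensional vector space over $K$ there is a basis in which its matrix is a direct sum of matrices of the following three types: (i) singular Jordan blocks $J_n(0)$, $n\ge1$ (ones on the first superdiagonal); (ii) $[\Phi\,\diagdown\,I]=\begin{bmatrix}0&I\\\Phi&0\end{bmatrix}$, where $\Phi$ is a nonsingular Frobenius block for which $\sqrt[*]{\Phi}$ does not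 exist, and $I$ is the identity matrix of the same size; (iii) $\sqrt[*]{\Phi}\,q(\Phi)$, where $\Phi$ is a Frobenius block for which $\sqrt[*]{\Phi}$ exists and $q$ is an admissible function for $\Phi$. If the form has one such direct sum as its matrix in some basis, then another such direct sum is its matrix in some basis if and only if the second is obtained from the first by a permutation of summands and the following replacements (so that the summands of type (i) are uniquely determined): * in type (ii), replacement of a block $\Phi$ by the Frobenius block $\Psi$ with $\chi_\Psi=\chi_\Phi^\vee$; * in type (iii), replacement of the whole group $\sqrt[*]{\Phi}\,q_1(\Phi)\oplus\dots\oplus\sqrt[*]{\Phi}\,q_m(\Phi)$ of summands with the same $\Phi$ by $\sqrt[*]{\Phi}\,q'_1(\Phi)\oplus\dots\oplus\sqrt[*]{\Phi}\,q'_m(\Phi)$, where the $q'_i$ are admissible functions for $\Phi$ and the Hermitian forms $\sum_i q_i(\kappa)x_i^\circ x_i$ and $\sum_i q'_i(\kappa)x_i^\circ x_i$ are equivalent over the field $K[\kappa]$ with the involution $^\circ$. In particular, if $K$ is algebraically closed with the identity involution, then the summands of type (iii) can be taken equal to $\sqrt[*]{\Phi}$. If $K$ is algebraically closed with nonidentity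 involution, or $K$ is real closed, then the summands of type (iii) can be taken equal to $\pm\sqrt[*]{\Phi}$. In these cases the summands are then uniquely determined by the form, up to permutation and up to the above replacement in type (ii). -/

import Mathlib

open Polynomial Matrix
open scoped LaurentPolynomial

noncomputable section

namespace SesqCanon

variable {K : Type*} [Field K] [StarRing K]

/-- For `f = a₀xⁿ + ⋯ + aₙ` with `aₙ = f(0) ≠ 0`, the polynomial
`f^∨ = āₙ⁻¹ (āₙ xⁿ + ⋯ + ā₁ x + ā₀)`. -/
def dualPoly (f : K[X]) : K[X] :=
  C (star (f.coeff 0))⁻¹ * (f.map (starRingEnd K)).reverse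

/-- A Frobenius block: the companion matrix of a power `p ^ s`, `s ≥ 1`, of a monic irreducible
polynomial `p`. It is recorded by `p` and `s`, which it determines. -/
structure FrobeniusBlock (K : Type*) [Field K] where
  p : K[X]
  s : ℕ
  monic : p.Monic
  irreducible : Irreducible p
  s_pos : 0 < s

namespace FrobeniusBlock

/-- The characteristic polynomial of the block. -/
def χ (Φ : FrobeniusBlock K) : K[X] := Φ.p ^ Φ.s

/-- The size of the block. -/
def dim (Φ : FrobeniusBlock K) : ℕ := Φ.χ.natDegree

/-- The block as a matrix: ones below the diagonal, and the last column consists of the negatives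
of the coefficients of `1, x, …, x ^ (n - 1)` in the characteristic polynomial. -/
def toMatrix (Φ : FrobeniusBlock K) : Matrix (Fin Φ.dim) (Fin Φ.dim) K :=
  Matrix.of fun i j =>
    if (j : ℕ) + 1 = Φ.dim then -Φ.χ.coeff i else if (i : ℕ) = j + 1 then 1 else 0

/-- The condition on a matrix to be a `∗`-root `∗√Φ` of the block:
`X` is nonsingular and `X = X^* Φ`. -/
def IsStarRoot (Φ : FrobeniusBlock K) (X : Matrix (Fin Φ.dim) (Fin Φ.dim) K) : Prop :=
  X.det ≠ 0 ∧ X = Xᴴ * Φ.toMatrix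

/-- `∗√Φ` exists. -/
def HasStarRoot (Φ : FrobeniusBlock K) : Prop := ∃ X, Φ.IsStarRoot X

instance (Φ : FrobeniusBlock K) : Fact (Irreducible Φ.p) := ⟨Φ.irreducible⟩

/-- The field `K[κ] = K[x] / p K[x]`. -/
abbrev ResidueField (Φ : FrobeniusBlock K) : Type _ := AdjoinRoot Φ.p

/-- The residue class `κ` of `x`. -/
def kappa (Φ : FrobeniusBlock K) : Φ.ResidueField := AdjoinRoot.root Φ.p

theorem eval₂_kappa_inv (Φ : FrobeniusBlock K) (h : dualPoly Φ.p = Φ.p) :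
    Φ.p.eval₂ ((AdjoinRoot.of Φ.p).comp (starRingEnd K)) Φ.kappa⁻¹ = 0 := by
  have hp0 : Φ.p.coeff 0 ≠ 0 := by
    intro h0
    apply Φ.irreducible.ne_zero
    rw [← h, dualPoly, h0]
    simp
  have hk0 : Φ.kappa ≠ 0 := by
    intro h0
    have h1 : Φ.p.eval₂ (AdjoinRoot.of Φ.p) Φ.kappa = 0 := AdjoinRoot.eval₂_root Φ.p
    rw [h0, eval₂_at_zero] at h1
    exact hp0 ((map_eq_zero _).1 h1)
  have h1 : (dualPoly Φ.p).eval₂ (AdjoinRoot.of Φ.p) Φ.kappa = 0 := by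
    rw [h]
    exact AdjoinRoot.eval₂_root Φ.p
  rw [dualPoly, eval₂_mul, eval₂_C, mul_eq_zero] at h1
  have h2 : (Φ.p.map (starRingEnd K)).reverse.eval₂ (AdjoinRoot.of Φ.p) Φ.kappa = 0 := by
    rcases h1 with h1 | h1
    · exact absurd ((map_eq_zero _).1 h1) (inv_ne_zero (star_ne_zero.2 hp0))
    · exact h1
  let _ : Invertible Φ.kappa⁻¹ := invertibleOfNonzero (inv_ne_zero hk0)
  have h3 := eval₂_reverse_eq_zero_iff (AdjoinRoot.of Φ.p) Φ.kappa⁻¹ (Φ.p.map (starRingEnd K))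
  rw [invOf_eq_inv, inv_inv] at h3
  rw [← eval₂_map]
  exact h3.1 h2

open Classical in
/-- The involution `f(κ)° = f̄(κ⁻¹)` on `K[κ]`. It is well defined if `p = p^∨`, which is the case
for every block that has a `∗`-root; it is only used for such blocks. -/
def involution (Φ : FrobeniusBlock K) : Φ.ResidueField →+* Φ.ResidueField :=
  if h : dualPoly Φ.p = Φ.p then
    AdjoinRoot.lift ((AdjoinRoot.of Φ.p).comp (starRingEnd K)) Φ.kappa⁻¹ (Φ.eval₂_kappa_inv h)
  else RingHom.id _

theorem involution_mk (Φ : FrobeniusBlock K) (h : dualPoly Φ.p = Φ.p) (f : K[X]) :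
    Φ.involution (AdjoinRoot.mk Φ.p f) =
      (f.map (starRingEnd K)).eval₂ (AdjoinRoot.of Φ.p) Φ.kappa⁻¹ := by
  rw [involution, dif_pos h, AdjoinRoot.lift_mk, eval₂_map]

/-- The value `q(Φ)` of a Laurent polynomial at a (nonsingular) block. -/
def evalMatrix (Φ : FrobeniusBlock K) (q : K[T;T⁻¹]) : Matrix (Fin Φ.dim) (Fin Φ.dim) K :=
  q.coeff.sum fun i a => a • Φ.toMatrix ^ i

/-- The value `q(κ)` of a Laurent polynomial. -/
def evalKappa (Φ : FrobeniusBlock K) (q : K[T;T⁻¹]) : Φ.ResidueField :=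
  q.coeff.sum fun i a => AdjoinRoot.of Φ.p a * Φ.kappa ^ i

/-- The Hermitian form `q₁(κ) x₁° y₁ + ⋯ + qₘ(κ) xₘ° yₘ` over `K[κ]`. -/
def hermForm (Φ : FrobeniusBlock K) (l : List K[T;T⁻¹])
    (x y : Fin l.length → Φ.ResidueField) : Φ.ResidueField :=
  ∑ i, Φ.evalKappa (l.get i) * Φ.involution (x i) * y i

/-- Equivalence over `K[κ]` of the Hermitian forms given by two lists of functions `qᵢ`. -/
def HermEquivalent (Φ : FrobeniusBlock K) (l l' : List K[T;T⁻¹]) : Prop :=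
  ∃ S : (Fin l.length → Φ.ResidueField) ≃ₗ[Φ.ResidueField] (Fin l'.length → Φ.ResidueField),
    ∀ x y, Φ.hermForm l' (S x) (S y) = Φ.hermForm l x y

end FrobeniusBlock

/-- The involution of `K` is the identity. -/
def TrivialInvolution (K : Type*) [Field K] [StarRing K] : Prop := ∀ a : K, star a = a

/-- Let `p` have degree `2r` or `2r + 1`. The Laurent polynomial `q` has the form
`ā_r x^{-r} + ⋯ + a₀ + ⋯ + a_r x^r` with `a₀ = ā₀`, and if `deg p = 2r`, then moreover
* `a_r = 0` if the involution on `K` is the identity;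
* `a_r = ā_r` if the involution is not the identity and `p(0) ≠ 1`;
* `a_r = -ā_r` if the involution is not the identity and `p(0) = 1`. -/
structure IsStationaryFunction (p : K[X]) (q : K[T;T⁻¹]) : Prop where
  symm : ∀ i : ℤ, q.coeff (-i) = star (q.coeff i)
  bounded : ∀ i : ℤ, ((p.natDegree / 2 : ℕ) : ℤ) < i → q.coeff i = 0
  even_a : Even p.natDegree → TrivialInvolution K →
    q.coeff ((p.natDegree / 2 : ℕ) : ℤ) = 0
  even_b : Even p.natDegree → ¬ TrivialInvolution K → p.coeff 0 ≠ 1 →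
    q.coeff ((p.natDegree / 2 : ℕ) : ℤ) = star (q.coeff ((p.natDegree / 2 : ℕ) : ℤ))
  even_c : Even p.natDegree → ¬ TrivialInvolution K → p.coeff 0 = 1 →
    q.coeff ((p.natDegree / 2 : ℕ) : ℤ) = -star (q.coeff ((p.natDegree / 2 : ℕ) : ℤ))

/-- The (labels of the) direct summands: `J_n(0)`, `[Φ ⧹ I]`, and `∗√Φ q(Φ)`. -/
inductive Summand (K : Type*) [Field K] : Type _
  | jordan (n : ℕ) : Summand K
  | skew (Φ : FrobeniusBlock K) : Summand K
  | root (Φ : FrobeniusBlock K) (q : K[T;T⁻¹]) : Summand K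

namespace Summand

/-- The conditions under which a summand is admitted. -/
def Admissible : Summand K → Prop
  | jordan n => 0 < n
  | skew Φ => Φ.toMatrix.det ≠ 0 ∧ ¬ Φ.HasStarRoot
  | root Φ q => Φ.HasStarRoot ∧ q ≠ 0 ∧ IsStationaryFunction Φ.p q

/-- The size of a summand. -/
def size : Summand K → ℕ
  | jordan n => n
  | skew Φ => Φ.dim + Φ.dim
  | root Φ _ => Φ.dim

/-- The matrix of a summand, where `R Φ` is the chosen `∗`-root of `Φ`. The skew sum `[Φ ⧹ I]` has
the identity in its upper right and `Φ` in its lower left corner. -/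
def toMatrix (R : ∀ Φ : FrobeniusBlock K, Matrix (Fin Φ.dim) (Fin Φ.dim) K) :
    (A : Summand K) → Matrix (Fin A.size) (Fin A.size) K
  | jordan n => Matrix.of fun i j : Fin n => if (i : ℕ) + 1 = j then 1 else 0
  | skew Φ => Matrix.reindex finSumFinEquiv finSumFinEquiv
      (Matrix.fromBlocks 0 (1 : Matrix (Fin Φ.dim) (Fin Φ.dim) K) Φ.toMatrix 0)
  | root Φ q => R Φ * Φ.evalMatrix q

/-- `some n` on `J_n(0)`. -/
def jordanSize? : Summand K → Option ℕ
  | jordan n => some n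
  | _ => none

/-- `some Φ` on `[Φ ⧹ I]`. -/
def skewBlock? : Summand K → Option (FrobeniusBlock K)
  | skew Φ => some Φ
  | _ => none

/-- `some (Φ, q)` on `∗√Φ q(Φ)`. -/
def rootData? : Summand K → Option (FrobeniusBlock K × K[T;T⁻¹])
  | root Φ q => some (Φ, q)
  | _ => none

open Classical in
/-- `some q` on `∗√Φ q(Φ)`, for the given `Φ`. -/
def rootFunction? (Φ : FrobeniusBlock K) : Summand K → Option K[T;T⁻¹]
  | root Ψ q => if Ψ = Φ then some q else none
  | _ => none

end Summand

/-- The direct sum of the matrices of the summands in a list. -/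
def directSum (R : ∀ Φ : FrobeniusBlock K, Matrix (Fin Φ.dim) (Fin Φ.dim) K)
    (D : List (Summand K)) :
    Matrix (Σ i : Fin D.length, Fin (D.get i).size) (Σ i : Fin D.length, Fin (D.get i).size) K :=
  Matrix.blockDiagonal' fun i => (D.get i).toMatrix R

/-- `M` is the matrix of the sesquilinear form `B` (semilinear in the first argument) in some basis
of the space. -/
def HasMatrix {V : Type*} [AddCommGroup V] [Module K V] (B : V →ₗ⋆[K] V →ₗ[K] K)
    {ι : Type*} (M : Matrix ι ι K) : Prop :=
  ∃ b : Module.Basis ι K V, ∀ i j, B (b i) (b j) = M i j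

/-- The summands `J_n(0)` are the same up to permutation. -/
def SameJordan (D D' : List (Summand K)) : Prop :=
  (D.filterMap Summand.jordanSize?).Perm (D'.filterMap Summand.jordanSize?)

/-- The summands `[Φ ⧹ I]` are the same up to permutation and replacements of a block `Φ` by the
block `Ψ` with `χ_Ψ = χ_Φ^∨`. -/
def SameSkew (D D' : List (Summand K)) : Prop :=
  Multiset.Rel (fun Φ Ψ : FrobeniusBlock K => Ψ = Φ ∨ Ψ.χ = dualPoly Φ.χ)
    (D.filterMap Summand.skewBlock? : Multiset (FrobeniusBlock K))
    (D'.filterMap Summand.skewBlock? : Multiset (FrobeniusBlock K))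

/-- The summands `∗√Φ q(Φ)` are the same up to permutation. -/
def SameRoot (D D' : List (Summand K)) : Prop :=
  (D.filterMap Summand.rootData?).Perm (D'.filterMap Summand.rootData?)

/-- For every `Φ`, the groups of all summands `∗√Φ q(Φ)` with this `Φ` correspond to equivalent
Hermitian forms over `K[κ]` (in particular, they have the same number of members). -/
def EquivalentRoot (D D' : List (Summand K)) : Prop :=
  ∀ Φ : FrobeniusBlock K,
    Φ.HermEquivalent (D.filterMap (Summand.rootFunction? Φ))
      (D'.filterMap (Summand.rootFunction? Φ))

/-- All summands are admitted. -/
def IsCanonical (D : List (Summand K)) : Prop := ∀ A ∈ D, A.Admissible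

/-- All summands are admitted, and every function `q` occurring in a summand `∗√Φ q(Φ)` belongs
to `Q`. For `Q = {1}` these summands are the `∗√Φ`, for `Q = {1, -1}` they are the `±∗√Φ`. -/
def IsCanonicalWith (Q : Set K[T;T⁻¹]) (D : List (Summand K)) : Prop :=
  IsCanonical D ∧ ∀ Φ q, Summand.root Φ q ∈ D → q ∈ Q

end SesqCanon

end

open Polynomial Matrix
open scoped LaurentPolynomial

set_option linter.unusedSectionVars false

noncomputable section

namespace SesqCanon

variable {K : Type*} [Field K] [StarRing K]

/-! ### Congruence of matrices -/

section Congruence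

/-! The degenerate part of a form is controlled by iterated right orthogonal complements. Let X₁ be
the right radical and X₂ its right orthogonal complement. The form induced on X₂/X₁ lives on a
smaller space, and the singular Jordan blocks of the whole form come from those of X₂/X₁ by putting
two vectors in front of each chain and adding some new blocks of sizes 1 and 2, while the
nonsingular part is unchanged (`HasSingularDecomp.of_step`). Conversely, the dimensions of the
iterated complements of the whole space determine the block sizes, and a late complement of even
index recovers the nonsingular part up to congruence (`singular_unique`).

A nondegenerate form B has a cosquare τ, defined by B(u, v) = conj B(τv, u). It is an isometry, so
the adjoint of f(τ) is f̄(τ⁻¹). The cyclic module of a block Φ with characteristic polynomial χ =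
p^s is the local Frobenius algebra E = K[x]/χ with maximal ideal (π) and socle (π^(s-1)). The
equation X = X^*Φ says that X is the matrix of a form on E whose cosquare is multiplication by x.
Such forms are (f, g) ↦ ℓ(f°g) for a functional ℓ that is nonzero on the socle and satisfies ℓ(y°) =
conj ℓ(x⁻¹y); thus ∗√Φ exists exactly when p is self-dual and such an ℓ exists.

Given ℓ, the form on Ker χ(τ) is ℓ composed with an E-valued pairing (`pairing`), Hermitian when ℓ
is symmetric. As 2 is invertible, polarisation yields a vector whose length is a unit. Every fixed
element of the residue field is the value of a stationary function (`exists_stationary`), and units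
congruent to 1 have square roots, so the vector can be rescaled to have length q(x); its cyclic
module is a summand ∗√Φ q(Φ). If ∗√Φ does not exist, then either p ≠ p^∨ and the kernels involved
are isotropic, or ℓ can be chosen skew; in that case all lengths are nilpotent and a hyperbolic pair
can be constructed. Both cases give [Φ ⧹ I] (`exists_skew_gram`). The span found is stable under τ
and nonsingular, so it splits off with its orthogonal complement.

For uniqueness, consider the quotient of Ker p(τ)^s by Ker p(τ)^(s-1) + p(τ) Ker p(τ)^(s+1). It is a
vector space over K[κ] whose dimension counts the cyclic summands of type exactly Φ, and B(y,
p(τ)^(s-1) y') induces on it the Hermitian form with coefficients qᵢ(κ) (`IsTop`, `FormTop`). These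
data depend only on B and are computed on an explicit model (`exists_model`). Conversely, an
equivalence of Hermitian forms over K[κ] lifts to E by Newton iteration
(`exists_lift_of_hermitian`), so equivalent groups of summands are congruent.

Over an algebraically closed field with identity involution, all admissible one-dimensional
Hermitian forms over K[κ] are equivalent. In the other special cases the involution of K[κ] is
positive (`IsPositiveInvolution`): each form is a sum of signs, and these are unique by the law of
inertia. -/

/-- `∗`-congruence of square matrices with arbitrary index types. -/
def MCong {ι κ : Type*} [Fintype ι] [Fintype κ] [DecidableEq ι] [DecidableEq κ]
    (M : Matrix ι ι K) (N : Matrix κ κ K) : Prop :=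
  ∃ (P : Matrix ι κ K) (Q : Matrix κ ι K), P * Q = 1 ∧ Q * P = 1 ∧ N = Pᴴ * M * P

variable {ι κ μ ι' κ' : Type*} [Fintype ι] [Fintype κ] [Fintype μ] [Fintype ι'] [Fintype κ']
  [DecidableEq ι] [DecidableEq κ] [DecidableEq μ] [DecidableEq ι'] [DecidableEq κ']

theorem MCong.refl (M : Matrix ι ι K) : MCong M M := ⟨1, 1, by simp, by simp, by simp⟩

theorem MCong.symm {M : Matrix ι ι K} {N : Matrix κ κ K} (h : MCong M N) : MCong N M := by
  obtain ⟨P, Q, h1, h2, h3⟩ := h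
  refine ⟨Q, P, h2, h1, ?_⟩
  have h4 : Qᴴ * Pᴴ = 1 := by rw [← conjTranspose_mul, h1, conjTranspose_one]
  calc M = (Qᴴ * Pᴴ) * M * (P * Q) := by rw [h4, h1]; simp
    _ = Qᴴ * N * Q := by rw [h3]; simp only [Matrix.mul_assoc]

theorem MCong.trans {M : Matrix ι ι K} {N : Matrix κ κ K} {L : Matrix μ μ K}
    (h : MCong M N) (h' : MCong N L) : MCong M L := by
  obtain ⟨P, Q, h1, h2, h3⟩ := h
  obtain ⟨P', Q', h1', h2', h3'⟩ := h'
  refine ⟨P * P', Q' * Q, ?_, ?_, ?_⟩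
  · rw [Matrix.mul_assoc, ← Matrix.mul_assoc P', h1', Matrix.one_mul, h1]
  · rw [Matrix.mul_assoc, ← Matrix.mul_assoc Q, h2, Matrix.one_mul, h2']
  · rw [h3', h3, conjTranspose_mul]; simp only [Matrix.mul_assoc]

theorem MCong.of_equiv {M : Matrix ι ι K} {N : Matrix κ κ K} (e : ι ≃ κ)
    (h : ∀ i j, M i j = N (e i) (e j)) : MCong M N := by
  refine ⟨(1 : Matrix ι ι K).submatrix id e.symm, (1 : Matrix ι ι K).submatrix e.symm id,
    ?_, ?_, ?_⟩
  · rw [Matrix.submatrix_mul_equiv]; simp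
  · rw [← Matrix.submatrix_mul _ _ _ _ _ Function.bijective_id]; simp
  · ext i j
    rw [Matrix.mul_apply, Finset.sum_eq_single (e.symm j), Matrix.mul_apply,
      Finset.sum_eq_single (e.symm i)]
    · simp [h, Matrix.one_apply]
    · intro b _ hb
      simp [hb]
    · simp
    · intro b _ hb
      simp [hb]
    · simp

theorem MCong.fromBlocks {M : Matrix ι ι K} {N : Matrix κ κ K} {M' : Matrix ι' ι' K}
    {N' : Matrix κ' κ' K} (h : MCong M N) (h' : MCong M' N') :
    MCong (fromBlocks M 0 0 M') (fromBlocks N 0 0 N') := by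
  obtain ⟨P, Q, h1, h2, h3⟩ := h
  obtain ⟨P', Q', h1', h2', h3'⟩ := h'
  refine ⟨Matrix.fromBlocks P 0 0 P', Matrix.fromBlocks Q 0 0 Q', ?_, ?_, ?_⟩
  · simp [fromBlocks_multiply, h1, h1']
  · simp [fromBlocks_multiply, h2, h2']
  · simp [fromBlocks_multiply, fromBlocks_conjTranspose, h3, h3']

theorem MCong.assoc (M : Matrix ι ι K) (N : Matrix κ κ K) (L : Matrix μ μ K) :
    MCong (Matrix.fromBlocks (Matrix.fromBlocks M 0 0 N) 0 0 L)
      (Matrix.fromBlocks M 0 0 (Matrix.fromBlocks N 0 0 L)) := by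
  refine MCong.of_equiv (Equiv.sumAssoc ι κ μ) ?_
  rintro ((i | i) | i) ((j | j) | j) <;> simp

theorem MCong.comm (M : Matrix ι ι K) (N : Matrix κ κ K) :
    MCong (Matrix.fromBlocks M 0 0 N) (Matrix.fromBlocks N 0 0 M) := by
  refine MCong.of_equiv (Equiv.sumComm ι κ) ?_
  rintro (i | i) (j | j) <;> simp

theorem MCong.empty_left [IsEmpty ι] (M : Matrix ι ι K) (N : Matrix κ κ K) :
    MCong (Matrix.fromBlocks M 0 0 N) N := by
  refine MCong.of_equiv (Equiv.emptySum ι κ) ?_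
  rintro (i | i) (j | j)
  · exact isEmptyElim i
  · exact isEmptyElim i
  · exact isEmptyElim j
  · simp

end Congruence

/-! ### Matrices of a form in different bases -/

section HasMatrix

variable {V : Type*} [AddCommGroup V] [Module K V]

theorem form_sum_sum {ι κ : Type*} (B : V →ₗ⋆[K] V →ₗ[K] K) (s : Finset ι) (t : Finset κ)
    (x : ι → K) (y : κ → K) (v : ι → V) (w : κ → V) :
    B (∑ i ∈ s, x i • v i) (∑ j ∈ t, y j • w j) =
      ∑ i ∈ s, ∑ j ∈ t, star (x i) * B (v i) (w j) * y j := by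
  rw [map_sum B, LinearMap.sum_apply]
  refine Finset.sum_congr rfl fun i _ => ?_
  rw [map_sum]
  refine Finset.sum_congr rfl fun j _ => ?_
  simp only [LinearMap.map_smulₛₗ, LinearMap.smul_apply, smul_eq_mul, map_smul, starRingEnd_apply]
  ring

variable {ι κ : Type*} [Fintype ι] [Fintype κ] [DecidableEq ι] [DecidableEq κ]

theorem HasMatrix.congr {B : V →ₗ⋆[K] V →ₗ[K] K} {M : Matrix ι ι K} {N : Matrix κ κ K}
    (hB : HasMatrix B M) (h : MCong M N) : HasMatrix B N := by
  obtain ⟨b, hb⟩ := hB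
  obtain ⟨P, Q, h1, h2, h3⟩ := h
  let e : (κ → K) ≃ₗ[K] (ι → K) := Matrix.toLin'OfInv h2 h1
  refine ⟨Module.Basis.ofEquivFun (b.equivFun.trans e.symm), fun i j => ?_⟩
  have hv : ∀ k, Module.Basis.ofEquivFun (b.equivFun.trans e.symm) k = ∑ i, P i k • b i := by
    intro k
    rw [Module.Basis.coe_ofEquivFun]
    simp only [LinearEquiv.trans_symm, LinearEquiv.symm_symm, LinearEquiv.trans_apply]
    rw [Module.Basis.equivFun_symm_apply]
    refine Finset.sum_congr rfl fun i _ => ?_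
    congr 1
    simp [e, Matrix.toLin'OfInv]
  rw [hv, hv, form_sum_sum, h3, Matrix.mul_apply]
  simp only [Matrix.mul_apply, Finset.sum_mul, hb, conjTranspose_apply]
  exact Finset.sum_comm

theorem HasMatrix.mcong {B : V →ₗ⋆[K] V →ₗ[K] K} {M : Matrix ι ι K} {N : Matrix κ κ K}
    (hM : HasMatrix B M) (hN : HasMatrix B N) : MCong M N := by
  obtain ⟨b, hb⟩ := hM
  obtain ⟨c, hc⟩ := hN
  refine ⟨b.toMatrix c, c.toMatrix b, ?_, ?_, ?_⟩
  · simp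
  · simp
  · ext i j
    rw [← hc, ← b.sum_toMatrix_smul_self c i, ← b.sum_toMatrix_smul_self c j, form_sum_sum,
      Matrix.mul_apply]
    simp only [Matrix.mul_apply, Finset.sum_mul, hb, conjTranspose_apply]
    exact Finset.sum_comm

/-- The form with a given matrix on the space of coordinate vectors. -/
def matrixForm (M : Matrix ι ι K) : (ι → K) →ₗ⋆[K] (ι → K) →ₗ[K] K :=
  LinearMap.mk₂'ₛₗ _ _ (fun x y => ∑ i, ∑ j, star (x i) * M i j * y j)
    (fun x x' y => by simp [add_mul, Finset.sum_add_distrib])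
    (fun c x y => by simp [Finset.mul_sum, mul_assoc, starRingEnd_apply])
    (fun x y y' => by simp [mul_add, Finset.sum_add_distrib])
    (fun c x y => by simp [Finset.mul_sum]; simp only [mul_left_comm])

theorem matrixForm_hasMatrix (M : Matrix ι ι K) : HasMatrix (matrixForm M) M := by
  refine ⟨Pi.basisFun K ι, fun i j => ?_⟩
  simp only [matrixForm, Pi.basisFun_apply, LinearMap.mk₂'ₛₗ_apply]
  rw [Finset.sum_eq_single i, Finset.sum_eq_single j]
  · simp
  · intro k _ hk; simp [hk]
  · simp
  · intro k _ hk; simp [hk]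
  · simp

/-- The restriction of a sesquilinear form to a subspace. -/
def restrictForm (B : V →ₗ⋆[K] V →ₗ[K] K) (W : Submodule K V) : W →ₗ⋆[K] W →ₗ[K] K :=
  LinearMap.mk₂'ₛₗ _ _ (fun x y => B x y) (fun x x' y => by simp) (fun c x y => by simp)
    (fun x y y' => by simp) (fun c x y => by simp)

@[simp] theorem restrictForm_apply (B : V →ₗ⋆[K] V →ₗ[K] K) (W : Submodule K V) (x y : W) :
    restrictForm B W x y = B x y := rfl

theorem HasMatrix.of_isCompl {B : V →ₗ⋆[K] V →ₗ[K] K} {W W' : Submodule K V}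
    (hW : IsCompl W W') (h1 : ∀ x ∈ W, ∀ y ∈ W', B x y = 0) (h2 : ∀ x ∈ W', ∀ y ∈ W, B x y = 0)
    {M : Matrix ι ι K} {N : Matrix κ κ K} (hM : HasMatrix (restrictForm B W) M)
    (hN : HasMatrix (restrictForm B W') N) : HasMatrix B (Matrix.fromBlocks M 0 0 N) := by
  obtain ⟨b, hb⟩ := hM
  obtain ⟨c, hc⟩ := hN
  refine ⟨(b.prod c).map (Submodule.prodEquivOfIsCompl W W' hW), ?_⟩
  rintro (i | i) (j | j)
  · simpa using hb i j
  · simpa using h1 _ (b i).2 _ (c j).2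
  · simpa using h2 _ (c i).2 _ (b j).2
  · simpa using hc i j

end HasMatrix

/-! ### Direct sums indexed by lists -/

section Lists

variable (R : ∀ Φ : FrobeniusBlock K, Matrix (Fin Φ.dim) (Fin Φ.dim) K)

theorem blockDiagonal'_succ {n : ℕ} {m : Fin (n + 1) → Type} [∀ i, Fintype (m i)]
    [∀ i, DecidableEq (m i)] (M : ∀ i, Matrix (m i) (m i) K) :
    MCong (blockDiagonal' M) (fromBlocks (M 0) 0 0 (blockDiagonal' fun i : Fin n => M i.succ)) := by
  let f : m 0 ⊕ (Σ i : Fin n, m i.succ) → Σ i, m i :=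
    Sum.elim (fun a => ⟨0, a⟩) (fun x => ⟨x.1.succ, x.2⟩)
  have hf : Function.Bijective f := by
    constructor
    · rintro (a | ⟨i, a⟩) (b | ⟨j, b⟩) h
      · simp only [f, Sum.elim_inl, Sigma.mk.injEq, true_and, heq_eq_eq] at h
        rw [h]
      · simp only [f, Sum.elim_inl, Sum.elim_inr, Sigma.mk.injEq] at h
        exact absurd h.1.symm (Fin.succ_ne_zero j)
      · simp only [f, Sum.elim_inl, Sum.elim_inr, Sigma.mk.injEq] at h
        exact absurd h.1 (Fin.succ_ne_zero i)
      · simp only [f, Sum.elim_inr, Sigma.mk.injEq] at h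
        obtain ⟨h1, h2⟩ := h
        obtain rfl := Fin.succ_injective _ h1
        rw [eq_of_heq h2]
    · rintro ⟨i, a⟩
      induction i using Fin.cases with
      | zero => exact ⟨Sum.inl a, rfl⟩
      | succ i => exact ⟨Sum.inr ⟨i, a⟩, rfl⟩
  refine (MCong.of_equiv (Equiv.ofBijective f hf) ?_).symm
  rintro (a | ⟨i, a⟩) (b | ⟨j, b⟩)
  · simp [f, blockDiagonal'_apply_eq]
  · simp only [fromBlocks_apply₁₂, Equiv.ofBijective_apply, f, Sum.elim_inl, Sum.elim_inr]
    rw [blockDiagonal'_apply_ne _ _ _ (Fin.succ_ne_zero j).symm]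
    rfl
  · simp only [fromBlocks_apply₂₁, Equiv.ofBijective_apply, f, Sum.elim_inl, Sum.elim_inr]
    rw [blockDiagonal'_apply_ne _ _ _ (Fin.succ_ne_zero i)]
    rfl
  · simp only [fromBlocks_apply₂₂, Equiv.ofBijective_apply, f, Sum.elim_inr]
    by_cases hij : i = j
    · subst hij
      rw [blockDiagonal'_apply_eq, blockDiagonal'_apply_eq]
    · rw [blockDiagonal'_apply_ne _ _ _ hij,
        blockDiagonal'_apply_ne _ _ _ (fun h => hij (Fin.succ_injective _ h))]

theorem directSum_cons (A : Summand K) (D : List (Summand K)) :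
    MCong (directSum R (A :: D)) (fromBlocks (A.toMatrix R) 0 0 (directSum R D)) :=
  blockDiagonal'_succ (n := D.length) (m := fun i => Fin ((A :: D).get i).size)
    fun i => ((A :: D).get i).toMatrix R

instance directSumIndex_nil_isEmpty :
    IsEmpty (Σ i : Fin ([] : List (Summand K)).length, Fin (([] : List (Summand K)).get i).size) :=
  ⟨fun x => Fin.elim0 x.1⟩

theorem directSum_append (D D' : List (Summand K)) :
    MCong (directSum R (D ++ D')) (fromBlocks (directSum R D) 0 0 (directSum R D')) := by
  induction D with
  | nil => exact (MCong.empty_left _ _).symm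
  | cons A D ih =>
    exact (directSum_cons R A (D ++ D')).trans (((MCong.refl _).fromBlocks ih).trans
      ((MCong.assoc _ _ _).symm.trans ((directSum_cons R A D).symm.fromBlocks (MCong.refl _))))

theorem directSum_perm {D D' : List (Summand K)} (h : D.Perm D') :
    MCong (directSum R D) (directSum R D') := by
  induction h with
  | nil => exact MCong.refl _
  | cons A _ ih =>
    exact (directSum_cons R A _).trans (((MCong.refl _).fromBlocks ih).trans
      (directSum_cons R A _).symm)
  | swap A A' D =>
    have h1 := ((directSum_cons R A' (A :: D)).trans
      ((MCong.refl _).fromBlocks (directSum_cons R A D))).trans (MCong.assoc _ _ _).symm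
    have h2 := ((directSum_cons R A (A' :: D)).trans
      ((MCong.refl _).fromBlocks (directSum_cons R A' D))).trans (MCong.assoc _ _ _).symm
    exact h1.trans (((MCong.comm _ _).fromBlocks (MCong.refl _)).trans h2.symm)
  | trans _ _ ih1 ih2 => exact ih1.trans ih2

theorem directSum_append_congr {D₁ D₁' D₂ D₂' : List (Summand K)}
    (h₁ : MCong (directSum R D₁) (directSum R D₁')) (h₂ : MCong (directSum R D₂) (directSum R D₂')) :
    MCong (directSum R (D₁ ++ D₂)) (directSum R (D₁' ++ D₂')) :=
  (directSum_append R D₁ D₂).trans ((h₁.fromBlocks h₂).trans (directSum_append R D₁' D₂').symm)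

/-- A list indexed by a family is congruent to the block diagonal matrix of the family. -/
theorem directSum_family {ι : Type*} [Fintype ι] [DecidableEq ι] (A : ι → Summand K)
    (D : List (Summand K)) (e : ι ≃ Fin D.length) (h : ∀ i, A i = D.get (e i)) :
    MCong (Matrix.blockDiagonal' fun i => (A i).toMatrix R) (directSum R D) := by
  obtain rfl : A = fun i => D.get (e i) := funext h
  refine MCong.of_equiv (Equiv.sigmaCongrLeft (β := fun i => Fin (D.get i).size) e) ?_
  rintro ⟨i, a⟩ ⟨j, b⟩
  by_cases hij : i = j
  · subst hij
    simp [directSum, blockDiagonal'_apply_eq]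
  · rw [blockDiagonal'_apply_ne _ _ _ hij]
    simp only [directSum]
    exact (blockDiagonal'_apply_ne _ _ _ (fun h => hij (e.injective h))).symm

theorem exists_list_of_family {ι : Type*} [Fintype ι] [DecidableEq ι] (A : ι → Summand K) :
    ∃ D : List (Summand K), (∀ X, X ∈ D ↔ ∃ i, A i = X) ∧
      MCong (Matrix.blockDiagonal' fun i => (A i).toMatrix R) (directSum R D) := by
  let e := Fintype.equivFin ι
  refine ⟨List.ofFn (A ∘ e.symm), fun X => ?_,
    directSum_family R A _ (e.trans (finCongr (by simp))) fun i => ?_⟩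
  · rw [List.mem_ofFn]
    exact ⟨fun ⟨i, hi⟩ => ⟨_, hi⟩, fun ⟨i, hi⟩ => ⟨e i, by simpa using hi⟩⟩
  · simp

end Lists

/-! ### Splitting off the singular part -/

section Singular

universe u

variable {V : Type u} [AddCommGroup V] [Module K V]

/-- The subspace of all `v` with `B(x, v) = 0` for `x ∈ S`. -/
def rightPerp (B : V →ₗ⋆[K] V →ₗ[K] K) (S : Submodule K V) : Submodule K V where
  carrier := {v | ∀ x ∈ S, B x v = 0}
  add_mem' := fun ha hb x hx => by simp [ha x hx, hb x hx]
  zero_mem' := fun x _ => by simp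
  smul_mem' := fun c v hv x hx => by simp [hv x hx]

/-- The subspace of all `v` with `B(v, x) = 0` for `x ∈ S`. -/
def leftPerp (B : V →ₗ⋆[K] V →ₗ[K] K) (S : Submodule K V) : Submodule K V where
  carrier := {v | ∀ x ∈ S, B v x = 0}
  add_mem' := fun ha hb x hx => by simp [ha x hx, hb x hx]
  zero_mem' := fun x _ => by simp
  smul_mem' := fun c v hv x hx => by simp [hv x hx]

/-- The form is nondegenerate. -/
def Nondeg (B : V →ₗ⋆[K] V →ₗ[K] K) : Prop := ∀ v, (∀ u, B u v = 0) → v = 0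

/-- If the values p ↦ (B(p, q k)) did not fill the coordinate space, a nonzero functional would
vanish on them, and its coefficients would give a combination of the q k orthogonal to all of P.
This is the source of vectors with prescribed products below. -/
theorem exists_form_eq (B : V →ₗ⋆[K] V →ₗ[K] K) (P : Submodule K V) {κ : Type*} [Fintype κ]
    (q : κ → V) (h : ∀ c : κ → K, (∀ p ∈ P, B p (∑ k, c k • q k) = 0) → c = 0) (d : κ → K) :
    ∃ p ∈ P, ∀ k, B p (q k) = d k := by
  classical
  let f : V →ₗ⋆[K] (κ → K) :=
    { toFun := fun p k => B p (q k)
      map_add' := fun x y => by ext; simp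
      map_smul' := fun c x => by ext; simp }
  by_cases hS : P.map f = ⊤
  · have : d ∈ P.map f := hS ▸ Submodule.mem_top
    obtain ⟨p, hp, hpd⟩ := this
    exact ⟨p, hp, fun k => congrFun hpd k⟩
  · exfalso
    obtain ⟨φ, hφ, hle⟩ := Submodule.exists_le_ker_of_lt_top _ (lt_top_iff_ne_top.2 hS)
    apply hφ
    have hc : (fun k => φ (Pi.single k 1)) = 0 := by
      apply h
      intro p hp
      have h1 : φ (f p) = 0 := hle (Submodule.mem_map_of_mem hp)
      rw [← LinearMap.sum_single_apply (fun _ => K) (f p), map_sum] at h1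
      rw [map_sum, ← h1]
      refine Finset.sum_congr rfl fun k _ => ?_
      have h2 : (Pi.single k (f p k) : κ → K) = f p k • Pi.single k 1 := by
        rw [← Pi.single_smul]; simp
      rw [map_smul, h2, map_smul, smul_eq_mul, smul_eq_mul, mul_comm]
      rfl
    refine LinearMap.pi_ext' fun k => LinearMap.ext_ring ?_
    simpa using congrFun hc k

/-- The Jordan block with eigenvalue `0`. -/
def jordanMatrix (n : ℕ) : Matrix (Fin n) (Fin n) K :=
  Matrix.of fun i j => if (i : ℕ) + 1 = j then 1 else 0

/-- The form is an orthogonal sum of a nondegenerate form and of singular Jordan blocks. -/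
def HasSingularDecomp (B : V →ₗ⋆[K] V →ₗ[K] K) : Prop :=
  ∃ (ν ι : Type) (_ : Fintype ν) (_ : Fintype ι) (_ : DecidableEq ν) (_ : DecidableEq ι)
    (n : ι → ℕ) (N : Matrix ν ν K), (∀ i, 0 < n i) ∧ N.det ≠ 0 ∧
    HasMatrix B (Matrix.fromBlocks N 0 0 (Matrix.blockDiagonal' fun i => jordanMatrix (n i)))

theorem exists_sup_eq_and_disjoint {X X' : Submodule K V} (h : X ≤ X') :
    ∃ Y, X ⊔ Y = X' ∧ Disjoint X Y := by
  obtain ⟨Z, hZ⟩ := X.exists_isCompl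
  refine ⟨Z ⊓ X', ?_, hZ.disjoint.mono_right inf_le_left⟩
  rw [← sup_inf_assoc_of_le Z h, hZ.sup_eq_top, top_inf_eq]

theorem eq_zero_of_mulVec {ν : Type*} [Fintype ν] [DecidableEq ν] {N : Matrix ν ν K}
    (hN : N.det ≠ 0) {c : ν → K} (h : ∀ i, ∑ j, N i j * c j = 0) : c = 0 := by
  by_contra hc
  exact hN (Matrix.exists_mulVec_eq_zero_iff.1 ⟨c, hc, funext h⟩)

theorem HasMatrix.nondeg_iff {ν : Type*} [Fintype ν] [DecidableEq ν] {N : Matrix ν ν K}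
    {B : V →ₗ⋆[K] V →ₗ[K] K} (h : HasMatrix B N) : Nondeg B ↔ N.det ≠ 0 := by
  obtain ⟨b, hb⟩ := h
  constructor
  · intro hB hN
    obtain ⟨c, hc, hc'⟩ := Matrix.exists_mulVec_eq_zero_iff.2 hN
    apply hc
    have h1 : ∑ j, c j • b j = 0 := by
      apply hB
      intro u
      rw [← b.sum_repr u, form_sum_sum]
      refine Finset.sum_eq_zero fun i _ => ?_
      have h2 : ∑ j, N i j * c j = 0 := congrFun hc' i
      simp only [hb, mul_assoc, ← Finset.mul_sum, h2, mul_zero]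
    funext j
    exact Fintype.linearIndependent_iff.1 b.linearIndependent c h1 j
  · intro hN v hv
    have h1 : (fun j => b.repr v j) = 0 := by
      apply eq_zero_of_mulVec hN
      intro i
      have := hv (b i)
      rw [← b.sum_repr v, map_sum] at this
      simpa [hb, mul_comm] using this
    rw [← b.sum_repr v]
    exact Finset.sum_eq_zero fun j _ => by simp [show b.repr v j = 0 from congrFun h1 j]

theorem eq_sum_repr_of_mem {Y : Submodule K V} {κ : Type*} [Fintype κ] (y : Module.Basis κ K Y)
    {w : V} (hw : w ∈ Y) : w = ∑ k, y.repr ⟨w, hw⟩ k • (y k : V) := by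
  conv_lhs => rw [show w = ((⟨w, hw⟩ : Y) : V) from rfl, ← y.sum_repr ⟨w, hw⟩]
  rw [Submodule.coe_sum]
  rfl

section Step

variable [FiniteDimensional K V] {B : V →ₗ⋆[K] V →ₗ[K] K} {Y : Submodule K V}

/-- In a chain e₁, e₂, e₃, … with B(eₜ, eₜ₊₁) = 1, the vector e₁ lies in the right radical X₁, e₂
lies outside X₂ = X₁^⊥, and e₃, … survive in X₂/X₁, for which Y is a model. Reversing this, each
chain of Y receives two vectors in front. The space V/X₂ is dual to X₁ modulo the two-sided radical
X₀; the dual pairs not attached to a chain of Y give blocks of size 2, and X₀ gives blocks of size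
1. -/
theorem HasSingularDecomp.of_step
    (hY : rightPerp B ⊤ ⊔ Y = rightPerp B (rightPerp B ⊤)) (hd : Disjoint (rightPerp B ⊤) Y)
    (hdec : HasSingularDecomp (restrictForm B Y)) : HasSingularDecomp B := by
  obtain ⟨ν, ι, _, _, _, _, n, N, hn, hN, y, hy⟩ := hdec
  set X1 := rightPerp B ⊤ with hX1
  set X2 := rightPerp B X1 with hX2
  -- `o i` is the position of the first vector of the `i`-th chain of `Y`; these positions are
  -- exactly the zero columns of the matrix of the form on `Y`.
  let o : ι → ν ⊕ Σ i, Fin (n i) := fun i => Sum.inr ⟨i, ⟨0, hn i⟩⟩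
  -- facts about `X1`, `X2` and the matrix of the form on `Y`
  have hr : ∀ u, ∀ x ∈ X1, B u x = 0 := fun u x hx => hx u trivial
  have hl : ∀ x ∈ X1, ∀ v ∈ X2, B x v = 0 := fun x hx v hv => hv x hx
  have hX12 : X1 ≤ X2 := fun x hx => fun u _ => hr u x hx
  have hYX2 : Y ≤ X2 := hY ▸ le_sup_right
  have hyX2 : ∀ k, (y k : V) ∈ X2 := fun k => hYX2 (y k).2
  have hyy : ∀ a b, B (y (Sum.inl a)) (y (Sum.inl b)) = N a b := fun a b => hy _ _
  have hyJ : ∀ a i t, B (y (Sum.inl a)) (y (Sum.inr ⟨i, t⟩)) = 0 := fun a i t => hy _ _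
  have hJy : ∀ a i t, B (y (Sum.inr ⟨i, t⟩)) (y (Sum.inl a)) = 0 := fun a i t => hy _ _
  have hJJ : ∀ i (t t' : Fin (n i)), B (y (Sum.inr ⟨i, t⟩)) (y (Sum.inr ⟨i, t'⟩)) =
      if (t : ℕ) + 1 = t' then 1 else 0 := fun i t t' => by
    refine (hy _ _).trans ?_
    simp [blockDiagonal'_apply_eq, jordanMatrix]
  have hJJ' : ∀ i j (t : Fin (n i)) (t' : Fin (n j)), i ≠ j →
      B (y (Sum.inr ⟨i, t⟩)) (y (Sum.inr ⟨j, t'⟩)) = 0 := fun i j t t' hij => by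
    refine (hy _ _).trans ?_
    simp [blockDiagonal'_apply_ne _ _ _ hij]
  have ho : ∀ i j, (o i = o j) ↔ i = j := fun i j =>
    ⟨fun h => congrArg Sigma.fst (Sum.inr.inj h), fun h => h ▸ rfl⟩
  have hyo : ∀ i k, B (y k) (y (o i)) = 0 := by
    rintro i (a | ⟨j, t⟩)
    · exact hyJ _ _ _
    · by_cases hij : j = i
      · subst hij
        exact (hJJ _ _ _).trans (by simp)
      · exact hJJ' _ _ _ _ hij
  -- the vectors preceding the chains of `Y`
  have hz : ∀ i, ∃ z, ∀ k, B z (y k) = if k = o i then 1 else 0 := by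
    intro i
    obtain ⟨p, -, hp⟩ := exists_form_eq B ⊤ (fun k => (y k : V)) (fun c hc => by
      have h1 : ((∑ k, c k • y k : Y) : V) ∈ X1 := by
        intro u hu
        have := hc u hu
        simpa using this
      have h2 : (∑ k, c k • y k : Y) = 0 :=
        Subtype.ext (Submodule.disjoint_def.1 hd _ h1 (Subtype.mem _))
      funext k
      exact Fintype.linearIndependent_iff.1 y.linearIndependent c h2 k)
      (fun k => if k = o i then 1 else 0)
    exact ⟨p, hp⟩
  choose z hz using hz
  -- Together with the `z i`, a basis of `Z'` will span a complement of `X2`. A vector of `Z'` has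
  -- product zero with all of `Y`, so a chain that reaches it ends there and has length 2.
  obtain ⟨Z', hZ', hdZ'⟩ := exists_sup_eq_and_disjoint
    (inf_le_left : leftPerp B Y ⊓ X2 ≤ leftPerp B Y)
  let z' := Module.finBasis K Z'
  have hz₃Y : ∀ k l, B (z' k) (y l) = 0 := fun k l =>
    (hZ' ▸ le_sup_right : Z' ≤ leftPerp B Y) (z' k).2 _ (y l).2
  let ζ := ι ⊕ Fin (Module.finrank K Z')
  let zf : ζ → V := Sum.elim z (fun k => (z' k : V))
  have hzi : ∀ c : ζ → K, ∑ k, c k • zf k ∈ X2 → c = 0 := by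
    intro c hc
    have h1 : ∀ i, c (Sum.inl i) = 0 := by
      intro i
      obtain ⟨x, hx, w, hw, hxw⟩ := Submodule.mem_sup.1 (hY.symm ▸ hc : _ ∈ X1 ⊔ Y)
      have h2 : B (∑ k, c k • zf k) (y (o i)) = 0 := by
        rw [← hxw, map_add, LinearMap.add_apply, hl x hx _ (hyX2 _), zero_add]
        have h5 := eq_sum_repr_of_mem y hw
        rw [h5, map_sum, LinearMap.sum_apply]
        exact Finset.sum_eq_zero fun k _ => by simp [hyo]
      rw [Fintype.sum_sum_type, map_add, LinearMap.add_apply, map_sum, map_sum,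
        LinearMap.sum_apply, LinearMap.sum_apply] at h2
      simpa [zf, hz, hz₃Y, ho] using h2
    have h7 : ∑ k, c (Sum.inr k) • z' k = 0 := by
      have h8 : ∑ k, c k • zf k = ((∑ k, c (Sum.inr k) • z' k : Z') : V) := by
        rw [Fintype.sum_sum_type]
        simp [zf, h1]
      apply Subtype.ext
      rw [h8] at hc
      exact Submodule.disjoint_def.1 hdZ' _
        ⟨(hZ' ▸ le_sup_right : Z' ≤ leftPerp B Y) (Subtype.mem _), hc⟩ (Subtype.mem _)
    funext k
    rcases k with i | k
    · exact h1 i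
    · exact Fintype.linearIndependent_iff.1 z'.linearIndependent _ h7 k
  have hzV : ∀ v, ∃ c : ζ → K, v - ∑ k, c k • zf k ∈ X2 := by
    intro v
    let v1 := v - ∑ i, star (B v (y (o i))) • z i
    have hv1 : ∀ i, B v1 (y (o i)) = 0 := by
      intro i
      simp [v1, map_sum, LinearMap.sum_apply, hz, ho, starRingEnd_apply]
    -- Apart from its zero columns, the matrix of the form on `Y` has independent columns, so the
    -- remaining products of `v1` with `Y` are already attained by an element of `Y`.
    obtain ⟨w, hw, hw'⟩ := exists_form_eq B Y
      (fun k : {k : ν ⊕ Σ i, Fin (n i) // ∀ i, k ≠ o i} => (y k : V)) (fun c hc => by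
        have hc' : ∀ k, ∑ l : {k : ν ⊕ Σ i, Fin (n i) // ∀ i, k ≠ o i},
            c l * B (y k) (y l) = 0 := by
          intro k
          have := hc _ (y k).2
          rw [map_sum] at this
          simpa using this
        have hν : (fun a : ν => c ⟨Sum.inl a, fun i h => by simp [o] at h⟩) = 0 := by
          apply eq_zero_of_mulVec hN
          intro a
          have h1 := hc' (Sum.inl a)
          let f : ν → {k : ν ⊕ Σ i, Fin (n i) // ∀ i, k ≠ o i} :=
            fun a => ⟨Sum.inl a, fun i h => by simp [o] at h⟩
          have hf : Function.Injective f := fun a b h => by simpa [f] using h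
          rw [← Finset.sum_subset (Finset.subset_univ (Finset.univ.map ⟨f, hf⟩)),
            Finset.sum_map] at h1
          · rw [← h1]
            refine Finset.sum_congr rfl fun b _ => ?_
            rw [← hyy, mul_comm]
            rfl
          · rintro ⟨(b | ⟨j, t⟩), hk⟩ _ hb
            · exact absurd (Finset.mem_map_of_mem ⟨f, hf⟩ (Finset.mem_univ b)) hb
            · rw [hyJ, mul_zero]
        funext k
        rcases k with ⟨(a | ⟨i, t⟩), hk⟩
        · exact congrFun hν a
        · obtain ⟨t, ht⟩ := t
          rcases t with _ | t
          · exact absurd rfl (hk i)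
          · have h1 := hc' (Sum.inr ⟨i, ⟨t, by omega⟩⟩)
            rw [Finset.sum_eq_single ⟨Sum.inr ⟨i, ⟨t + 1, ht⟩⟩, hk⟩] at h1
            · rw [hJJ] at h1
              simpa using h1
            · rintro ⟨(b | ⟨j, t'⟩), hk'⟩ _ hb
              · rw [hJy, mul_zero]
              · by_cases hij : i = j
                · subst hij
                  rw [hJJ, if_neg, mul_zero]
                  intro h
                  apply hb
                  congr 3
                  exact Fin.ext h.symm
                · rw [hJJ' _ _ _ _ hij, mul_zero]
            · simp) (fun k => B v1 (y k))
    have hv2 : v1 - w ∈ leftPerp B Y := by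
      intro u hu
      have h3 : ∀ k, B (v1 - w) (y k) = 0 := by
        intro k
        rw [map_sub, LinearMap.sub_apply, sub_eq_zero]
        by_cases hk : ∃ i, k = o i
        · obtain ⟨i, rfl⟩ := hk
          rw [hv1]
          have h5 := eq_sum_repr_of_mem y hw
          rw [h5, map_sum, LinearMap.sum_apply]
          refine (Finset.sum_eq_zero fun k _ => ?_).symm
          simp [hyo]
        · push Not at hk
          exact (hw' ⟨k, hk⟩).symm
      have h5 := eq_sum_repr_of_mem y hu
      rw [h5, map_sum]
      exact Finset.sum_eq_zero fun k _ => by rw [map_smul, h3, smul_zero]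
    obtain ⟨a, ha, b, hb, hab⟩ := Submodule.mem_sup.1 (hZ'.symm ▸ hv2 : _ ∈ _ ⊔ Z')
    have h5 := eq_sum_repr_of_mem z' hb
    refine ⟨Sum.elim (fun i => star (B v (y (o i)))) (fun k => z'.repr ⟨b, hb⟩ k), ?_⟩
    have h6 : v - ∑ k, (Sum.elim (fun i => star (B v (y (o i))))
        (fun k => z'.repr ⟨b, hb⟩ k) : ζ → K) k • zf k = w + a := by
      rw [Fintype.sum_sum_type]
      simp only [Sum.elim_inl, Sum.elim_inr, zf]
      rw [← h5]
      have : v - ∑ i, star (B v (y (o i))) • z i = v1 := rfl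
      rw [← sub_sub, this, sub_eq_iff_eq_add, add_assoc, hab]
      abel
    rw [h6]
    exact X2.add_mem (hYX2 hw) ha.2
  -- No nonzero combination of the `zf k` is orthogonal to `X1`, so `X1` realises every system of
  -- values on them.
  have hrep : ∀ d : ζ → K, ∃ x ∈ X1, ∀ k, B x (zf k) = d k :=
    exists_form_eq B X1 zf fun c hc => hzi c hc
  choose x hxX1 hx using hrep
  -- the new basis
  let xf : ζ → V := fun k => x (Pi.single k 1)
  -- A summand from the right radical has no effect in the second argument. In the first argument it
  -- is chosen to cancel the products with all `zf l`, and it is orthogonal to `Y`.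
  let yf : ν ⊕ (Σ i, Fin (n i)) → V := fun k => y k + x fun l => -B (y k) (zf l)
  let zg : ζ → V := fun k => zf k + x fun l => -B (zf k) (zf l)
  let X0 := X1 ⊓ leftPerp B ⊤
  let w := Module.finBasis K X0
  have gx : ∀ u k, B u (xf k) = 0 := fun u k => hr _ _ (hxX1 _)
  have gxz : ∀ k l, B (xf k) (zg l) = if k = l then 1 else 0 := fun k l => by
    simp only [zg, map_add, hr _ _ (hxX1 _), add_zero, xf, hx]
    rw [Pi.single_apply]
    simp only [eq_comm]
  have gxy : ∀ k l, B (xf k) (yf l) = 0 := fun k l => by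
    simp only [yf, map_add, hr _ _ (hxX1 _), add_zero, xf]
    exact hl _ (hxX1 _) _ (hyX2 _)
  have gzz : ∀ k l, B (zg k) (zg l) = 0 := fun k l => by
    simp only [zg, map_add, LinearMap.add_apply, hr _ _ (hxX1 _), add_zero, hx]
    simp
  have gyz : ∀ k l, B (yf k) (zg l) = 0 := fun k l => by
    simp only [yf, zg, map_add, LinearMap.add_apply, hr _ _ (hxX1 _), add_zero, hx]
    simp
  have gyy : ∀ k l, B (yf k) (yf l) = B (y k) (y l) := fun k l => by
    simp only [yf, map_add, LinearMap.add_apply, hr _ _ (hxX1 _), add_zero,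
      hl _ (hxX1 _) _ (hyX2 _)]
  have gzy : ∀ k l, B (zg k) (yf l) = B (zf k) (y l) := fun k l => by
    simp only [yf, zg, map_add, LinearMap.add_apply, hr _ _ (hxX1 _), add_zero,
      hl _ (hxX1 _) _ (hyX2 _)]
  have gw : ∀ u k, B u (w k) = 0 := fun u k => hr _ _ (w k).2.1
  have gw' : ∀ u k, B (w k) u = 0 := fun u k => (w k).2.2 u trivial
  let ι' := ι ⊕ Fin (Module.finrank K Z') ⊕ Fin (Module.finrank K X0)
  let n' : ι' → ℕ := Sum.elim (fun i => n i + 2) (Sum.elim (fun _ => 2) (fun _ => 1))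
  let E : ν ⊕ (Σ i, Fin (n' i)) → V := Sum.elim (fun a => yf (Sum.inl a)) fun k =>
    match k with
    | ⟨Sum.inl i, t⟩ => (Fin.cons (xf (Sum.inl i)) (Fin.cons (zg (Sum.inl i))
        (fun t => yf (Sum.inr ⟨i, t⟩))) : Fin (n i + 2) → V) t
    | ⟨Sum.inr (Sum.inl j), t⟩ =>
        (Fin.cons (xf (Sum.inr j)) (fun _ => zg (Sum.inr j)) : Fin 2 → V) t
    | ⟨Sum.inr (Sum.inr m), _⟩ => w m
  have E0 : ∀ a, E (Sum.inl a) = yf (Sum.inl a) := fun a => rfl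
  have E1 : ∀ i, E (Sum.inr ⟨Sum.inl i, (0 : Fin (n i + 2))⟩) = xf (Sum.inl i) := fun i => rfl
  have E2 : ∀ i, E (Sum.inr ⟨Sum.inl i, ((0 : Fin (n i + 1)).succ : Fin (n i + 2))⟩) =
    zg (Sum.inl i) := fun i => rfl
  have E3 : ∀ i t, E (Sum.inr ⟨Sum.inl i, (Fin.succ (Fin.succ t) : Fin (n i + 2))⟩) =
    yf (Sum.inr ⟨i, t⟩) := fun i t => rfl
  have E4 : ∀ j, E (Sum.inr ⟨Sum.inr (Sum.inl j), (0 : Fin 2)⟩) = xf (Sum.inr j) := fun j => rfl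
  have E5 : ∀ j (t : Fin 1), E (Sum.inr ⟨Sum.inr (Sum.inl j), (t.succ : Fin 2)⟩) =
    zg (Sum.inr j) := fun j t => rfl
  have E6 : ∀ m t, E (Sum.inr ⟨Sum.inr (Sum.inr m), t⟩) = w m := fun m t => rfl
  -- dimensions
  have hVz : IsCompl (Submodule.span K (Set.range zf)) X2 := by
    constructor
    · rw [Submodule.disjoint_def]
      intro v hv hv'
      obtain ⟨c, rfl⟩ := (Submodule.mem_span_range_iff_exists_fun K).1 hv
      rw [hzi c hv']
      simp
    · rw [codisjoint_iff, eq_top_iff]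
      intro v _
      obtain ⟨c, hc⟩ := hzV v
      refine Submodule.mem_sup.2 ⟨_, (Submodule.mem_span_range_iff_exists_fun K).2 ⟨c, rfl⟩, _, hc, ?_⟩
      abel
  have hlz : LinearIndependent K zf := Fintype.linearIndependent_iff.2 fun c hc k =>
    congrFun (hzi c (hc ▸ X2.zero_mem)) k
  have hX1c : ∀ v ∈ X1, v - ∑ k, star (B v (zf k)) • xf k ∈ X0 := by
    intro v hv
    have h1 : ∑ k, star (B v (zf k)) • xf k ∈ X1 :=
      X1.sum_mem fun k _ => X1.smul_mem _ (hxX1 _)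
    refine ⟨X1.sub_mem hv h1, fun u _ => ?_⟩
    obtain ⟨c, hc⟩ := hzV u
    have h2 : ∀ l, B (v - ∑ k, star (B v (zf k)) • xf k) (zf l) = 0 := by
      intro l
      simp [map_sum, LinearMap.sum_apply, xf, hx, Pi.single_apply, starRingEnd_apply]
    have h3 := hl _ (X1.sub_mem hv h1) _ hc
    rw [map_sub, sub_eq_zero] at h3
    rw [h3, map_sum]
    exact Finset.sum_eq_zero fun k _ => by rw [map_smul, h2, smul_zero]
  have hxz : ∀ c : ζ → K, ∀ l, B (∑ k, c k • xf k) (zf l) = star (c l) := by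
    intro c l
    simp [map_sum, LinearMap.sum_apply, xf, hx, Pi.single_apply, starRingEnd_apply]
  have hlx : LinearIndependent K xf := Fintype.linearIndependent_iff.2 fun c hc k => by
    have := hxz c k
    rw [hc] at this
    simpa using this.symm
  have hX0 : X0 ⊔ Submodule.span K (Set.range xf) = X1 := by
    apply le_antisymm
    · refine sup_le inf_le_left (Submodule.span_le.2 ?_)
      rintro _ ⟨k, rfl⟩
      exact hxX1 _
    · intro v hv
      refine Submodule.mem_sup.2 ⟨_, hX1c v hv, _,
        (Submodule.mem_span_range_iff_exists_fun K).2 ⟨_, rfl⟩, by abel⟩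
  have hX0d : X0 ⊓ Submodule.span K (Set.range xf) = ⊥ := by
    rw [eq_bot_iff]
    rintro v ⟨hv, hv'⟩
    obtain ⟨c, rfl⟩ := (Submodule.mem_span_range_iff_exists_fun K).1 hv'
    have : c = 0 := funext fun k => by
      have h1 := hxz c k
      rw [hv.2 _ trivial] at h1
      simpa using h1.symm
    simp [this]
  have d1 := Submodule.finrank_add_eq_of_isCompl hVz
  rw [finrank_span_eq_card hlz] at d1
  have d2 := Submodule.finrank_sup_add_finrank_inf_eq X1 Y
  rw [hY, hd.eq_bot, finrank_bot, Module.finrank_eq_card_basis y] at d2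
  have d3 := Submodule.finrank_sup_add_finrank_inf_eq X0 (Submodule.span K (Set.range xf))
  rw [hX0, hX0d, finrank_bot, finrank_span_eq_card hlx] at d3
  -- dim V = |ζ| + dim X₂, dim X₂ = dim X₁ + dim Y and dim X₁ = dim X₀ + |ζ|, so each `zf k`
  -- accounts for two dimensions, matching the two vectors added per chain.
  have hcard : Fintype.card (ν ⊕ Σ i, Fin (n' i)) = Module.finrank K V := by
    simp only [Fintype.card_sum, Fintype.card_sigma, Fintype.card_fin, ζ, ι',
      Fintype.sum_sum_type, n', Sum.elim_inl, Sum.elim_inr, Finset.sum_add_distrib,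
      Finset.sum_const, Finset.card_univ, smul_eq_mul] at d1 d2 d3 ⊢
    omega
  have hspan : ⊤ ≤ Submodule.span K (Set.range E) := by
    set S := Submodule.span K (Set.range E) with hS
    have hE : ∀ k, E k ∈ S := fun k => Submodule.subset_span ⟨k, rfl⟩
    have hxS : ∀ k, xf k ∈ S := by
      rintro (i | j)
      · exact E1 i ▸ hE _
      · exact E4 j ▸ hE _
    have hX0S : X0 ≤ S := by
      intro v hv
      rw [eq_sum_repr_of_mem w hv]
      exact S.sum_mem fun k _ => S.smul_mem _ (E6 k (0 : Fin 1) ▸ hE _)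
    have hX1S : X1 ≤ S := by
      rw [← hX0]
      refine sup_le hX0S (Submodule.span_le.2 ?_)
      rintro _ ⟨k, rfl⟩
      exact hxS k
    have hyS : ∀ k, (y k : V) ∈ S := by
      intro k
      have h1 : yf k ∈ S := by
        rcases k with a | ⟨i, t⟩
        · exact E0 a ▸ hE _
        · exact E3 i t ▸ hE _
      have h2 := S.sub_mem h1 (hX1S (hxX1 fun l => -B (y k) (zf l)))
      simpa [yf] using h2
    have hzS : ∀ k, zf k ∈ S := by
      intro k
      have h1 : zg k ∈ S := by
        rcases k with i | j
        · exact E2 i ▸ hE _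
        · exact E5 j 0 ▸ hE _
      have h2 := S.sub_mem h1 (hX1S (hxX1 fun l => -B (zf k) (zf l)))
      simpa [zg] using h2
    have hYS : Y ≤ S := by
      intro v hv
      rw [eq_sum_repr_of_mem y hv]
      exact S.sum_mem fun k _ => S.smul_mem _ (hyS k)
    rw [← hVz.sup_eq_top, ← hY]
    refine sup_le (Submodule.span_le.2 ?_) (sup_le hX1S hYS)
    rintro _ ⟨k, rfl⟩
    exact hzS k
  refine ⟨ν, ι', inferInstance, inferInstance, inferInstance, inferInstance, n', N, ?_, hN,
    basisOfTopLeSpanOfCardEqFinrank E hspan hcard, ?_⟩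
  · rintro (i | j | m)
    · exact Nat.succ_pos _
    · exact Nat.succ_pos _
    · exact Nat.succ_pos _
  · intro k l
    rw [coe_basisOfTopLeSpanOfCardEqFinrank]
    have hval : ∀ (c d : ι') (t : Fin (n' c)) (t' : Fin (n' d)),
        (Matrix.fromBlocks N 0 0 (blockDiagonal' fun i => jordanMatrix (n' i)))
          (Sum.inr ⟨c, t⟩) (Sum.inr ⟨d, t'⟩) = if c = d ∧ (t : ℕ) + 1 = t' then 1 else 0 := by
      intro c d t t'
      by_cases hcd : c = d
      · subst hcd
        simp [blockDiagonal'_apply_eq, jordanMatrix]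
      · simp [blockDiagonal'_apply_ne _ _ _ hcd, hcd]
    have hcase : ∀ (c : ι') (t : Fin (n' c)),
        (∃ i, c = Sum.inl i ∧ (t : ℕ) = 0 ∧ E (Sum.inr ⟨c, t⟩) = xf (Sum.inl i)) ∨
        (∃ i, c = Sum.inl i ∧ (t : ℕ) = 1 ∧ E (Sum.inr ⟨c, t⟩) = zg (Sum.inl i)) ∨
        (∃ i, ∃ s : Fin (n i), c = Sum.inl i ∧ (t : ℕ) = s + 2 ∧
          E (Sum.inr ⟨c, t⟩) = yf (Sum.inr ⟨i, s⟩)) ∨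
        (∃ j, c = Sum.inr (Sum.inl j) ∧ (t : ℕ) = 0 ∧ E (Sum.inr ⟨c, t⟩) = xf (Sum.inr j)) ∨
        (∃ j, c = Sum.inr (Sum.inl j) ∧ (t : ℕ) = 1 ∧ E (Sum.inr ⟨c, t⟩) = zg (Sum.inr j)) ∨
        (∃ m, c = Sum.inr (Sum.inr m) ∧ (t : ℕ) = 0 ∧ E (Sum.inr ⟨c, t⟩) = w m) := by
      rintro (i | j | m) t
      · change Fin (n i + 2) at t
        induction t using Fin.cases with
        | zero => exact Or.inl ⟨i, rfl, rfl, rfl⟩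
        | succ t =>
          induction t using Fin.cases with
          | zero => exact Or.inr (Or.inl ⟨i, rfl, rfl, rfl⟩)
          | succ t => exact Or.inr (Or.inr (Or.inl ⟨i, t, rfl, rfl, rfl⟩))
      · refine Or.inr (Or.inr (Or.inr ?_))
        change Fin (1 + 1) at t
        induction t using Fin.cases with
        | zero => exact Or.inl ⟨j, rfl, rfl, rfl⟩
        | succ t => exact Or.inr (Or.inl ⟨j, rfl, by rw [Subsingleton.elim t 0]; rfl, rfl⟩)
      · refine Or.inr (Or.inr (Or.inr (Or.inr (Or.inr ⟨m, rfl, ?_, rfl⟩))))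
        change Fin 1 at t
        rw [Subsingleton.elim t 0]
        rfl
    have hio : ∀ i j (t : Fin (n j)), (Sum.inr ⟨j, t⟩ = o i) ↔ (i = j ∧ 0 = (t : ℕ)) := by
      intro i j t
      constructor
      · intro h
        obtain ⟨h1, h2⟩ := Sigma.mk.inj (Sum.inr.inj h)
        subst h1
        exact ⟨rfl, by rw [eq_of_heq h2]⟩
      · rintro ⟨rfl, h⟩
        exact congrArg Sum.inr (Sigma.ext rfl (heq_of_eq (Fin.ext h.symm)))
    have hoi : ∀ i a, ¬ (Sum.inl a = o i) := fun i a h => by simp [o] at h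
    have hzfi : ∀ i l, B (zf (Sum.inl i)) (y l) = if l = o i then 1 else 0 := fun i l => hz i l
    have hzfj : ∀ j l, B (zf (Sum.inr j)) (y l) = 0 := fun j l => hz₃Y j l
    have hJJ2 : ∀ i j (t : Fin (n i)) (t' : Fin (n j)), B (y (Sum.inr ⟨i, t⟩))
        (y (Sum.inr ⟨j, t'⟩)) = if i = j ∧ (t : ℕ) + 1 = t' then 1 else 0 := by
      intro i j t t'
      by_cases hij : i = j
      · subst hij
        rw [hJJ]; simp
      · rw [hJJ' _ _ _ _ hij]; simp [hij]
    have e1 : ∀ i i', ((Sum.inl i : ζ) = Sum.inl i') ↔ i = i' := fun _ _ => Sum.inl_injective.eq_iff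
    have e2 : ∀ i i', ((Sum.inr i : ζ) = Sum.inr i') ↔ i = i' := fun _ _ => Sum.inr_injective.eq_iff
    have e3 : ∀ i i', ¬ ((Sum.inr i : ζ) = Sum.inl i') := fun _ _ => Sum.inr_ne_inl
    have e4 : ∀ i i', ¬ ((Sum.inl i : ζ) = Sum.inr i') := fun _ _ => Sum.inl_ne_inr
    have f1 : ∀ i i', ((Sum.inl i : ι') = Sum.inl i') ↔ i = i' := fun _ _ => Sum.inl_injective.eq_iff
    have f2 : ∀ i i', ((Sum.inr i : ι') = Sum.inr i') ↔ i = i' := fun _ _ => Sum.inr_injective.eq_iff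
    have f3 : ∀ i i', ¬ ((Sum.inr i : ι') = Sum.inl i') := fun _ _ => Sum.inr_ne_inl
    have f4 : ∀ i i', ¬ ((Sum.inl i : ι') = Sum.inr i') := fun _ _ => Sum.inl_ne_inr
    rcases k with a | ⟨c, t⟩ <;> rcases l with a' | ⟨d, t'⟩
    · rw [E0, E0, gyy, hyy, fromBlocks_apply₁₁]
    · rw [E0, fromBlocks_apply₁₂]
      rcases hcase d t' with ⟨i, -, -, h⟩ | ⟨i, -, -, h⟩ | ⟨i, s, -, -, h⟩ | ⟨j, -, -, h⟩ |
        ⟨j, -, -, h⟩ | ⟨m, -, -, h⟩ <;> simp [h, gx, gyz, gyy, hyJ, gw]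
    · rw [E0, fromBlocks_apply₂₁]
      rcases hcase c t with ⟨i, -, -, h⟩ | ⟨i, -, -, h⟩ | ⟨i, s, -, -, h⟩ | ⟨j, -, -, h⟩ |
        ⟨j, -, -, h⟩ | ⟨m, -, -, h⟩ <;> simp [h, gxy, gzy, gyy, hJy, gw', hzfi, hzfj, hoi]
    · rw [hval]
      rcases hcase c t with ⟨i, h1, h2, h⟩ | ⟨i, h1, h2, h⟩ | ⟨i, s, h1, h2, h⟩ | ⟨j, h1, h2, h⟩ |
        ⟨j, h1, h2, h⟩ | ⟨m, h1, h2, h⟩ <;>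
      rcases hcase d t' with ⟨i', h1', h2', h'⟩ | ⟨i', h1', h2', h'⟩ | ⟨i', s', h1', h2', h'⟩ |
        ⟨j', h1', h2', h'⟩ | ⟨j', h1', h2', h'⟩ | ⟨m', h1', h2', h'⟩ <;>
      rw [h, h', h2, h2', h1, h1'] <;>
      simp [gx, gxz, gxy, gzz, gyz, gyy, gzy, gw, gw', hJJ2, hzfi, hzfj, hio,
        e1, e2, e3, e4, f1, f2, f3, f4, @eq_comm ℕ 0]

theorem hasSingularDecomp_of_finrank (d : ℕ) : ∀ (V : Type u) [AddCommGroup V] [Module K V]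
    [FiniteDimensional K V] (B : V →ₗ⋆[K] V →ₗ[K] K), Module.finrank K V = d →
    HasSingularDecomp B := by
  induction d using Nat.strong_induction_on with
  | _ d ih =>
    intro V _ _ _ B hV
    by_cases hX : rightPerp B ⊤ = ⊥
    · let b := Module.finBasis K V
      let N : Matrix _ _ K := Matrix.of fun i j => B (b i) (b j)
      have hbN : HasMatrix B N := ⟨b, fun i j => rfl⟩
      refine ⟨Fin (Module.finrank K V), PEmpty, inferInstance, inferInstance, inferInstance,
        inferInstance, fun _ => 0, N, fun i => i.elim, hbN.nondeg_iff.1 fun v hv => ?_, ?_⟩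
      · have : v ∈ rightPerp B ⊤ := fun u _ => hv u
        rwa [hX] at this
      · exact hbN.congr ((MCong.empty_left _ _).symm.trans (MCong.comm _ _))
    · have h12 : rightPerp B ⊤ ≤ rightPerp B (rightPerp B ⊤) := fun x hx u _ => hx u trivial
      obtain ⟨Y, hY, hd⟩ := exists_sup_eq_and_disjoint h12
      refine HasSingularDecomp.of_step hY hd (ih _ ?_ Y _ rfl)
      rw [← hV]
      apply Submodule.finrank_lt
      rintro rfl
      exact hX (disjoint_top.1 hd)

theorem hasSingularDecomp (B : V →ₗ⋆[K] V →ₗ[K] K) :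
    HasSingularDecomp B := hasSingularDecomp_of_finrank _ V B rfl

end Step

end Singular

/-! ### Uniqueness of the singular part -/

section SingularUnique

variable {V : Type*} [AddCommGroup V] [Module K V]

/-- The iterated right orthogonal complements of the whole space. -/
def perpSeq (B : V →ₗ⋆[K] V →ₗ[K] K) : ℕ → Submodule K V
  | 0 => ⊤
  | k + 1 => rightPerp B (perpSeq B k)

/-- The position `a` of a singular Jordan block belongs to the `k`-th iterated complement. -/
def ChainMem (k a : ℕ) : Prop := if a < k then Even a else Even k

theorem chainMem_zero (a : ℕ) : ChainMem 0 a := by simp [ChainMem]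

theorem chainMem_succ_zero (k : ℕ) : ChainMem (k + 1) 0 := by simp [ChainMem]

/-- A chain vector other than the first has a nonzero product only with its predecessor on the left,
so it lies in the next complement exactly when the predecessor is not in the current one. -/
theorem chainMem_succ_succ (k a : ℕ) : ChainMem (k + 1) (a + 1) ↔ ¬ ChainMem k a := by
  unfold ChainMem
  simp only [Nat.add_lt_add_iff_right]
  split_ifs <;> simp [Nat.even_add_one]

/-- Two steps of the sequence change the status of one position only, which is why comparing steps
`k` and `k + 2` detects whether a block reaches size `k + 2`. -/
theorem chainMem_add_two {k a : ℕ} (h : a ≠ k + 1) : ChainMem (k + 2) a ↔ ChainMem k a := by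
  unfold ChainMem
  have h2 : Even (k + 2) ↔ Even k := by simp [Nat.even_add]
  split_ifs with h3 h4 h4
  · rfl
  · obtain rfl : a = k := by omega
    rfl
  · omega
  · exact h2

theorem chainMem_self_add_one (k : ℕ) : ChainMem k (k + 1) ↔ Even k := by simp [ChainMem]

theorem chainMem_add_two_add_one (k : ℕ) : ChainMem (k + 2) (k + 1) ↔ ¬ Even k := by
  simp [ChainMem, Nat.even_add_one]

theorem chainMem_of_lt {k a : ℕ} (h : a < k) : ChainMem k a ↔ Even a := by simp [ChainMem, h]

open Classical in
/-- The number of positions of a Jordan block of size `m` in the `k`-th iterated complement. -/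
def chainCount (k m : ℕ) : ℕ := ((Finset.range m).filter (ChainMem k)).card

theorem chainCount_one (m : ℕ) : chainCount 1 m = if 1 ≤ m then 1 else 0 := by
  classical
  unfold chainCount
  split_ifs with h
  · rw [Finset.card_eq_one]
    refine ⟨0, ?_⟩
    ext a
    simp only [Finset.mem_filter, Finset.mem_range, ChainMem, Finset.mem_singleton]
    rcases a with _ | a
    · simp; omega
    · simp
  · obtain rfl : m = 0 := by omega
    simp

/-- Position `k + 1` is lost between the two steps if `k` is even and gained if `k` is odd. The
correction is placed on the side where no subtraction is needed. -/
theorem chainCount_add_two (k m : ℕ) :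
    chainCount (k + 2) m + (if Even k ∧ k + 2 ≤ m then 1 else 0) =
      chainCount k m + (if ¬ Even k ∧ k + 2 ≤ m then 1 else 0) := by
  classical
  induction m with
  | zero => simp [chainCount]
  | succ m ih =>
    have hs : ∀ j, chainCount j (m + 1) = chainCount j m + if ChainMem j m then 1 else 0 := by
      intro j
      unfold chainCount
      rw [Finset.range_add_one, Finset.filter_insert]
      split_ifs with h
      · rw [Finset.card_insert_of_notMem (by simp)]
      · simp
    rw [hs, hs]
    by_cases hm : m = k + 1
    · subst hm
      simp only [chainMem_self_add_one, chainMem_add_two_add_one]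
      have h1 : ¬ (k + 2 ≤ k + 1) := by omega
      simp only [h1, and_false, if_false, add_zero] at ih
      rw [ih]
      by_cases hk : Even k <;> simp [hk]
    · simp only [chainMem_add_two hm]
      have h1 : (k + 2 ≤ m + 1) ↔ (k + 2 ≤ m) := by omega
      simp only [h1]
      omega

variable {B : V →ₗ⋆[K] V →ₗ[K] K} {ν ι : Type*} [Fintype ν] [Fintype ι] [DecidableEq ν]
  [DecidableEq ι] {n : ι → ℕ} {N : Matrix ν ν K}

/-- The basis vectors spanning the `k`-th iterated complement. -/
def chainSet (ν : Type*) {ι : Type*} (n : ι → ℕ) (k : ℕ) : Set (ν ⊕ Σ i, Fin (n i)) :=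
  {x | Sum.elim (fun _ => Even k) (fun y => ChainMem k (y.2 : ℕ)) x}

@[simp] theorem inl_mem_chainSet {a : ν} {k : ℕ} : Sum.inl a ∈ chainSet ν n k ↔ Even k := Iff.rfl

@[simp] theorem inr_mem_chainSet {i : ι} {t : Fin (n i)} {k : ℕ} :
    Sum.inr ⟨i, t⟩ ∈ chainSet ν n k ↔ ChainMem k t := Iff.rfl

/-- All iterated complements are coordinate subspaces. As `N` is nonsingular, the vectors of the
nonsingular part are all in or all out, alternating with the parity of the step; along a chain,
taking products with basis vectors shifts the coordinates by one. -/
theorem mem_perpSeq (hN : N.det ≠ 0) (b : Module.Basis (ν ⊕ Σ i, Fin (n i)) K V)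
    (hb : ∀ x y, B (b x) (b y) =
      Matrix.fromBlocks N 0 0 (Matrix.blockDiagonal' fun i => jordanMatrix (n i)) x y)
    (k : ℕ) (v : V) : v ∈ perpSeq B k ↔ ∀ x, x ∉ chainSet ν n k → b.repr v x = 0 := by
  have hν : ∀ a v, B (b (Sum.inl a)) v = ∑ c, N a c * b.repr v (Sum.inl c) := by
    intro a v
    conv_lhs => rw [← b.sum_repr v]
    rw [map_sum, Fintype.sum_sum_type]
    simp [hb, mul_comm]
  have hJ : ∀ i (t : Fin (n i)) v, B (b (Sum.inr ⟨i, t⟩)) v =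
      if h : (t : ℕ) + 1 < n i then b.repr v (Sum.inr ⟨i, ⟨t + 1, h⟩⟩) else 0 := by
    intro i t v
    conv_lhs => rw [← b.sum_repr v]
    rw [map_sum, Fintype.sum_sum_type]
    simp only [map_smul, hb, fromBlocks_apply₂₁, fromBlocks_apply₂₂, Matrix.zero_apply, smul_zero,
      Finset.sum_const_zero, zero_add]
    rw [Fintype.sum_sigma, Finset.sum_eq_single i]
    · simp only [blockDiagonal'_apply_eq, jordanMatrix, Matrix.of_apply]
      split_ifs with h
      · rw [Finset.sum_eq_single ⟨t + 1, h⟩]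
        · simp
        · intro s _ hs
          rw [if_neg, smul_zero]
          exact fun hts => hs (Fin.ext hts.symm)
        · simp
      · refine Finset.sum_eq_zero fun s _ => ?_
        rw [if_neg, smul_zero]
        have := s.2
        omega
    · intro j _ hj
      refine Finset.sum_eq_zero fun s _ => ?_
      rw [blockDiagonal'_apply_ne _ _ _ hj.symm, smul_zero]
    · simp
  induction k generalizing v with
  | zero =>
    refine ⟨fun _ x hx => absurd ?_ hx, fun _ => trivial⟩
    rcases x with a | ⟨i, t⟩
    · simp
    · exact chainMem_zero (t : ℕ)
  | succ k ih =>
    have h1 : v ∈ perpSeq B (k + 1) ↔ ∀ x ∈ chainSet ν n k, B (b x) v = 0 := by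
      constructor
      · intro h x hx
        refine h _ ((ih _).2 fun y hy => ?_)
        rw [b.repr_self, Finsupp.single_apply, if_neg]
        rintro rfl
        exact hy hx
      · intro h u hu
        replace hu := (ih u).1 hu
        rw [← b.sum_repr u, map_sum, LinearMap.sum_apply]
        refine Finset.sum_eq_zero fun x _ => ?_
        by_cases hx : x ∈ chainSet ν n k
        · simp [h x hx]
        · simp [hu x hx]
    rw [h1]
    constructor
    · rintro h (a | ⟨i, ⟨t, ht⟩⟩) hx
      · simp only [inl_mem_chainSet, Nat.even_add_one, not_not] at hx
        refine congrFun (eq_zero_of_mulVec hN (c := fun c => b.repr v (Sum.inl c)) fun c => ?_) a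
        rw [← hν]
        exact h _ hx
      · rcases t with _ | t
        · exact absurd (chainMem_succ_zero k) hx
        · simp only [inr_mem_chainSet, chainMem_succ_succ, not_not] at hx
          have h2 := h (Sum.inr ⟨i, ⟨t, by omega⟩⟩) hx
          rw [hJ, dif_pos ht] at h2
          exact h2
    · rintro h (a | ⟨i, t⟩) hx
      · rw [hν]
        refine Finset.sum_eq_zero fun c _ => ?_
        rw [h, mul_zero]
        simpa [Nat.even_add_one] using hx
      · rw [hJ]
        split_ifs with ht
        · apply h
          simp only [inr_mem_chainSet, chainMem_succ_succ, not_not]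
          exact hx
        · rfl

open Classical in
theorem finrank_perpSeq (hN : N.det ≠ 0) (b : Module.Basis (ν ⊕ Σ i, Fin (n i)) K V)
    (hb : ∀ x y, B (b x) (b y) =
      Matrix.fromBlocks N 0 0 (Matrix.blockDiagonal' fun i => jordanMatrix (n i)) x y)
    (k : ℕ) : Module.finrank K (perpSeq B k) =
      (if Even k then Fintype.card ν else 0) + ∑ i, chainCount k (n i) := by
  have h1 : perpSeq B k = Submodule.span K (Set.range fun x : chainSet ν n k => b x) := by
    ext v
    rw [mem_perpSeq hN b hb, ← Set.image_eq_range, b.mem_span_image]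
    constructor
    · intro h x hx
      by_contra hx'
      exact (Finsupp.mem_support_iff.1 hx) (h x hx')
    · intro h x hx
      by_contra hx'
      exact hx (h (Finsupp.mem_support_iff.2 hx'))
  have h2 : LinearIndependent K fun x : chainSet ν n k => b x :=
    b.linearIndependent.comp _ Subtype.val_injective
  rw [h1, finrank_span_eq_card h2,
    Fintype.card_subtype]
  rw [Finset.card_filter, Fintype.sum_sum_type]
  congr 1
  · simp only [inl_mem_chainSet]
    split_ifs with h <;> simp
  · rw [Fintype.sum_sigma]
    refine Finset.sum_congr rfl fun i _ => ?_
    simp only [inr_mem_chainSet]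
    rw [← Finset.card_filter, chainCount]
    refine Finset.card_bij (fun t _ => (t : ℕ)) ?_ ?_ ?_
    · intro t ht
      simpa using ht
    · intro t _ s _ h
      exact Fin.ext h
    · intro t ht
      simp only [Finset.mem_filter, Finset.mem_range] at ht
      exact ⟨⟨t, ht.1⟩, by simpa using ht.2, rfl⟩

theorem card_le_of_mul_eq_one {ν ν' : Type*} [Fintype ν] [Fintype ν'] [DecidableEq ν]
    {L : Matrix ν ν' K} {c : Matrix ν' ν K} (h : L * c = 1) :
    Fintype.card ν ≤ Fintype.card ν' := by
  have h1 : Function.Injective (Matrix.mulVecLin c) := by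
    intro x y hxy
    have := congrArg (Matrix.mulVec L) hxy
    simpa [h] using this
  simpa using LinearMap.finrank_le_finrank_of_injective h1

/-- Nonsingularity gives each transition matrix a left inverse, hence inequalities between the sizes
in both directions; with equal sizes a left inverse is two-sided. -/
theorem mcong_of_eq_of_eq {ν ν' : Type*} [Fintype ν] [Fintype ν'] [DecidableEq ν] [DecidableEq ν']
    {N : Matrix ν ν K} {N' : Matrix ν' ν' K} (hN : N.det ≠ 0) (hN' : N'.det ≠ 0)
    {c : Matrix ν' ν K} {c' : Matrix ν ν' K} (h : N = cᴴ * N' * c) (h' : N' = c'ᴴ * N * c') :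
    MCong N N' := by
  have h1 : (N⁻¹ * cᴴ * N') * c = 1 := by
    rw [Matrix.mul_assoc, Matrix.mul_assoc, ← Matrix.mul_assoc cᴴ, ← h,
      Matrix.nonsing_inv_mul _ (isUnit_iff_ne_zero.2 hN)]
  have h2 : (N'⁻¹ * c'ᴴ * N) * c' = 1 := by
    rw [Matrix.mul_assoc, Matrix.mul_assoc, ← Matrix.mul_assoc c'ᴴ, ← h',
      Matrix.nonsing_inv_mul _ (isUnit_iff_ne_zero.2 hN')]
  have hc := le_antisymm (card_le_of_mul_eq_one h1) (card_le_of_mul_eq_one h2)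
  refine MCong.symm ⟨c, N⁻¹ * cᴴ * N', ?_, h1, h⟩
  exact (Matrix.mul_eq_one_comm_of_card_eq _ _ _ hc).1 h1

/-- A late complement of even index contains the nonsingular basis vectors. Their components along
the chains of the other decomposition sit in even positions, hence also in the following complement
of odd index. That complement is orthogonal to both of its even neighbours on the appropriate side,
so these components drop out of all products. -/
theorem exists_eq_conj_of_singular_decomp {ν' ι' : Type*} [Fintype ν'] [Fintype ι']
    [DecidableEq ν'] [DecidableEq ι'] {n' : ι' → ℕ} {N' : Matrix ν' ν' K}
    (hN : N.det ≠ 0) (b : Module.Basis (ν ⊕ Σ i, Fin (n i)) K V)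
    (hb : ∀ x y, B (b x) (b y) =
      Matrix.fromBlocks N 0 0 (Matrix.blockDiagonal' fun i => jordanMatrix (n i)) x y)
    (hN' : N'.det ≠ 0) (b' : Module.Basis (ν' ⊕ Σ i, Fin (n' i)) K V)
    (hb' : ∀ x y, B (b' x) (b' y) =
      Matrix.fromBlocks N' 0 0 (Matrix.blockDiagonal' fun i => jordanMatrix (n' i)) x y) :
    ∃ c : Matrix ν' ν K, N = cᴴ * N' * c := by
  -- `M` bounds all block sizes, so from index `2 * M` on membership of a chain position depends
  -- only on its own parity.
  let M := ∑ i, n' i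
  have hM : ∀ i, n' i ≤ M := fun i => Finset.single_le_sum (fun _ _ => Nat.zero_le _)
    (Finset.mem_univ i)
  let c : Matrix ν' ν K := Matrix.of fun y x => b'.repr (b (Sum.inl x)) (Sum.inl y)
  let r : ν → V := fun x => ∑ z, b'.repr (b (Sum.inl x)) (Sum.inr z) • b' (Sum.inr z)
  have hbx : ∀ x, b (Sum.inl x) = ∑ y, c y x • b' (Sum.inl y) + r x := by
    intro x
    conv_lhs => rw [← b'.sum_repr (b (Sum.inl x)), Fintype.sum_sum_type]
    rfl
  have heven : ∀ x k, Even k → b (Sum.inl x) ∈ perpSeq B k := by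
    intro x k hk
    rw [mem_perpSeq hN b hb]
    rintro (a | ⟨i, t⟩) h
    · exact absurd hk h
    · rw [b.repr_self, Finsupp.single_apply, if_neg (by simp)]
  have hr : ∀ x, r x ∈ perpSeq B (2 * M + 1) := by
    intro x
    refine Submodule.sum_mem _ fun z _ => ?_
    by_cases hz : b'.repr (b (Sum.inl x)) (Sum.inr z) = 0
    · rw [hz, zero_smul]; exact Submodule.zero_mem _
    · refine Submodule.smul_mem _ _ ?_
      rw [mem_perpSeq hN' b' hb']
      intro w hw
      rw [b'.repr_self, Finsupp.single_apply, if_neg]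
      rintro rfl
      apply hz
      have h1 := (mem_perpSeq hN' b' hb' (2 * M) _).1 (heven x (2 * M) (even_two_mul _))
      apply h1
      obtain ⟨i, t⟩ := z
      have h2 : (t : ℕ) < n' i := t.2
      have h3 := hM i
      rw [inr_mem_chainSet, chainMem_of_lt (by omega)] at hw ⊢
      exact hw
  have hy : ∀ y k, Even k → b' (Sum.inl y) ∈ perpSeq B k := by
    intro y k hk
    rw [mem_perpSeq hN' b' hb']
    rintro (a | ⟨i, t⟩) h
    · exact absurd hk h
    · rw [b'.repr_self, Finsupp.single_apply, if_neg (by simp)]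
  refine ⟨c, ?_⟩
  ext x x'
  have h0 : N x x' = B (b (Sum.inl x)) (b (Sum.inl x')) := by rw [hb, fromBlocks_apply₁₁]
  have h1 : B (r x) (b (Sum.inl x')) = 0 :=
    heven x' (2 * M + 1 + 1) ⟨M + 1, by ring⟩ _ (hr x)
  have h2 : B (∑ y, c y x • b' (Sum.inl y)) (r x') = 0 :=
    hr x' _ (Submodule.sum_mem _ fun y _ => Submodule.smul_mem _ _ (hy y _ (even_two_mul _)))
  rw [h0, hbx x, map_add, LinearMap.add_apply, h1, add_zero, hbx x', map_add, h2, add_zero,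
    form_sum_sum, Matrix.mul_apply]
  simp only [Matrix.mul_apply, Finset.sum_mul, hb', conjTranspose_apply, fromBlocks_apply₁₁]
  exact Finset.sum_comm

theorem card_filter_le_eq {ι : Type*} [Fintype ι] (n : ι → ℕ) (j : ℕ) :
    (Finset.univ.filter fun i => j ≤ n i).card = (Finset.univ.filter fun i => j = n i).card +
      (Finset.univ.filter fun i => j + 1 ≤ n i).card := by
  classical
  rw [← Finset.card_union_of_disjoint]
  · congr 1
    ext i
    simp
    omega
  · rw [Finset.disjoint_filter]
    intro i _ h1 h2
    omega

theorem singular_unique {ν' ι' : Type*} [Fintype ν'] [Fintype ι']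
    [DecidableEq ν'] [DecidableEq ι'] {n' : ι' → ℕ} {N' : Matrix ν' ν' K}
    (hn : ∀ i, 0 < n i) (hn' : ∀ i, 0 < n' i) (hN : N.det ≠ 0) (hN' : N'.det ≠ 0)
    (h : HasMatrix B (Matrix.fromBlocks N 0 0 (Matrix.blockDiagonal' fun i => jordanMatrix (n i))))
    (h' : HasMatrix B
      (Matrix.fromBlocks N' 0 0 (Matrix.blockDiagonal' fun i => jordanMatrix (n' i)))) :
    Finset.univ.val.map n = Finset.univ.val.map n' ∧ MCong N N' := by
  classical
  obtain ⟨b, hb⟩ := h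
  obtain ⟨b', hb'⟩ := h'
  obtain ⟨c, hc⟩ := exists_eq_conj_of_singular_decomp hN b hb hN' b' hb'
  obtain ⟨c', hc'⟩ := exists_eq_conj_of_singular_decomp hN' b' hb' hN b hb
  refine ⟨?_, mcong_of_eq_of_eq hN hN' hc hc'⟩
  have hdim : ∀ k, (if Even k then Fintype.card ν else 0) + ∑ i, chainCount k (n i) =
      (if Even k then Fintype.card ν' else 0) + ∑ i, chainCount k (n' i) := fun k => by
    rw [← finrank_perpSeq hN b hb, ← finrank_perpSeq hN' b' hb']
  -- The first complement contains one vector per block and nothing of the nonsingular part. For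
  -- sizes `k + 2` one compares steps `k` and `k + 2`, which have the same parity, so the size of
  -- the nonsingular part cancels.
  have hge : ∀ j, 0 < j → (Finset.univ.filter fun i => j ≤ n i).card =
      (Finset.univ.filter fun i => j ≤ n' i).card := by
    intro j hj
    rcases j with _ | _ | k
    · omega
    · have := hdim 1
      simp only [chainCount_one, Nat.not_even_one, if_false, zero_add, ← Finset.card_filter] at this
      exact this
    · have e1 := hdim k
      have e2 := hdim (k + 2)
      have h2 : Even (k + 2) ↔ Even k := by simp [Nat.even_add]
      simp only [h2] at e2
      have s1 := Finset.sum_congr (rfl : (Finset.univ : Finset ι) = Finset.univ)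
        fun i _ => chainCount_add_two k (n i)
      have s2 := Finset.sum_congr (rfl : (Finset.univ : Finset ι') = Finset.univ)
        fun i _ => chainCount_add_two k (n' i)
      rw [Finset.sum_add_distrib, Finset.sum_add_distrib] at s1 s2
      by_cases hk : Even k
      · simp only [hk, true_and, not_true, false_and, if_false, Finset.sum_const_zero, add_zero,
          ← Finset.card_filter, if_true] at s1 s2 e1 e2
        change (Finset.univ.filter fun i => k + 2 ≤ n i).card =
          (Finset.univ.filter fun i => k + 2 ≤ n' i).card
        omega
      · simp only [hk, not_false_iff, true_and, false_and, if_false, Finset.sum_const_zero,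
          add_zero, ← Finset.card_filter, zero_add] at s1 s2 e1 e2
        change (Finset.univ.filter fun i => k + 2 ≤ n i).card =
          (Finset.univ.filter fun i => k + 2 ≤ n' i).card
        omega
  ext j
  rcases Nat.eq_zero_or_pos j with rfl | hj
  · rw [Multiset.count_eq_zero_of_notMem, Multiset.count_eq_zero_of_notMem]
    · intro h
      obtain ⟨i, -, hi⟩ := Multiset.mem_map.1 h
      exact (hn' i).ne' hi
    · intro h
      obtain ⟨i, -, hi⟩ := Multiset.mem_map.1 h
      exact (hn i).ne' hi
  · have a1 := card_filter_le_eq n j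
    have a2 := card_filter_le_eq n' j
    have a3 := hge j hj
    have a4 := hge (j + 1) (Nat.succ_pos j)
    rw [Multiset.count_map, Multiset.count_map]
    change (Finset.univ.filter fun i => j = n i).card = (Finset.univ.filter fun i => j = n' i).card
    omega

end SingularUnique

/-! ### The dual polynomial -/

section DualPoly

theorem dualPoly_mul (f g : K[X]) : dualPoly (f * g) = dualPoly f * dualPoly g := by
  simp only [dualPoly, Polynomial.map_mul, reverse_mul_of_domain, mul_coeff_zero, star_mul', mul_inv,
    C_mul]
  ring

theorem dualPoly_one : dualPoly (1 : K[X]) = 1 := by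
  have : (1 : K[X]).reverse = 1 := by rw [← C_1, reverse_C]
  simp [dualPoly, this]

theorem dualPoly_pow (f : K[X]) (n : ℕ) : dualPoly (f ^ n) = dualPoly f ^ n := by
  induction n with
  | zero => simp [dualPoly_one]
  | succ n ih => rw [pow_succ, dualPoly_mul, ih, pow_succ]

theorem natDegree_dualPoly {f : K[X]} (h : f.coeff 0 ≠ 0) :
    (dualPoly f).natDegree = f.natDegree := by
  have h1 : (f.map (starRingEnd K)).coeff 0 ≠ 0 := by simpa using h
  rw [dualPoly, natDegree_C_mul (inv_ne_zero (star_ne_zero.2 h)), reverse_natDegree,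
    natTrailingDegree_eq_zero.2 (Or.inr h1), natDegree_map, Nat.sub_zero]

theorem coeff_dualPoly (f : K[X]) {i : ℕ} (hi : i ≤ f.natDegree) :
    (dualPoly f).coeff i = (star (f.coeff 0))⁻¹ * star (f.coeff (f.natDegree - i)) := by
  rw [dualPoly, coeff_C_mul, coeff_reverse, natDegree_map, revAt_le hi, coeff_map]
  rfl

theorem dualPoly_monic {f : K[X]} (h : f.coeff 0 ≠ 0) : (dualPoly f).Monic := by
  rw [Monic, leadingCoeff, natDegree_dualPoly h, coeff_dualPoly f le_rfl, Nat.sub_self,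
    inv_mul_cancel₀ (star_ne_zero.2 h)]

theorem coeff_zero_dualPoly {f : K[X]} (hf : f.Monic) :
    (dualPoly f).coeff 0 = (star (f.coeff 0))⁻¹ := by
  rw [coeff_dualPoly f (Nat.zero_le _), Nat.sub_zero, hf.coeff_natDegree, star_one, mul_one]

theorem dualPoly_dualPoly {f : K[X]} (hf : f.Monic) (h : f.coeff 0 ≠ 0) :
    dualPoly (dualPoly f) = f := by
  ext i
  by_cases hi : i ≤ f.natDegree
  · rw [coeff_dualPoly _ (by rwa [natDegree_dualPoly h]), coeff_zero_dualPoly hf,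
      natDegree_dualPoly h, coeff_dualPoly f (Nat.sub_le _ _), Nat.sub_sub_self hi]
    simp only [star_inv₀, star_star, star_mul', inv_inv]
    field_simp
  · have h1 : (dualPoly (dualPoly f)).natDegree = f.natDegree := by
      rw [natDegree_dualPoly, natDegree_dualPoly h]
      rw [coeff_zero_dualPoly hf]
      exact inv_ne_zero (star_ne_zero.2 h)
    rw [coeff_eq_zero_of_natDegree_lt (by omega), coeff_eq_zero_of_natDegree_lt (by omega)]

/-- `dualPoly` is multiplicative and involutive on monic polynomials with nonzero constant term and
keeps the degree, so it carries factorisations to factorisations. -/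
theorem dualPoly_irreducible {f : K[X]} (hf : f.Monic) (h : f.coeff 0 ≠ 0) (hi : Irreducible f) :
    Irreducible (dualPoly f) := by
  rw [(dualPoly_monic h).irreducible_iff_natDegree']
  rw [hf.irreducible_iff_natDegree'] at hi
  refine ⟨fun h1 => hi.1 ?_, fun a b ha hb hab => ?_⟩
  · rw [← dualPoly_dualPoly hf h, h1, dualPoly_one]
  · have h0 : a.coeff 0 * b.coeff 0 ≠ 0 := by
      rw [← mul_coeff_zero, hab, coeff_zero_dualPoly hf]
      exact inv_ne_zero (star_ne_zero.2 h)
    have ha0 := left_ne_zero_of_mul h0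
    have hb0 := right_ne_zero_of_mul h0
    have h2 := hi.2 (dualPoly a) (dualPoly b) (dualPoly_monic ha0) (dualPoly_monic hb0)
      (by rw [← dualPoly_mul, hab, dualPoly_dualPoly hf h])
    rw [natDegree_dualPoly hb0] at h2
    rwa [natDegree_dualPoly h]

/-- Evaluation of the dual polynomial in terms of the inverse. -/
theorem eval₂_dualPoly {A : Type*} [CommRing A] (φ : K →+* A) (u : Aˣ) (f : K[X]) :
    f.eval₂ (φ.comp (starRingEnd K)) (↑u⁻¹ : A) * (u : A) ^ f.natDegree =
      (f.map (starRingEnd K)).reverse.eval₂ φ u := by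
  let _ : Invertible (↑u⁻¹ : A) := ⟨u, by simp, by simp⟩
  have h := eval₂_reverse_mul_pow φ (↑u⁻¹ : A) (f.map (starRingEnd K))
  have h1 : ⅟(↑u⁻¹ : A) = u := rfl
  rw [h1, natDegree_map] at h
  rw [← eval₂_map, ← h, mul_assoc, ← mul_pow]
  simp

end DualPoly

namespace FrobeniusBlock

/-! ### The algebra of a Frobenius block -/

section Algebra

variable (Φ : FrobeniusBlock K)

theorem χ_monic : Φ.χ.Monic := Φ.monic.pow _

/-- The algebra `K[x] / χ K[x]`. -/
abbrev E : Type _ := AdjoinRoot Φ.χ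

/-- The class of `x`. -/
abbrev x : Φ.E := AdjoinRoot.root Φ.χ

/-- The class of `p`. -/
abbrev π : Φ.E := AdjoinRoot.mk Φ.χ Φ.p

theorem natDegree_p_pos : 0 < Φ.p.natDegree := Φ.irreducible.natDegree_pos

theorem dim_pos : 0 < Φ.dim := by
  rw [dim, χ, Φ.monic.natDegree_pow]
  exact Nat.mul_pos Φ.s_pos Φ.natDegree_p_pos

instance : NeZero Φ.dim := ⟨Nat.pos_iff_ne_zero.1 Φ.dim_pos⟩

/-- The basis `1, x, …, x ^ (n - 1)`. -/
def bas : Module.Basis (Fin Φ.dim) K Φ.E := AdjoinRoot.powerBasisAux' Φ.χ_monic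

instance : Module.Finite K Φ.E := Module.Finite.of_basis Φ.bas

theorem finrank_E : Module.finrank K Φ.E = Φ.dim := by
  rw [Module.finrank_eq_card_basis Φ.bas, Fintype.card_fin]

theorem bas_apply (i : Fin Φ.dim) : Φ.bas i = Φ.x ^ (i : ℕ) :=
  (AdjoinRoot.powerBasis' Φ.χ_monic).basis_eq_pow i

theorem x_pow_dim : Φ.x ^ Φ.dim = ∑ i : Fin Φ.dim, (-Φ.χ.coeff i) • Φ.x ^ (i : ℕ) := by
  have h : aeval Φ.x Φ.χ = 0 := by rw [AdjoinRoot.aeval_eq, AdjoinRoot.mk_self]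
  rw [aeval_eq_sum_range, Finset.sum_range_succ, Φ.χ_monic.coeff_natDegree, one_smul] at h
  rw [Fin.sum_univ_eq_sum_range (fun i => (-Φ.χ.coeff i) • Φ.x ^ i)]
  simp only [neg_smul, Finset.sum_neg_distrib]
  exact eq_neg_of_add_eq_zero_right h

theorem x_mul_bas (j : Fin Φ.dim) : Φ.x * Φ.bas j = ∑ i, Φ.toMatrix i j • Φ.bas i := by
  rw [bas_apply, ← pow_succ']
  simp only [toMatrix, Matrix.of_apply, bas_apply]
  split_ifs with h
  · rw [h, x_pow_dim]
  · have hj := j.2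
    rw [Finset.sum_eq_single ⟨(j : ℕ) + 1, by omega⟩]
    · simp
    · intro i _ hi
      rw [if_neg, zero_smul]
      exact fun h' => hi (Fin.ext h')
    · simp

/-- This identity transfers computations with polynomials in the block to the algebra `E`. -/
theorem toMatrix_eq : Φ.toMatrix = Algebra.leftMulMatrix Φ.bas Φ.x := by
  ext i j
  rw [Algebra.leftMulMatrix_eq_repr_mul, x_mul_bas, map_sum, Finsupp.finsetSum_apply]
  simp [Finsupp.single_apply]

theorem χ_coeff_zero_ne (h : Φ.p.coeff 0 ≠ 0) : Φ.χ.coeff 0 ≠ 0 := by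
  rw [χ, coeff_zero_eq_eval_zero, eval_pow, ← coeff_zero_eq_eval_zero]
  exact pow_ne_zero _ h

theorem coeff_zero_ne_of_det_ne (h : Φ.toMatrix.det ≠ 0) : Φ.p.coeff 0 ≠ 0 := by
  intro h0
  apply h
  have h1 : Φ.χ.coeff 0 = 0 := by
    rw [χ, coeff_zero_eq_eval_zero, eval_pow, ← coeff_zero_eq_eval_zero, h0,
      zero_pow Φ.s_pos.ne']
  refine Matrix.det_eq_zero_of_row_eq_zero 0 fun j => ?_
  simp [toMatrix, h1]

theorem isUnit_mk_of_isCoprime {f g : K[X]} (h : IsCoprime g f) : IsUnit (AdjoinRoot.mk f g) := by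
  obtain ⟨a, b, hab⟩ := h
  refine IsUnit.of_mul_eq_one (AdjoinRoot.mk f a) ?_
  rw [← map_mul, ← map_one (AdjoinRoot.mk f), AdjoinRoot.mk_eq_mk, ← hab]
  exact ⟨-b, by ring⟩

theorem isUnit_mk {g : K[X]} (h : ¬ Φ.p ∣ g) : IsUnit (AdjoinRoot.mk Φ.χ g) :=
  isUnit_mk_of_isCoprime ((Φ.irreducible.coprime_iff_not_dvd.2 h).symm.pow_right)

theorem not_p_dvd_X (h : Φ.p.coeff 0 ≠ 0) : ¬ Φ.p ∣ (X : K[X]) := by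
  rintro ⟨q, hq⟩
  have h1 : q.coeff 0 = 0 := by
    have := congrArg (fun f => coeff f 0) hq
    simp only [coeff_X_zero, mul_coeff_zero] at this
    exact (mul_eq_zero.1 this.symm).resolve_left h
  obtain ⟨q', rfl⟩ := X_dvd_iff.2 h1
  have h2 : (X : K[X]) * 1 = X * (Φ.p * q') := by rw [mul_one, ← mul_assoc, mul_comm X Φ.p, mul_assoc, ← hq]
  have h3 := mul_left_cancel₀ X_ne_zero h2
  exact Φ.irreducible.not_isUnit (IsUnit.of_mul_eq_one _ h3.symm)

/-- The class of `x` as a unit. -/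
def u (h : Φ.p.coeff 0 ≠ 0) : Φ.Eˣ := (Φ.isUnit_mk (Φ.not_p_dvd_X h)).unit

@[simp] theorem coe_u (h : Φ.p.coeff 0 ≠ 0) : (Φ.u h : Φ.E) = Φ.x := rfl

theorem det_ne_of_coeff_zero_ne (h : Φ.p.coeff 0 ≠ 0) : Φ.toMatrix.det ≠ 0 := by
  rw [toMatrix_eq, ← coe_u Φ h]
  exact ((Matrix.isUnit_iff_isUnit_det _).1 ((Φ.u h).isUnit.map (Algebra.leftMulMatrix Φ.bas))).ne_zero

theorem det_ne_iff : Φ.toMatrix.det ≠ 0 ↔ Φ.p.coeff 0 ≠ 0 :=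
  ⟨Φ.coeff_zero_ne_of_det_ne, Φ.det_ne_of_coeff_zero_ne⟩

theorem π_pow_s : Φ.π ^ Φ.s = 0 := by
  rw [← map_pow]; exact AdjoinRoot.mk_self

theorem π_pow_pred_ne_zero : Φ.π ^ (Φ.s - 1) ≠ 0 := by
  rw [← map_pow, Ne, AdjoinRoot.mk_eq_zero, χ,
    pow_dvd_pow_iff Φ.irreducible.ne_zero Φ.irreducible.not_isUnit]
  have := Φ.s_pos
  omega

/-- `E` is local: a polynomial is prime to χ = p^s or divisible by p, and the class of p is
nilpotent. -/
theorem isUnit_or_isNilpotent (a : Φ.E) : IsUnit a ∨ IsNilpotent a := by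
  obtain ⟨g, rfl⟩ := AdjoinRoot.mk_surjective a
  by_cases h : Φ.p ∣ g
  · right
    obtain ⟨g', rfl⟩ := h
    refine ⟨Φ.s, ?_⟩
    rw [map_mul, mul_pow, Φ.π_pow_s, zero_mul]
  · exact Or.inl (Φ.isUnit_mk h)

instance : Nontrivial Φ.E := ⟨⟨Φ.π ^ (Φ.s - 1), 0, Φ.π_pow_pred_ne_zero⟩⟩

/-- Every nonzero ideal of `E` contains the socle: a nonzero class is π^k times a unit with k < s,
and the missing power of π can be supplied. -/
theorem exists_mul_eq {a : Φ.E} (h : a ≠ 0) : ∃ b, a * b = Φ.π ^ (Φ.s - 1) := by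
  obtain ⟨g, rfl⟩ := AdjoinRoot.mk_surjective a
  rw [Ne, AdjoinRoot.mk_eq_zero] at h
  have hg0 : g ≠ 0 := by rintro rfl; exact h (dvd_zero _)
  have hfin : FiniteMultiplicity Φ.p g := FiniteMultiplicity.of_not_isUnit Φ.irreducible.not_isUnit hg0
  obtain ⟨c, hc, hcp⟩ := hfin.exists_eq_pow_mul_and_not_dvd
  set k := multiplicity Φ.p g
  have hk : k < Φ.s := by
    by_contra hk
    apply h
    rw [hc]
    exact (pow_dvd_pow _ (not_lt.1 hk)).mul_right _
  obtain ⟨v, hv⟩ := Φ.isUnit_mk hcp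
  refine ⟨↑v⁻¹ * Φ.π ^ (Φ.s - 1 - k), ?_⟩
  rw [hc, map_mul, ← hv, map_pow, mul_assoc, Units.mul_inv_cancel_left, ← pow_add]
  congr 1
  omega

/-- A functional on the algebra is nondegenerate if it does not vanish on an ideal. -/
def NondegFun (ℓ : Φ.E →ₗ[K] K) : Prop := ∀ a, (∀ b, ℓ (a * b) = 0) → a = 0

variable {Φ}

/-- Since the socle lies in every nonzero ideal, a functional need only be tested there. -/
theorem nondegFun_of_ne {ℓ : Φ.E →ₗ[K] K} {a : Φ.E} (h : ℓ (Φ.π ^ (Φ.s - 1) * a) ≠ 0) :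
    Φ.NondegFun ℓ := by
  intro b hb
  by_contra hb0
  obtain ⟨c, hc⟩ := Φ.exists_mul_eq hb0
  apply h
  rw [← hc, mul_assoc]
  exact hb _

theorem NondegFun.exists_ne {ℓ : Φ.E →ₗ[K] K} (h : Φ.NondegFun ℓ) :
    ∃ a, ℓ (Φ.π ^ (Φ.s - 1) * a) ≠ 0 := by
  by_contra hc
  push Not at hc
  exact Φ.π_pow_pred_ne_zero (h _ hc)

/-- The map a ↦ ℓ(a ·) from `E` to its dual is injective by nondegeneracy, hence bijective by
equality of dimensions. -/
theorem NondegFun.exists_eq {ℓ : Φ.E →ₗ[K] K} (h : Φ.NondegFun ℓ) (φ : Φ.E →ₗ[K] K) :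
    ∃ a, ∀ b, φ b = ℓ (a * b) := by
  let T : Φ.E →ₗ[K] Module.Dual K Φ.E := LinearMap.mk₂ K (fun a b => ℓ (a * b))
    (fun a a' b => by simp [add_mul]) (fun c a b => by simp)
    (fun a b b' => by simp [mul_add]) (fun c a b => by simp)
  have hT : Function.Injective T := by
    rw [injective_iff_map_eq_zero]
    intro a ha
    exact h a fun b => LinearMap.congr_fun ha b
  have hT' : Function.Surjective T :=
    (LinearMap.injective_iff_surjective_of_finrank_eq_finrank
      (Subspace.dual_finrank_eq).symm).1 hT
  obtain ⟨a, ha⟩ := hT' φ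
  exact ⟨a, fun b => (LinearMap.congr_fun ha b).symm⟩

theorem NondegFun.ext {ℓ : Φ.E →ₗ[K] K} (h : Φ.NondegFun ℓ) {a a' : Φ.E}
    (haa : ∀ b, ℓ (a * b) = ℓ (a' * b)) : a = a' := by
  rw [← sub_eq_zero]
  refine h _ fun b => ?_
  rw [sub_mul, map_sub, haa, sub_self]

end Algebra

end FrobeniusBlock

/-! ### Cosquares and adjoints -/

section Cosquare

variable {V : Type*} [AddCommGroup V] [Module K V]

/-- `τ` is the cosquare of the form: `B(u, v)` is conjugate to `B(τ v, u)`. -/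
def IsCosq (B : V →ₗ⋆[K] V →ₗ[K] K) (τ : V →ₗ[K] V) : Prop := ∀ u v, B u v = star (B (τ v) u)

theorem IsCosq.map_map {B : V →ₗ⋆[K] V →ₗ[K] K} {τ : V →ₗ[K] V} (h : IsCosq B τ) (u v : V) :
    B (τ u) (τ v) = B u v := by
  rw [h u v, h (τ v) u, star_star]

theorem isCosq_of_basis {ι : Type*} [Fintype ι] (b : Module.Basis ι K V)
    {B : V →ₗ⋆[K] V →ₗ[K] K} {τ : V →ₗ[K] V}
    (h : ∀ i j, B (b i) (b j) = star (B (τ (b j)) (b i))) : IsCosq B τ := by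
  intro u v
  have hτ : τ v = ∑ j, b.repr v j • τ (b j) := by
    conv_lhs => rw [← b.sum_repr v, map_sum]
    simp
  conv_rhs => rw [hτ, ← b.sum_repr u, form_sum_sum]
  conv_lhs => rw [← b.sum_repr v, ← b.sum_repr u, form_sum_sum]
  rw [star_sum, Finset.sum_comm]
  refine Finset.sum_congr rfl fun j _ => ?_
  rw [star_sum]
  refine Finset.sum_congr rfl fun i _ => ?_
  rw [star_mul', star_mul', star_star, ← h]
  ring

/-- The adjoint of an isometry is its inverse, and scalars leave the first argument conjugated. -/
theorem adjoint_aeval {B : V →ₗ⋆[K] V →ₗ[K] K} {T T' : V →ₗ[K] V} (hT : T * T' = 1)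
    (hB : ∀ u v, B (T u) (T v) = B u v) (f : K[X]) (u v : V) :
    B (aeval T f u) v = B u (aeval T' (f.map (starRingEnd K)) v) := by
  have hn : ∀ n : ℕ, ∀ u v, B ((T ^ n) u) v = B u ((T' ^ n) v) := by
    intro n
    induction n with
    | zero => simp
    | succ n ih =>
      intro u v
      have h1 : T (T' v) = v := LinearMap.congr_fun hT v
      rw [pow_succ', Module.End.mul_apply, pow_succ, Module.End.mul_apply, ← ih]
      conv_lhs => rw [← h1, hB]
  induction f using Polynomial.induction_on' with
  | add f g hf hg => simp [hf, hg]
  | monomial n a => simp [aeval_monomial, hn]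

theorem Nondeg.exists_cosq [FiniteDimensional K V] {B : V →ₗ⋆[K] V →ₗ[K] K} (hB : Nondeg B) :
    ∃ τ : V →ₗ[K] V, IsCosq B τ := by
  let b := Module.finBasis K V
  let N : Matrix _ _ K := Matrix.of fun i j => B (b i) (b j)
  have hN : IsUnit N.det := isUnit_iff_ne_zero.2 ((HasMatrix.nondeg_iff ⟨b, fun i j => rfl⟩).1 hB)
  -- In matrices the defining relation of the cosquare reads Nᴴ = Mᴴ N, and this is its solution.
  let M := (Nᴴ)⁻¹ * N
  refine ⟨Matrix.toLin b b M, isCosq_of_basis b fun i j => ?_⟩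
  have h1 : Mᴴ * N = Nᴴ := by
    simp only [M]
    rw [conjTranspose_mul, conjTranspose_nonsing_inv, conjTranspose_conjTranspose,
      Matrix.mul_assoc, Matrix.nonsing_inv_mul _ hN, Matrix.mul_one]
  have h2 := congrFun (congrFun h1 j) i
  rw [Matrix.mul_apply] at h2
  rw [Matrix.toLin_self, map_sum, LinearMap.sum_apply]
  have h3 : ∑ k, B (M k j • b k) (b i) = ∑ k, Mᴴ j k * N k i :=
    Finset.sum_congr rfl fun k _ => by simp [N, starRingEnd_apply]
  rw [h3, h2]
  simp [N]

theorem IsCosq.injective {B : V →ₗ⋆[K] V →ₗ[K] K} {τ : V →ₗ[K] V} (h : IsCosq B τ)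
    (hB : Nondeg B) : Function.Injective τ := by
  rw [injective_iff_map_eq_zero]
  intro v hv
  refine hB v fun u => ?_
  rw [h, hv]
  simp

theorem IsCosq.exists_inv [FiniteDimensional K V] {B : V →ₗ⋆[K] V →ₗ[K] K} {τ : V →ₗ[K] V}
    (h : IsCosq B τ) (hB : Nondeg B) : ∃ τ' : V →ₗ[K] V, τ * τ' = 1 ∧ τ' * τ = 1 := by
  let e := LinearEquiv.ofInjectiveEndo τ (h.injective hB)
  refine ⟨e.symm, ?_, ?_⟩
  · ext v; exact e.apply_symm_apply v
  · ext v; exact e.symm_apply_apply v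

/-- The form with a given matrix in a given basis. -/
def formOfBasis {ι : Type*} [Fintype ι] [DecidableEq ι] (b : Module.Basis ι K V)
    (M : Matrix ι ι K) : V →ₗ⋆[K] V →ₗ[K] K :=
  LinearMap.mk₂'ₛₗ _ _ (fun x y => matrixForm M (b.equivFun x) (b.equivFun y))
    (fun x x' y => by simp) (fun c x y => by simp)
    (fun x y y' => by simp) (fun c x y => by simp)

theorem formOfBasis_apply {ι : Type*} [Fintype ι] [DecidableEq ι] (b : Module.Basis ι K V)
    (M : Matrix ι ι K) (i j : ι) : formOfBasis b M (b i) (b j) = M i j := by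
  simp only [formOfBasis, LinearMap.mk₂'ₛₗ_apply, matrixForm]
  rw [Finset.sum_eq_single i, Finset.sum_eq_single j]
  · simp
  · intro k _ hk; simp [hk.symm]
  · simp
  · intro k _ hk; simp [hk.symm]
  · simp

end Cosquare

/-! ### The involution of the algebra of a block, and `∗`-roots -/

namespace FrobeniusBlock

section Involution

variable (Φ : FrobeniusBlock K)

/-- The polynomial `p` is its own dual. -/
def SelfDual : Prop := dualPoly Φ.p = Φ.p

variable {Φ}

theorem SelfDual.coeff_ne (h : Φ.SelfDual) : Φ.p.coeff 0 ≠ 0 := by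
  intro h0
  apply Φ.irreducible.ne_zero
  rw [← h, dualPoly, h0]
  simp

theorem SelfDual.χ_eq (h : Φ.SelfDual) : dualPoly Φ.χ = Φ.χ := by
  rw [χ, dualPoly_pow, h]

/-- The elements f̄(u⁻¹) and f^∨(u) differ by a power of u and a nonzero constant, both units. -/
theorem eval₂_inv_eq_zero_iff {f : K[X]} (hf : f.coeff 0 ≠ 0) {A : Type*} [CommRing A] (φ : K →+* A)
    (u : Aˣ) : f.eval₂ (φ.comp (starRingEnd K)) (↑u⁻¹ : A) = 0 ↔ (dualPoly f).eval₂ φ u = 0 := by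
  have h1 := eval₂_dualPoly φ u f
  rw [dualPoly, eval₂_mul, eval₂_C, ← h1]
  have hu : IsUnit (φ (star (f.coeff 0))⁻¹) :=
    (isUnit_iff_ne_zero.2 (inv_ne_zero (star_ne_zero.2 hf))).map φ
  rw [hu.mul_right_eq_zero, (u.isUnit.pow _).mul_left_eq_zero]

/-- The involution `f(x)° = f̄(x⁻¹)` of the algebra of the block. -/
def σ (h : Φ.SelfDual) : Φ.E →+* Φ.E :=
  AdjoinRoot.lift ((AdjoinRoot.of Φ.χ).comp (starRingEnd K)) (↑(Φ.u h.coeff_ne)⁻¹ : Φ.E) (by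
    rw [eval₂_inv_eq_zero_iff (Φ.χ_coeff_zero_ne h.coeff_ne), h.χ_eq]
    exact AdjoinRoot.eval₂_root _)

@[simp] theorem σ_of (h : Φ.SelfDual) (a : K) :
    σ h (AdjoinRoot.of Φ.χ a) = AdjoinRoot.of Φ.χ (star a) := by
  rw [σ, AdjoinRoot.lift_of]; rfl

@[simp] theorem σ_x (h : Φ.SelfDual) : σ h Φ.x = ↑(Φ.u h.coeff_ne)⁻¹ := by
  rw [σ, AdjoinRoot.lift_root]

theorem σ_mk (h : Φ.SelfDual) (f : K[X]) : σ h (AdjoinRoot.mk Φ.χ f) =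
    f.eval₂ ((AdjoinRoot.of Φ.χ).comp (starRingEnd K)) (↑(Φ.u h.coeff_ne)⁻¹ : Φ.E) := by
  rw [σ, AdjoinRoot.lift_mk]

@[simp] theorem σ_inv_u (h : Φ.SelfDual) : σ h (↑(Φ.u h.coeff_ne)⁻¹ : Φ.E) = Φ.x := by
  have h1 : σ h (↑(Φ.u h.coeff_ne)⁻¹ : Φ.E) * σ h Φ.x = 1 := by
    rw [← map_mul, ← coe_u Φ h.coeff_ne, Units.inv_mul, map_one]
  rw [σ_x] at h1
  rw [← coe_u Φ h.coeff_ne]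
  exact (Units.mul_inv_eq_one).1 h1

@[simp] theorem σ_σ (h : Φ.SelfDual) (a : Φ.E) : σ h (σ h a) = a := by
  have h1 : (σ h).comp (σ h) = RingHom.id _ := by
    refine AdjoinRoot.ringHom_ext ?_ ?_
    · ext a
      simp
    · simp
  exact RingHom.congr_fun h1 a

theorem σ_smul (h : Φ.SelfDual) (c : K) (a : Φ.E) : σ h (c • a) = star c • σ h a := by
  rw [Algebra.smul_def, Algebra.smul_def, map_mul]
  congr 1
  exact σ_of h c

/-- The form `(f, g) ↦ ℓ(f° a g)` on the algebra of the block. -/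
def tform (h : Φ.SelfDual) (ℓ : Φ.E →ₗ[K] K) (a : Φ.E) : Φ.E →ₗ⋆[K] Φ.E →ₗ[K] K :=
  LinearMap.mk₂'ₛₗ _ _ (fun f g => ℓ (σ h f * a * g)) (fun f f' g => by simp [add_mul])
    (fun c f g => by simp [σ_smul, starRingEnd_apply])
    (fun f g g' => by simp [mul_add]) (fun c f g => by simp)

@[simp] theorem tform_apply (h : Φ.SelfDual) (ℓ : Φ.E →ₗ[K] K) (a f g : Φ.E) :
    tform h ℓ a f g = ℓ (σ h f * a * g) := rfl

/-- Symmetry of a functional up to the factor `η`. -/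
def IsSymmFun (h : Φ.SelfDual) (η : K) (ℓ : Φ.E →ₗ[K] K) : Prop :=
  ∀ y, ℓ (σ h y) = η * star (ℓ (↑(Φ.u h.coeff_ne)⁻¹ * y))

variable (Φ) in
/-- The form on the algebra whose matrix in the basis `1, x, …` is given. -/
def matForm (X : Matrix (Fin Φ.dim) (Fin Φ.dim) K) : Φ.E →ₗ⋆[K] Φ.E →ₗ[K] K :=
  formOfBasis Φ.bas X

variable (Φ) in
/-- The functional `g ↦ X(1, g)`. -/
def rootFun (X : Matrix (Fin Φ.dim) (Fin Φ.dim) K) : Φ.E →ₗ[K] K := Φ.matForm X 1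

variable {X : Matrix (Fin Φ.dim) (Fin Φ.dim) K}

/-- Read entry by entry, X = X^*Φ is the cosquare relation between basis vectors for multiplication
by x. -/
theorem IsStarRoot.isCosq (hX : Φ.IsStarRoot X) :
    IsCosq (Φ.matForm X) (LinearMap.mulLeft K Φ.x) := by
  refine isCosq_of_basis Φ.bas fun i j => ?_
  rw [LinearMap.mulLeft_apply, x_mul_bas, map_sum, LinearMap.sum_apply, matForm,
    formOfBasis_apply, star_sum]
  conv_lhs => rw [hX.2, Matrix.mul_apply]
  refine Finset.sum_congr rfl fun k _ => ?_
  rw [LinearMap.map_smulₛₗ, LinearMap.smul_apply, formOfBasis_apply, smul_eq_mul, star_mul',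
    starRingEnd_apply, star_star, conjTranspose_apply, mul_comm]

theorem IsStarRoot.coeff_ne (hX : Φ.IsStarRoot X) : Φ.p.coeff 0 ≠ 0 := by
  rw [← det_ne_iff]
  intro h
  apply hX.1
  rw [hX.2, Matrix.det_mul, h, mul_zero]

theorem IsStarRoot.nondeg (hX : Φ.IsStarRoot X) : Nondeg (Φ.matForm X) :=
  (HasMatrix.nondeg_iff ⟨Φ.bas, fun _ _ => formOfBasis_apply _ _ _ _⟩).2 hX.1

theorem aeval_mulLeft_eval₂ (a : Φ.E) (f : K[X]) (b : Φ.E) :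
    aeval (LinearMap.mulLeft K a) f b = aeval a f * b := by
  have h := (Polynomial.aeval_algHom_apply (Algebra.lmul K Φ.E) a f)
  have h2 : Algebra.lmul K Φ.E a = LinearMap.mulLeft K a := rfl
  rw [h2] at h
  rw [h]
  rfl

theorem IsStarRoot.matForm_mul (hX : Φ.IsStarRoot X) (f : K[X]) (a b : Φ.E) :
    Φ.matForm X (AdjoinRoot.mk Φ.χ f * a) b =
      Φ.matForm X a (f.eval₂ ((AdjoinRoot.of Φ.χ).comp (starRingEnd K))
        (↑(Φ.u hX.coeff_ne)⁻¹ : Φ.E) * b) := by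
  have hT : LinearMap.mulLeft K Φ.x * LinearMap.mulLeft K (↑(Φ.u hX.coeff_ne)⁻¹ : Φ.E) = 1 := by
    ext a
    simp only [Module.End.mul_apply, LinearMap.mulLeft_apply, ← mul_assoc, Module.End.one_apply]
    rw [← coe_u Φ hX.coeff_ne, Units.mul_inv, one_mul]
  have h := adjoint_aeval hT hX.isCosq.map_map f a b
  rw [aeval_mulLeft_eval₂, aeval_mulLeft_eval₂, AdjoinRoot.aeval_eq] at h
  rw [h, aeval_def, eval₂_map]
  rfl

/-- The adjoint of χ(x) = 0 is χ̄(x⁻¹), which therefore vanishes as well. Hence χ divides χ^∨, so p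
divides p^∨, and these are monic of equal degree. -/
theorem IsStarRoot.selfDual (hX : Φ.IsStarRoot X) : Φ.SelfDual := by
  have h1 : Φ.χ.eval₂ ((AdjoinRoot.of Φ.χ).comp (starRingEnd K))
      (↑(Φ.u hX.coeff_ne)⁻¹ : Φ.E) = 0 := by
    apply hX.nondeg
    intro a
    have h := hX.matForm_mul Φ.χ a 1
    rw [AdjoinRoot.mk_self, zero_mul, mul_one] at h
    rw [← h]
    simp
  rw [eval₂_inv_eq_zero_iff (Φ.χ_coeff_zero_ne hX.coeff_ne)] at h1
  have h2 : AdjoinRoot.mk Φ.χ (dualPoly Φ.χ) = 0 := by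
    rw [← AdjoinRoot.aeval_eq]
    exact h1
  rw [AdjoinRoot.mk_eq_zero, χ, dualPoly_pow] at h2
  have h3 : Φ.p ∣ dualPoly Φ.p :=
    Φ.irreducible.prime.dvd_of_dvd_pow ((dvd_pow_self _ Φ.s_pos.ne').trans h2)
  exact (eq_of_monic_of_dvd_of_natDegree_le Φ.monic (dualPoly_monic hX.coeff_ne) h3
    (natDegree_dualPoly hX.coeff_ne).le)

theorem HasStarRoot.selfDual (h : Φ.HasStarRoot) : Φ.SelfDual := h.choose_spec.selfDual

/-- As the adjoint of multiplication by a is multiplication by σ(a), everything can be moved to the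
second argument. The `∗`-root is thus encoded by a single functional. -/
theorem IsStarRoot.matForm_eq (hX : Φ.IsStarRoot X) (h : Φ.SelfDual) (a b : Φ.E) :
    Φ.matForm X a b = Φ.rootFun X (σ h a * b) := by
  obtain ⟨f, rfl⟩ := AdjoinRoot.mk_surjective a
  rw [rootFun, σ_mk, ← hX.matForm_mul, mul_one]

theorem IsStarRoot.nondegFun (hX : Φ.IsStarRoot X) : Φ.NondegFun (Φ.rootFun X) := by
  intro a ha
  apply hX.nondeg
  intro b
  rw [hX.matForm_eq hX.selfDual, mul_comm]
  exact ha _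

theorem IsStarRoot.isSymmFun (hX : Φ.IsStarRoot X) (h : Φ.SelfDual) :
    IsSymmFun h 1 (Φ.rootFun X) := by
  intro y
  have h1 := hX.isCosq y 1
  rw [hX.matForm_eq h, hX.matForm_eq h, mul_one, LinearMap.mulLeft_apply, mul_one, σ_x] at h1
  rw [h1, one_mul]

/-- The symmetry of ℓ makes multiplication by x the cosquare of (f, g) ↦ ℓ(σ(f) g), so the Gram
matrix of this form in the power basis is a `∗`-root. -/
theorem hasStarRoot_of_isSymmFun (h : Φ.SelfDual) {ℓ : Φ.E →ₗ[K] K} (hℓ : Φ.NondegFun ℓ)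
    (hs : IsSymmFun h 1 ℓ) : Φ.HasStarRoot := by
  have hm : HasMatrix (tform h ℓ 1) (Matrix.of fun i j => tform h ℓ 1 (Φ.bas i) (Φ.bas j)) :=
    ⟨Φ.bas, fun i j => rfl⟩
  refine ⟨Matrix.of fun i j => tform h ℓ 1 (Φ.bas i) (Φ.bas j), ?_, ?_⟩
  · rw [← hm.nondeg_iff]
    intro a ha
    refine hℓ a fun b => ?_
    have := ha (σ h b)
    rwa [tform_apply, σ_σ, mul_one, mul_comm] at this
  · ext i j
    rw [Matrix.mul_apply]
    have h1 : tform h ℓ 1 (Φ.bas i) (Φ.bas j) = star (tform h ℓ 1 (Φ.x * Φ.bas j) (Φ.bas i)) := by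
      have h2 := hs (σ h (Φ.bas j) * Φ.bas i)
      simp only [tform_apply, mul_one, map_mul, σ_σ, σ_x] at h2 ⊢
      rw [mul_comm, h2, one_mul, mul_assoc]
    rw [Matrix.of_apply, h1, x_mul_bas, map_sum, LinearMap.sum_apply, star_sum]
    refine Finset.sum_congr rfl fun k _ => ?_
    rw [LinearMap.map_smulₛₗ, LinearMap.smul_apply, smul_eq_mul, star_mul', starRingEnd_apply,
      star_star, conjTranspose_apply, mul_comm, Matrix.of_apply]

end Involution

end FrobeniusBlock

/-! ### Laurent polynomials -/

section Laurent

theorem laurent_eval₂_eq_sum {S : Type*} [CommRing S] (f : K →+* S) (x : Sˣ) (q : K[T;T⁻¹]) :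
    LaurentPolynomial.eval₂ f x q = q.coeff.sum fun i a => f a * ((x ^ i : Sˣ) : S) := by
  induction q using LaurentPolynomial.induction_on' with
  | add p q hp hq =>
    rw [map_add, hp, hq, AddMonoidAlgebra.coeff_add, Finsupp.sum_add_index']
    · simp
    · intro i a b; rw [map_add, add_mul]
  | C_mul_T n a =>
    rw [LaurentPolynomial.eval₂_C_mul_T, ← LaurentPolynomial.single_eq_C_mul_T,
      AddMonoidAlgebra.coeff_single, Finsupp.sum_single_index]
    simp

theorem laurent_eval₂_symm {S : Type*} [CommRing S] (f : K →+* S) (x : Sˣ) (ψ : S →+* S)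
    (hf : ∀ a, ψ (f a) = f (star a)) (hx : ψ x = ↑x⁻¹) {q : K[T;T⁻¹]}
    (hq : ∀ i : ℤ, q.coeff (-i) = star (q.coeff i)) :
    ψ (LaurentPolynomial.eval₂ f x q) = LaurentPolynomial.eval₂ f x q := by
  have hx' : Units.map ψ.toMonoidHom x = x⁻¹ := Units.ext hx
  have hz : ∀ i : ℤ, ψ ((x ^ i : Sˣ) : S) = ((x ^ (-i) : Sˣ) : S) := by
    intro i
    have : ψ ((x ^ i : Sˣ) : S) = (Units.map ψ.toMonoidHom (x ^ i) : S) := rfl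
    rw [this, map_zpow, hx', _root_.inv_zpow']
  rw [laurent_eval₂_eq_sum, Finsupp.sum, map_sum]
  refine Finset.sum_nbij' (fun i => -i) (fun i => -i) ?_ ?_ ?_ ?_ ?_
  · intro i hi
    rw [Finsupp.mem_support_iff] at hi ⊢
    rw [hq]
    exact star_ne_zero.2 hi
  · intro i hi
    rw [Finsupp.mem_support_iff] at hi ⊢
    rw [hq]
    exact star_ne_zero.2 hi
  · simp
  · simp
  · intro i _
    rw [map_mul, hf, hz, hq]

theorem coeff_toLaurent_natCast (f : K[X]) (n : ℕ) : (toLaurent f).coeff (n : ℤ) = f.coeff n := by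
  rw [LaurentPolynomial.coeff_toLaurent]
  exact Finsupp.mapDomain_apply Nat.cast_injective _ _

theorem coeff_toLaurent_of_neg (f : K[X]) {n : ℤ} (hn : n < 0) : (toLaurent f).coeff n = 0 := by
  rw [LaurentPolynomial.coeff_toLaurent]
  apply Finsupp.mapDomain_of_notMem_range
  rintro ⟨m, rfl⟩
  simp at hn
  omega

theorem coeff_mul_T (f : K[T;T⁻¹]) (m n : ℤ) :
    (f * LaurentPolynomial.T m).coeff n = f.coeff (n - m) := by
  induction f using LaurentPolynomial.induction_on' with
  | add p q hp hq => simp [add_mul, hp, hq]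
  | C_mul_T k a =>
    rw [mul_assoc, ← LaurentPolynomial.T_add, ← LaurentPolynomial.single_eq_C_mul_T,
      ← LaurentPolynomial.single_eq_C_mul_T, AddMonoidAlgebra.coeff_single,
      AddMonoidAlgebra.coeff_single, Finsupp.single_apply, Finsupp.single_apply]
    congr 1
    exact propext ⟨fun h => by omega, fun h => by omega⟩

/-- The Laurent polynomial `x ^ (-r) f(x)`. -/
def shiftLaurent (r : ℕ) (f : K[X]) : K[T;T⁻¹] := toLaurent f * LaurentPolynomial.T (-(r : ℤ))

theorem shiftLaurent_coeff (r : ℕ) (f : K[X]) (n : ℕ) {j : ℤ} (hj : j + r = n) :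
    (shiftLaurent r f).coeff j = f.coeff n := by
  rw [shiftLaurent, coeff_mul_T, ← coeff_toLaurent_natCast, ← hj]
  congr 1
  ring

theorem shiftLaurent_coeff_neg (r : ℕ) (f : K[X]) {j : ℤ} (hj : j + r < 0) :
    (shiftLaurent r f).coeff j = 0 := by
  rw [shiftLaurent, coeff_mul_T]
  exact coeff_toLaurent_of_neg _ (by omega)

theorem eval₂_shiftLaurent {S : Type*} [CommRing S] (φ : K →+* S) (x : Sˣ) (r : ℕ) (f : K[X]) :
    LaurentPolynomial.eval₂ φ x (shiftLaurent r f) = f.eval₂ φ x * ((x ^ (-(r : ℤ)) : Sˣ) : S) := by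
  rw [shiftLaurent, map_mul, LaurentPolynomial.eval₂_toLaurent, LaurentPolynomial.eval₂_T]

/-- Every Laurent polynomial with exponents in `[-r, r]` is `x ^ (-r) f(x)`. -/
theorem exists_shiftLaurent (r : ℕ) {q : K[T;T⁻¹]} (h : ∀ i : ℤ, (r : ℤ) < i → q.coeff i = 0)
    (h' : ∀ i : ℤ, i < -(r : ℤ) → q.coeff i = 0) :
    ∃ f : K[X], f.natDegree ≤ 2 * r ∧ q = shiftLaurent r f := by
  let f : K[X] := ∑ i ∈ Finset.range (2 * r + 1), C (q.coeff ((i : ℤ) - r)) * X ^ i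
  refine ⟨f, ?_, ?_⟩
  · refine natDegree_sum_le_of_forall_le _ _ fun i hi => ?_
    rw [Finset.mem_range] at hi
    exact (natDegree_C_mul_X_pow_le _ _).trans (by omega)
  · refine LaurentPolynomial.ext fun j => ?_
    by_cases hj : j + r < 0
    · rw [shiftLaurent_coeff_neg _ _ hj, h' j (by omega)]
    · obtain ⟨n, hn⟩ := Int.eq_ofNat_of_zero_le (not_lt.1 hj)
      rw [shiftLaurent_coeff r f n hn]
      simp only [f, finsetSum_coeff, coeff_C_mul_X_pow]
      rw [Finset.sum_ite_eq]
      split_ifs with hm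
      · congr 1; omega
      · rw [Finset.mem_range] at hm
        exact h j (by omega)

theorem invert_shiftLaurent_coeff (r : ℕ) (f : K[X]) (j : ℤ) :
    (LaurentPolynomial.invert (shiftLaurent r (f.map (starRingEnd K)))).coeff j =
      star ((shiftLaurent r f).coeff (-j)) := by
  rw [LaurentPolynomial.invert_apply]
  by_cases hj : -j + r < 0
  · rw [shiftLaurent_coeff_neg _ _ hj, shiftLaurent_coeff_neg _ _ hj, star_zero]
  · obtain ⟨n, hn⟩ := Int.eq_ofNat_of_zero_le (not_lt.1 hj)
    rw [shiftLaurent_coeff r _ n hn, shiftLaurent_coeff r _ n hn, coeff_map]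
    rfl

end Laurent

/-! ### Values of Laurent polynomials in the algebra and in the residue field -/

namespace FrobeniusBlock

section Residue

variable {Φ : FrobeniusBlock K}

/-- The class of `x` in the residue field as a unit. -/
def kappaUnit (h : Φ.SelfDual) : Φ.ResidueFieldˣ := Units.mk0 Φ.kappa (by
  intro h0
  have h1 : Φ.p.eval₂ (AdjoinRoot.of Φ.p) Φ.kappa = 0 := AdjoinRoot.eval₂_root Φ.p
  rw [h0, eval₂_at_zero] at h1
  exact h.coeff_ne ((map_eq_zero _).1 h1))

theorem coe_kappaUnit (h : Φ.SelfDual) : (kappaUnit h : Φ.ResidueField) = Φ.kappa := rfl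

theorem evalKappa_eq (h : Φ.SelfDual) (q : K[T;T⁻¹]) :
    Φ.evalKappa q = LaurentPolynomial.eval₂ (AdjoinRoot.of Φ.p) (kappaUnit h) q := by
  rw [laurent_eval₂_eq_sum, evalKappa]
  refine Finsupp.sum_congr fun i _ => ?_
  rw [Units.val_zpow_eq_zpow_val, coe_kappaUnit]

/-- The value of a Laurent polynomial at `x` in the algebra of the block. -/
def levE (h : Φ.SelfDual) (q : K[T;T⁻¹]) : Φ.E :=
  LaurentPolynomial.eval₂ (AdjoinRoot.of Φ.χ) (Φ.u h.coeff_ne) q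

theorem evalMatrix_eq (h : Φ.SelfDual) (q : K[T;T⁻¹]) :
    Φ.evalMatrix q = Algebra.leftMulMatrix Φ.bas (levE h q) := by
  rw [levE, laurent_eval₂_eq_sum, evalMatrix, Finsupp.sum, Finsupp.sum, map_sum]
  refine Finset.sum_congr rfl fun i _ => ?_
  have h1 : AdjoinRoot.of Φ.χ (q.coeff i) = algebraMap K Φ.E (q.coeff i) := rfl
  rw [h1, ← Algebra.smul_def, map_smul]
  congr 1
  have h2 : Algebra.leftMulMatrix Φ.bas ((Φ.u h.coeff_ne ^ i : Φ.Eˣ) : Φ.E) =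
      (Units.map (Algebra.leftMulMatrix Φ.bas).toRingHom.toMonoidHom (Φ.u h.coeff_ne ^ i) :
        Matrix (Fin Φ.dim) (Fin Φ.dim) K) := rfl
  rw [h2, map_zpow, Matrix.coe_units_zpow, toMatrix_eq]
  rfl

variable (Φ) in
/-- The projection of the algebra of the block onto the residue field. -/
def res : Φ.E →+* Φ.ResidueField :=
  AdjoinRoot.lift (AdjoinRoot.of Φ.p) Φ.kappa (by
    have h1 : Φ.p.eval₂ (AdjoinRoot.of Φ.p) Φ.kappa = 0 := AdjoinRoot.eval₂_root Φ.p
    rw [χ, eval₂_pow, h1, zero_pow Φ.s_pos.ne'])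

@[simp] theorem res_mk (f : K[X]) : Φ.res (AdjoinRoot.mk Φ.χ f) = AdjoinRoot.mk Φ.p f := by
  rw [res, AdjoinRoot.lift_mk]
  exact AdjoinRoot.aeval_eq f

@[simp] theorem res_of (a : K) : Φ.res (AdjoinRoot.of Φ.χ a) = AdjoinRoot.of Φ.p a := by
  rw [res, AdjoinRoot.lift_of]

@[simp] theorem res_x : Φ.res Φ.x = Φ.kappa := by
  rw [res, AdjoinRoot.lift_root]

theorem res_surjective : Function.Surjective Φ.res := by
  intro a
  obtain ⟨f, rfl⟩ := AdjoinRoot.mk_surjective a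
  exact ⟨AdjoinRoot.mk _ f, res_mk f⟩

theorem res_eq_zero_iff (a : Φ.E) : Φ.res a = 0 ↔ Φ.π ∣ a := by
  obtain ⟨f, rfl⟩ := AdjoinRoot.mk_surjective a
  rw [res_mk, AdjoinRoot.mk_eq_zero]
  constructor
  · rintro ⟨g, rfl⟩
    exact ⟨AdjoinRoot.mk _ g, map_mul _ _ _⟩
  · rintro ⟨b, hb⟩
    obtain ⟨g, rfl⟩ := AdjoinRoot.mk_surjective b
    rw [← map_mul, AdjoinRoot.mk_eq_mk] at hb
    have h1 : Φ.p ∣ Φ.χ := dvd_pow_self _ Φ.s_pos.ne'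
    have h2 := dvd_add (h1.trans hb) (dvd_mul_right Φ.p g)
    rwa [sub_add_cancel] at h2

theorem isUnit_iff_res_ne_zero (a : Φ.E) : IsUnit a ↔ Φ.res a ≠ 0 := by
  constructor
  · intro h
    exact (h.map Φ.res).ne_zero
  · intro h
    obtain ⟨f, rfl⟩ := AdjoinRoot.mk_surjective a
    rw [res_mk, Ne, AdjoinRoot.mk_eq_zero] at h
    exact Φ.isUnit_mk h

theorem isNilpotent_iff_res_eq_zero (a : Φ.E) : IsNilpotent a ↔ Φ.res a = 0 := by
  constructor
  · intro h
    exact (h.map Φ.res).eq_zero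
  · intro h
    refine (Φ.isUnit_or_isNilpotent a).resolve_left fun hu => ?_
    exact (isUnit_iff_res_ne_zero a).1 hu h

@[simp] theorem involution_of (h : Φ.SelfDual) (a : K) :
    Φ.involution (AdjoinRoot.of Φ.p a) = AdjoinRoot.of Φ.p (star a) := by
  rw [involution, dif_pos (show dualPoly Φ.p = Φ.p from h), AdjoinRoot.lift_of]
  rfl

@[simp] theorem involution_kappa (h : Φ.SelfDual) : Φ.involution Φ.kappa = Φ.kappa⁻¹ := by
  rw [involution, dif_pos (show dualPoly Φ.p = Φ.p from h)]
  exact AdjoinRoot.lift_root _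

theorem res_inv_u (h : Φ.SelfDual) : Φ.res (↑(Φ.u h.coeff_ne)⁻¹ : Φ.E) = Φ.kappa⁻¹ := by
  have h1 : Φ.res (↑(Φ.u h.coeff_ne)⁻¹ : Φ.E) * Φ.kappa = 1 := by
    rw [← res_x, ← map_mul, ← coe_u Φ h.coeff_ne, Units.inv_mul, map_one]
  exact eq_inv_of_mul_eq_one_left h1

theorem res_σ (h : Φ.SelfDual) (a : Φ.E) : Φ.res (σ h a) = Φ.involution (Φ.res a) := by
  have h1 : Φ.res.comp (σ h) = Φ.involution.comp Φ.res := by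
    refine AdjoinRoot.ringHom_ext ?_ ?_
    · ext a
      simp [h]
    · rw [RingHom.comp_apply, RingHom.comp_apply, σ_x, res_inv_u h, res_x, involution_kappa h]
  exact RingHom.congr_fun h1 a

theorem involution_involution (h : Φ.SelfDual) (a : Φ.ResidueField) :
    Φ.involution (Φ.involution a) = a := by
  obtain ⟨b, rfl⟩ := res_surjective a
  rw [← res_σ h, ← res_σ h, σ_σ]

theorem res_levE (h : Φ.SelfDual) (q : K[T;T⁻¹]) : Φ.res (levE h q) = Φ.evalKappa q := by
  rw [evalKappa_eq h, levE, laurent_eval₂_eq_sum, laurent_eval₂_eq_sum, Finsupp.sum, Finsupp.sum,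
    map_sum]
  refine Finset.sum_congr rfl fun i _ => ?_
  have h1 : Units.map Φ.res.toMonoidHom (Φ.u h.coeff_ne) = kappaUnit h := Units.ext res_x
  rw [map_mul, res_of, ← h1, ← map_zpow]
  rfl

theorem σ_levE (h : Φ.SelfDual) {q : K[T;T⁻¹]} (hq : ∀ i : ℤ, q.coeff (-i) = star (q.coeff i)) :
    σ h (levE h q) = levE h q :=
  laurent_eval₂_symm _ _ _ (σ_of h) (by rw [coe_u, σ_x]) hq

theorem involution_evalKappa (h : Φ.SelfDual) {q : K[T;T⁻¹]}
    (hq : ∀ i : ℤ, q.coeff (-i) = star (q.coeff i)) :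
    Φ.involution (Φ.evalKappa q) = Φ.evalKappa q := by
  rw [← res_levE h, ← res_σ h, σ_levE h hq]

theorem matForm_mul_evalMatrix {X : Matrix (Fin Φ.dim) (Fin Φ.dim) K} (hX : Φ.IsStarRoot X)
    (h : Φ.SelfDual) (q : K[T;T⁻¹]) (i j : Fin Φ.dim) :
    tform h (Φ.rootFun X) (levE h q) (Φ.bas i) (Φ.bas j) = (X * Φ.evalMatrix q) i j := by
  rw [tform_apply, mul_assoc, ← hX.matForm_eq h, evalMatrix_eq h, Matrix.mul_apply]
  conv_lhs => rw [← Φ.bas.sum_repr (levE h q * Φ.bas j), map_sum]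
  refine Finset.sum_congr rfl fun k _ => ?_
  rw [map_smul, matForm, formOfBasis_apply, Algebra.leftMulMatrix_eq_repr_mul, smul_eq_mul,
    mul_comm]

/-! ### Stationary functions -/

theorem SelfDual.coeff_sub (h : Φ.SelfDual) {i : ℕ} (hi : i ≤ Φ.p.natDegree) :
    star (Φ.p.coeff (Φ.p.natDegree - i)) = star (Φ.p.coeff 0) * Φ.p.coeff i := by
  have h1 := coeff_dualPoly Φ.p hi
  rw [show dualPoly Φ.p = Φ.p from h] at h1
  rw [h1, mul_inv_cancel_left₀ (star_ne_zero.2 h.coeff_ne)]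

theorem SelfDual.coeff_zero_mul (h : Φ.SelfDual) : star (Φ.p.coeff 0) * Φ.p.coeff 0 = 1 := by
  rw [← h.coeff_sub (Nat.zero_le _), Nat.sub_zero, Φ.monic.coeff_natDegree, star_one]

/-- If q(κ) = 0, then p divides x^r q(x), which has degree at most 2r. This leaves only deg p = 2r
and x^r q(x) = c p(x). Comparing outer coefficients gives a_r = c and ā_r = p(0) c, and each of the
three conditions on a_r in even degree then rules out c ≠ 0. -/
theorem evalKappa_ne_zero (hchar : (2 : K) ≠ 0) (h : Φ.SelfDual) {q : K[T;T⁻¹]} (hq0 : q ≠ 0)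
    (hq : IsStationaryFunction Φ.p q) : Φ.evalKappa q ≠ 0 := by
  intro h0
  set r := Φ.p.natDegree / 2 with hr
  obtain ⟨f, hf, rfl⟩ := exists_shiftLaurent r hq.bounded (fun i hi => by
    have := hq.symm (-i)
    rw [neg_neg] at this
    rw [this, hq.bounded (-i) (by omega), star_zero])
  rw [evalKappa_eq h, eval₂_shiftLaurent, Units.mul_left_eq_zero, coe_kappaUnit] at h0
  have h1 : AdjoinRoot.mk Φ.p f = 0 := by rw [← AdjoinRoot.aeval_eq]; exact h0
  rw [AdjoinRoot.mk_eq_zero] at h1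
  have hf0 : f ≠ 0 := by
    rintro rfl
    exact hq0 (by simp [shiftLaurent])
  have hdeg := natDegree_le_of_dvd h1 hf0
  obtain ⟨g, rfl⟩ := h1
  have hg0 : g ≠ 0 := right_ne_zero_of_mul hf0
  rw [natDegree_mul Φ.irreducible.ne_zero hg0] at hf
  have hev : Φ.p.natDegree = 2 * r := by omega
  have hg : g.natDegree = 0 := by omega
  rw [natDegree_eq_zero] at hg
  obtain ⟨c, rfl⟩ := hg
  have hc : c ≠ 0 := by rintro rfl; simp at hg0
  have hE : Even Φ.p.natDegree := ⟨r, by omega⟩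
  have hcr : (shiftLaurent r (Φ.p * C c)).coeff (r : ℤ) = c := by
    rw [shiftLaurent_coeff r _ (2 * r) (by push_cast; ring), coeff_mul_C, ← hev,
      Φ.monic.coeff_natDegree, one_mul]
  have hc0 : (shiftLaurent r (Φ.p * C c)).coeff (-(r : ℤ)) = Φ.p.coeff 0 * c := by
    rw [shiftLaurent_coeff r _ 0 (by push_cast; ring), coeff_mul_C]
  have hs := hq.symm r
  rw [hc0, hcr] at hs
  by_cases ht : TrivialInvolution K
  · have := hq.even_a hE ht
    rw [hcr] at this
    exact hc this
  · by_cases hp : Φ.p.coeff 0 = 1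
    · have := hq.even_c hE ht hp
      rw [hcr] at this
      rw [hp, one_mul] at hs
      rw [← hs] at this
      have h2 : (2 : K) * c = 0 := by linear_combination this
      exact (mul_ne_zero hchar hc) h2
    · have := hq.even_b hE ht hp
      rw [hcr, ← hs] at this
      exact hp (mul_right_cancel₀ hc (by rw [one_mul]; exact this.symm))

/-- Self-duality gives p(0)² = 1. If p(0) = -1, the coefficients are antisymmetric, so 1 is a root
and the irreducible p is linear, of odd degree. -/
theorem SelfDual.coeff_zero_eq_one (hchar : (2 : K) ≠ 0) (h : Φ.SelfDual)
    (ht : TrivialInvolution K) (he : Even Φ.p.natDegree) : Φ.p.coeff 0 = 1 := by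
  have h1 := h.coeff_zero_mul
  rw [ht] at h1
  rcases mul_self_eq_one_iff.1 h1 with h2 | h2
  · exact h2
  exfalso
  have h3 : Φ.p.eval 1 = -Φ.p.eval 1 := by
    conv_lhs => rw [eval_eq_sum_range, ← Finset.sum_range_reflect]
    rw [eval_eq_sum_range, ← Finset.sum_neg_distrib]
    refine Finset.sum_congr rfl fun i hi => ?_
    rw [Finset.mem_range] at hi
    have h4 := h.coeff_sub (Nat.lt_succ_iff.1 hi)
    rw [ht, ht, h2] at h4
    rw [one_pow, one_pow, show Φ.p.natDegree + 1 - 1 - i = Φ.p.natDegree - i by omega, h4]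
    ring
  have h4 : Φ.p.eval 1 = 0 := by
    have : (2 : K) * Φ.p.eval 1 = 0 := by linear_combination h3
    exact (mul_eq_zero.1 this).resolve_left hchar
  have h5 := degree_eq_one_of_irreducible_of_root Φ.irreducible h4
  have h6 := natDegree_eq_of_degree_eq_some h5
  rw [h6] at he
  exact absurd he (by decide)

/-- Every element of the residue field which is fixed by the involution is the value of a
stationary function. -/
theorem exists_stationary (hchar : (2 : K) ≠ 0) (h : Φ.SelfDual) {a : Φ.ResidueField}
    (ha : Φ.involution a = a) : ∃ q, IsStationaryFunction Φ.p q ∧ Φ.evalKappa q = a := by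
  set r := Φ.p.natDegree / 2 with hr
  have h2 : (2 : Φ.ResidueField) ≠ 0 := by
    have : (2 : Φ.ResidueField) = AdjoinRoot.of Φ.p 2 := (map_ofNat _ 2).symm
    rw [this, Ne, map_eq_zero]
    exact hchar
  -- A reduced representative of κ^r a/2, shifted by x^(-r), has its exponents in [-r, r]. It takes
  -- the value a/2, so adding its image under the involution produces a symmetric function with
  -- value a.
  obtain ⟨f, hf, hfa⟩ : ∃ f : K[X], f.natDegree ≤ 2 * r ∧
      AdjoinRoot.mk Φ.p f = a / 2 * Φ.kappa ^ r := by
    obtain ⟨f, hf⟩ := AdjoinRoot.mk_surjective (a / 2 * Φ.kappa ^ r)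
    refine ⟨f %ₘ Φ.p, ?_, ?_⟩
    · have := natDegree_modByMonic_lt f Φ.monic (fun h1 => Φ.irreducible.not_isUnit (h1 ▸ isUnit_one))
      omega
    · rw [← hf, AdjoinRoot.mk_eq_mk, ← modByMonic_add_div f Φ.p]
      exact ⟨-(f /ₘ Φ.p), by rw [modByMonic_add_div]; linear_combination modByMonic_add_div f Φ.p⟩
  set g := shiftLaurent r f with hg
  have hga : Φ.evalKappa g = a / 2 := by
    have h3 : f.eval₂ (AdjoinRoot.of Φ.p) Φ.kappa = AdjoinRoot.mk Φ.p f := AdjoinRoot.aeval_eq f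
    rw [evalKappa_eq h, hg, eval₂_shiftLaurent, coe_kappaUnit, h3, hfa, Units.val_zpow_eq_zpow_val,
      coe_kappaUnit, mul_assoc, ← zpow_natCast, ← zpow_add₀ (show Φ.kappa ≠ 0 from (kappaUnit h).ne_zero)]
    simp
  have hgb : ∀ i : ℤ, (r : ℤ) < i → g.coeff i = 0 := by
    intro i hi
    rw [hg, shiftLaurent_coeff r f (i + r).toNat (by omega), coeff_eq_zero_of_natDegree_lt (by omega)]
  have hgb' : ∀ i : ℤ, i < -(r : ℤ) → g.coeff i = 0 := by
    intro i hi
    rw [hg, shiftLaurent_coeff_neg _ _ (by omega)]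
  set g' := LaurentPolynomial.invert (shiftLaurent r (f.map (starRingEnd K))) with hg'
  have hg₃c : ∀ i, g'.coeff i = star (g.coeff (-i)) := invert_shiftLaurent_coeff r f
  have hq0s : ∀ i : ℤ, (g + g').coeff (-i) = star ((g + g').coeff i) := by
    intro i
    simp [hg₃c, add_comm]
  have hg₃a : Φ.evalKappa g' = a / 2 := by
    have h5 : Φ.involution (Φ.evalKappa g) = Φ.evalKappa g' := by
      rw [evalKappa_eq h, laurent_eval₂_eq_sum, Finsupp.sum, map_sum, evalKappa_eq h,
        laurent_eval₂_eq_sum]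
      refine Finset.sum_nbij' (fun i => -i) (fun i => -i) ?_ ?_ ?_ ?_ ?_
      · intro i hi
        rw [Finsupp.mem_support_iff] at hi ⊢
        rw [hg₃c, neg_neg]
        exact star_ne_zero.2 hi
      · intro i hi
        rw [Finsupp.mem_support_iff] at hi ⊢
        rw [hg₃c] at hi
        exact star_ne_zero.1 hi
      · simp
      · simp
      · intro i _
        simp only []
        rw [map_mul, involution_of h, hg₃c, neg_neg, Units.val_zpow_eq_zpow_val,
          Units.val_zpow_eq_zpow_val, coe_kappaUnit, map_zpow₀, involution_kappa h, _root_.inv_zpow']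
    rw [← h5, hga, map_div₀, ha, map_ofNat]
  have hq0a : Φ.evalKappa (g + g') = a := by
    rw [evalKappa_eq h, map_add, ← evalKappa_eq h, ← evalKappa_eq h, hga, hg₃a, ← two_mul, mul_div_cancel₀ _ h2]
  have hq0b : ∀ i : ℤ, (r : ℤ) < i → (g + g').coeff i = 0 := by
    intro i hi
    rw [AddMonoidAlgebra.coeff_add, Finsupp.add_apply, hgb i hi, hg₃c, hgb' _ (by omega)]
    simp
  by_cases hE : Even Φ.p.natDegree
  swap
  · exact ⟨g + g', ⟨hq0s, hq0b, fun h1 => absurd h1 hE, fun h1 => absurd h1 hE,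
      fun h1 => absurd h1 hE⟩, hq0a⟩
  have hdeg : Φ.p.natDegree = 2 * r := by
    obtain ⟨m, hm⟩ := hE
    omega
  set α := (g + g').coeff (r : ℤ) with hα
  have h2s : star (2 : K) = 2 := star_ofNat 2
  have hpp := h.coeff_zero_mul
  set p0 := Φ.p.coeff 0 with hp0
  have hp0' := h.coeff_ne
  -- The function c x^(-r) p(x) vanishes at κ and is symmetric when c̄ = c p(0). Subtracting it
  -- changes the top coefficient α to α - c without changing the value at κ.
  have key : ∀ c : K, star c = c * p0 → (TrivialInvolution K → α - c = 0) →
      (¬ TrivialInvolution K → p0 ≠ 1 → α - c = star (α - c)) →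
      (¬ TrivialInvolution K → p0 = 1 → α - c = -star (α - c)) →
      ∃ q, IsStationaryFunction Φ.p q ∧ Φ.evalKappa q = a := by
    intro c hc h3 h4 h5
    set P := shiftLaurent r (Φ.p * C c) with hP
    have hPr : (g + g' - P).coeff (r : ℤ) = α - c := by
      rw [AddMonoidAlgebra.coeff_sub, Finsupp.sub_apply, hP,
        shiftLaurent_coeff r _ (2 * r) (by push_cast; ring), coeff_mul_C, ← hdeg,
        Φ.monic.coeff_natDegree, one_mul]
    refine ⟨g + g' - P, ⟨?_, ?_, ?_, ?_, ?_⟩, ?_⟩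
    · intro i
      have hPs : P.coeff (-i) = star (P.coeff i) := by
        by_cases hi : i + r < 0
        · rw [hP, shiftLaurent_coeff_neg _ _ hi, star_zero,
            shiftLaurent_coeff r _ (-i + r).toNat (by omega), coeff_mul_C,
            coeff_eq_zero_of_natDegree_lt (by omega), zero_mul]
        · obtain ⟨n, hn⟩ := Int.eq_ofNat_of_zero_le (not_lt.1 hi)
          rw [hP, shiftLaurent_coeff r _ n hn, coeff_mul_C, star_mul', hc]
          by_cases hn2 : 2 * r < n
          · rw [shiftLaurent_coeff_neg _ _ (by omega), coeff_eq_zero_of_natDegree_lt (by omega)]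
            simp
          · rw [shiftLaurent_coeff r _ (2 * r - n) (by omega), coeff_mul_C]
            have h6 := h.coeff_sub (i := 2 * r - n) (by omega)
            rw [show Φ.p.natDegree - (2 * r - n) = n by omega] at h6
            rw [h6]
            linear_combination (-Φ.p.coeff (2 * r - n) * c) * hpp
      rw [AddMonoidAlgebra.coeff_sub, Finsupp.sub_apply, Finsupp.sub_apply, hq0s, hPs, star_sub]
    · intro i hi
      rw [AddMonoidAlgebra.coeff_sub, Finsupp.sub_apply, hq0b i hi, hP,
        shiftLaurent_coeff r _ (i + r).toNat (by omega), coeff_mul_C,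
        coeff_eq_zero_of_natDegree_lt (by omega)]
      simp
    · intro _ ht
      rw [hPr, h3 ht]
    · intro _ ht hp
      rw [hPr]
      exact h4 ht hp
    · intro _ ht hp
      rw [hPr]
      exact h5 ht hp
    · have h6 : Φ.evalKappa P = 0 := by
        rw [evalKappa_eq h, hP, eval₂_shiftLaurent, eval₂_mul, coe_kappaUnit]
        have h1 : Φ.p.eval₂ (AdjoinRoot.of Φ.p) Φ.kappa = 0 := AdjoinRoot.eval₂_root Φ.p
        rw [h1, zero_mul, zero_mul]
      rw [evalKappa_eq h, map_sub, ← evalKappa_eq h, ← evalKappa_eq h, hq0a, h6, sub_zero]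
  -- The choices of c: α itself for the identity involution, the symmetric part of α if p(0) = 1,
  -- which leaves a skew coefficient, and otherwise the solution of c (1 - p(0)) = α - ᾱ, which
  -- makes α - c self-conjugate.
  by_cases ht : TrivialInvolution K
  · have hp1 : p0 = 1 := h.coeff_zero_eq_one hchar ht hE
    exact key α (by rw [ht, hp1, mul_one]) (fun _ => sub_self _) (fun h' => absurd ht h')
      (fun h' => absurd ht h')
  · by_cases hp1 : p0 = 1
    · refine key ((α + star α) / 2) ?_ (fun h' => absurd h' ht) (fun _ h' => absurd hp1 h') ?_
      · rw [star_div₀, star_add, star_star, h2s, hp1, mul_one, add_comm]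
      · intro _ _
        rw [star_sub, star_div₀, star_add, star_star, h2s]
        field_simp
        ring
    · have h1p : 1 - p0 ≠ 0 := sub_ne_zero.2 (Ne.symm hp1)
      have hsp : star p0 = p0⁻¹ := eq_inv_of_mul_eq_one_left hpp
      have h1p' : p0 - 1 ≠ 0 := sub_ne_zero.2 hp1
      have hsc : star ((α - star α) / (1 - p0)) = (α - star α) / (1 - p0) * p0 := by
        rw [star_div₀, star_sub, star_star, star_sub, star_one, hsp]
        have h7 : 1 - p0⁻¹ = (p0 - 1) * p0⁻¹ := by
          rw [sub_mul, mul_inv_cancel₀ hp0', one_mul]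
        rw [h7]
        field_simp
        ring
      refine key ((α - star α) / (1 - p0)) hsc (fun h' => absurd h' ht) ?_ (fun _ h' => absurd h' hp1)
      intro _ _
      rw [star_sub, hsc]
      field_simp
      ring

end Residue

end FrobeniusBlock

/-! ### Splitting off a family with nonsingular Gram matrix -/

section Gram

variable {V : Type*} [AddCommGroup V] [Module K V] {B : V →ₗ⋆[K] V →ₗ[K] K}
variable {ι : Type*} [Fintype ι] [DecidableEq ι] {b : ι → V} {M : Matrix ι ι K}

theorem linearIndependent_of_gram (hb : ∀ i j, B (b i) (b j) = M i j) (hM : M.det ≠ 0) :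
    LinearIndependent K b := by
  rw [Fintype.linearIndependent_iff]
  intro c hc
  refine congrFun (eq_zero_of_mulVec hM (c := c) fun i => ?_)
  have h := congrArg (B (b i)) hc
  rw [map_sum, map_zero] at h
  rw [← h]
  exact Finset.sum_congr rfl fun j _ => by rw [map_smul, hb, smul_eq_mul, mul_comm]

theorem HasMatrix.of_gram [FiniteDimensional K V] (hb : ∀ i j, B (b i) (b j) = M i j)
    (hM : M.det ≠ 0) (hcard : Fintype.card ι = Module.finrank K V) : HasMatrix B M := by
  have hli := linearIndependent_of_gram hb hM
  refine ⟨Module.Basis.mk hli (hli.span_eq_top_of_card_eq_finrank' hcard).ge, fun i j => ?_⟩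
  rw [Module.Basis.mk_apply, Module.Basis.mk_apply, hb]

/-- A nonsingular Gram matrix makes the right orthogonal complement of the span a linear complement.
Since B(x, y) = conj B(τy, x), stability of the span under τ makes that complement orthogonal on the
left too, and the form on it is again nondegenerate. -/
theorem exists_complement_of_gram [FiniteDimensional K V] {τ : V →ₗ[K] V} (hB : Nondeg B)
    (hτ : IsCosq B τ) (hb : ∀ i j, B (b i) (b j) = M i j) (hM : M.det ≠ 0)
    (hspan : ∀ i, τ (b i) ∈ Submodule.span K (Set.range b)) :
    ∃ W : Submodule K V, Nondeg (restrictForm B W) ∧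
      Module.finrank K W + Fintype.card ι = Module.finrank K V ∧
      ∀ (κ : Type) [Fintype κ] [DecidableEq κ] (N : Matrix κ κ K),
        HasMatrix (restrictForm B W) N → HasMatrix B (fromBlocks M 0 0 N) := by
  have hli := linearIndependent_of_gram hb hM
  set U := Submodule.span K (Set.range b) with hU
  have hUτ : ∀ y ∈ U, τ y ∈ U := by
    intro y hy
    induction hy using Submodule.span_induction with
    | mem y hy => obtain ⟨i, rfl⟩ := hy; exact hspan i
    | zero => rw [map_zero]; exact U.zero_mem
    | add x y _ _ hx hy => rw [map_add]; exact U.add_mem hx hy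
    | smul c x _ hx => rw [map_smul]; exact U.smul_mem c hx
  have hmat : HasMatrix (restrictForm B U) M :=
    ⟨Module.Basis.span hli, fun i j => by
      rw [restrictForm_apply, Module.Basis.span_apply, Module.Basis.span_apply, hb]⟩
  have hnd := hmat.nondeg_iff.2 hM
  set W := rightPerp B U with hW
  have h1 : ∀ x ∈ U, ∀ y ∈ W, B x y = 0 := fun x hx y hy => hy x hx
  have h2 : ∀ x ∈ W, ∀ y ∈ U, B x y = 0 := by
    intro x hx y hy
    rw [hτ, hx (τ y) (hUτ y hy), star_zero]
  have hc : IsCompl U W := by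
    refine ⟨?_, ?_⟩
    · rw [Submodule.disjoint_def]
      intro y hy hy'
      have := hnd ⟨y, hy⟩ fun x => hy' x x.2
      exact congrArg Subtype.val this
    · rw [codisjoint_iff, eq_top_iff]
      intro v _
      set c := M⁻¹ *ᵥ fun i => B (b i) v with hcdef
      have hMc : M *ᵥ c = fun i => B (b i) v := by
        rw [hcdef, Matrix.mulVec_mulVec, Matrix.mul_nonsing_inv _ (isUnit_iff_ne_zero.2 hM),
          Matrix.one_mulVec]
      set w := ∑ j, c j • b j with hw
      have hwU : w ∈ U := Submodule.sum_mem _ fun j _ =>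
        U.smul_mem _ (Submodule.subset_span ⟨j, rfl⟩)
      have hbw : ∀ i, B (b i) (v - w) = 0 := by
        intro i
        rw [map_sub, sub_eq_zero, hw, map_sum]
        have := congrFun hMc i
        rw [← this, Matrix.mulVec, dotProduct]
        exact Finset.sum_congr rfl fun j _ => by rw [map_smul, hb, smul_eq_mul, mul_comm]
      have hvW : v - w ∈ W := by
        intro x hx
        induction hx using Submodule.span_induction with
        | mem y hy => obtain ⟨i, rfl⟩ := hy; exact hbw i
        | zero => simp
        | add x y _ _ hx hy => simp [hx, hy]
        | smul c x _ hx => simp [hx]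
      rw [← add_sub_cancel w v]
      exact Submodule.add_mem_sup hwU hvW
  refine ⟨W, ?_, ?_, ?_⟩
  · intro y hy
    have : (y : V) = 0 := by
      refine hB y fun u => ?_
      obtain ⟨x, hx, z, hz, rfl⟩ := Submodule.mem_sup.1
        (show u ∈ U ⊔ W by rw [hc.sup_eq_top]; exact Submodule.mem_top)
      have h3 := hy ⟨z, hz⟩
      rw [restrictForm_apply] at h3
      rw [map_add, LinearMap.add_apply, h1 x hx y y.2, h3, add_zero]
    exact Subtype.ext this
  · rw [← Submodule.finrank_add_eq_of_isCompl hc, finrank_span_eq_card hli, add_comm]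
  · intro κ _ _ N hN
    exact HasMatrix.of_isCompl hc h1 h2 hmat hN

end Gram

/-! ### The action of the algebra of a block -/

namespace FrobeniusBlock

section Act

variable {V : Type*} [AddCommGroup V] [Module K V] (Φ : FrobeniusBlock K) (τ : V →ₗ[K] V)

/-- The kernel of `χ(τ)`. -/
def kerχ : Submodule K V := LinearMap.ker (aeval τ Φ.χ)

variable {Φ τ} in
theorem mem_kerχ {v : V} : v ∈ Φ.kerχ τ ↔ aeval τ Φ.χ v = 0 := LinearMap.mem_ker

/-- The map `f(x) ↦ f(τ)`, which is an action on the kernel of `χ(τ)`. -/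
def act : Φ.E →ₗ[K] V →ₗ[K] V :=
  (aeval τ).toLinearMap ∘ₗ AdjoinRoot.modByMonicHom Φ.χ_monic

variable {Φ τ}

theorem act_mk {v : V} (hv : v ∈ Φ.kerχ τ) (f : K[X]) :
    Φ.act τ (AdjoinRoot.mk Φ.χ f) v = aeval τ f v := by
  have h1 : Φ.act τ (AdjoinRoot.mk Φ.χ f) = aeval τ (f %ₘ Φ.χ) := rfl
  rw [h1]
  conv_rhs => rw [← modByMonic_add_div f Φ.χ, mul_comm, map_add, map_mul, LinearMap.add_apply,
    Module.End.mul_apply, mem_kerχ.1 hv, map_zero, add_zero]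

theorem aeval_mem {v : V} (hv : v ∈ Φ.kerχ τ) (f : K[X]) : aeval τ f v ∈ Φ.kerχ τ := by
  rw [mem_kerχ, ← Module.End.mul_apply, ← map_mul, mul_comm, map_mul, Module.End.mul_apply,
    mem_kerχ.1 hv, map_zero]

theorem act_mem {v : V} (hv : v ∈ Φ.kerχ τ) (a : Φ.E) : Φ.act τ a v ∈ Φ.kerχ τ := aeval_mem hv _

theorem act_mul {v : V} (hv : v ∈ Φ.kerχ τ) (a b : Φ.E) :
    Φ.act τ (a * b) v = Φ.act τ a (Φ.act τ b v) := by
  obtain ⟨f, rfl⟩ := AdjoinRoot.mk_surjective a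
  obtain ⟨g, rfl⟩ := AdjoinRoot.mk_surjective b
  rw [act_mk (act_mem hv _), act_mk hv, ← map_mul, act_mk hv, map_mul, Module.End.mul_apply]

theorem act_one {v : V} (hv : v ∈ Φ.kerχ τ) : Φ.act τ 1 v = v := by
  rw [← map_one (AdjoinRoot.mk Φ.χ), act_mk hv, map_one, Module.End.one_apply]

theorem act_x {v : V} (hv : v ∈ Φ.kerχ τ) : Φ.act τ Φ.x v = τ v := by
  rw [show Φ.x = AdjoinRoot.mk Φ.χ X from rfl, act_mk hv, aeval_X]

theorem act_inv_u (h : Φ.p.coeff 0 ≠ 0) {τ' : V →ₗ[K] V} (hT : τ' * τ = 1) {v : V}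
    (hv : v ∈ Φ.kerχ τ) : Φ.act τ (↑(Φ.u h)⁻¹ : Φ.E) v = τ' v := by
  have h1 : τ (Φ.act τ (↑(Φ.u h)⁻¹ : Φ.E) v) = v := by
    rw [← act_x (act_mem hv _), ← act_mul hv, ← coe_u Φ h, Units.mul_inv, act_one hv]
  have h2 := LinearMap.congr_fun hT (Φ.act τ (↑(Φ.u h)⁻¹ : Φ.E) v)
  rw [Module.End.mul_apply, h1, Module.End.one_apply] at h2
  exact h2.symm

theorem act_aeval_inv_u (h : Φ.p.coeff 0 ≠ 0) {τ' : V →ₗ[K] V} (hT : τ' * τ = 1) {v : V}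
    (hv : v ∈ Φ.kerχ τ) (f : K[X]) :
    Φ.act τ (aeval (↑(Φ.u h)⁻¹ : Φ.E) f) v = aeval τ' f v := by
  induction f using Polynomial.induction_on' with
  | add f g hf hg => simp [hf, hg]
  | monomial n a =>
    rw [← C_mul_X_pow_eq_monomial, map_mul, aeval_C, map_pow, aeval_X, ← Algebra.smul_def, map_smul,
      LinearMap.smul_apply, map_mul, aeval_C, map_pow (aeval τ'), aeval_X, ← Algebra.smul_def,
      LinearMap.smul_apply]
    congr 1
    induction n with
    | zero => rw [pow_zero, pow_zero, act_one hv, Module.End.one_apply]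
    | succ n ih =>
      rw [pow_succ', act_mul hv, act_inv_u h hT (act_mem hv _), ih, pow_succ', Module.End.mul_apply]

theorem σ_mk' (h : Φ.SelfDual) (f : K[X]) : σ h (AdjoinRoot.mk Φ.χ f) =
    aeval (↑(Φ.u h.coeff_ne)⁻¹ : Φ.E) (f.map (starRingEnd K)) := by
  rw [σ_mk, aeval_def, eval₂_map]
  rfl

theorem act_mem_span (a : Φ.E) (v : V) :
    Φ.act τ a v ∈ Submodule.span K (Set.range fun i => Φ.act τ (Φ.bas i) v) := by
  rw [← Φ.bas.sum_repr a, map_sum, LinearMap.sum_apply]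
  refine Submodule.sum_mem _ fun i _ => ?_
  rw [map_smul, LinearMap.smul_apply]
  exact Submodule.smul_mem _ _ (Submodule.subset_span ⟨i, rfl⟩)

end Act

end FrobeniusBlock

/-- `τ` is the cosquare of the form, and `τ'` its inverse. -/
structure IsCosqPair {V : Type*} [AddCommGroup V] [Module K V] (B : V →ₗ⋆[K] V →ₗ[K] K)
    (τ τ' : V →ₗ[K] V) : Prop where
  cosq : IsCosq B τ
  right : τ * τ' = 1
  left : τ' * τ = 1

theorem IsCosqPair.map_map_inv {V : Type*} [AddCommGroup V] [Module K V] {B : V →ₗ⋆[K] V →ₗ[K] K}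
    {τ τ' : V →ₗ[K] V} (h : IsCosqPair B τ τ') (u v : V) : B (τ' u) (τ' v) = B u v := by
  have h1 : ∀ w, τ (τ' w) = w := LinearMap.congr_fun h.right
  rw [← h.cosq.map_map, h1, h1]

theorem map_star_map_star (f : K[X]) : (f.map (starRingEnd K)).map (starRingEnd K) = f := by
  rw [Polynomial.map_map, show (starRingEnd K).comp (starRingEnd K) = RingHom.id K by ext; simp,
    Polynomial.map_id]

theorem IsCosqPair.adjoint_aeval_right {V : Type*} [AddCommGroup V] [Module K V]
    {B : V →ₗ⋆[K] V →ₗ[K] K} {τ τ' : V →ₗ[K] V} (h : IsCosqPair B τ τ') (f : K[X]) (u v : V) :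
    B u (aeval τ f v) = B (aeval τ' (f.map (starRingEnd K)) u) v := by
  rw [adjoint_aeval h.left h.map_map_inv, map_star_map_star]

theorem Nondeg.exists_cosqPair {V : Type*} [AddCommGroup V] [Module K V] [FiniteDimensional K V]
    {B : V →ₗ⋆[K] V →ₗ[K] K} (hB : Nondeg B) : ∃ τ τ', IsCosqPair B τ τ' := by
  obtain ⟨τ, hτ⟩ := hB.exists_cosq
  obtain ⟨τ', h1, h2⟩ := hτ.exists_inv hB
  exact ⟨τ, τ', hτ, h1, h2⟩

namespace FrobeniusBlock

/-! ### Hermitian pairings with values in the algebra of a block -/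

section Pairing

variable {V : Type*} [AddCommGroup V] [Module K V] {Φ : FrobeniusBlock K}
variable (B : V →ₗ⋆[K] V →ₗ[K] K) (τ : V →ₗ[K] V) {ℓ : Φ.E →ₗ[K] K} (hℓ : Φ.NondegFun ℓ)

/-- The element `a` of the algebra with `B(u, f(τ) v) = ℓ(a f)` for all `f`. -/
def pairing (u v : V) : Φ.E := (hℓ.exists_eq (B u ∘ₗ (Φ.act τ).flip v)).choose

theorem pairing_spec (u v : V) (f : Φ.E) : B u (Φ.act τ f v) = ℓ (pairing B τ hℓ u v * f) :=
  (hℓ.exists_eq (B u ∘ₗ (Φ.act τ).flip v)).choose_spec f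

theorem pairing_eq_of_forall {u v : V} {a : Φ.E} (h : ∀ f, B u (Φ.act τ f v) = ℓ (a * f)) :
    pairing B τ hℓ u v = a :=
  hℓ.ext fun f => by rw [← pairing_spec, h]

theorem pairing_add_left (u u' v : V) :
    pairing B τ hℓ (u + u') v = pairing B τ hℓ u v + pairing B τ hℓ u' v :=
  pairing_eq_of_forall B τ hℓ fun f => by
    rw [map_add, LinearMap.add_apply, pairing_spec B τ hℓ, pairing_spec B τ hℓ, add_mul, map_add]

theorem pairing_add_right (u v v' : V) :
    pairing B τ hℓ u (v + v') = pairing B τ hℓ u v + pairing B τ hℓ u v' :=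
  pairing_eq_of_forall B τ hℓ fun f => by
    rw [map_add, map_add, pairing_spec B τ hℓ, pairing_spec B τ hℓ, add_mul, map_add]

theorem pairing_act_right {v : V} (hv : v ∈ Φ.kerχ τ) (u : V) (a : Φ.E) :
    pairing B τ hℓ u (Φ.act τ a v) = pairing B τ hℓ u v * a :=
  pairing_eq_of_forall B τ hℓ fun f => by
    rw [← act_mul hv, pairing_spec B τ hℓ, mul_comm f a, mul_assoc]

variable {B τ} {τ' : V →ₗ[K] V}

theorem act_adjoint (hτ : IsCosqPair B τ τ') (h : Φ.SelfDual) {u v : V} (hu : u ∈ Φ.kerχ τ) (hv : v ∈ Φ.kerχ τ) (a : Φ.E) :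
    B (Φ.act τ a u) v = B u (Φ.act τ (σ h a) v) := by
  obtain ⟨f, rfl⟩ := AdjoinRoot.mk_surjective a
  rw [act_mk hu, σ_mk', act_aeval_inv_u h.coeff_ne hτ.left hv, adjoint_aeval hτ.right hτ.cosq.map_map]

theorem pairing_act_left (hτ : IsCosqPair B τ τ') (h : Φ.SelfDual) {u v : V} (hu : u ∈ Φ.kerχ τ) (hv : v ∈ Φ.kerχ τ)
    (a : Φ.E) : pairing B τ hℓ (Φ.act τ a u) v = σ h a * pairing B τ hℓ u v :=
  pairing_eq_of_forall B τ hℓ fun f => by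
    rw [act_adjoint hτ h hu (act_mem hv _), ← act_mul hv, pairing_spec B τ hℓ]
    congr 1
    ring

/-- Exchanging the arguments introduces τ, and moving it across the form yields x⁻¹. This is exactly
the factor in the symmetry condition on ℓ, so no power of x is left. -/
theorem pairing_symm (hτ : IsCosqPair B τ τ') (h : Φ.SelfDual) {η : K} (hη : η * η = 1) (hs : IsSymmFun h η ℓ) {u v : V}
    (hu : u ∈ Φ.kerχ τ) (hv : v ∈ Φ.kerχ τ) :
    pairing B τ hℓ u v = η • σ h (pairing B τ hℓ v u) :=
  pairing_eq_of_forall B τ hℓ fun f => by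
    have h1 := hs (pairing B τ hℓ v u * σ h f)
    rw [hτ.cosq, ← act_x (act_mem hv _), ← act_mul hv, act_adjoint hτ h hv hu,
      pairing_spec B τ hℓ, map_mul (σ h), σ_x]
    rw [map_mul (σ h), σ_σ, mul_left_comm] at h1
    rw [smul_mul_assoc, map_smul, h1, smul_eq_mul, ← mul_assoc η, hη, one_mul]

theorem form_act_act (hτ : IsCosqPair B τ τ') (h : Φ.SelfDual) {u v : V} (hu : u ∈ Φ.kerχ τ) (hv : v ∈ Φ.kerχ τ)
    (a f : Φ.E) : B (Φ.act τ a u) (Φ.act τ f v) = ℓ (σ h a * pairing B τ hℓ u v * f) := by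
  rw [pairing_spec B τ hℓ, pairing_act_left hℓ hτ h hu hv]

end Pairing

end FrobeniusBlock

/-! ### Dual blocks -/

section DualBlock

theorem aeval_reflect {A : Type*} [Ring A] [Algebra K A] {τ τ' : A} (h : τ' * τ = 1) (N : ℕ)
    (f : K[X]) (hf : f.natDegree ≤ N) : aeval τ (reflect N f) = aeval τ' f * τ ^ N := by
  have hpow : ∀ n : ℕ, τ' ^ n * τ ^ n = 1 := by
    intro n
    induction n with
    | zero => simp
    | succ n ih => rw [pow_succ, pow_succ', mul_assoc, ← mul_assoc τ', h, one_mul, ih]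
  refine Polynomial.induction_with_natDegree_le
    (motive := fun f => aeval τ (reflect N f) = aeval τ' f * τ ^ N) N ?_ ?_ ?_ f hf
  · simp
  · intro n r _ hn
    rw [reflect_C_mul_X_pow, map_mul, map_mul, aeval_C, aeval_C, map_pow, map_pow, aeval_X, aeval_X,
      revAt_le hn, mul_assoc]
    congr 1
    rw [← Nat.add_sub_cancel' hn, pow_add, ← mul_assoc, hpow, one_mul, Nat.add_sub_cancel_left]
  · intro f g _ _ hf hg
    rw [reflect_add, map_add, map_add, hf, hg, add_mul]

variable {V : Type*} [AddCommGroup V] [Module K V] {B : V →ₗ⋆[K] V →ₗ[K] K} {τ τ' : V →ₗ[K] V}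

theorem IsCosqPair.pow_injective (h : IsCosqPair B τ τ') (n : ℕ) :
    Function.Injective (τ ^ n : V →ₗ[K] V) := by
  rw [Module.End.coe_pow]
  refine Function.Injective.iterate (Function.LeftInverse.injective (g := τ') ?_) n
  exact fun w => LinearMap.congr_fun h.left w

/-- Up to a nonzero scalar, f^∨(τ) is f̄(τ⁻¹) times a power of τ, which commutes with it and is
injective. -/
theorem IsCosqPair.aeval_dualPoly (h : IsCosqPair B τ τ') {f : K[X]} (hf : f.coeff 0 ≠ 0) (u : V) :
    aeval τ (dualPoly f) u = 0 ↔ aeval τ' (f.map (starRingEnd K)) u = 0 := by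
  have hc : Commute (aeval τ' (f.map (starRingEnd K))) (τ ^ (f.map (starRingEnd K)).natDegree) := by
    have h1 : Commute τ' τ := by rw [Commute, SemiconjBy, h.left, h.right]
    have h2 : ∀ g : K[X], Commute (aeval τ' g) τ := by
      intro g
      induction g using Polynomial.induction_on' with
      | add f g hf hg => rw [map_add]; exact hf.add_left hg
      | monomial n a =>
        rw [← C_mul_X_pow_eq_monomial, map_mul, aeval_C, map_pow, aeval_X]
        exact Commute.mul_left (Algebra.commutes a τ) (h1.pow_left n)
    exact (h2 _).pow_right _
  rw [dualPoly, map_mul, aeval_C, reverse, aeval_reflect h.left _ _ le_rfl, hc.eq, ← Algebra.smul_def,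
    LinearMap.smul_apply, smul_eq_zero_iff_right (inv_ne_zero (star_ne_zero.2 hf)),
    Module.End.mul_apply, map_eq_zero_iff _ (h.pow_injective _)]

theorem IsCosqPair.left_nondeg (h : IsCosqPair B τ τ') (hB : Nondeg B) {y : V}
    (hy : ∀ z, B y z = 0) : y = 0 := by
  refine hB y fun u => ?_
  have h1 := h.cosq y (τ' u)
  rw [hy, show τ (τ' u) = u from LinearMap.congr_fun h.right u] at h1
  exact star_eq_zero.1 h1.symm

namespace FrobeniusBlock

/-- The block with the dual characteristic polynomial. -/
def dual (Φ : FrobeniusBlock K) (h : Φ.p.coeff 0 ≠ 0) : FrobeniusBlock K where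
  p := dualPoly Φ.p
  s := Φ.s
  monic := dualPoly_monic h
  irreducible := dualPoly_irreducible Φ.monic h Φ.irreducible
  s_pos := Φ.s_pos

variable {Φ : FrobeniusBlock K} (h : Φ.p.coeff 0 ≠ 0)

theorem dual_χ : (Φ.dual h).χ = dualPoly Φ.χ := (dualPoly_pow _ _).symm

theorem dual_dim : (Φ.dual h).dim = Φ.dim := by
  rw [dim, dual_χ, natDegree_dualPoly (Φ.χ_coeff_zero_ne h), dim]

theorem dual_coeff_ne : (Φ.dual h).p.coeff 0 ≠ 0 := by
  rw [show (Φ.dual h).p = dualPoly Φ.p from rfl, coeff_zero_dualPoly Φ.monic]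
  exact inv_ne_zero (star_ne_zero.2 h)

theorem mem_kerχ_dual_iff (hτ : IsCosqPair B τ τ') {u : V} :
    u ∈ (Φ.dual h).kerχ τ ↔ aeval τ' (Φ.χ.map (starRingEnd K)) u = 0 := by
  rw [mem_kerχ, dual_χ, hτ.aeval_dualPoly (Φ.χ_coeff_zero_ne h)]

/-- A pair of dual isotropic cyclic vectors gives a summand `[Φ ⧹ I]`. -/
theorem exists_skew_gram [FiniteDimensional K V] (hτ : IsCosqPair B τ τ') {v u : V}
    (hv : v ∈ Φ.kerχ τ) (hu : u ∈ (Φ.dual h).kerχ τ)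
    (hvv : ∀ a b, B (Φ.act τ a v) (Φ.act τ b v) = 0)
    (huu : ∀ a b, B ((Φ.dual h).act τ a u) ((Φ.dual h).act τ b u) = 0)
    (hne : B u (aeval τ (Φ.p ^ (Φ.s - 1)) v) ≠ 0) :
    ∃ b : Fin Φ.dim ⊕ Fin Φ.dim → V,
      (∀ i j, B (b i) (b j) = (fromBlocks 0 1 Φ.toMatrix 0 : Matrix _ _ K) i j) ∧
      ∀ i, τ (b i) ∈ Submodule.span K (Set.range b) := by
  set Cu : Submodule K V := LinearMap.range (((Φ.dual h).act τ).flip u) with hCu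
  have hCu_τ' : ∀ y ∈ Cu, τ' y ∈ Cu := by
    rintro _ ⟨a, rfl⟩
    refine ⟨↑((Φ.dual h).u (dual_coeff_ne h))⁻¹ * a, ?_⟩
    rw [LinearMap.flip_apply, LinearMap.flip_apply, act_mul hu,
      act_inv_u (dual_coeff_ne h) hτ.left (act_mem hu _)]
  have hCu_τ : ∀ y ∈ Cu, τ y ∈ Cu := by
    rintro _ ⟨a, rfl⟩
    refine ⟨(Φ.dual h).x * a, ?_⟩
    rw [LinearMap.flip_apply, LinearMap.flip_apply, act_mul hu, act_x (act_mem hu _)]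
  have hiso : ∀ y ∈ Cu, ∀ z ∈ Cu, B y z = 0 := by
    rintro _ ⟨a, rfl⟩ _ ⟨b, rfl⟩
    exact huu a b
  set q : Fin Φ.dim → V := fun i => Φ.act τ (Φ.bas i) v with hq
  -- The product between the two cyclic modules is perfect on this side: a nonzero annihilated class
  -- could be multiplied into the socle generator, and its annihilation contradicts `hne`.
  have hperf : ∀ c : Fin Φ.dim → K, (∀ y ∈ Cu, B y (∑ k, c k • q k) = 0) → c = 0 := by
    intro c hc
    by_contra hc0
    set a := ∑ k, c k • Φ.bas k with ha
    have ha0 : a ≠ 0 := by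
      intro ha0
      apply hc0
      funext k
      exact Fintype.linearIndependent_iff.1 Φ.bas.linearIndependent c ha0 k
    have hsum : ∑ k, c k • q k = Φ.act τ a v := by
      rw [ha, map_sum, LinearMap.sum_apply]
      exact Finset.sum_congr rfl fun k _ => by rw [map_smul, LinearMap.smul_apply]
    obtain ⟨b, hb⟩ := Φ.exists_mul_eq ha0
    obtain ⟨g, rfl⟩ := AdjoinRoot.mk_surjective b
    apply hne
    rw [← act_mk hv, map_pow, ← hb, mul_comm, act_mul hv, act_mk (act_mem hv _),
      hτ.adjoint_aeval_right, ← hsum]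
    refine hc _ ⟨aeval (↑((Φ.dual h).u (dual_coeff_ne h))⁻¹ : (Φ.dual h).E)
      (g.map (starRingEnd K)), ?_⟩
    rw [LinearMap.flip_apply, act_aeval_inv_u (dual_coeff_ne h) hτ.left hu]
  choose y hyC hy using fun i : Fin Φ.dim =>
    exists_form_eq B Cu q hperf (fun j => (1 : Matrix (Fin Φ.dim) (Fin Φ.dim) K) i j)
  -- The `y i` are dual to the `q j` when standing on the left. The shift by τ⁻¹ makes them dual
  -- when standing on the right, which produces the identity block; the other block is then the
  -- matrix of τ.
  set c : Fin Φ.dim → V := fun i => τ' (y i) with hc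
  have hττ' : ∀ w, τ (τ' w) = w := fun w => LinearMap.congr_fun hτ.right w
  have hcC : ∀ i, c i ∈ Cu := fun i => hCu_τ' _ (hyC i)
  have hqc : ∀ i j, B (q i) (c j) = (1 : Matrix (Fin Φ.dim) (Fin Φ.dim) K) i j := by
    intro i j
    have h1 := hy j i
    rw [hτ.cosq, ← hττ' (y j), hτ.cosq.map_map] at h1
    rw [← star_star (B (q i) (c j)), h1, Matrix.one_apply, Matrix.one_apply]
    by_cases hij : i = j
    · simp [hij]
    · simp [hij, Ne.symm hij]
  have hcq : ∀ i j, B (c i) (q j) = Φ.toMatrix i j := by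
    intro i j
    have h1 : τ (q j) = ∑ k, Φ.toMatrix k j • q k := by
      rw [hq, ← act_x (act_mem hv _), ← act_mul hv, x_mul_bas, map_sum, LinearMap.sum_apply]
      exact Finset.sum_congr rfl fun k _ => by rw [map_smul, LinearMap.smul_apply]
    rw [hτ.cosq, h1, map_sum, LinearMap.sum_apply, star_sum, Finset.sum_eq_single i]
    · rw [LinearMap.map_smulₛₗ, LinearMap.smul_apply, hqc, Matrix.one_apply_eq, smul_eq_mul,
        mul_one, starRingEnd_apply, star_star]
    · intro k _ hk
      rw [LinearMap.map_smulₛₗ, LinearMap.smul_apply, hqc, Matrix.one_apply_ne hk, smul_zero,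
        star_zero]
    · simp
  have hgram : ∀ i j, B (Sum.elim q c i) (Sum.elim q c j) =
      (fromBlocks 0 1 Φ.toMatrix 0 : Matrix (Fin Φ.dim ⊕ Fin Φ.dim) (Fin Φ.dim ⊕ Fin Φ.dim) K) i j := by
    rintro (i | i) (j | j)
    · exact hvv _ _
    · exact hqc i j
    · exact hcq i j
    · exact hiso _ (hcC i) _ (hcC j)
  refine ⟨Sum.elim q c, hgram, ?_⟩
  have hli : LinearIndependent K c := by
    rw [Fintype.linearIndependent_iff]
    intro d hd i
    have h1 := congrArg (B (q i)) hd
    rw [map_sum, map_zero, Finset.sum_eq_single i] at h1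
    · rwa [map_smul, hqc, Matrix.one_apply_eq, smul_eq_mul, mul_one] at h1
    · intro k _ hk
      rw [map_smul, hqc, Matrix.one_apply_ne hk.symm, smul_zero]
    · simp
  have hspan : Submodule.span K (Set.range c) = Cu := by
    refine Submodule.eq_of_le_of_finrank_le ?_ ?_
    · rw [Submodule.span_le]
      rintro _ ⟨i, rfl⟩
      exact hcC i
    · rw [finrank_span_eq_card hli, Fintype.card_fin, ← dual_dim h, ← finrank_E]
      exact LinearMap.finrank_range_le _
  rintro (i | i)
  · have h1 : τ (q i) ∈ Submodule.span K (Set.range q) := by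
      rw [hq, ← act_x (act_mem hv _), ← act_mul hv]
      exact act_mem_span _ _
    refine Submodule.span_mono ?_ h1
    rintro _ ⟨k, rfl⟩
    exact ⟨Sum.inl k, rfl⟩
  · have h1 : τ (c i) ∈ Submodule.span K (Set.range c) := hspan ▸ hCu_τ _ (hcC i)
    refine Submodule.span_mono ?_ h1
    rintro _ ⟨k, rfl⟩
    exact ⟨Sum.inr k, rfl⟩

/-- An irreducible factor p is taken with its full multiplicity s in the minimal polynomial of τ, so
some v in Ker p(τ)^s is not killed by p(τ)^(s-1). Nondegeneracy gives a vector with nonzero product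
with p(τ)^(s-1) v, and the adjoint of the projector onto Ker p(τ)^s moves that vector into the
kernel of χ^∨(τ) without changing the product. -/
theorem exists_cyclic_pair [FiniteDimensional K V] [Nontrivial V] (hB : Nondeg B)
    (hτ : IsCosqPair B τ τ') : ∃ (Φ : FrobeniusBlock K) (h : Φ.p.coeff 0 ≠ 0) (v u : V),
      v ∈ Φ.kerχ τ ∧ u ∈ (Φ.dual h).kerχ τ ∧ B u (aeval τ (Φ.p ^ (Φ.s - 1)) v) ≠ 0 := by
  have hint : IsIntegral K τ := Algebra.IsIntegral.isIntegral τ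
  have hμm := minpoly.monic hint
  obtain ⟨p, hpm, hpi, hpd⟩ := Polynomial.exists_monic_irreducible_factor (minpoly K τ)
    (minpoly.not_isUnit K τ)
  have hfin : FiniteMultiplicity p (minpoly K τ) :=
    FiniteMultiplicity.of_not_isUnit hpi.not_isUnit hμm.ne_zero
  obtain ⟨g, hg, hpg⟩ := hfin.exists_eq_pow_mul_and_not_dvd
  set s := multiplicity p (minpoly K τ)
  have hs : 0 < s := by
    rw [Nat.pos_iff_ne_zero]
    intro hs
    rw [hs, pow_zero, one_mul] at hg
    exact hpg (hg ▸ hpd)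
  let Φ : FrobeniusBlock K := ⟨p, s, hpm, hpi, hs⟩
  have hg0 : g ≠ 0 := by rintro rfl; exact hpg (dvd_zero _)
  obtain ⟨v0, hv0⟩ : ∃ v0, aeval τ (p ^ (s - 1) * g) v0 ≠ 0 := by
    by_contra hc
    push Not at hc
    have h1 : minpoly K τ ∣ p ^ (s - 1) * g := minpoly.dvd K τ (LinearMap.ext hc)
    rw [hg] at h1
    have h2 := (mul_dvd_mul_iff_right hg0).1 h1
    rw [pow_dvd_pow_iff hpi.ne_zero hpi.not_isUnit] at h2
    omega
  set v := aeval τ g v0 with hvdef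
  have hv1 : aeval τ (p ^ (s - 1)) v ≠ 0 := by
    rw [hvdef, ← Module.End.mul_apply, ← map_mul]
    exact hv0
  have hv : v ∈ Φ.kerχ τ := by
    rw [mem_kerχ, hvdef, ← Module.End.mul_apply, ← map_mul]
    change aeval τ (p ^ s * g) v0 = 0
    rw [← hg, minpoly.aeval, LinearMap.zero_apply]
  -- Otherwise p is associated to X, and the injective map τ would kill p(τ)^(s-1) v.
  have hp0 : Φ.p.coeff 0 ≠ 0 := by
    intro h0
    obtain ⟨c, hc⟩ := Irreducible.dvd_symm irreducible_X hpi (X_dvd_iff.2 h0)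
    have h1 : aeval τ (p * p ^ (s - 1)) v = 0 := by
      rw [← pow_succ', Nat.sub_add_cancel hs]
      exact hv
    apply hv1
    apply hτ.pow_injective 1
    have h2 : aeval τ (X * p ^ (s - 1)) v = 0 := by
      rw [hc, mul_comm p, mul_assoc, map_mul, Module.End.mul_apply, h1, map_zero]
    rw [map_mul, aeval_X, Module.End.mul_apply] at h2
    rw [pow_one, map_zero, h2]
  obtain ⟨u0, hu0⟩ : ∃ u0, B u0 (aeval τ (p ^ (s - 1)) v) ≠ 0 := by
    by_contra hc
    push Not at hc
    exact hv1 (hB _ hc)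
  have hcop : IsCoprime Φ.χ g := (hpi.coprime_iff_not_dvd.2 hpg).pow_left
  obtain ⟨a, b, hab⟩ := hcop
  refine ⟨Φ, hp0, v, aeval τ' ((b * g).map (starRingEnd K)) u0, hv, ?_, ?_⟩
  · rw [mem_kerχ_dual_iff hp0 hτ, ← Module.End.mul_apply, ← map_mul, ← Polynomial.map_mul]
    refine hτ.left_nondeg hB fun z => ?_
    have h1 : Φ.χ * (b * g) = b * minpoly K τ := by
      rw [hg]
      change p ^ s * (b * g) = _
      ring
    rw [← hτ.adjoint_aeval_right, h1, map_mul, minpoly.aeval, mul_zero, LinearMap.zero_apply,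
      map_zero]
  · rw [← hτ.adjoint_aeval_right]
    have h1 : ∀ y ∈ Φ.kerχ τ, aeval τ (b * g) y = y := by
      intro y hy
      have h2 := LinearMap.congr_fun (congrArg (aeval τ) hab) y
      rw [map_add, map_mul, LinearMap.add_apply, Module.End.mul_apply, mem_kerχ.1 hy, map_zero,
        zero_add, map_one, Module.End.one_apply] at h2
      exact h2
    rw [h1 _ (aeval_mem hv _)]
    exact hu0

/-- Kernels belonging to a block which is not self-dual are isotropic. -/
theorem form_eq_zero_of_not_selfDual (hτ : IsCosqPair B τ τ') (hΦ : ¬ Φ.SelfDual)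
    (h : Φ.p.coeff 0 ≠ 0) {x y : V} (hx : x ∈ Φ.kerχ τ) (hy : y ∈ Φ.kerχ τ) : B x y = 0 := by
  have hcop : IsCoprime Φ.χ (dualPoly Φ.χ) := by
    rw [χ, dualPoly_pow]
    refine IsCoprime.pow ?_
    rw [Φ.irreducible.coprime_iff_not_dvd]
    intro hd
    exact hΦ (eq_of_monic_of_dvd_of_natDegree_le Φ.monic (dualPoly_monic h) hd
      (natDegree_dualPoly h).le)
  obtain ⟨a, b, hab⟩ := hcop
  have h1 : y = aeval τ (dualPoly Φ.χ) (aeval τ b y) := by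
    have h2 := LinearMap.congr_fun (congrArg (aeval τ) hab) y
    rw [map_add, map_mul, LinearMap.add_apply, Module.End.mul_apply, mem_kerχ.1 hy, map_zero,
      zero_add, map_one, Module.End.one_apply, mul_comm, map_mul, Module.End.mul_apply] at h2
    exact h2.symm
  have h0 := Φ.χ_coeff_zero_ne h
  have h2 : aeval τ' ((dualPoly Φ.χ).map (starRingEnd K)) x = 0 := by
    rw [← hτ.aeval_dualPoly, dualPoly_dualPoly Φ.χ_monic h0]
    · exact hx
    · rw [coeff_zero_dualPoly Φ.χ_monic]
      exact inv_ne_zero (star_ne_zero.2 h0)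
  rw [h1, hτ.adjoint_aeval_right, h2]
  simp

end FrobeniusBlock

end DualBlock

/-! ### Existence of a decomposition of nonsingular forms -/

namespace FrobeniusBlock

section Normalisation

variable {Φ : FrobeniusBlock K}

theorem two_ne_zero_residue (hchar : (2 : K) ≠ 0) : (2 : Φ.ResidueField) ≠ 0 := by
  have : (2 : Φ.ResidueField) = AdjoinRoot.of Φ.p 2 := (map_ofNat _ 2).symm
  rw [this, Ne, map_eq_zero]
  exact hchar

theorem isUnit_two (hchar : (2 : K) ≠ 0) : IsUnit (2 : Φ.E) := by
  rw [isUnit_iff_res_ne_zero, map_ofNat]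
  exact two_ne_zero_residue hchar

/-- Newton iteration starts from 1, where X² - c is nilpotent and its derivative 2 is a unit. The
root near 1 is unique, so σ must fix it. -/
theorem exists_sqrt (hchar : (2 : K) ≠ 0) (h : Φ.SelfDual) {c : Φ.E} (hc : IsNilpotent (c - 1))
    (hσ : σ h c = c) : ∃ g, g * g = c ∧ σ h g = g ∧ IsNilpotent (g - 1) := by
  have h1 : IsNilpotent (aeval (1 : Φ.E) (X ^ 2 - C c : Φ.E[X])) := by
    have : aeval (1 : Φ.E) (X ^ 2 - C c : Φ.E[X]) = -(c - 1) := by simp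
    rw [this]
    exact hc.neg
  have h2 : IsUnit (aeval (1 : Φ.E) (derivative (X ^ 2 - C c : Φ.E[X]))) := by
    have : aeval (1 : Φ.E) (derivative (X ^ 2 - C c : Φ.E[X])) = 2 := by simp [one_add_one_eq_two]
    rw [this]
    exact isUnit_two hchar
  obtain ⟨g, ⟨hg1, hg2⟩, huniq⟩ := existsUnique_nilpotent_sub_and_aeval_eq_zero h1 h2
  have hval : ∀ y : Φ.E, aeval y (X ^ 2 - C c : Φ.E[X]) = y * y - c := by
    intro y; simp [sq]
  rw [hval, sub_eq_zero] at hg2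
  refine ⟨g, hg2, huniq _ ⟨?_, ?_⟩, ?_⟩
  · have := hg1.map (σ h)
    rwa [map_sub, map_one] at this
  · rw [hval, ← map_mul, hg2, hσ, sub_self]
  · rw [← neg_sub]; exact hg1.neg

variable {V : Type*} [AddCommGroup V] [Module K V] {B : V →ₗ⋆[K] V →ₗ[K] K} {τ τ' : V →ₗ[K] V}
variable {ℓ : Φ.E →ₗ[K] K}

/-- A vector can be rescaled so that its length equals a given function which is equal to it
in the residue field. -/
theorem exists_normalisation (hchar : (2 : K) ≠ 0) (hτ : IsCosqPair B τ τ') (h : Φ.SelfDual)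
    (hℓ : Φ.NondegFun ℓ) (hs : IsSymmFun h 1 ℓ) {w : V} (hw : w ∈ Φ.kerχ τ) {b : Φ.E}
    (hb : σ h b = b) (hbu : IsUnit b) (hres : Φ.res (pairing B τ hℓ w w) = Φ.res b) :
    ∃ g, IsNilpotent (g - 1) ∧
      pairing B τ hℓ (Φ.act τ g w) (Φ.act τ g w) = b := by
  set a := pairing B τ hℓ w w with ha
  have hσa : σ h a = a := by
    have := pairing_symm hℓ hτ h (one_mul 1) hs hw hw
    rw [one_smul, ← ha] at this
    exact this.symm
  have hau : IsUnit a := by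
    rw [isUnit_iff_res_ne_zero, hres, ← isUnit_iff_res_ne_zero]
    exact hbu
  obtain ⟨a', ha'⟩ := hau.exists_right_inv
  have hσa' : σ h a' = a' := by
    have h1 : a * σ h a' = 1 := by rw [← hσa, ← map_mul, ha', map_one]
    calc σ h a' = (a * a') * σ h a' := by rw [ha', one_mul]
      _ = a' * (a * σ h a') := by ring
      _ = a' := by rw [h1, mul_one]
  -- Acting with a fixed g multiplies the length a by g², so g has to be a square root of b a⁻¹,
  -- which is congruent to 1 modulo nilpotents.
  obtain ⟨g, hg1, hg2, hg3⟩ := exists_sqrt hchar h (c := b * a') (by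
    rw [isNilpotent_iff_res_eq_zero, map_sub, map_mul, ← hres, ← map_mul, ha', map_one, sub_self])
    (by rw [map_mul, hb, hσa'])
  refine ⟨g, hg3, ?_⟩
  rw [pairing_act_right _ _ _ (hw), pairing_act_left hℓ hτ h hw hw, hg2, ← ha]
  calc g * a * g = a * (g * g) := by ring
    _ = b := by rw [hg1, mul_left_comm, ha', mul_one]

theorem gram_of_pairing {X : Matrix (Fin Φ.dim) (Fin Φ.dim) K} (hX : Φ.IsStarRoot X)
    (hτ : IsCosqPair B τ τ') (h : Φ.SelfDual) {w : V} (hw : w ∈ Φ.kerχ τ) {q : K[T;T⁻¹]}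
    (hq : pairing B τ hX.nondegFun w w = levE h q) (i j : Fin Φ.dim) :
    B (Φ.act τ (Φ.bas i) w) (Φ.act τ (Φ.bas j) w) = (X * Φ.evalMatrix q) i j := by
  rw [form_act_act hX.nondegFun hτ h hw hw, hq, ← matForm_mul_evalMatrix hX h, tform_apply]

theorem τ_act_mem_span {w : V} (hw : w ∈ Φ.kerχ τ) (i : Fin Φ.dim) :
    τ (Φ.act τ (Φ.bas i) w) ∈ Submodule.span K (Set.range fun i => Φ.act τ (Φ.bas i) w) := by
  rw [← act_x (act_mem hw _), ← act_mul hw]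
  exact act_mem_span _ _

/-- A nonunit is a multiple of π, and a factor π^(s-1) coming from p(τ)^(s-1) would annihilate it.
-/
theorem isUnit_pairing (hℓ : Φ.NondegFun ℓ) {u v : V} (hv : v ∈ Φ.kerχ τ)
    (hne : B u (aeval τ (Φ.p ^ (Φ.s - 1)) v) ≠ 0) : IsUnit (pairing B τ hℓ u v) := by
  rw [isUnit_iff_res_ne_zero, Ne, res_eq_zero_iff]
  rintro ⟨c, hc⟩
  apply hne
  rw [← act_mk hv, map_pow, pairing_spec B τ hℓ, hc]
  have : Φ.π * c * Φ.π ^ (Φ.s - 1) = Φ.π ^ Φ.s * c := by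
    rw [← Nat.sub_add_cancel Φ.s_pos, pow_succ, Nat.add_sub_cancel]
    ring
  rw [this, π_pow_s, zero_mul, map_zero]

/-- If `∗√Φ` exists, then there is a cyclic vector of invertible length. -/
theorem exists_isUnit_pairing_self (hchar : (2 : K) ≠ 0) (hτ : IsCosqPair B τ τ') (h : Φ.SelfDual)
    (hℓ : Φ.NondegFun ℓ) (hs : IsSymmFun h 1 ℓ) {u v : V} (hu : u ∈ Φ.kerχ τ) (hv : v ∈ Φ.kerχ τ)
    (huv : IsUnit (pairing B τ hℓ u v)) : ∃ w ∈ Φ.kerχ τ, IsUnit (pairing B τ hℓ w w) := by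
  obtain ⟨c, hc⟩ := huv.exists_right_inv
  set v' := Φ.act τ c v with hv'
  have hv₃m : v' ∈ Φ.kerχ τ := act_mem hv _
  have huv' : pairing B τ hℓ u v' = 1 := by rw [hv', pairing_act_right _ _ _ hv, hc]
  have hvu' : pairing B τ hℓ v' u = 1 := by
    rw [pairing_symm hℓ hτ h (one_mul 1) hs hv₃m hu, huv', map_one, one_smul]
  by_cases h1 : IsUnit (pairing B τ hℓ u u)
  · exact ⟨u, hu, h1⟩
  by_cases h2 : IsUnit (pairing B τ hℓ v' v')
  · exact ⟨v', hv₃m, h2⟩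
  -- Polarisation: both lengths are nilpotent and both mixed products are 1, so the length of the
  -- sum is 2 modulo nilpotents.
  refine ⟨u + v', add_mem hu hv₃m, ?_⟩
  rw [isUnit_iff_res_ne_zero, not_not] at h1 h2
  rw [isUnit_iff_res_ne_zero, pairing_add_left, pairing_add_right, pairing_add_right, map_add,
    map_add, map_add, h1, h2, huv', hvu', map_one, zero_add, add_zero, one_add_one_eq_two]
  exact two_ne_zero_residue hchar

/-- If `∗√Φ` does not exist, then there is a nondegenerate functional which is skew symmetric. -/
theorem exists_skew_functional (hchar : (2 : K) ≠ 0) (h : Φ.SelfDual) (hΦ : ¬ Φ.HasStarRoot) :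
    ∃ ℓ : Φ.E →ₗ[K] K, Φ.NondegFun ℓ ∧ IsSymmFun h (-1) ℓ := by
  obtain ⟨ℓ, hℓ⟩ := Module.Projective.exists_dual_ne_zero K Φ.π_pow_pred_ne_zero
  let ℓ' : Φ.E →ₗ[K] K :=
    { toFun := fun y => star (ℓ (↑(Φ.u h.coeff_ne)⁻¹ * σ h y))
      map_add' := fun a b => by rw [map_add, mul_add, map_add, star_add]
      map_smul' := fun c a => by
        rw [σ_smul, mul_smul_comm, map_smul, smul_eq_mul, star_mul', star_star]; rfl }
  have hℓ' : ∀ y, ℓ' y = star (ℓ (↑(Φ.u h.coeff_ne)⁻¹ * σ h y)) := fun _ => rfl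
  have hx : Φ.x * (↑(Φ.u h.coeff_ne)⁻¹ : Φ.E) = 1 := by
    rw [← coe_u Φ h.coeff_ne, Units.mul_inv]
  have hsum : ∀ η : K, η * η = 1 → star η = η → IsSymmFun h η (ℓ + η • ℓ') := by
    intro η hη hηs y
    rw [LinearMap.add_apply, LinearMap.add_apply, LinearMap.smul_apply, LinearMap.smul_apply, hℓ',
      hℓ', σ_σ, map_mul (σ h), σ_inv_u, ← mul_assoc, mul_comm _ Φ.x, hx, one_mul, star_add,
      smul_eq_mul, smul_eq_mul, star_mul', star_star, hηs]
    linear_combination (-ℓ (σ h y)) * hη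
  -- The symmetrised functional satisfies the symmetry required of a `∗`-root, so it cannot be
  -- nondegenerate and vanishes on the socle. There the skew-symmetrised functional is then twice ℓ.
  have hdeg : ∀ y, (ℓ + (1 : K) • ℓ') (Φ.π ^ (Φ.s - 1) * y) = 0 := by
    intro y
    by_contra hc
    exact hΦ (hasStarRoot_of_isSymmFun h (nondegFun_of_ne hc) (hsum 1 (one_mul 1) (star_one K)))
  refine ⟨ℓ + (-1 : K) • ℓ', nondegFun_of_ne (a := 1) ?_, hsum (-1) (by norm_num) (by simp)⟩
  have h1 := hdeg 1
  rw [mul_one, LinearMap.add_apply, LinearMap.smul_apply, one_smul] at h1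
  rw [mul_one, LinearMap.add_apply, LinearMap.smul_apply, neg_one_smul]
  intro h2
  have h3 : (2 : K) * ℓ (Φ.π ^ (Φ.s - 1)) = 0 := by linear_combination h1 + h2
  exact (mul_ne_zero hchar hℓ) h3

/-- A length a satisfies σ(a) = -a. If it were a unit, ℓ(a ·) would be nondegenerate and symmetric,
which would give a `∗`-root. -/
theorem isNilpotent_pairing_self (hΦ : ¬ Φ.HasStarRoot) (hτ : IsCosqPair B τ τ') (h : Φ.SelfDual)
    (hℓ : Φ.NondegFun ℓ) (hs : IsSymmFun h (-1) ℓ) {w : V} (hw : w ∈ Φ.kerχ τ) :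
    IsNilpotent (pairing B τ hℓ w w) := by
  refine (Φ.isUnit_or_isNilpotent _).resolve_left fun hu => hΦ ?_
  set a := pairing B τ hℓ w w with ha
  have hσa : σ h a = -a := by
    have := pairing_symm hℓ hτ h (by norm_num) hs hw hw
    rw [neg_one_smul, ← ha] at this
    rw [this, neg_neg, ← this]
  refine hasStarRoot_of_isSymmFun h (ℓ := ℓ ∘ₗ LinearMap.mulLeft K a) ?_ ?_
  · intro b hb
    have h1 : a * b = 0 := hℓ _ fun c => by
      have := hb c
      rw [LinearMap.comp_apply, LinearMap.mulLeft_apply, ← mul_assoc] at this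
      exact this
    exact (hu.mul_right_eq_zero).1 h1
  · intro y
    have h1 := hs (a * y)
    rw [map_mul (σ h), hσa, neg_mul, map_neg] at h1
    rw [LinearMap.comp_apply, LinearMap.comp_apply, LinearMap.mulLeft_apply, LinearMap.mulLeft_apply,
      mul_left_comm a]
    linear_combination -h1

/-- The equation expresses that v + g u is isotropic when g is skew, the product of u and v is 1,
and a, b are the lengths of v, u. Newton iteration starts from 0, where the derivative is -2. The
element -σ(g) solves the same equation, so uniqueness makes g skew. -/
theorem exists_skew_root (hchar : (2 : K) ≠ 0) (h : Φ.SelfDual) {a b : Φ.E} (ha : IsNilpotent a)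
    (hσa : σ h a = -a) (hσb : σ h b = -b) :
    ∃ g, a - 2 * g - g * g * b = 0 ∧ σ h g = -g := by
  set P : Φ.E[X] := C a - C 2 * X - X ^ 2 * C b with hP
  have hval : ∀ y : Φ.E, aeval y P = a - 2 * y - y * y * b := by
    intro y; simp [hP, sq]
  have h1 : IsNilpotent (aeval (0 : Φ.E) P) := by
    rw [hval]
    simpa using ha
  have h2 : IsUnit (aeval (0 : Φ.E) (derivative P)) := by
    have : aeval (0 : Φ.E) (derivative P) = -2 := by simp [hP]
    rw [this]
    exact (isUnit_two hchar).neg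
  obtain ⟨g, ⟨hg1, hg2⟩, huniq⟩ := existsUnique_nilpotent_sub_and_aeval_eq_zero h1 h2
  rw [hval] at hg2
  refine ⟨g, hg2, ?_⟩
  have h3 : -σ h g = g := by
    refine huniq _ ⟨?_, ?_⟩
    · rw [zero_sub, isNilpotent_neg_iff] at hg1 ⊢
      exact (hg1.map (σ h)).neg
    · rw [hval]
      have := congrArg (σ h) hg2
      rw [map_sub, map_sub, map_mul, map_mul, map_mul, hσa, hσb, map_ofNat, map_zero] at this
      linear_combination -this
  rw [← h3, neg_neg, h3]

/-- If `∗√Φ` does not exist, then a pair of cyclic vectors can be made isotropic. -/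
theorem exists_isotropic_pair (hchar : (2 : K) ≠ 0) (hΦ : ¬ Φ.HasStarRoot)
    (hτ : IsCosqPair B τ τ') (h : Φ.SelfDual) (hℓ : Φ.NondegFun ℓ) (hs : IsSymmFun h (-1) ℓ)
    {u v : V} (hu : u ∈ Φ.kerχ τ) (hv : v ∈ Φ.kerχ τ) (huv : IsUnit (pairing B τ hℓ u v)) :
    ∃ u' ∈ Φ.kerχ τ, ∃ v' ∈ Φ.kerχ τ, pairing B τ hℓ u' u' = 0 ∧ pairing B τ hℓ v' v' = 0 ∧
      pairing B τ hℓ u' v' = 1 := by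
  have hsymm : ∀ {x y : V}, x ∈ Φ.kerχ τ → y ∈ Φ.kerχ τ →
      pairing B τ hℓ x y = -σ h (pairing B τ hℓ y x) := fun hx hy => by
    rw [pairing_symm hℓ hτ h (by norm_num) hs hx hy, neg_one_smul]
  have hself : ∀ {x : V}, x ∈ Φ.kerχ τ → σ h (pairing B τ hℓ x x) = -pairing B τ hℓ x x :=
    fun hx => by rw [← neg_eq_iff_eq_neg, ← hsymm hx hx]
  have hscale : ∀ {x y : V}, x ∈ Φ.kerχ τ → y ∈ Φ.kerχ τ → IsUnit (pairing B τ hℓ x y) →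
      ∃ x' ∈ Φ.kerχ τ, pairing B τ hℓ x' y = 1 := by
    intro x y hx hy hxy
    obtain ⟨c, hc⟩ := hxy.exists_left_inv
    exact ⟨_, act_mem hx (σ h c), by rw [pairing_act_left hℓ hτ h hx hy, σ_σ, hc]⟩
  obtain ⟨u₁, hu₁, hu₁v⟩ := hscale hu hv huv
  have hvu₁ : pairing B τ hℓ v u₁ = -1 := by rw [hsymm hv hu₁, hu₁v, map_one]
  obtain ⟨g, hg1, hg2⟩ := exists_skew_root hchar h
    (isNilpotent_pairing_self hΦ hτ h hℓ hs hv) (hself hv) (hself hu₁)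
  set v' := v + Φ.act τ g u₁ with hv'
  have hv₃m : v' ∈ Φ.kerχ τ := add_mem hv (act_mem hu₁ _)
  have hv₃v₃ : pairing B τ hℓ v' v' = 0 := by
    rw [hv', pairing_add_left, pairing_add_right, pairing_add_right, pairing_act_right _ _ _ hu₁,
      pairing_act_right _ _ _ hu₁, pairing_act_left hℓ hτ h hu₁ hv, pairing_act_left hℓ hτ h hu₁ hu₁,
      hvu₁, hu₁v, hg2]
    linear_combination hg1
  have hu₁v' : IsUnit (pairing B τ hℓ u₁ v') := by
    rw [isUnit_iff_res_ne_zero, hv', pairing_add_right, pairing_act_right _ _ _ hu₁, hu₁v, map_add,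
      map_one, map_mul, (isNilpotent_iff_res_eq_zero _).1
        (isNilpotent_pairing_self hΦ hτ h hℓ hs hu₁), zero_mul, add_zero]
    exact one_ne_zero
  obtain ⟨u₂, hu₂, hu₂v'⟩ := hscale hu₁ hv₃m hu₁v'
  have hv₃u₂ : pairing B τ hℓ v' u₂ = -1 := by rw [hsymm hv₃m hu₂, hu₂v', map_one]
  obtain ⟨t, ht⟩ := (isUnit_two (Φ := Φ) hchar).exists_right_inv
  have hσt : σ h t = t := by
    have h1 : 2 * σ h t = 1 := by rw [← map_ofNat (σ h) 2, ← map_mul, ht, map_one]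
    calc σ h t = (2 * t) * σ h t := by rw [ht, one_mul]
      _ = t * (2 * σ h t) := by ring
      _ = t := by rw [h1, mul_one]
  set b := pairing B τ hℓ u₂ u₂ with hb
  have hσb : σ h b = -b := hself hu₂
  -- Once `v'` is isotropic the equation for the other vector is linear: the coefficient -b/2
  -- removes the length b, because b is skew. Here `t` is one half.
  refine ⟨u₂ + Φ.act τ (-(b * t)) v', add_mem hu₂ (act_mem hv₃m _), v', hv₃m, ?_, hv₃v₃, ?_⟩
  · rw [pairing_add_left, pairing_add_right, pairing_add_right, pairing_act_right _ _ _ hv₃m,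
      pairing_act_right _ _ _ hv₃m, pairing_act_left hℓ hτ h hv₃m hu₂,
      pairing_act_left hℓ hτ h hv₃m hv₃m, hv₃v₃, hu₂v', hv₃u₂, ← hb, map_neg, map_mul, hσb, hσt]
    linear_combination (-b) * ht
  · rw [pairing_add_left, pairing_act_left hℓ hτ h hv₃m hv₃m, hv₃v₃, hu₂v', mul_zero, add_zero]

end Normalisation

end FrobeniusBlock

/-! ### Splitting off canonical summands -/

section Existence

variable {V : Type*} [AddCommGroup V] [Module K V]

theorem Summand.root_det_ne (hchar : (2 : K) ≠ 0)
    {R : ∀ Φ : FrobeniusBlock K, Matrix (Fin Φ.dim) (Fin Φ.dim) K}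
    (hR : ∀ Φ : FrobeniusBlock K, Φ.HasStarRoot → Φ.IsStarRoot (R Φ)) {Φ : FrobeniusBlock K}
    {q : K[T;T⁻¹]} (hA : (root Φ q).Admissible) : ((root Φ q).toMatrix R).det ≠ 0 := by
  obtain ⟨hΦ, hq0, hq⟩ := hA
  have h := hΦ.selfDual
  have h1 : IsUnit (FrobeniusBlock.levE h q) := by
    rw [FrobeniusBlock.isUnit_iff_res_ne_zero, FrobeniusBlock.res_levE]
    exact FrobeniusBlock.evalKappa_ne_zero hchar h hq0 hq
  have h2 : (R Φ * Φ.evalMatrix q).det ≠ 0 := by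
    rw [Matrix.det_mul, FrobeniusBlock.evalMatrix_eq h]
    exact mul_ne_zero (hR Φ hΦ).1
      ((Matrix.isUnit_iff_isUnit_det _).1 (h1.map (Algebra.leftMulMatrix Φ.bas))).ne_zero
  exact h2

theorem FrobeniusBlock.det_fromBlocks_ne {Φ : FrobeniusBlock K} (h : Φ.toMatrix.det ≠ 0) :
    (fromBlocks 0 (1 : Matrix (Fin Φ.dim) (Fin Φ.dim) K) Φ.toMatrix 0).det ≠ 0 := by
  have h1 : fromBlocks 0 (1 : Matrix (Fin Φ.dim) (Fin Φ.dim) K) Φ.toMatrix 0 *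
      fromBlocks 0 Φ.toMatrix⁻¹ 1 0 = 1 := by
    rw [fromBlocks_multiply, Matrix.mul_nonsing_inv _ (isUnit_iff_ne_zero.2 h)]
    simp
  exact (Matrix.isUnit_det_of_right_inverse h1).ne_zero

theorem Summand.skew_det_ne {R : ∀ Φ : FrobeniusBlock K, Matrix (Fin Φ.dim) (Fin Φ.dim) K}
    {Φ : FrobeniusBlock K} (h : Φ.toMatrix.det ≠ 0) : ((skew Φ).toMatrix R).det ≠ 0 := by
  have h2 : (Matrix.reindex finSumFinEquiv finSumFinEquiv
      (Matrix.fromBlocks 0 (1 : Matrix (Fin Φ.dim) (Fin Φ.dim) K) Φ.toMatrix 0)).det ≠ 0 := by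
    rw [Matrix.det_reindex_self]
    exact FrobeniusBlock.det_fromBlocks_ne h
  exact h2

/-- Every nonzero nonsingular form contains a nonsingular canonical summand. -/
theorem exists_summand_gram (hchar : (2 : K) ≠ 0) [FiniteDimensional K V] [Nontrivial V]
    {R : ∀ Φ : FrobeniusBlock K, Matrix (Fin Φ.dim) (Fin Φ.dim) K}
    (hR : ∀ Φ : FrobeniusBlock K, Φ.HasStarRoot → Φ.IsStarRoot (R Φ))
    {B : V →ₗ⋆[K] V →ₗ[K] K} {τ τ' : V →ₗ[K] V} (hB : Nondeg B) (hτ : IsCosqPair B τ τ') :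
    ∃ A : Summand K, A.Admissible ∧ 0 < A.size ∧ (A.toMatrix R).det ≠ 0 ∧
      ∃ b : Fin A.size → V, (∀ i j, B (b i) (b j) = A.toMatrix R i j) ∧
        ∀ i, τ (b i) ∈ Submodule.span K (Set.range b) := by
  obtain ⟨Φ, h0, v, u, hv, hu, hne⟩ := FrobeniusBlock.exists_cyclic_pair hB hτ
  by_cases hΦ : Φ.HasStarRoot
  · have h := hΦ.selfDual
    have hX := hR Φ hΦ
    have hu' : u ∈ Φ.kerχ τ := by
      rw [FrobeniusBlock.mem_kerχ, FrobeniusBlock.dual_χ, h.χ_eq] at hu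
      exact hu
    obtain ⟨w, hw, hwu⟩ := FrobeniusBlock.exists_isUnit_pairing_self hchar hτ h hX.nondegFun
      (hX.isSymmFun h) hu' hv (FrobeniusBlock.isUnit_pairing hX.nondegFun hv hne)
    have hfix : Φ.involution (Φ.res (FrobeniusBlock.pairing B τ hX.nondegFun w w)) =
        Φ.res (FrobeniusBlock.pairing B τ hX.nondegFun w w) := by
      conv_rhs => rw [FrobeniusBlock.pairing_symm hX.nondegFun hτ h (one_mul 1) (hX.isSymmFun h) hw hw]
      rw [one_smul, FrobeniusBlock.res_σ]
    obtain ⟨q, hq, hqe⟩ := FrobeniusBlock.exists_stationary hchar h hfix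
    have hq0 : q ≠ 0 := by
      rintro rfl
      rw [FrobeniusBlock.evalKappa_eq h, map_zero] at hqe
      exact (FrobeniusBlock.isUnit_iff_res_ne_zero _).1 hwu hqe.symm
    have hbu : IsUnit (FrobeniusBlock.levE h q) := by
      rw [FrobeniusBlock.isUnit_iff_res_ne_zero, FrobeniusBlock.res_levE]
      exact FrobeniusBlock.evalKappa_ne_zero hchar h hq0 hq
    obtain ⟨g, -, hg⟩ := FrobeniusBlock.exists_normalisation hchar hτ h hX.nondegFun (hX.isSymmFun h)
      hw (FrobeniusBlock.σ_levE h hq.symm) hbu (by rw [FrobeniusBlock.res_levE, hqe])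
    have hA : (Summand.root Φ q).Admissible := ⟨hΦ, hq0, hq⟩
    exact ⟨Summand.root Φ q, hA, Φ.dim_pos, Summand.root_det_ne hchar hR hA,
      fun i => Φ.act τ (Φ.bas i) (Φ.act τ g w),
      fun i j => FrobeniusBlock.gram_of_pairing hX hτ h (FrobeniusBlock.act_mem hw g) hg i j,
      fun i => FrobeniusBlock.τ_act_mem_span (FrobeniusBlock.act_mem hw g) i⟩
  · have hdet := Φ.det_ne_of_coeff_zero_ne h0
    refine ⟨Summand.skew Φ, ⟨hdet, hΦ⟩, Nat.add_pos_left Φ.dim_pos _, Summand.skew_det_ne hdet, ?_⟩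
    suffices hs : ∃ b : Fin Φ.dim ⊕ Fin Φ.dim → V,
        (∀ i j, B (b i) (b j) = (fromBlocks 0 1 Φ.toMatrix 0 : Matrix _ _ K) i j) ∧
        ∀ i, τ (b i) ∈ Submodule.span K (Set.range b) by
      obtain ⟨b, hb1, hb2⟩ := hs
      refine ⟨b ∘ finSumFinEquiv.symm, fun i j => hb1 _ _, fun i => ?_⟩
      have hr : Set.range (b ∘ (finSumFinEquiv (m := Φ.dim) (n := Φ.dim)).symm) = Set.range b :=
        finSumFinEquiv.symm.surjective.range_comp b
      exact hr.symm ▸ hb2 _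
    by_cases h : Φ.SelfDual
    · have hdual : Φ.dual h0 = Φ := by
        obtain ⟨p, s, hp1, hp2, hs⟩ := Φ
        have : dualPoly p = p := h
        simp [FrobeniusBlock.dual, this]
      rw [hdual] at hu
      obtain ⟨ℓ, hℓ, hs⟩ := FrobeniusBlock.exists_skew_functional hchar h hΦ
      obtain ⟨u', hu', v', hv', hu₃u₃, hv₃v₃, hu₃v₃⟩ := FrobeniusBlock.exists_isotropic_pair hchar hΦ
        hτ h hℓ hs hu hv (FrobeniusBlock.isUnit_pairing hℓ hv hne)
      -- ℓ may vanish at the socle generator itself; acting with `c` on `v'` makes the product that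
      -- has to be nonzero equal to ℓ(π^(s-1) c).
      obtain ⟨c, hc⟩ := hℓ.exists_ne
      have hiso : ∀ {w}, w ∈ Φ.kerχ τ → FrobeniusBlock.pairing B τ hℓ w w = 0 → ∀ a b,
          B (Φ.act τ a w) (Φ.act τ b w) = 0 := fun hw hw0 a b => by
        rw [FrobeniusBlock.form_act_act hℓ hτ h hw hw, hw0, mul_zero, zero_mul, map_zero]
      refine FrobeniusBlock.exists_skew_gram h0 (v := Φ.act τ c v') (u := u') hτ
        (FrobeniusBlock.act_mem hv' _) (by rw [hdual]; exact hu') (hiso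
          (FrobeniusBlock.act_mem hv' _) ?_) ?_ ?_
      · rw [FrobeniusBlock.pairing_act_right _ _ _ hv', FrobeniusBlock.pairing_act_left hℓ hτ h hv' hv',
          hv₃v₃, mul_zero, zero_mul]
      · rw [hdual]
        exact hiso hu' hu₃u₃
      · rw [← FrobeniusBlock.act_mk (FrobeniusBlock.act_mem hv' _), map_pow,
          ← FrobeniusBlock.act_mul hv', FrobeniusBlock.pairing_spec B τ hℓ, hu₃v₃, one_mul]
        exact hc
    · refine FrobeniusBlock.exists_skew_gram h0 hτ hv hu ?_ ?_ hne
      · intro a b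
        exact FrobeniusBlock.form_eq_zero_of_not_selfDual hτ h h0 (FrobeniusBlock.act_mem hv _)
          (FrobeniusBlock.act_mem hv _)
      · intro a b
        refine FrobeniusBlock.form_eq_zero_of_not_selfDual hτ (Φ := Φ.dual h0) ?_
          (FrobeniusBlock.dual_coeff_ne h0) (FrobeniusBlock.act_mem hu _)
          (FrobeniusBlock.act_mem hu _)
        intro h'
        apply h
        have h2 : dualPoly (dualPoly Φ.p) = dualPoly Φ.p := h'
        rw [dualPoly_dualPoly Φ.monic h0] at h2
        exact h2.symm

theorem exists_directSum_of_nondeg_aux (hchar : (2 : K) ≠ 0)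
    {R : ∀ Φ : FrobeniusBlock K, Matrix (Fin Φ.dim) (Fin Φ.dim) K}
    (hR : ∀ Φ : FrobeniusBlock K, Φ.HasStarRoot → Φ.IsStarRoot (R Φ)) (n : ℕ) :
    ∀ (V : Type u) [AddCommGroup V] [Module K V] [FiniteDimensional K V]
      (B : V →ₗ⋆[K] V →ₗ[K] K), Module.finrank K V = n → Nondeg B →
      ∃ D : List (Summand K), IsCanonical D ∧ HasMatrix B (directSum R D) := by
  induction n using Nat.strong_induction_on with
  | _ n ih =>
    intro V _ _ _ B hn hB
    rcases subsingleton_or_nontrivial V with hV | hV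
    · refine ⟨[], by simp [IsCanonical], ?_⟩
      exact ⟨Module.Basis.empty V, fun i => isEmptyElim i⟩
    · obtain ⟨τ, τ', hτ⟩ := hB.exists_cosqPair
      obtain ⟨A, hA, hpos, hdet, b, hb, hspan⟩ := exists_summand_gram hchar hR hB hτ
      obtain ⟨W, hW, hcard, hext⟩ := exists_complement_of_gram hB hτ.cosq hb hdet hspan
      rw [Fintype.card_fin] at hcard
      obtain ⟨D, hD, hDm⟩ := ih (Module.finrank K W) (by omega) W (restrictForm B W) rfl hW
      refine ⟨A :: D, ?_, (hext _ _ hDm).congr (directSum_cons R A D).symm⟩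
      intro A' hA'
      rcases List.mem_cons.1 hA' with rfl | h
      · exact hA
      · exact hD _ h

theorem exists_directSum (hchar : (2 : K) ≠ 0) [FiniteDimensional K V]
    {R : ∀ Φ : FrobeniusBlock K, Matrix (Fin Φ.dim) (Fin Φ.dim) K}
    (hR : ∀ Φ : FrobeniusBlock K, Φ.HasStarRoot → Φ.IsStarRoot (R Φ))
    (B : V →ₗ⋆[K] V →ₗ[K] K) :
    ∃ D : List (Summand K), IsCanonical D ∧ HasMatrix B (directSum R D) := by
  obtain ⟨ν, ι, _, _, _, _, n, N, hn, hN, hBN⟩ := hasSingularDecomp B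
  have hm := matrixForm_hasMatrix N
  obtain ⟨D, hD, hDm⟩ := exists_directSum_of_nondeg_aux hchar hR _ _ (matrixForm N) rfl
    (hm.nondeg_iff.2 hN)
  obtain ⟨D', hD', hDm'⟩ := exists_list_of_family R fun i => Summand.jordan (K := K) (n i)
  refine ⟨D ++ D', ?_, ?_⟩
  · intro A hA
    rcases List.mem_append.1 hA with h | h
    · exact hD _ h
    · obtain ⟨i, rfl⟩ := (hD' A).1 h
      exact hn i
  · exact hBN.congr (((hm.mcong hDm).fromBlocks hDm').trans (directSum_append R D D').symm)

end Existence

/-! ### The top layer of the kernel of a block -/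

section Top

universe v

variable {V : Type*} [AddCommGroup V] [Module K V] {V₂ : Type*} [AddCommGroup V₂] [Module K V₂]

theorem aeval_prodMap (τ : V →ₗ[K] V) (τ₂ : V₂ →ₗ[K] V₂) (f : K[X]) (y : V × V₂) :
    aeval (τ.prodMap τ₂) f y = (aeval τ f y.1, aeval τ₂ f y.2) := by
  have hn : ∀ (n : ℕ) (y : V × V₂), ((τ.prodMap τ₂) ^ n) y = ((τ ^ n) y.1, (τ₂ ^ n) y.2) := by
    intro n
    induction n with
    | zero => intro y; simp
    | succ n ih => intro y; rw [pow_succ, Module.End.mul_apply, ih, pow_succ, pow_succ]; rfl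
  induction f using Polynomial.induction_on' with
  | add f g hf hg => simp [hf, hg]
  | monomial n a => simp [aeval_monomial, hn]

theorem map_aeval_of_comm {τ : V →ₗ[K] V} {τ₂ : V₂ →ₗ[K] V₂} (e : V ≃ₗ[K] V₂)
    (he : ∀ y, e (τ y) = τ₂ (e y)) (f : K[X]) (y : V) : e (aeval τ f y) = aeval τ₂ f (e y) := by
  have hn : ∀ (n : ℕ) (y : V), e ((τ ^ n) y) = (τ₂ ^ n) (e y) := by
    intro n
    induction n with
    | zero => intro y; simp
    | succ n ih => intro y; rw [pow_succ, Module.End.mul_apply, ih, pow_succ, Module.End.mul_apply, he]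
  induction f using Polynomial.induction_on' with
  | add f g hf hg => simp [hf, hg]
  | monomial n a => simp [aeval_monomial, hn]

namespace FrobeniusBlock

/-- The vector belongs to `Ker p(τ)^(s-1) + p(τ) Ker p(τ)^(s+1)`. -/
def IsDeep (Φ : FrobeniusBlock K) (τ : V →ₗ[K] V) (y : V) : Prop :=
  ∃ z₁ z₂, y = z₁ + aeval τ Φ.p z₂ ∧ aeval τ (Φ.p ^ (Φ.s - 1)) z₁ = 0 ∧
    aeval τ (Φ.p ^ (Φ.s + 1)) z₂ = 0

/-- The function identifies the quotient of `Ker p(τ)^s` by the deep vectors with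
a coordinate space over the residue field. -/
structure IsTop (Φ : FrobeniusBlock K) (τ : V →ₗ[K] V) {ι : Type*} (r : V → ι → Φ.ResidueField) :
    Prop where
  add : ∀ y ∈ Φ.kerχ τ, ∀ y' ∈ Φ.kerχ τ, r (y + y') = r y + r y'
  smul : ∀ (f : K[X]), ∀ y ∈ Φ.kerχ τ, r (aeval τ f y) = AdjoinRoot.mk Φ.p f • r y
  surj : ∀ a, ∃ y ∈ Φ.kerχ τ, r y = a
  zero_iff : ∀ y ∈ Φ.kerχ τ, r y = 0 ↔ Φ.IsDeep τ y

variable {Φ : FrobeniusBlock K} {τ : V →ₗ[K] V} {τ₂ : V₂ →ₗ[K] V₂}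
variable {ι ι' : Type*} {r : V → ι → Φ.ResidueField} {r' : V → ι' → Φ.ResidueField}

theorem IsTop.sub (h : Φ.IsTop τ r) {y y' : V} (hy : y ∈ Φ.kerχ τ) (hy' : y' ∈ Φ.kerχ τ) :
    r (y - y') = r y - r y' := by
  rw [eq_sub_iff_add_eq, ← h.add _ (sub_mem hy hy') _ hy', sub_add_cancel]

/-- Both coordinate maps are onto with the deep vectors as kernel, and deepness depends on τ alone,
so each factors through the other. -/
theorem IsTop.exists_equiv (h : Φ.IsTop τ r) (h' : Φ.IsTop τ r') :
    ∃ S : (ι → Φ.ResidueField) ≃ₗ[Φ.ResidueField] (ι' → Φ.ResidueField),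
      ∀ y ∈ Φ.kerχ τ, S (r y) = r' y := by
  choose y hyk hy using h.surj
  have key : ∀ z ∈ Φ.kerχ τ, r' (y (r z)) = r' z := by
    intro z hz
    rw [← sub_eq_zero, ← h'.sub (hyk _) hz, h'.zero_iff _ (sub_mem (hyk _) hz),
      ← h.zero_iff _ (sub_mem (hyk _) hz), h.sub (hyk _) hz, hy, sub_self]
  let S : (ι → Φ.ResidueField) →ₗ[Φ.ResidueField] (ι' → Φ.ResidueField) :=
    { toFun := fun a => r' (y a)
      map_add' := fun a b => by
        rw [← h'.add _ (hyk _) _ (hyk _), ← key _ (add_mem (hyk a) (hyk b)),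
          h.add _ (hyk _) _ (hyk _), hy, hy]
      map_smul' := fun c a => by
        obtain ⟨f, rfl⟩ := AdjoinRoot.mk_surjective c
        rw [RingHom.id_apply, ← h'.smul _ _ (hyk _), ← key _ (aeval_mem (hyk a) f),
          h.smul _ _ (hyk _), hy] }
  have hS : ∀ z ∈ Φ.kerχ τ, S (r z) = r' z := key
  refine ⟨LinearEquiv.ofBijective S ⟨?_, ?_⟩, hS⟩
  · rw [injective_iff_map_eq_zero]
    intro a ha
    have h1 := (h.zero_iff _ (hyk a)).2 ((h'.zero_iff _ (hyk a)).1 ha)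
    rwa [hy] at h1
  · intro b
    obtain ⟨z, hz, rfl⟩ := h'.surj b
    exact ⟨r z, hS z hz⟩

theorem IsTop.reindex (h : Φ.IsTop τ r) (e : ι' ≃ ι) : Φ.IsTop τ fun y i => r y (e i) where
  add y hy y' hy' := by funext i; simp [h.add y hy y' hy']
  smul f y hy := by funext i; simp [h.smul f y hy]
  surj a := by
    obtain ⟨y, hy, hya⟩ := h.surj (a ∘ e.symm)
    exact ⟨y, hy, by funext i; simp [hya]⟩
  zero_iff y hy := by
    rw [← h.zero_iff y hy]
    constructor
    · intro h1; funext i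
      have := congrFun h1 (e.symm i)
      simpa using this
    · intro h1; funext i; rw [h1]; rfl

theorem mem_kerχ_prod {y : V × V₂} :
    y ∈ Φ.kerχ (τ.prodMap τ₂) ↔ y.1 ∈ Φ.kerχ τ ∧ y.2 ∈ Φ.kerχ τ₂ := by
  rw [mem_kerχ, aeval_prodMap, Prod.mk_eq_zero]
  rfl

theorem isDeep_prod {y : V × V₂} :
    Φ.IsDeep (τ.prodMap τ₂) y ↔ Φ.IsDeep τ y.1 ∧ Φ.IsDeep τ₂ y.2 := by
  constructor
  · rintro ⟨z₁, z₂, h1, h2, h3⟩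
    rw [aeval_prodMap, Prod.mk_eq_zero] at h2 h3
    rw [aeval_prodMap] at h1
    exact ⟨⟨z₁.1, z₂.1, by rw [h1]; rfl, h2.1, h3.1⟩, ⟨z₁.2, z₂.2, by rw [h1]; rfl, h2.2, h3.2⟩⟩
  · rintro ⟨⟨z₁, z₂, h1, h2, h3⟩, ⟨w₁, w₂, h4, h5, h6⟩⟩
    refine ⟨(z₁, w₁), (z₂, w₂), ?_, ?_, ?_⟩
    · rw [aeval_prodMap]; exact Prod.ext h1 h4
    · rw [aeval_prodMap]; exact Prod.ext h2 h5
    · rw [aeval_prodMap]; exact Prod.ext h3 h6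

theorem IsTop.prod {r₂ : V₂ → ι' → Φ.ResidueField} (h : Φ.IsTop τ r) (h₂ : Φ.IsTop τ₂ r₂) :
    Φ.IsTop (τ.prodMap τ₂) fun y => Sum.elim (r y.1) (r₂ y.2) where
  add y hy y' hy' := by
    rw [mem_kerχ_prod] at hy hy'
    funext i
    rcases i with i | i
    · simp [h.add _ hy.1 _ hy'.1]
    · simp [h₂.add _ hy.2 _ hy'.2]
  smul f y hy := by
    rw [mem_kerχ_prod] at hy
    rw [aeval_prodMap]
    funext i
    rcases i with i | i
    · simp [h.smul f _ hy.1]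
    · simp [h₂.smul f _ hy.2]
  surj a := by
    obtain ⟨y, hy, hya⟩ := h.surj (a ∘ Sum.inl)
    obtain ⟨y₂, hy₂, hya₂⟩ := h₂.surj (a ∘ Sum.inr)
    refine ⟨(y, y₂), mem_kerχ_prod.2 ⟨hy, hy₂⟩, ?_⟩
    funext i
    rcases i with i | i
    · simp [hya]
    · simp [hya₂]
  zero_iff y hy := by
    rw [mem_kerχ_prod] at hy
    rw [isDeep_prod, ← h.zero_iff _ hy.1, ← h₂.zero_iff _ hy.2]
    constructor
    · intro h1
      exact ⟨funext fun i => congrFun h1 (Sum.inl i), funext fun i => congrFun h1 (Sum.inr i)⟩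
    · rintro ⟨h1, h2⟩
      funext i
      rcases i with i | i
      · simp [h1]
      · simp [h2]

theorem IsTop.transport {r₂ : V₂ → ι → Φ.ResidueField} (h : Φ.IsTop τ₂ r₂) (e : V ≃ₗ[K] V₂)
    (he : ∀ y, e (τ y) = τ₂ (e y)) : Φ.IsTop τ fun y => r₂ (e y) := by
  have hm : ∀ (f : K[X]) (y : V), e (aeval τ f y) = aeval τ₂ f (e y) := map_aeval_of_comm e he
  have hker : ∀ y, y ∈ Φ.kerχ τ ↔ e y ∈ Φ.kerχ τ₂ := by
    intro y
    rw [mem_kerχ, mem_kerχ, ← hm, LinearEquiv.map_eq_zero_iff]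
  refine ⟨fun y hy y' hy' => ?_, fun f y hy => ?_, fun a => ?_, fun y hy => ?_⟩
  · rw [map_add, h.add _ ((hker y).1 hy) _ ((hker y').1 hy')]
  · rw [hm, h.smul f _ ((hker y).1 hy)]
  · obtain ⟨z, hz, hza⟩ := h.surj a
    refine ⟨e.symm z, (hker _).2 (by rwa [e.apply_symm_apply]), ?_⟩
    rw [e.apply_symm_apply, hza]
  · rw [h.zero_iff _ ((hker y).1 hy)]
    constructor
    · rintro ⟨z₁, z₂, h1, h2, h3⟩
      refine ⟨e.symm z₁, e.symm z₂, e.injective ?_, e.injective ?_, e.injective ?_⟩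
      · rw [map_add, hm, e.apply_symm_apply, e.apply_symm_apply, h1]
      · rw [hm, e.apply_symm_apply, h2, map_zero]
      · rw [hm, e.apply_symm_apply, h3, map_zero]
    · rintro ⟨z₁, z₂, h1, h2, h3⟩
      refine ⟨e z₁, e z₂, ?_, ?_, ?_⟩
      · rw [h1, map_add, hm]
      · rw [← hm, h2, map_zero]
      · rw [← hm, h3, map_zero]

theorem aeval_mulLeft_x (Θ : FrobeniusBlock K) (f : K[X]) (a : Θ.E) :
    aeval (LinearMap.mulLeft K Θ.x) f a = AdjoinRoot.mk Θ.χ f * a := by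
  rw [aeval_mulLeft_eval₂, AdjoinRoot.aeval_eq]

-- In the algebra of the block the deep vectors are the multiples of π: such multiples qualify
-- because p^(s+1) kills everything, and a unit is not killed by π^(s-1).
variable (Φ) in
theorem isTop_self : Φ.IsTop (LinearMap.mulLeft K Φ.x) fun a (_ : PUnit.{v+1}) => Φ.res a where
  add a _ b _ := by funext; simp
  smul f a _ := by funext; rw [aeval_mulLeft_x]; simp
  surj b := by
    obtain ⟨a, ha⟩ := res_surjective (b ⟨⟩)
    refine ⟨a, ?_, by funext i; rw [ha]⟩
    rw [mem_kerχ, aeval_mulLeft_x, AdjoinRoot.mk_self, zero_mul]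
  zero_iff a _ := by
    rw [funext_iff]
    simp only [Pi.zero_apply, forall_const]
    constructor
    · intro ha
      obtain ⟨c, rfl⟩ := (res_eq_zero_iff a).1 ha
      refine ⟨0, c, ?_, ?_, ?_⟩
      · rw [aeval_mulLeft_x, zero_add]
      · rw [map_zero]
      · rw [aeval_mulLeft_x, pow_succ, map_mul, map_pow, π_pow_s, zero_mul, zero_mul]
    · rintro ⟨z₁, z₂, h1, h2, -⟩
      rw [aeval_mulLeft_x, map_pow] at h2
      rw [h1, aeval_mulLeft_x, map_add, map_mul, (res_eq_zero_iff Φ.π).2 dvd_rfl, zero_mul, add_zero]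
      by_contra hne
      have hu := (isUnit_iff_res_ne_zero z₁).2 hne
      exact Φ.π_pow_pred_ne_zero ((hu.mul_left_eq_zero).1 h2)

theorem isTop_of_forall_isDeep [IsEmpty ι] (h : ∀ y ∈ Φ.kerχ τ, Φ.IsDeep τ y) : Φ.IsTop τ r where
  add _ _ _ _ := Subsingleton.elim _ _
  smul _ _ _ := Subsingleton.elim _ _
  surj _ := ⟨0, zero_mem _, Subsingleton.elim _ _⟩
  zero_iff y hy := ⟨fun _ => h y hy, fun _ => Subsingleton.elim _ _⟩

/-- A different block contributes nothing. With the same p and a smaller exponent it is killed by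
p^(s-1); with a larger exponent the kernel of p^s is p times elements killed by p^(s+1); with
another irreducible polynomial the kernel is zero. -/
theorem isTop_of_ne [IsEmpty ι] {Θ : FrobeniusBlock K} (hne : Θ ≠ Φ) {r : Θ.E → ι → Φ.ResidueField} :
    Φ.IsTop (LinearMap.mulLeft K Θ.x) r := by
  refine isTop_of_forall_isDeep fun y hy => ?_
  rw [mem_kerχ, aeval_mulLeft_x] at hy
  simp only [IsDeep, aeval_mulLeft_x]
  by_cases hp : Θ.p = Φ.p
  · have hs : Θ.s ≠ Φ.s := by
      intro hs
      apply hne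
      obtain ⟨p, s, _, _, _⟩ := Θ
      obtain ⟨p', s', _, _, _⟩ := Φ
      simp only at hp hs
      subst hp hs
      rfl
    have hχ : Θ.χ = Φ.p ^ Θ.s := by rw [χ, hp]
    rcases lt_or_gt_of_ne hs with hs | hs
    · refine ⟨y, 0, by simp, ?_, by simp⟩
      have : Θ.χ ∣ Φ.p ^ (Φ.s - 1) := by rw [hχ]; exact pow_dvd_pow _ (by omega)
      rw [AdjoinRoot.mk_eq_zero.2 this, zero_mul]
    · obtain ⟨g, rfl⟩ := AdjoinRoot.mk_surjective y
      rw [← map_mul, AdjoinRoot.mk_eq_zero, hχ, χ, ← Nat.add_sub_cancel' hs.le, pow_add,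
        mul_dvd_mul_iff_left (pow_ne_zero _ Φ.irreducible.ne_zero)] at hy
      obtain ⟨g', rfl⟩ := hy
      refine ⟨0, AdjoinRoot.mk Θ.χ (Φ.p ^ (Θ.s - Φ.s - 1) * g'), ?_, by simp, ?_⟩
      · rw [zero_add, ← map_mul, ← mul_assoc, ← pow_succ', Nat.sub_add_cancel (by omega)]
      · rw [← map_mul, AdjoinRoot.mk_eq_zero, ← mul_assoc, ← pow_add, hχ]
        exact (pow_dvd_pow _ (by omega)).mul_right _
  · have hu : IsUnit (AdjoinRoot.mk Θ.χ Φ.χ) := by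
      refine Θ.isUnit_mk fun hd => hp ?_
      exact eq_of_monic_of_associated Θ.monic Φ.monic
        (Θ.irreducible.associated_of_dvd Φ.irreducible (Θ.irreducible.prime.dvd_of_dvd_pow hd))
    have : y = 0 := (hu.mul_right_eq_zero).1 hy
    exact ⟨0, 0, by simp [this], by simp, by simp⟩

/-- Compatibility of coordinates on the top layer with a form. -/
def FormTop (Φ : FrobeniusBlock K) (ℓ : Φ.E →ₗ[K] K) (B : V →ₗ⋆[K] V →ₗ[K] K) (τ : V →ₗ[K] V)
    [Fintype ι] (r : V → ι → Φ.ResidueField) (c : ι → Φ.ResidueField) : Prop :=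
  ∀ y ∈ Φ.kerχ τ, ∀ y' ∈ Φ.kerχ τ, ∀ a : Φ.E,
    Φ.res a = ∑ i, c i * Φ.involution (r y i) * r y' i →
    B y (aeval τ (Φ.p ^ (Φ.s - 1)) y') = ℓ (Φ.π ^ (Φ.s - 1) * a)

/-- The orthogonal sum of two forms. -/
def prodForm (B : V →ₗ⋆[K] V →ₗ[K] K) (B₂ : V₂ →ₗ⋆[K] V₂ →ₗ[K] K) :
    V × V₂ →ₗ⋆[K] V × V₂ →ₗ[K] K :=
  LinearMap.mk₂'ₛₗ _ _ (fun x y => B x.1 y.1 + B₂ x.2 y.2) (fun x x' y => by simp; ring)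
    (fun c x y => by simp [mul_add]) (fun x y y' => by simp; ring) (fun c x y => by simp [mul_add])

@[simp] theorem prodForm_apply (B : V →ₗ⋆[K] V →ₗ[K] K) (B₂ : V₂ →ₗ⋆[K] V₂ →ₗ[K] K) (x y : V × V₂) :
    prodForm B B₂ x y = B x.1 y.1 + B₂ x.2 y.2 := rfl

variable {ℓ : Φ.E →ₗ[K] K} {B : V →ₗ⋆[K] V →ₗ[K] K} {B₂ : V₂ →ₗ⋆[K] V₂ →ₗ[K] K}
variable {c : ι → Φ.ResidueField} {c₂ : ι' → Φ.ResidueField} [Fintype ι] [Fintype ι']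

theorem FormTop.prod {r₂ : V₂ → ι' → Φ.ResidueField} (h : Φ.FormTop ℓ B τ r c)
    (h₂ : Φ.FormTop ℓ B₂ τ₂ r₂ c₂) :
    Φ.FormTop ℓ (prodForm B B₂) (τ.prodMap τ₂) (fun y => Sum.elim (r y.1) (r₂ y.2))
      (Sum.elim c c₂) := by
  intro y hy y' hy' a ha
  rw [mem_kerχ_prod] at hy hy'
  rw [Fintype.sum_sum_type] at ha
  simp only [Sum.elim_inl, Sum.elim_inr] at ha
  obtain ⟨b, hb⟩ := res_surjective (∑ i, c i * Φ.involution (r y.1 i) * r y'.1 i)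
  rw [prodForm_apply, aeval_prodMap, h _ hy.1 _ hy'.1 b hb, h₂ _ hy.2 _ hy'.2 (a - b) (by
    rw [map_sub, ha, hb, add_sub_cancel_left]), ← map_add, mul_sub, add_sub_cancel]

theorem FormTop.reindex (h : Φ.FormTop ℓ B τ r c) (e : ι' ≃ ι) {c' : ι' → Φ.ResidueField}
    (hc : ∀ i, c' i = c (e i)) : Φ.FormTop ℓ B τ (fun y i => r y (e i)) c' := by
  intro y hy y' hy' a ha
  refine h y hy y' hy' a ?_
  rw [ha, ← e.sum_comp]
  exact Finset.sum_congr rfl fun i _ => by rw [hc]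

theorem FormTop.transport {r₂ : V₂ → ι → Φ.ResidueField} (h : Φ.FormTop ℓ B₂ τ₂ r₂ c)
    (e : V ≃ₗ[K] V₂) (he : ∀ y, e (τ y) = τ₂ (e y)) (hB : ∀ x y, B x y = B₂ (e x) (e y)) :
    Φ.FormTop ℓ B τ (fun y => r₂ (e y)) c := by
  have hker : ∀ y, y ∈ Φ.kerχ τ → e y ∈ Φ.kerχ τ₂ := by
    intro y hy
    rw [mem_kerχ, ← map_aeval_of_comm e he, mem_kerχ.1 hy, map_zero]
  intro y hy y' hy' a ha
  rw [hB, map_aeval_of_comm e he]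
  exact h _ (hker y hy) _ (hker y' hy') a ha

/-- All kernel vectors being deep, p(τ)^(s-1) y' = p(τ)^s z₂ for some z₂, and the adjoint of p(τ)^s
kills y because χ is self-dual. -/
theorem formTop_of_isEmpty [IsEmpty ι] {τ' : V →ₗ[K] V} (hτ : IsCosqPair B τ τ') (h : Φ.SelfDual)
    (hr : Φ.IsTop τ r) : Φ.FormTop ℓ B τ r c := by
  intro y hy y' hy' a ha
  rw [Fintype.sum_empty, res_eq_zero_iff] at ha
  obtain ⟨b, rfl⟩ := ha
  have hs : Φ.s - 1 + 1 = Φ.s := Nat.sub_add_cancel Φ.s_pos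
  rw [← mul_assoc, ← pow_succ, hs, π_pow_s, zero_mul, map_zero]
  obtain ⟨z₁, z₂, rfl, h1, -⟩ := (hr.zero_iff y' hy').1 (Subsingleton.elim _ _)
  rw [map_add, h1, zero_add, ← Module.End.mul_apply, ← map_mul, ← pow_succ, hs,
    hτ.adjoint_aeval_right]
  have h2 : aeval τ' ((Φ.p ^ Φ.s).map (starRingEnd K)) y = 0 :=
    (hτ.aeval_dualPoly (Φ.χ_coeff_zero_ne h.coeff_ne) y).1 (by rw [h.χ_eq]; exact hy)
  rw [h2]
  simp

theorem formTop_self (h : Φ.SelfDual) (q : K[T;T⁻¹]) :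
    Φ.FormTop ℓ (tform h ℓ (levE h q)) (LinearMap.mulLeft K Φ.x)
      (fun a (_ : PUnit.{v+1}) => Φ.res a) (fun _ => Φ.evalKappa q) := by
  intro y _ y' _ a ha
  rw [Fintype.sum_unique, ← res_levE h, ← res_σ h, ← map_mul, ← map_mul, ← sub_eq_zero, ← map_sub,
    res_eq_zero_iff] at ha
  obtain ⟨b, hb⟩ := ha
  rw [aeval_mulLeft_x, tform_apply, map_pow]
  have h1 : Φ.π ^ (Φ.s - 1) * a = σ h y * levE h q * (Φ.π ^ (Φ.s - 1) * y') +
      Φ.π ^ (Φ.s - 1) * Φ.π * b := by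
    linear_combination Φ.π ^ (Φ.s - 1) * hb
  rw [h1, ← pow_succ, Nat.sub_add_cancel Φ.s_pos, π_pow_s, zero_mul, add_zero]

end FrobeniusBlock

end Top

/-! ### Model spaces of the nonsingular summands -/

section Model

universe u

namespace FrobeniusBlock

variable {Φ : FrobeniusBlock K}

theorem SelfDual.dual_eq (h : Φ.SelfDual) (h0 : Φ.p.coeff 0 ≠ 0) : Φ.dual h0 = Φ := by
  obtain ⟨p, s, hp1, hp2, hs⟩ := Φ
  have : dualPoly p = p := h
  simp [dual, this]

theorem dual_dual (h : Φ.p.coeff 0 ≠ 0) : (Φ.dual h).dual (dual_coeff_ne h) = Φ := by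
  obtain ⟨p, s, hp1, hp2, hs⟩ := Φ
  have : dualPoly (dualPoly p) = p := dualPoly_dualPoly hp1 h
  simp [dual, this]

theorem not_hasStarRoot_dual (h : Φ.p.coeff 0 ≠ 0) (hΦ : ¬ Φ.HasStarRoot) :
    ¬ (Φ.dual h).HasStarRoot := by
  intro h1
  have h2 := SelfDual.dual_eq h1.selfDual (dual_coeff_ne h)
  rw [dual_dual h] at h2
  exact hΦ (h2 ▸ h1)

/-- The map `f(x) ↦ f̄(x⁻¹)` from the algebra of a block to the algebra of the dual block. -/
def toDual (h : Φ.p.coeff 0 ≠ 0) : Φ.E →+* (Φ.dual h).E :=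
  AdjoinRoot.lift ((AdjoinRoot.of (Φ.dual h).χ).comp (starRingEnd K))
    (↑((Φ.dual h).u (dual_coeff_ne h))⁻¹ : (Φ.dual h).E) (by
      rw [eval₂_inv_eq_zero_iff (Φ.χ_coeff_zero_ne h), ← dual_χ h]
      exact AdjoinRoot.eval₂_root _)

@[simp] theorem toDual_x (h : Φ.p.coeff 0 ≠ 0) :
    toDual h Φ.x = ↑((Φ.dual h).u (dual_coeff_ne h))⁻¹ := by
  rw [toDual, AdjoinRoot.lift_root]

theorem toDual_smul (h : Φ.p.coeff 0 ≠ 0) (c : K) (a : Φ.E) :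
    toDual h (c • a) = star c • toDual h a := by
  rw [Algebra.smul_def, Algebra.smul_def, map_mul]
  congr 1
  exact AdjoinRoot.lift_of _

theorem toDual_π (h : Φ.p.coeff 0 ≠ 0) :
    ∃ b : (Φ.dual h).Eˣ, toDual h Φ.π = (Φ.dual h).π * b := by
  have h1 := eval₂_dualPoly (AdjoinRoot.of (Φ.dual h).χ) ((Φ.dual h).u (dual_coeff_ne h)) Φ.p
  rw [coe_u] at h1
  have hc : IsUnit (AdjoinRoot.of (Φ.dual h).χ (star (Φ.p.coeff 0))⁻¹) :=
    (isUnit_iff_ne_zero.2 (inv_ne_zero (star_ne_zero.2 h))).map _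
  have h2 : (Φ.dual h).π = AdjoinRoot.of (Φ.dual h).χ (star (Φ.p.coeff 0))⁻¹ *
      (Φ.p.map (starRingEnd K)).reverse.eval₂ (AdjoinRoot.of (Φ.dual h).χ) (Φ.dual h).x := by
    rw [π, ← AdjoinRoot.aeval_eq, aeval_def]
    change (dualPoly Φ.p).eval₂ _ _ = _
    rw [dualPoly, eval₂_mul, eval₂_C]
    rfl
  refine ⟨(hc.unit * (Φ.dual h).u (dual_coeff_ne h) ^ Φ.p.natDegree)⁻¹, ?_⟩
  rw [Units.eq_mul_inv_iff_mul_eq, Units.val_mul, Units.val_pow_eq_pow_val, IsUnit.unit_spec, coe_u,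
    h2, ← h1, toDual, AdjoinRoot.lift_mk]
  ring

theorem exists_toDual_eq (h : Φ.p.coeff 0 ≠ 0) : ∃ b : (Φ.dual h).Eˣ,
    toDual h (Φ.x * Φ.π ^ (Φ.s - 1)) = (Φ.dual h).π ^ (Φ.s - 1) * b := by
  obtain ⟨b, hb⟩ := toDual_π h
  refine ⟨((Φ.dual h).u (dual_coeff_ne h))⁻¹ * b ^ (Φ.s - 1), ?_⟩
  rw [map_mul, toDual_x, map_pow, hb, mul_pow, Units.val_mul, Units.val_pow_eq_pow_val]
  ring

theorem toDual_ne_zero (h : Φ.p.coeff 0 ≠ 0) : toDual h (Φ.x * Φ.π ^ (Φ.s - 1)) ≠ 0 := by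
  obtain ⟨b, hb⟩ := exists_toDual_eq h
  rw [hb, Ne, Units.mul_left_eq_zero]
  exact (Φ.dual h).π_pow_pred_ne_zero

/-- The form of type `[Φ ⧹ I]` on the product of the algebras of a block and its dual. -/
def skewForm (h : Φ.p.coeff 0 ≠ 0) (ℓ : (Φ.dual h).E →ₗ[K] K) :
    Φ.E × (Φ.dual h).E →ₗ⋆[K] Φ.E × (Φ.dual h).E →ₗ[K] K :=
  LinearMap.mk₂'ₛₗ _ _
    -- The second term is dictated by the first: it makes multiplication by x on both factors the
    -- cosquare.
    (fun y z => ℓ (toDual h y.1 * z.2) + star (ℓ (toDual h (Φ.x * z.1) * y.2)))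
    (fun y y' z => by simp only [Prod.fst_add, Prod.snd_add, map_add, add_mul, mul_add, star_add]; ring)
    (fun c y z => by
      simp only [Prod.smul_fst, Prod.smul_snd, toDual_smul, smul_mul_assoc, mul_smul_comm, map_smul,
        smul_eq_mul, star_mul', starRingEnd_apply, mul_add])
    (fun y z z' => by simp only [Prod.fst_add, Prod.snd_add, map_add, add_mul, mul_add, star_add]; ring)
    (fun c y z => by
      simp only [Prod.smul_fst, Prod.smul_snd, toDual_smul, smul_mul_assoc, mul_smul_comm, map_smul,
        smul_eq_mul, star_mul', star_star, mul_add, RingHom.id_apply])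

theorem skewForm_apply (h : Φ.p.coeff 0 ≠ 0) (ℓ : (Φ.dual h).E →ₗ[K] K)
    (y z : Φ.E × (Φ.dual h).E) :
    skewForm h ℓ y z = ℓ (toDual h y.1 * z.2) + star (ℓ (toDual h (Φ.x * z.1) * y.2)) := rfl

theorem mulLeft_x_mul (h : Φ.p.coeff 0 ≠ 0) :
    LinearMap.mulLeft K Φ.x * LinearMap.mulLeft K (↑(Φ.u h)⁻¹ : Φ.E) = 1 := by
  ext a
  rw [Module.End.mul_apply, LinearMap.mulLeft_apply, LinearMap.mulLeft_apply, ← mul_assoc,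
    ← coe_u Φ h, Units.mul_inv, one_mul, Module.End.one_apply]

theorem mulLeft_inv_mul (h : Φ.p.coeff 0 ≠ 0) :
    LinearMap.mulLeft K (↑(Φ.u h)⁻¹ : Φ.E) * LinearMap.mulLeft K Φ.x = 1 := by
  ext a
  rw [Module.End.mul_apply, LinearMap.mulLeft_apply, LinearMap.mulLeft_apply, ← mul_assoc,
    ← coe_u Φ h, Units.inv_mul, one_mul, Module.End.one_apply]

end FrobeniusBlock

theorem prodMap_mul_eq_one {V V₂ : Type*} [AddCommGroup V] [Module K V] [AddCommGroup V₂]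
    [Module K V₂] {τ τ' : V →ₗ[K] V} {τ₂ τ₂' : V₂ →ₗ[K] V₂} (h : τ * τ' = 1) (h₂ : τ₂ * τ₂' = 1) :
    τ.prodMap τ₂ * τ'.prodMap τ₂' = 1 :=
  LinearMap.ext fun y => Prod.ext (LinearMap.congr_fun h y.1) (LinearMap.congr_fun h₂ y.2)

namespace FrobeniusBlock

variable {Φ : FrobeniusBlock K}

theorem skewForm_isCosqPair (h : Φ.p.coeff 0 ≠ 0) (ℓ : (Φ.dual h).E →ₗ[K] K) :
    IsCosqPair (skewForm h ℓ)
      ((LinearMap.mulLeft K Φ.x).prodMap (LinearMap.mulLeft K (Φ.dual h).x))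
      ((LinearMap.mulLeft K (↑(Φ.u h)⁻¹ : Φ.E)).prodMap
        (LinearMap.mulLeft K (↑((Φ.dual h).u (dual_coeff_ne h))⁻¹ : (Φ.dual h).E))) where
  cosq y z := by
    simp only [skewForm_apply, LinearMap.prodMap_apply, LinearMap.mulLeft_apply, star_add, star_star]
    rw [add_comm]
    congr 2
    rw [map_mul, toDual_x]
    calc toDual h y.1 * z.2 = (↑((Φ.dual h).u (dual_coeff_ne h))⁻¹ * (Φ.dual h).x) *
          (toDual h y.1 * z.2) := by
            rw [← coe_u (Φ.dual h) (dual_coeff_ne h), Units.inv_mul, one_mul]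
      _ = _ := by ring
  right := prodMap_mul_eq_one (mulLeft_x_mul h) (mulLeft_x_mul _)
  left := prodMap_mul_eq_one (mulLeft_inv_mul h) (mulLeft_inv_mul _)

/-- The two factors play symmetric roles, so a suitable ℓ gives one form whose matrix is [Φ ⧹ I] in
one basis and [Φ^∨ ⧹ I] in another. It suffices that ℓ be nonzero at the image of x π^(s-1) in the
dual algebra, which generates the socle there. -/
theorem exists_skewForm (h : Φ.p.coeff 0 ≠ 0) : ∃ ℓ : (Φ.dual h).E →ₗ[K] K,
    (∃ b : Fin Φ.dim ⊕ Fin Φ.dim → Φ.E × (Φ.dual h).E, ∀ i j, skewForm h ℓ (b i) (b j) =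
      (fromBlocks 0 1 Φ.toMatrix 0 : Matrix _ _ K) i j) ∧
    (∃ b : Fin (Φ.dual h).dim ⊕ Fin (Φ.dual h).dim → Φ.E × (Φ.dual h).E, ∀ i j,
      skewForm h ℓ (b i) (b j) = (fromBlocks 0 1 (Φ.dual h).toMatrix 0 : Matrix _ _ K) i j) := by
  obtain ⟨ℓ, hℓ⟩ := Module.Projective.exists_dual_ne_zero K (toDual_ne_zero h)
  refine ⟨ℓ, ?_⟩
  have hv : ((1, 0) : Φ.E × (Φ.dual h).E) ∈
      Φ.kerχ ((LinearMap.mulLeft K Φ.x).prodMap (LinearMap.mulLeft K (Φ.dual h).x)) := by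
    rw [mem_kerχ, aeval_prodMap, aeval_mulLeft_x, AdjoinRoot.mk_self, zero_mul, map_zero]
    rfl
  have hu : ∀ c, ((0, c) : Φ.E × (Φ.dual h).E) ∈ (Φ.dual h).kerχ
      ((LinearMap.mulLeft K Φ.x).prodMap (LinearMap.mulLeft K (Φ.dual h).x)) := by
    intro c
    rw [mem_kerχ, aeval_prodMap, aeval_mulLeft_x, aeval_mulLeft_x, AdjoinRoot.mk_self, zero_mul,
      mul_zero]
    rfl
  have hvv : ∀ a b, skewForm h ℓ
      (Φ.act ((LinearMap.mulLeft K Φ.x).prodMap (LinearMap.mulLeft K (Φ.dual h).x)) a (1, 0))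
      (Φ.act ((LinearMap.mulLeft K Φ.x).prodMap (LinearMap.mulLeft K (Φ.dual h).x)) b (1, 0)) = 0 := by
    intro a b
    obtain ⟨f, rfl⟩ := AdjoinRoot.mk_surjective a
    obtain ⟨g, rfl⟩ := AdjoinRoot.mk_surjective b
    rw [act_mk hv, act_mk hv, aeval_prodMap, aeval_prodMap, skewForm_apply]
    simp
  have huu : ∀ c a b, skewForm h ℓ
      ((Φ.dual h).act ((LinearMap.mulLeft K Φ.x).prodMap (LinearMap.mulLeft K (Φ.dual h).x)) a (0, c))
      ((Φ.dual h).act ((LinearMap.mulLeft K Φ.x).prodMap (LinearMap.mulLeft K (Φ.dual h).x)) b (0, c)) = 0 := by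
    intro c a b
    obtain ⟨f, rfl⟩ := AdjoinRoot.mk_surjective a
    obtain ⟨g, rfl⟩ := AdjoinRoot.mk_surjective b
    rw [act_mk (hu c), act_mk (hu c), aeval_prodMap, aeval_prodMap, skewForm_apply]
    simp
  constructor
  · refine (exists_skew_gram h (skewForm_isCosqPair h ℓ) hv (hu 1) hvv (huu 1) ?_).imp
      fun b hb => hb.1
    rw [aeval_prodMap, skewForm_apply, aeval_mulLeft_x, map_pow, mul_one, map_zero, mul_one, zero_mul,
      map_zero, zero_add]
    exact star_ne_zero.2 hℓ
  · obtain ⟨c, hc⟩ := exists_toDual_eq h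
    refine (exists_skew_gram (dual_coeff_ne h) (skewForm_isCosqPair h ℓ) (hu c) (u := (1, 0))
      (by rw [dual_dual]; exact hv) (huu c) (by rw [dual_dual]; exact hvv) ?_).imp
      fun b hb => hb.1
    rw [aeval_prodMap, skewForm_apply, aeval_mulLeft_x, aeval_mulLeft_x, map_pow (AdjoinRoot.mk _),
      mul_zero, mul_zero, map_zero, star_zero, add_zero, map_one, one_mul]
    change ℓ ((Φ.dual h).π ^ (Φ.s - 1) * c) ≠ 0
    rw [← hc]
    exact hℓ

theorem tform_isCosqPair (h : Φ.SelfDual) {ℓ : Φ.E →ₗ[K] K} (hs : IsSymmFun h 1 ℓ) {a : Φ.E}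
    (ha : σ h a = a) : IsCosqPair (tform h ℓ a) (LinearMap.mulLeft K Φ.x)
      (LinearMap.mulLeft K (↑(Φ.u h.coeff_ne)⁻¹ : Φ.E)) where
  cosq f g := by
    have h1 := hs (σ h g * a * f)
    rw [map_mul (σ h), map_mul (σ h), σ_σ, ha, one_mul] at h1
    rw [tform_apply, tform_apply, LinearMap.mulLeft_apply, map_mul (σ h), σ_x,
      show (↑(Φ.u h.coeff_ne)⁻¹ : Φ.E) * σ h g * a * f = ↑(Φ.u h.coeff_ne)⁻¹ * (σ h g * a * f) by ring,
      ← h1]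
    congr 1
    ring
  right := mulLeft_x_mul h.coeff_ne
  left := mulLeft_inv_mul h.coeff_ne

/-- The invariants at a block with a `∗`-root. -/
def RootTop {V : Type*} [AddCommGroup V] [Module K V] (Φ : FrobeniusBlock K) (ℓ : Φ.E →ₗ[K] K)
    (B : V →ₗ⋆[K] V →ₗ[K] K) (τ : V →ₗ[K] V) (l : List K[T;T⁻¹]) : Prop :=
  ∃ r : V → Fin l.length → Φ.ResidueField, Φ.IsTop τ r ∧
    Φ.FormTop ℓ B τ r fun i => Φ.evalKappa (l.get i)

/-- The number of cyclic summands belonging to a block. -/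
def CardTop {V : Type*} [AddCommGroup V] [Module K V] (Φ : FrobeniusBlock K) (τ : V →ₗ[K] V)
    (n : ℕ) : Prop :=
  ∃ r : V → Fin n → Φ.ResidueField, Φ.IsTop τ r

section Combine

variable {V : Type*} [AddCommGroup V] [Module K V] {V₂ : Type*} [AddCommGroup V₂] [Module K V₂]
variable {B : V →ₗ⋆[K] V →ₗ[K] K} {B₂ : V₂ →ₗ⋆[K] V₂ →ₗ[K] K}
variable {τ τ' : V →ₗ[K] V} {τ₂ τ₂' : V₂ →ₗ[K] V₂} {ℓ : Φ.E →ₗ[K] K}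

theorem CardTop.prod {n n₂ : ℕ} (h : Φ.CardTop τ n) (h₂ : Φ.CardTop τ₂ n₂) :
    Φ.CardTop (τ.prodMap τ₂) (n + n₂) := by
  obtain ⟨r, hr⟩ := h
  obtain ⟨r₂, hr₂⟩ := h₂
  exact ⟨_, (hr.prod hr₂).reindex finSumFinEquiv.symm⟩

theorem CardTop.unique {n n' : ℕ} (h : Φ.CardTop τ n) (h' : Φ.CardTop τ n') : n = n' := by
  obtain ⟨r, hr⟩ := h
  obtain ⟨r', hr'⟩ := h'
  obtain ⟨S, -⟩ := hr.exists_equiv hr'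
  have := S.finrank_eq
  rwa [Module.finrank_fin_fun, Module.finrank_fin_fun] at this

theorem cardTop_self : Φ.CardTop (LinearMap.mulLeft K Φ.x) 1 :=
  ⟨_, (isTop_self.{0} Φ).reindex (Equiv.equivPUnit (Fin 1))⟩

theorem cardTop_of_ne {Θ : FrobeniusBlock K} (hne : Θ ≠ Φ) :
    Φ.CardTop (LinearMap.mulLeft K Θ.x) 0 := ⟨fun _ => Fin.elim0, isTop_of_ne hne⟩

open Classical in
theorem cardTop_ite (Θ : FrobeniusBlock K) :
    Φ.CardTop (LinearMap.mulLeft K Θ.x) (if Θ = Φ then 1 else 0) := by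
  split_ifs with h
  · subst h; exact cardTop_self
  · exact cardTop_of_ne h

theorem RootTop.cons {l : List K[T;T⁻¹]} (h : Φ.RootTop ℓ B₂ τ₂ l) (hΦ : Φ.SelfDual)
    (q : K[T;T⁻¹]) :
    Φ.RootTop ℓ (prodForm (tform hΦ ℓ (levE hΦ q)) B₂) ((LinearMap.mulLeft K Φ.x).prodMap τ₂)
      (q :: l) := by
  obtain ⟨r, hr, hf⟩ := h
  let e : Fin (l.length + 1) ≃ PUnit.{1} ⊕ Fin l.length :=
    ((finSuccEquiv l.length).trans (Equiv.optionEquivSumPUnit.{0} _)).trans (Equiv.sumComm _ _)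
  refine ⟨_, ((isTop_self.{0} Φ).prod hr).reindex e, ((formTop_self hΦ q).prod hf).reindex e ?_⟩
  intro i
  refine Fin.cases ?_ (fun i => ?_) i
  · simp [e]
  · simp [e]

theorem RootTop.prod_of_isDeep {l : List K[T;T⁻¹]} (h : Φ.RootTop ℓ B₂ τ₂ l) (hΦ : Φ.SelfDual)
    (hτ : IsCosqPair B τ τ') (h0 : Φ.CardTop τ 0) :
    Φ.RootTop ℓ (prodForm B B₂) (τ.prodMap τ₂) l := by
  obtain ⟨r, hr, hf⟩ := h
  obtain ⟨r₀, hr₀⟩ := h0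
  have hf₀ : Φ.FormTop ℓ B τ r₀ (fun _ => 0) := formTop_of_isEmpty hτ hΦ hr₀
  exact ⟨_, (hr₀.prod hr).reindex (Equiv.emptySum _ _).symm,
    (hf₀.prod hf).reindex (Equiv.emptySum _ _).symm fun i => rfl⟩

theorem prodForm_isCosqPair (h : IsCosqPair B τ τ') (h₂ : IsCosqPair B₂ τ₂ τ₂') :
    IsCosqPair (prodForm B B₂) (τ.prodMap τ₂) (τ'.prodMap τ₂') where
  cosq x y := by
    rw [prodForm_apply, prodForm_apply, star_add, h.cosq, h₂.cosq]
    rfl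
  right := prodMap_mul_eq_one h.right h₂.right
  left := prodMap_mul_eq_one h.left h₂.left

theorem prodForm_hasMatrix {ι κ : Type*} {M : Matrix ι ι K} {N : Matrix κ κ K} (h : HasMatrix B M)
    (h₂ : HasMatrix B₂ N) : HasMatrix (prodForm B B₂) (fromBlocks M 0 0 N) := by
  obtain ⟨b, hb⟩ := h
  obtain ⟨b₂, hb₂⟩ := h₂
  refine ⟨b.prod b₂, ?_⟩
  rintro (i | i) (j | j) <;> simp [hb, hb₂]

theorem exists_isometry {ι : Type*} [Fintype ι] {M : Matrix ι ι K} (h : HasMatrix B M)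
    (h₂ : HasMatrix B₂ M) : ∃ e : V ≃ₗ[K] V₂, ∀ x y, B x y = B₂ (e x) (e y) := by
  obtain ⟨b, hb⟩ := h
  obtain ⟨b₂, hb₂⟩ := h₂
  refine ⟨b.equiv b₂ (Equiv.refl _), fun x y => ?_⟩
  have he : ∀ z, b.equiv b₂ (Equiv.refl _) z = ∑ i, b.repr z i • b₂ i := by
    intro z
    conv_lhs => rw [← b.sum_repr z, map_sum]
    simp
  rw [he, he]
  conv_lhs => rw [← b.sum_repr x, ← b.sum_repr y]
  rw [form_sum_sum, form_sum_sum]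
  simp only [hb, hb₂]

theorem prodForm_nondeg (h : Nondeg B) (h₂ : Nondeg B₂) : Nondeg (prodForm B B₂) := by
  intro y hy
  refine Prod.ext (h _ fun u => ?_) (h₂ _ fun u => ?_)
  · simpa using hy (u, 0)
  · simpa using hy (0, u)

/-- Over a nondegenerate form the cosquare is determined by the form. -/
theorem isometry_comm (hτ : IsCosqPair B τ τ') (hτ₂ : IsCosqPair B₂ τ₂ τ₂') (hB₂ : Nondeg B₂)
    {e : V ≃ₗ[K] V₂} (he : ∀ x y, B x y = B₂ (e x) (e y)) (y : V) : e (τ y) = τ₂ (e y) := by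
  rw [← sub_eq_zero]
  refine hτ₂.left_nondeg hB₂ fun z => ?_
  have h1 := hτ.cosq (e.symm z) y
  rw [he, he, e.apply_symm_apply, hτ₂.cosq z (e y)] at h1
  rw [map_sub, LinearMap.sub_apply, star_injective h1, sub_self]

end Combine

end FrobeniusBlock

/-- The dual block, if it exists. -/
def FrobeniusBlock.dualOrSelf (Φ : FrobeniusBlock K) : FrobeniusBlock K :=
  open Classical in if h : Φ.p.coeff 0 ≠ 0 then Φ.dual h else Φ

theorem FrobeniusBlock.dualOrSelf_eq {Φ : FrobeniusBlock K} (h : Φ.p.coeff 0 ≠ 0) :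
    Φ.dualOrSelf = Φ.dual h := dif_pos h

open Classical in
/-- The number of cyclic summands with a given block in the summands `[Φ ⧹ I]`. -/
def skewCount (Φ : FrobeniusBlock K) (D : List (Summand K)) : ℕ :=
  (D.filterMap Summand.skewBlock?).count Φ +
    ((D.filterMap Summand.skewBlock?).map FrobeniusBlock.dualOrSelf).count Φ

/-! ### The invariants of a direct sum -/

section List

/-- The invariants of the nonsingular part of a direct sum. -/
def HasInvariants {V : Type*} [AddCommGroup V] [Module K V]
    (R : ∀ Φ : FrobeniusBlock K, Matrix (Fin Φ.dim) (Fin Φ.dim) K) (B : V →ₗ⋆[K] V →ₗ[K] K)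
    (τ : V →ₗ[K] V) (D : List (Summand K)) : Prop :=
  (∀ Φ : FrobeniusBlock K, ¬ Φ.HasStarRoot → Φ.CardTop τ (skewCount Φ D)) ∧
  ∀ Φ : FrobeniusBlock K, Φ.HasStarRoot →
    Φ.RootTop (Φ.rootFun (R Φ)) B τ (D.filterMap (Summand.rootFunction? Φ))

theorem skewCount_cons_root (Φ Θ : FrobeniusBlock K) (q : K[T;T⁻¹]) (D : List (Summand K)) :
    skewCount Φ (Summand.root Θ q :: D) = skewCount Φ D := rfl

open Classical in
theorem skewCount_cons_skew (Φ Θ : FrobeniusBlock K) (D : List (Summand K)) :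
    skewCount Φ (Summand.skew Θ :: D) =
      ((if Θ = Φ then 1 else 0) + (if Θ.dualOrSelf = Φ then 1 else 0)) + skewCount Φ D := by
  have h1 : (Summand.skew Θ :: D).filterMap Summand.skewBlock? =
      Θ :: D.filterMap Summand.skewBlock? := rfl
  rw [skewCount, h1, skewCount, List.map_cons, List.count_cons, List.count_cons]
  simp only [beq_iff_eq]
  ring

theorem hasMatrix_skew {V : Type*} [AddCommGroup V] [Module K V] [FiniteDimensional K V]
    {B : V →ₗ⋆[K] V →ₗ[K] K} (R : ∀ Φ : FrobeniusBlock K, Matrix (Fin Φ.dim) (Fin Φ.dim) K)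
    {Φ : FrobeniusBlock K} (h : Φ.toMatrix.det ≠ 0) {b : Fin Φ.dim ⊕ Fin Φ.dim → V}
    (hb : ∀ i j, B (b i) (b j) = (fromBlocks 0 1 Φ.toMatrix 0 : Matrix _ _ K) i j)
    (hdim : Module.finrank K V = Φ.dim + Φ.dim) : HasMatrix B ((Summand.skew Φ).toMatrix R) := by
  have h1 : ∀ i j : Fin Φ.dim ⊕ Fin Φ.dim, (fromBlocks 0 1 Φ.toMatrix 0 : Matrix _ _ K) i j =
      Matrix.reindex finSumFinEquiv finSumFinEquiv (fromBlocks 0 1 Φ.toMatrix 0)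
        (finSumFinEquiv i) (finSumFinEquiv j) := by
    intro i j
    rw [Matrix.reindex_apply, Matrix.submatrix_apply, Equiv.symm_apply_apply, Equiv.symm_apply_apply]
  exact (HasMatrix.of_gram hb (FrobeniusBlock.det_fromBlocks_ne h) (by simp [hdim])).congr
    (MCong.of_equiv (finSumFinEquiv (m := Φ.dim) (n := Φ.dim)) h1)

theorem finrank_skew {Φ : FrobeniusBlock K} (h : Φ.p.coeff 0 ≠ 0) :
    Module.finrank K (Φ.E × (Φ.dual h).E) = Φ.dim + Φ.dim := by
  rw [Module.finrank_prod, FrobeniusBlock.finrank_E, FrobeniusBlock.finrank_E,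
    FrobeniusBlock.dual_dim]

/-- On products of the algebras `E` the kernels and the forms are explicit, so the invariants can be
computed summand by summand. Any other form with the same matrix is isometric to this model and
inherits them. Summands J_n(0) are excluded because a singular form has no invertible cosquare. -/
theorem exists_model {K : Type u} [Field K] [StarRing K] (hchar : (2 : K) ≠ 0)
    {R : ∀ Φ : FrobeniusBlock K, Matrix (Fin Φ.dim) (Fin Φ.dim) K}
    (hR : ∀ Φ : FrobeniusBlock K, Φ.HasStarRoot → Φ.IsStarRoot (R Φ)) (D : List (Summand K))
    (hD : IsCanonical D) (hJ : ∀ n, Summand.jordan n ∉ D) :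
    ∃ (V : Type u) (_ : AddCommGroup V) (_ : Module K V) (B : V →ₗ⋆[K] V →ₗ[K] K)
      (τ τ' : V →ₗ[K] V), HasMatrix B (directSum R D) ∧ Nondeg B ∧ IsCosqPair B τ τ' ∧
      HasInvariants R B τ D := by
  induction D with
  | nil =>
    refine ⟨PUnit.{u + 1}, inferInstance, inferInstance, 0, 0, 0, ?_, ?_, ?_, ?_, ?_⟩
    · exact ⟨Module.Basis.empty PUnit.{u + 1}, fun i => isEmptyElim i⟩
    · exact fun _ _ => Subsingleton.elim _ _
    · exact ⟨fun _ _ => by simp, Subsingleton.elim _ _, Subsingleton.elim _ _⟩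
    · intro Φ _
      refine ⟨fun _ => Fin.elim0, FrobeniusBlock.isTop_of_forall_isDeep (ι := Fin 0) fun y _ => ?_⟩
      exact ⟨0, 0, Subsingleton.elim _ _, Subsingleton.elim _ _, Subsingleton.elim _ _⟩
    · intro Φ hΦ
      refine ⟨fun _ => Fin.elim0, FrobeniusBlock.isTop_of_forall_isDeep (ι := Fin 0) fun y _ => ?_, ?_⟩
      · exact ⟨0, 0, Subsingleton.elim _ _, Subsingleton.elim _ _, Subsingleton.elim _ _⟩
      · refine FrobeniusBlock.formTop_of_isEmpty (ι := Fin 0) (τ' := 0)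
          ⟨fun _ _ => by simp, Subsingleton.elim _ _, Subsingleton.elim _ _⟩ hΦ.selfDual
          (FrobeniusBlock.isTop_of_forall_isDeep fun y _ => ?_)
        exact ⟨0, 0, Subsingleton.elim _ _, Subsingleton.elim _ _, Subsingleton.elim _ _⟩
  | cons A D ih =>
    obtain ⟨V₂, _, _, B₂, τ₂, τ₂', hm, hnd, hτ₂, hc, hr⟩ := ih
      (fun A' hA' => hD A' (List.mem_cons_of_mem _ hA'))
      (fun n hn => hJ n (List.mem_cons_of_mem _ hn))
    have hA := hD A List.mem_cons_self
    cases A with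
    | jordan n => exact absurd List.mem_cons_self (hJ n)
    | skew Θ =>
      obtain ⟨hdet, hΘ⟩ := hA
      have h0 := Θ.coeff_zero_ne_of_det_ne hdet
      obtain ⟨ℓ, ⟨b, hb⟩, -⟩ := FrobeniusBlock.exists_skewForm h0
      have hmA := hasMatrix_skew R hdet hb (finrank_skew h0)
      have hτ := FrobeniusBlock.skewForm_isCosqPair h0 ℓ
      refine ⟨(Θ.E × (Θ.dual h0).E) × V₂, inferInstance, inferInstance,
        FrobeniusBlock.prodForm (FrobeniusBlock.skewForm h0 ℓ) B₂, _, _,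
        (FrobeniusBlock.prodForm_hasMatrix hmA hm).congr (directSum_cons R _ D).symm,
        FrobeniusBlock.prodForm_nondeg (hmA.nondeg_iff.2 (Summand.skew_det_ne hdet)) hnd,
        FrobeniusBlock.prodForm_isCosqPair hτ hτ₂, ?_, ?_⟩
      · intro Φ hΦ
        rw [skewCount_cons_skew, FrobeniusBlock.dualOrSelf_eq h0]
        exact ((FrobeniusBlock.cardTop_ite Θ).prod (FrobeniusBlock.cardTop_ite _)).prod (hc Φ hΦ)
      · intro Φ hΦ
        refine (hr Φ hΦ).prod_of_isDeep hΦ.selfDual hτ ?_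
        refine FrobeniusBlock.CardTop.prod (n := 0) (n₂ := 0) (FrobeniusBlock.cardTop_of_ne ?_)
          (FrobeniusBlock.cardTop_of_ne ?_)
        · rintro rfl
          exact hΘ hΦ
        · rintro rfl
          exact FrobeniusBlock.not_hasStarRoot_dual h0 hΘ hΦ
    | root Θ q =>
      obtain ⟨hΘ, hq0, hq⟩ := hA
      have h := hΘ.selfDual
      have hX := hR Θ hΘ
      have hmA : HasMatrix (FrobeniusBlock.tform h (Θ.rootFun (R Θ)) (FrobeniusBlock.levE h q))
          ((Summand.root Θ q).toMatrix R) :=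
        ⟨Θ.bas, fun i j => FrobeniusBlock.matForm_mul_evalMatrix hX h q i j⟩
      have hτ := FrobeniusBlock.tform_isCosqPair h (hX.isSymmFun h)
        (FrobeniusBlock.σ_levE h hq.symm)
      refine ⟨Θ.E × V₂, inferInstance, inferInstance, FrobeniusBlock.prodForm
        (FrobeniusBlock.tform h (Θ.rootFun (R Θ)) (FrobeniusBlock.levE h q)) B₂, _, _,
        (FrobeniusBlock.prodForm_hasMatrix hmA hm).congr (directSum_cons R _ D).symm,
        FrobeniusBlock.prodForm_nondeg
          (hmA.nondeg_iff.2 (Summand.root_det_ne hchar hR ⟨hΘ, hq0, hq⟩)) hnd,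
        FrobeniusBlock.prodForm_isCosqPair hτ hτ₂, ?_, ?_⟩
      · intro Φ hΦ
        rw [skewCount_cons_root, ← Nat.zero_add (skewCount Φ D)]
        refine (FrobeniusBlock.cardTop_of_ne ?_).prod (hc Φ hΦ)
        rintro rfl
        exact hΦ hΘ
      · intro Φ hΦ
        by_cases hΘΦ : Θ = Φ
        · subst hΘΦ
          have hl : (Summand.root Θ q :: D).filterMap (Summand.rootFunction? Θ) =
              q :: D.filterMap (Summand.rootFunction? Θ) := by
            simp [Summand.rootFunction?]
          rw [hl]
          exact (hr Θ hΦ).cons h q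
        · have hl : (Summand.root Θ q :: D).filterMap (Summand.rootFunction? Φ) =
              D.filterMap (Summand.rootFunction? Φ) := by
            simp [Summand.rootFunction?, hΘΦ]
          rw [hl]
          exact (hr Φ hΦ).prod_of_isDeep hΦ.selfDual hτ (FrobeniusBlock.cardTop_of_ne hΘΦ)

/-- The invariants can be read off from any form with the given matrix. -/
theorem hasInvariants (hchar : (2 : K) ≠ 0) {V : Type*} [AddCommGroup V] [Module K V]
    {R : ∀ Φ : FrobeniusBlock K, Matrix (Fin Φ.dim) (Fin Φ.dim) K}
    (hR : ∀ Φ : FrobeniusBlock K, Φ.HasStarRoot → Φ.IsStarRoot (R Φ)) {D : List (Summand K)}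
    (hD : IsCanonical D) (hJ : ∀ n, Summand.jordan n ∉ D) {B : V →ₗ⋆[K] V →ₗ[K] K}
    {τ τ' : V →ₗ[K] V} (hB : HasMatrix B (directSum R D)) (hτ : IsCosqPair B τ τ') :
    HasInvariants R B τ D := by
  obtain ⟨V₂, _, _, B₂, τ₂, τ₂', hm, hnd, hτ₂, hc, hr⟩ := exists_model hchar hR D hD hJ
  obtain ⟨e, he⟩ := FrobeniusBlock.exists_isometry hB hm
  have hcomm := FrobeniusBlock.isometry_comm hτ hτ₂ hnd he
  refine ⟨fun Φ hΦ => ?_, fun Φ hΦ => ?_⟩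
  · obtain ⟨r, h⟩ := hc Φ hΦ
    exact ⟨_, h.transport e hcomm⟩
  · obtain ⟨r, h, hf⟩ := hr Φ hΦ
    exact ⟨_, h.transport e hcomm, hf.transport e hcomm he⟩

end List

end Model

/-! ### Lifting equivalences of Hermitian forms from the residue field -/

section HermitianLift

variable {E : Type*} [CommRing E] [StarRing E] {ι : Type*} [Fintype ι] [DecidableEq ι]

theorem mul_mul_mem_of_forall_mem {J : Ideal E} {Y M : Matrix ι ι E} (hY : ∀ i j, Y i j ∈ J) (i j : ι) :
    (Y * M * Y) i j ∈ J * J := by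
  rw [Matrix.mul_apply]
  refine Ideal.sum_mem _ fun k _ => ?_
  refine Ideal.mul_mem_mul ?_ (hY k j)
  rw [Matrix.mul_apply]
  exact Ideal.sum_mem _ fun l _ => J.mul_mem_right _ (hY i l)

/-- A Hermitian matrix that agrees with an invertible one modulo a nilpotent ideal is congruent
to it. -/
theorem exists_conjTranspose_mul_mul_eq {I : Ideal E} {m : ℕ} (hm : I ^ m = ⊥) {c : E}
    (hc : c + c = 1) {A D D' : Matrix ι ι E} (hA : Aᴴ = A) (hD : Dᴴ = D) (hDD' : D * D' = 1)
    (hAD : ∀ i j, (D - A) i j ∈ I) : ∃ H, Hᴴ * A * H = D := by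
  have hcs : star c = c := by
    have h2 : star c + star c = 1 := by rw [← star_add, hc, star_one]
    calc star c = star c * (c + c) := by rw [hc, mul_one]
      _ = (star c + star c) * c := by ring
      _ = c := by rw [h2, one_mul]
  have hD₃D : D' * D = 1 := mul_eq_one_comm.1 hDD'
  have hD' : D'ᴴ = D' := by
    have h1 : D'ᴴ * D = 1 := by
      have := congrArg conjTranspose hDD'
      rwa [conjTranspose_mul, conjTranspose_one, hD] at this
    calc D'ᴴ = D'ᴴ * (D * D') := by rw [hDD', mul_one]
      _ = D' := by rw [← mul_assoc, h1, one_mul]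
  have key : ∀ k : ℕ, ∃ H : Matrix ι ι E, ∀ i j, (D - Hᴴ * A * H) i j ∈ I ^ (k + 1) := by
    intro k
    induction k with
    | zero => exact ⟨1, by simpa using hAD⟩
    | succ k ih =>
      obtain ⟨H, hH⟩ := ih
      set X := Hᴴ * A * H with hX
      have hXs : Xᴴ = X := by
        rw [hX, conjTranspose_mul, conjTranspose_mul, conjTranspose_conjTranspose, hA, mul_assoc]
      obtain ⟨Y, hY⟩ : ∃ Y, Y = D - X := ⟨_, rfl⟩
      have hXY : X = D - Y := by rw [hY, sub_sub_cancel]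
      have hYs : Yᴴ = Y := by rw [hY, conjTranspose_sub, hD, hXs]
      rw [← hY] at hH
      -- Newton step: with error Y = D - X, the factor 1 + ½ D⁻¹Y cancels the terms linear in Y. The
      -- new error has the form Y (…) Y, so its entries lie in the square of the previous power of
      -- the ideal, which is more than the one additional power needed.
      refine ⟨H * (1 + c • (D' * Y)), fun i j => ?_⟩
      have hZ : (1 + c • (D' * Y))ᴴ = 1 + c • (Y * D') := by
        rw [conjTranspose_add, conjTranspose_one, conjTranspose_smul, conjTranspose_mul, hYs, hD',
          hcs]
      have h1 : D - (H * (1 + c • (D' * Y)))ᴴ * A * (H * (1 + c • (D' * Y))) =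
          Y * (D' - (c * c) • (D' * X * D')) * Y := by
        have e1 : (H * (1 + c • (D' * Y)))ᴴ * A * (H * (1 + c • (D' * Y))) =
            (1 + c • (Y * D')) * X * (1 + c • (D' * Y)) := by
          rw [conjTranspose_mul, hZ, hX]
          simp only [mul_assoc]
        have e2 : Y * D' * X = Y - Y * D' * Y := by
          rw [hXY, mul_sub, mul_assoc Y D' D, hD₃D, mul_one]
        have e3 : X * (D' * Y) = Y - Y * D' * Y := by
          rw [hXY, sub_mul, ← mul_assoc, hDD', one_mul, mul_assoc]
        have e4 : (1 + c • (Y * D')) * X * (1 + c • (D' * Y)) =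
            X + c • (Y * D' * X) + c • (X * (D' * Y)) + (c * c) • (Y * D' * X * (D' * Y)) := by
          simp only [add_mul, mul_add, one_mul, mul_one, smul_mul_assoc, mul_smul_comm, smul_add, smul_smul]
          abel
        have e5 : c • (Y * D' * X) + c • (X * (D' * Y)) = Y - Y * D' * Y := by
          rw [e2, e3, ← add_smul, hc, one_smul]
        rw [e1, e4, add_assoc X, e5, mul_sub, sub_mul, Matrix.mul_smul, Matrix.smul_mul]
        simp only [mul_assoc]
        rw [hY]
        abel
      rw [h1]
      have h2 := mul_mul_mem_of_forall_mem (M := D' - (c * c) • (D' * X * D')) hH i j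
      rw [← pow_add] at h2
      exact Ideal.pow_le_pow_right (by omega) h2
  obtain ⟨H, hH⟩ := key m
  refine ⟨H, ?_⟩
  ext i j
  have h1 : (D - Hᴴ * A * H) i j ∈ I ^ m := Ideal.pow_le_pow_right (by omega) (hH i j)
  rw [hm, Ideal.mem_bot, Matrix.sub_apply, sub_eq_zero] at h1
  exact h1.symm

end HermitianLift

namespace FrobeniusBlock

variable {Φ : FrobeniusBlock K}

/-- The involution of the algebra as a star structure. -/
abbrev starRing (h : Φ.SelfDual) : StarRing Φ.E where
  star := σ h
  star_involutive := σ_σ h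
  star_mul a b := by rw [mul_comm]; exact map_mul (σ h) b a
  star_add := map_add (σ h)

/-- An entrywise lift of the matrix over the residue field transforms one diagonal form into another
modulo the nilpotent ideal (π); the discrepancy is then removed by
`exists_conjTranspose_mul_mul_eq`. -/
theorem exists_lift_of_hermitian (hchar : (2 : K) ≠ 0) (h : Φ.SelfDual) {ι ι' : Type*} [Fintype ι]
    [DecidableEq ι] [Fintype ι'] {d : ι → Φ.E} {d' : ι' → Φ.E} (hd : ∀ i, σ h (d i) = d i)
    (hdu : ∀ i, IsUnit (d i)) (hd' : ∀ i, σ h (d' i) = d' i) (S : ι' → ι → Φ.ResidueField)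
    (hS : ∀ j k, ∑ i, Φ.res (d' i) * Φ.involution (S i j) * S i k =
      if j = k then Φ.res (d j) else 0) :
    ∃ G : ι' → ι → Φ.E, ∀ j k, ∑ i, σ h (G i j) * d' i * G i k = if j = k then d j else 0 := by
  classical
  let _ := starRing h
  have hstar : ∀ a : Φ.E, star a = σ h a := fun _ => rfl
  choose G₀ hG₀ using fun i j => res_surjective (S i j)
  let G : Matrix ι' ι Φ.E := Matrix.of G₀
  obtain ⟨c, hc⟩ := (isUnit_two (Φ := Φ) hchar).exists_right_inv
  have hA : (Gᴴ * diagonal d' * G)ᴴ = Gᴴ * diagonal d' * G := by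
    have : (diagonal d')ᴴ = diagonal d' := by
      rw [diagonal_conjTranspose]; congr 1; funext i; exact hd' i
    rw [conjTranspose_mul, conjTranspose_mul, conjTranspose_conjTranspose, this, Matrix.mul_assoc]
  have happ : ∀ (G : Matrix ι' ι Φ.E) j k, (Gᴴ * diagonal d' * G) j k =
      ∑ i, σ h (G i j) * d' i * G i k := by
    intro G j k
    rw [Matrix.mul_apply]
    refine Finset.sum_congr rfl fun i _ => ?_
    rw [Matrix.mul_diagonal, conjTranspose_apply, hstar]
  have hD : (diagonal d)ᴴ = diagonal d := by
    rw [diagonal_conjTranspose]; congr 1; funext i; exact hd i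
  obtain ⟨H, hH⟩ := exists_conjTranspose_mul_mul_eq (I := Ideal.span {Φ.π}) (m := Φ.s)
    (A := Gᴴ * diagonal d' * G) (D := diagonal d)
    (D' := diagonal fun i => (↑(hdu i).unit⁻¹ : Φ.E)) (c := c)
    (by rw [Ideal.span_singleton_pow, π_pow_s, Ideal.span_singleton_eq_bot])
    (by rw [← two_mul, hc]) hA hD
    (by
      rw [diagonal_mul_diagonal, ← diagonal_one]
      congr 1
      funext i
      exact (hdu i).mul_val_inv) (by
    intro j k
    rw [Ideal.mem_span_singleton, ← res_eq_zero_iff, Matrix.sub_apply, happ, map_sub, map_sum,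
      diagonal_apply, sub_eq_zero, apply_ite Φ.res, map_zero, ← hS]
    refine Finset.sum_congr rfl fun i _ => ?_
    rw [map_mul, map_mul, res_σ, show Φ.res (G i j) = S i j from hG₀ i j,
      show Φ.res (G i k) = S i k from hG₀ i k]
    ring)
  refine ⟨G * H, fun j k => ?_⟩
  rw [← happ, conjTranspose_mul, ← diagonal_apply, ← hH]
  simp only [Matrix.mul_assoc]

/-- The orthogonal sum of the forms `ℓ(σ(x) d y)` on the algebra. -/
def piForm {ι : Type*} [Fintype ι] (h : Φ.SelfDual) (ℓ : Φ.E →ₗ[K] K) (d : ι → Φ.E) :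
    (ι → Φ.E) →ₗ⋆[K] (ι → Φ.E) →ₗ[K] K :=
  LinearMap.mk₂'ₛₗ _ _ (fun x y => ∑ i, tform h ℓ (d i) (x i) (y i))
    (fun x x' y => by simp only [Pi.add_apply, map_add, LinearMap.add_apply, Finset.sum_add_distrib])
    (fun c x y => by
      simp only [Pi.smul_apply, LinearMap.map_smulₛₗ, LinearMap.smul_apply, Finset.smul_sum])
    (fun x y y' => by simp only [Pi.add_apply, map_add, Finset.sum_add_distrib])
    (fun c x y => by simp only [Pi.smul_apply, map_smul, Finset.smul_sum, RingHom.id_apply])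

theorem piForm_apply {ι : Type*} [Fintype ι] (h : Φ.SelfDual) (ℓ : Φ.E →ₗ[K] K) (d : ι → Φ.E)
    (x y : ι → Φ.E) : piForm h ℓ d x y = ∑ i, ℓ (σ h (x i) * d i * y i) := rfl

theorem piForm_nondeg {ι : Type*} [Fintype ι] (h : Φ.SelfDual) {ℓ : Φ.E →ₗ[K] K}
    (hℓ : Φ.NondegFun ℓ) {d : ι → Φ.E} (hd : ∀ i, IsUnit (d i)) : Nondeg (piForm h ℓ d) := by
  classical
  intro y hy
  funext i
  have h1 : d i * y i = 0 := by
    refine hℓ.ext fun b => ?_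
    have h2 := hy (Pi.single i (σ h b))
    rw [piForm_apply, Finset.sum_eq_single i, Pi.single_eq_same, σ_σ] at h2
    · rw [zero_mul, map_zero, ← h2]
      congr 1
      ring
    · intro j _ hj
      rw [Pi.single_eq_of_ne hj, map_zero, zero_mul, zero_mul, map_zero]
    · simp
  exact (hd i).mul_right_eq_zero.1 h1

variable {R : ∀ Φ : FrobeniusBlock K, Matrix (Fin Φ.dim) (Fin Φ.dim) K}

theorem piForm_hasMatrix {ι : Type*} [Fintype ι] [DecidableEq ι] (hX : Φ.IsStarRoot (R Φ))
    (h : Φ.SelfDual) (q : ι → K[T;T⁻¹]) :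
    HasMatrix (piForm h (Φ.rootFun (R Φ)) fun i => levE h (q i))
      (Matrix.blockDiagonal' fun i => R Φ * Φ.evalMatrix (q i)) := by
  refine ⟨Pi.basis fun _ => Φ.bas, ?_⟩
  rintro ⟨i, k⟩ ⟨j, k'⟩
  rw [piForm_apply, Pi.basis_apply, Pi.basis_apply, Finset.sum_eq_single j]
  · by_cases hij : i = j
    · subst hij
      rw [blockDiagonal'_apply_eq, Pi.single_eq_same, Pi.single_eq_same]
      exact matForm_mul_evalMatrix hX h (q i) k k'
    · rw [blockDiagonal'_apply_ne _ _ _ hij, Pi.single_eq_of_ne (Ne.symm hij), map_zero, zero_mul,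
        zero_mul, map_zero]
  · intro l _ hl
    rw [Pi.single_eq_of_ne hl, mul_zero, map_zero]
  · simp

theorem mcong_root_map (l : List K[T;T⁻¹]) :
    MCong (Matrix.blockDiagonal' fun i => (Summand.root Φ (l.get i)).toMatrix R)
      (directSum R (l.map (Summand.root Φ))) :=
  directSum_family R (fun i => Summand.root Φ (l.get i)) (l.map (Summand.root Φ))
    (finCongr (List.length_map _).symm) (by simp)

/-- Groups of summands with the same block and equivalent Hermitian forms are congruent. -/
theorem mcong_of_hermEquivalent (hchar : (2 : K) ≠ 0) (hX : Φ.IsStarRoot (R Φ))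
    {l l' : List K[T;T⁻¹]} (hl : ∀ q ∈ l, (Summand.root Φ q).Admissible)
    (hl' : ∀ q ∈ l', (Summand.root Φ q).Admissible) (hll : Φ.HermEquivalent l l') :
    MCong (directSum R (l.map (Summand.root Φ))) (directSum R (l'.map (Summand.root Φ))) := by
  have h := hX.selfDual
  obtain ⟨S, hS⟩ := hll
  have hlen : l.length = l'.length := by
    have := S.finrank_eq
    rwa [Module.finrank_fin_fun, Module.finrank_fin_fun] at this
  have hunit : ∀ q, (Summand.root Φ q).Admissible → IsUnit (levE h q) := fun q hq => by
    rw [isUnit_iff_res_ne_zero, res_levE]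
    exact evalKappa_ne_zero hchar h hq.2.1 hq.2.2
  obtain ⟨G, hG⟩ := exists_lift_of_hermitian hchar h (d := fun i => levE h (l.get i))
    (d' := fun i => levE h (l'.get i)) (fun i => σ_levE h (hl _ (List.get_mem _ _)).2.2.symm)
    (fun i => hunit _ (hl _ (List.get_mem _ _)))
    (fun i => σ_levE h (hl' _ (List.get_mem _ _)).2.2.symm)
    (fun i j => S (Pi.single j 1) i) (by
      intro j k
      have h1 := hS (Pi.single j 1) (Pi.single k 1)
      rw [hermForm, hermForm] at h1
      simp only [res_levE]
      rw [h1, Finset.sum_eq_single k]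
      · by_cases hjk : j = k
        · subst hjk
          simp
        · rw [if_neg hjk, Pi.single_eq_of_ne (Ne.symm hjk), map_zero, mul_zero, zero_mul]
      · intro i _ hi
        rw [Pi.single_eq_of_ne hi, mul_zero]
      · simp)
  have hm : HasMatrix _ (Matrix.blockDiagonal' fun i : Fin l.length =>
      (Summand.root Φ (l.get i)).toMatrix R) := piForm_hasMatrix hX h fun i => l.get i
  have hm' : HasMatrix _ (Matrix.blockDiagonal' fun i : Fin l'.length =>
      (Summand.root Φ (l'.get i)).toMatrix R) := piForm_hasMatrix hX h fun i => l'.get i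
  have hdet := hm.nondeg_iff.1 (piForm_nondeg h hX.nondegFun fun i => hunit _ (hl _ (List.get_mem _ _)))
  -- The columns of `G`, multiplied by the basis of `E`, are vectors of the second space with the
  -- Gram matrix of the first.
  have hgram : ∀ x y : (Σ i : Fin l.length, Fin (Summand.root Φ (l.get i)).size),
      piForm h (Φ.rootFun (R Φ)) (fun i => levE h (l'.get i)) (fun i => G i x.1 * Φ.bas x.2)
        (fun i => G i y.1 * Φ.bas y.2) =
      Matrix.blockDiagonal' (fun i => (Summand.root Φ (l.get i)).toMatrix R) x y := by
    rintro ⟨i, k⟩ ⟨j, k'⟩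
    have h1 : ∑ a, σ h (G a i * Φ.bas k) * levE h (l'.get a) * (G a j * Φ.bas k') =
        σ h (Φ.bas k) * (if i = j then levE h (l.get i) else 0) * Φ.bas k' := by
      rw [← hG, Finset.mul_sum, Finset.sum_mul]
      refine Finset.sum_congr rfl fun a _ => ?_
      rw [map_mul]
      ring
    rw [piForm_apply, ← map_sum, h1]
    by_cases hij : i = j
    · subst hij
      rw [if_pos rfl, blockDiagonal'_apply_eq]
      exact matForm_mul_evalMatrix hX h (l.get i) k k'
    · rw [if_neg hij, blockDiagonal'_apply_ne _ _ _ hij, mul_zero, zero_mul, map_zero]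
  have hfin := HasMatrix.of_gram hgram hdet (by
    have hcard : ∀ i : Fin l.length, Fintype.card (Fin (Summand.root Φ (l.get i)).size) = Φ.dim :=
      fun _ => Fintype.card_fin _
    rw [Module.finrank_pi_fintype, Fintype.card_sigma, Finset.sum_congr rfl fun i _ => hcard i]
    simp [finrank_E, hlen])
  exact (mcong_root_map l).symm.trans ((hfin.mcong hm').trans (mcong_root_map l'))

end FrobeniusBlock

/-! ### Splitting lists, and multisets up to an involution -/

section Partition

variable {α β γ : Type*}

theorem perm_filterMap_append (f : α → Option β) (g : β → α) (hg : ∀ a b, f a = some b → g b = a)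
    (D : List α) : D.Perm ((D.filterMap f).map g ++ D.filter fun a => (f a).isNone) := by
  induction D with
  | nil => exact List.Perm.refl _
  | cons a D ih =>
    rcases h : f a with _ | b
    · rw [List.filterMap_cons_none h, List.filter_cons_of_pos (by simp [h])]
      exact (ih.cons a).trans List.perm_middle.symm
    · rw [List.filterMap_cons_some h, List.filter_cons_of_neg (by simp [h]), List.map_cons, hg a b h]
      exact ih.cons a

theorem filterMap_filter_isNone {f : α → Option β} {f' : α → Option γ}
    (h : ∀ a b, f a = some b → f' a = none) (D : List α) :
    (D.filter fun a => (f a).isNone).filterMap f' = D.filterMap f' := by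
  induction D with
  | nil => rfl
  | cons a D ih =>
    rcases ha : f a with _ | b
    · rw [List.filter_cons_of_pos (by simp [ha]), List.filterMap_cons, List.filterMap_cons, ih]
    · rw [List.filter_cons_of_neg (by simp [ha]), ih, List.filterMap_cons_none (h a b ha)]

/-- An element a of the first multiset either occurs in the second or is the image of an element
occurring there. In both cases this partner and its image cancel against a and d a, and induction
applies. -/
theorem rel_of_add_map_eq {d : α → α} (hd : Function.Involutive d) {S S' : Multiset α}
    (h : S + S.map d = S' + S'.map d) : Multiset.Rel (fun a b => b = a ∨ b = d a) S S' := by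
  classical
  induction S using Multiset.induction generalizing S' with
  | empty =>
    rw [Multiset.map_zero, add_zero, eq_comm, add_eq_zero] at h
    rw [h.1]
    exact Multiset.Rel.zero
  | cons a S ih =>
    have ha : a ∈ S' + S'.map d := by rw [← h]; simp
    have key : ∀ b T, S' = b ::ₘ T → (b = a ∨ b = d a) →
        Multiset.Rel (fun a b => b = a ∨ b = d a) (a ::ₘ S) S' := by
      rintro b T rfl hb
      refine Multiset.Rel.cons hb (ih ?_)
      have h1 : ∀ (x : α) (U : Multiset α), (x ::ₘ U) + (x ::ₘ U).map d =
          x ::ₘ d x ::ₘ (U + U.map d) := by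
        intro x U
        rw [Multiset.map_cons, Multiset.cons_add, Multiset.add_cons]
      rw [h1, h1] at h
      rcases hb with rfl | rfl
      · exact Multiset.cons_inj_right _ |>.1 (Multiset.cons_inj_right _ |>.1 h)
      · rw [hd a, Multiset.cons_swap] at h
        exact Multiset.cons_inj_right _ |>.1 (Multiset.cons_inj_right _ |>.1 h)
    rcases Multiset.mem_add.1 ha with ha | ha
    · obtain ⟨T, hT⟩ := Multiset.exists_cons_of_mem ha
      exact key a T hT (Or.inl rfl)
    · obtain ⟨b, hb, rfl⟩ := Multiset.mem_map.1 ha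
      obtain ⟨T, hT⟩ := Multiset.exists_cons_of_mem hb
      exact key b T hT (Or.inr (hd b).symm)

end Partition

/-! ### Recovering Hermitian forms from the invariants -/

namespace FrobeniusBlock

variable {Φ : FrobeniusBlock K}

/-- Both Hermitian forms are read off from the same values B(y, p(τ)^(s-1) f(τ) y'). Letting f vary,
nondegeneracy of ℓ identifies π^(s-1) a with π^(s-1) a', which means that a and a' agree modulo π.
The change of coordinates on the top layer is therefore an isometry. -/
theorem RootTop.hermEquivalent {V : Type*} [AddCommGroup V] [Module K V]
    {B : V →ₗ⋆[K] V →ₗ[K] K} {τ : V →ₗ[K] V} {ℓ : Φ.E →ₗ[K] K} (hℓ : Φ.NondegFun ℓ)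
    {l l' : List K[T;T⁻¹]} (h : Φ.RootTop ℓ B τ l) (h' : Φ.RootTop ℓ B τ l') :
    Φ.HermEquivalent l l' := by
  obtain ⟨r, hr, hf⟩ := h
  obtain ⟨r', hr', hf'⟩ := h'
  obtain ⟨S, hS⟩ := hr.exists_equiv hr'
  refine ⟨S, fun x y => ?_⟩
  obtain ⟨z, hz, rfl⟩ := hr.surj x
  obtain ⟨z', hz', rfl⟩ := hr.surj y
  rw [hS z hz, hS z' hz']
  obtain ⟨a, ha⟩ := res_surjective (Φ.hermForm l (r z) (r z'))
  obtain ⟨a', ha'⟩ := res_surjective (Φ.hermForm l' (r' z) (r' z'))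
  have h1 : Φ.π ^ (Φ.s - 1) * a = Φ.π ^ (Φ.s - 1) * a' := by
    refine hℓ.ext fun b => ?_
    obtain ⟨f, rfl⟩ := AdjoinRoot.mk_surjective b
    rw [mul_assoc, mul_assoc, ← hf z hz (aeval τ f z') (aeval_mem hz' f) (a * AdjoinRoot.mk Φ.χ f),
      hf' z hz (aeval τ f z') (aeval_mem hz' f) (a' * AdjoinRoot.mk Φ.χ f)]
    · rw [map_mul, ha', res_mk, hr'.smul f z' hz', hermForm, Finset.sum_mul]
      refine Finset.sum_congr rfl fun i _ => ?_
      rw [Pi.smul_apply, smul_eq_mul]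
      ring
    · rw [map_mul, ha, res_mk, hr.smul f z' hz', hermForm, Finset.sum_mul]
      refine Finset.sum_congr rfl fun i _ => ?_
      rw [Pi.smul_apply, smul_eq_mul]
      ring
  rw [← ha, ← ha', eq_comm, ← sub_eq_zero, ← map_sub]
  by_contra hne
  rw [← Ne, ← isUnit_iff_res_ne_zero] at hne
  rw [← sub_eq_zero, ← mul_sub, hne.mul_left_eq_zero] at h1
  exact Φ.π_pow_pred_ne_zero h1

theorem ext_χ {Φ Ψ : FrobeniusBlock K} (h : Φ.χ = Ψ.χ) : Φ = Ψ := by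
  have hp : Φ.p = Ψ.p := by
    have h1 : Φ.p ∣ Ψ.p := by
      have : Φ.p ∣ Ψ.χ := h ▸ dvd_pow_self _ Φ.s_pos.ne'
      exact Φ.irreducible.prime.dvd_of_dvd_pow this
    exact eq_of_monic_of_associated Φ.monic Ψ.monic
      ((Φ.irreducible.dvd_irreducible_iff_associated Ψ.irreducible).1 h1)
  have hs : Φ.s = Ψ.s := by
    have := congrArg natDegree h
    rw [χ, χ, natDegree_pow, natDegree_pow, hp] at this
    exact Nat.eq_of_mul_eq_mul_right Ψ.natDegree_p_pos this
  obtain ⟨p, s, _, _, _⟩ := Φ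
  obtain ⟨p', s', _, _, _⟩ := Ψ
  simp only at hp hs
  subst hp
  subst hs
  rfl

theorem dualOrSelf_involutive :
    Function.Involutive (dualOrSelf : FrobeniusBlock K → FrobeniusBlock K) := by
  intro Φ
  by_cases h : Φ.p.coeff 0 ≠ 0
  · rw [dualOrSelf_eq h, dualOrSelf_eq (dual_coeff_ne h), dual_dual]
  · rw [dualOrSelf, dualOrSelf, dif_neg h, dif_neg h]

end FrobeniusBlock

/-! ### Replacements preserve the congruence class -/

section Replacement

variable {R : ∀ Φ : FrobeniusBlock K, Matrix (Fin Φ.dim) (Fin Φ.dim) K}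

theorem mcong_skew_dual {Φ Ψ : FrobeniusBlock K} (hΦ : Φ.toMatrix.det ≠ 0)
    (h : Ψ.χ = dualPoly Φ.χ) :
    MCong ((Summand.skew Φ).toMatrix R) ((Summand.skew Ψ).toMatrix R) := by
  have h0 := Φ.det_ne_iff.1 hΦ
  obtain rfl : Ψ = Φ.dual h0 := FrobeniusBlock.ext_χ (h.trans (Φ.dual_χ h0).symm)
  obtain ⟨ℓ, ⟨b, hb⟩, b', hb'⟩ := FrobeniusBlock.exists_skewForm h0
  refine (hasMatrix_skew R hΦ hb (finrank_skew h0)).mcong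
    (hasMatrix_skew R ((FrobeniusBlock.det_ne_iff _).2 (FrobeniusBlock.dual_coeff_ne h0)) hb' ?_)
  rw [finrank_skew h0, FrobeniusBlock.dual_dim]

theorem mcong_of_rel_skew {S S' : Multiset (FrobeniusBlock K)}
    (h : Multiset.Rel (fun Φ Ψ : FrobeniusBlock K => Ψ = Φ ∨ Ψ.χ = dualPoly Φ.χ) S S') :
    ∀ l l' : List (FrobeniusBlock K), (l : Multiset (FrobeniusBlock K)) = S →
      (l' : Multiset (FrobeniusBlock K)) = S' → (∀ Φ ∈ l, Φ.toMatrix.det ≠ 0) →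
      MCong (directSum R (l.map Summand.skew)) (directSum R (l'.map Summand.skew)) := by
  induction h with
  | zero =>
    intro l l' hl hl' _
    rw [Multiset.coe_eq_zero] at hl hl'
    subst hl hl'
    exact MCong.refl _
  | @cons Φ Ψ S S' hr _ ih =>
    intro l l' hl hl' hdet
    have hl1 : l.Perm (Φ :: S.toList) := by
      rw [← Multiset.coe_eq_coe, hl, ← Multiset.cons_coe, Multiset.coe_toList]
    have hl2 : l'.Perm (Ψ :: S'.toList) := by
      rw [← Multiset.coe_eq_coe, hl', ← Multiset.cons_coe, Multiset.coe_toList]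
    refine (directSum_perm R (hl1.map _)).trans (MCong.trans ?_ (directSum_perm R (hl2.map _)).symm)
    rw [List.map_cons, List.map_cons]
    refine (directSum_cons R _ _).trans (MCong.trans (MCong.fromBlocks ?_ (ih S.toList S'.toList
      (Multiset.coe_toList _) (Multiset.coe_toList _) fun Θ hΘ => hdet Θ ?_))
        (directSum_cons R _ _).symm)
    · rcases hr with rfl | hr
      · exact MCong.refl _
      · exact mcong_skew_dual (hdet Φ (hl1.mem_iff.2 List.mem_cons_self)) hr
    · exact hl1.mem_iff.2 (List.mem_cons_of_mem _ hΘ)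

theorem rootFunction?_eq_some {Φ : FrobeniusBlock K} {A : Summand K} {q : K[T;T⁻¹]} :
    Summand.rootFunction? Φ A = some q ↔ A = Summand.root Φ q := by
  cases A with
  | root Ψ q' =>
    rw [Summand.rootFunction?]
    split_ifs with h
    · subst h; simp
    · simp [h]
  | _ => simp [Summand.rootFunction?]

theorem mem_filterMap_rootFunction? {Φ : FrobeniusBlock K} {D : List (Summand K)} {q : K[T;T⁻¹]} :
    q ∈ D.filterMap (Summand.rootFunction? Φ) ↔ Summand.root Φ q ∈ D := by
  rw [List.mem_filterMap]
  simp only [rootFunction?_eq_some]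
  exact ⟨by rintro ⟨a, ha, rfl⟩; exact ha, fun h => ⟨_, h, rfl⟩⟩

theorem hermEquivalent_nil (Φ : FrobeniusBlock K) : Φ.HermEquivalent [] [] :=
  ⟨LinearEquiv.refl _ _, fun _ _ => rfl⟩

/-- Induction on a list of blocks containing all those that occur: the group of one block is
collected by a permutation and exchanged, and the remaining summands involve only the rest of the
list. -/
theorem mcong_of_equivalentRoot (hchar : (2 : K) ≠ 0)
    (hR : ∀ Φ : FrobeniusBlock K, Φ.HasStarRoot → Φ.IsStarRoot (R Φ)) (L : List (FrobeniusBlock K)) :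
    ∀ D D' : List (Summand K), IsCanonical D → IsCanonical D' →
      (∀ A ∈ D, ∃ Φ ∈ L, ∃ q, A = Summand.root Φ q) →
      (∀ A ∈ D', ∃ Φ ∈ L, ∃ q, A = Summand.root Φ q) → EquivalentRoot D D' →
      MCong (directSum R D) (directSum R D') := by
  induction L with
  | nil =>
    intro D D' _ _ hD hD' _
    have h1 : D = [] := List.eq_nil_iff_forall_not_mem.2 fun A hA => by simpa using hD A hA
    have h2 : D' = [] := List.eq_nil_iff_forall_not_mem.2 fun A hA => by simpa using hD' A hA
    subst h1 h2
    exact MCong.refl _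
  | cons Φ L ih =>
    intro D D' hc hc' hD hD' h
    have hp := fun D : List (Summand K) => directSum_perm R (perm_filterMap_append
      (Summand.rootFunction? Φ) (Summand.root Φ) (fun A q hq => (rootFunction?_eq_some.1 hq).symm) D)
    refine (hp D).trans (MCong.trans (directSum_append_congr R ?_ ?_) (hp D').symm)
    · by_cases hΦ : Φ.HasStarRoot
      · exact FrobeniusBlock.mcong_of_hermEquivalent hchar (hR Φ hΦ)
          (fun q hq => hc _ (mem_filterMap_rootFunction?.1 hq))
          (fun q hq => hc' _ (mem_filterMap_rootFunction?.1 hq)) (h Φ)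
      · have hnil : ∀ D : List (Summand K), IsCanonical D →
            D.filterMap (Summand.rootFunction? Φ) = [] := fun D hD =>
          List.eq_nil_iff_forall_not_mem.2 fun q hq =>
            hΦ (hD _ (mem_filterMap_rootFunction?.1 hq)).1
        rw [hnil D hc, hnil D' hc']
        exact MCong.refl _
    · have hrest : ∀ D : List (Summand K), (∀ A ∈ D, ∃ Ψ ∈ Φ :: L, ∃ q, A = Summand.root Ψ q) →
          ∀ A ∈ D.filter (fun A => (Summand.rootFunction? Φ A).isNone),
            ∃ Ψ ∈ L, ∃ q, A = Summand.root Ψ q := by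
        intro D hD A hA
        rw [List.mem_filter] at hA
        obtain ⟨Ψ, hΨ, q, rfl⟩ := hD A hA.1
        rcases List.mem_cons.1 hΨ with rfl | hΨ
        · simp [rootFunction?_eq_some.2 rfl] at hA
        · exact ⟨Ψ, hΨ, q, rfl⟩
      refine ih _ _ (fun A hA => hc A (List.mem_filter.1 hA).1)
        (fun A hA => hc' A (List.mem_filter.1 hA).1) (hrest D hD) (hrest D' hD') fun Ψ => ?_
      by_cases hΨ : Ψ = Φ
      · subst hΨ
        have hnil : ∀ D : List (Summand K), (D.filter fun A => (Summand.rootFunction? Ψ A).isNone).filterMap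
            (Summand.rootFunction? Ψ) = [] := fun D =>
          List.eq_nil_iff_forall_not_mem.2 fun q hq => by
            rw [mem_filterMap_rootFunction?, List.mem_filter] at hq
            simp [rootFunction?_eq_some.2 rfl] at hq
        rw [hnil, hnil]
        exact hermEquivalent_nil Ψ
      · have hdis : ∀ A q, Summand.rootFunction? Φ A = some q → Summand.rootFunction? Ψ A = none := by
          intro A q hA
          rw [rootFunction?_eq_some] at hA
          subst hA
          rw [Summand.rootFunction?, if_neg (Ne.symm hΨ)]
        rw [filterMap_filter_isNone hdis, filterMap_filter_isNone hdis]
        exact h Ψ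

end Replacement

/-! ### Uniqueness of the summands -/

section Uniqueness

variable {R : ∀ Φ : FrobeniusBlock K, Matrix (Fin Φ.dim) (Fin Φ.dim) K}

/-- The nonsingular summands. -/
def nonsingularPart (D : List (Summand K)) : List (Summand K) :=
  D.filter fun A => (Summand.jordanSize? A).isNone

theorem jordanSize?_eq_some {A : Summand K} {n : ℕ} :
    Summand.jordanSize? A = some n ↔ A = Summand.jordan n := by
  cases A <;> simp [Summand.jordanSize?]

theorem skewBlock?_eq_some {A : Summand K} {Φ : FrobeniusBlock K} :
    Summand.skewBlock? A = some Φ ↔ A = Summand.skew Φ := by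
  cases A <;> simp [Summand.skewBlock?]

theorem mem_filterMap_skewBlock? {Φ : FrobeniusBlock K} {D : List (Summand K)} :
    Φ ∈ D.filterMap Summand.skewBlock? ↔ Summand.skew Φ ∈ D := by
  rw [List.mem_filterMap]
  simp only [skewBlock?_eq_some]
  exact ⟨by rintro ⟨a, ha, rfl⟩; exact ha, fun h => ⟨_, h, rfl⟩⟩

theorem mem_filterMap_jordanSize? {n : ℕ} {D : List (Summand K)} :
    n ∈ D.filterMap Summand.jordanSize? ↔ Summand.jordan n ∈ D := by
  rw [List.mem_filterMap]
  simp only [jordanSize?_eq_some]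
  exact ⟨by rintro ⟨a, ha, rfl⟩; exact ha, fun h => ⟨_, h, rfl⟩⟩

theorem IsCanonical.nonsingularPart {D : List (Summand K)} (h : IsCanonical D) :
    IsCanonical (nonsingularPart D) := fun A hA => h A (List.mem_filter.1 hA).1

theorem jordan_notMem_nonsingularPart (D : List (Summand K)) (n : ℕ) :
    Summand.jordan n ∉ nonsingularPart D := by
  intro h
  rw [SesqCanon.nonsingularPart, List.mem_filter] at h
  simp [Summand.jordanSize?] at h

theorem skewBlock?_nonsingularPart (D : List (Summand K)) :
    (nonsingularPart D).filterMap Summand.skewBlock? = D.filterMap Summand.skewBlock? :=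
  filterMap_filter_isNone (fun A n hA => by rw [jordanSize?_eq_some.1 hA]; rfl) D

theorem rootFunction?_nonsingularPart (Φ : FrobeniusBlock K) (D : List (Summand K)) :
    (nonsingularPart D).filterMap (Summand.rootFunction? Φ) =
      D.filterMap (Summand.rootFunction? Φ) :=
  filterMap_filter_isNone (fun A n hA => by rw [jordanSize?_eq_some.1 hA]; rfl) D

theorem perm_nonsingularPart (D : List (Summand K)) :
    D.Perm ((D.filterMap Summand.jordanSize?).map Summand.jordan ++ nonsingularPart D) :=
  perm_filterMap_append _ _ (fun _ _ hA => (jordanSize?_eq_some.1 hA).symm) D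

variable (R) in
theorem mcong_nonsingularPart (D : List (Summand K)) :
    MCong (directSum R D) (fromBlocks (directSum R (nonsingularPart D)) 0 0
      (Matrix.blockDiagonal' fun i => jordanMatrix ((D.filterMap Summand.jordanSize?).get i))) := by
  refine (directSum_perm R (perm_nonsingularPart D)).trans ((directSum_append R _ _).trans
    ((MCong.comm _ _).trans (MCong.fromBlocks (MCong.refl _) ?_)))
  exact (directSum_family R
    (fun i => Summand.jordan ((D.filterMap Summand.jordanSize?).get i)) _
    (finCongr (List.length_map _).symm) (by simp)).symm

/-- The replacements do not change the congruence class. -/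
theorem mcong_of_same (hchar : (2 : K) ≠ 0)
    (hR : ∀ Φ : FrobeniusBlock K, Φ.HasStarRoot → Φ.IsStarRoot (R Φ)) {D D' : List (Summand K)}
    (hD : IsCanonical D) (hD' : IsCanonical D') (hJ : SameJordan D D') (hS : SameSkew D D')
    (hE : EquivalentRoot D D') : MCong (directSum R D) (directSum R D') := by
  refine (directSum_perm R (perm_nonsingularPart D)).trans
    (MCong.trans (directSum_append_congr R (directSum_perm R (hJ.map _)) ?_)
      (directSum_perm R (perm_nonsingularPart D')).symm)
  have hp := fun D : List (Summand K) => directSum_perm R (perm_filterMap_append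
    Summand.skewBlock? Summand.skew (fun A Φ hA => (skewBlock?_eq_some.1 hA).symm) D)
  refine (hp _).trans (MCong.trans (directSum_append_congr R ?_ ?_) (hp _).symm)
  · rw [skewBlock?_nonsingularPart, skewBlock?_nonsingularPart]
    exact mcong_of_rel_skew hS _ _ rfl rfl fun Φ hΦ => (hD _ (mem_filterMap_skewBlock?.1 hΦ)).1
  · have hroot : ∀ (D : List (Summand K)), ∀ A ∈ (nonsingularPart D).filter
        (fun A => (Summand.skewBlock? A).isNone), ∃ Φ q, A = Summand.root Φ q := by
      intro D A hA
      rw [List.mem_filter] at hA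
      cases A with
      | jordan n => exact absurd hA.1 (jordan_notMem_nonsingularPart D n)
      | skew Φ => simp [Summand.skewBlock?] at hA
      | root Φ q => exact ⟨Φ, q, rfl⟩
    have hf : ∀ (D : List (Summand K)) (Φ : FrobeniusBlock K), ((nonsingularPart D).filter
        fun A => (Summand.skewBlock? A).isNone).filterMap (Summand.rootFunction? Φ) =
        D.filterMap (Summand.rootFunction? Φ) := by
      intro D Φ
      rw [filterMap_filter_isNone (fun A n hA => by rw [skewBlock?_eq_some.1 hA]; rfl),
        rootFunction?_nonsingularPart]
    refine mcong_of_equivalentRoot hchar hR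
      (((D ++ D').filterMap Summand.rootData?).map Prod.fst) _ _
      (fun A hA => hD.nonsingularPart A (List.mem_filter.1 hA).1)
      (fun A hA => hD'.nonsingularPart A (List.mem_filter.1 hA).1) ?_ ?_ ?_
    · intro A hA
      obtain ⟨Φ, q, rfl⟩ := hroot D A hA
      refine ⟨Φ, List.mem_map.2 ⟨(Φ, q), List.mem_filterMap.2 ⟨Summand.root Φ q, List.mem_append_left _ ?_, rfl⟩,
        rfl⟩, q, rfl⟩
      exact (List.mem_filter.1 (List.mem_filter.1 hA).1).1
    · intro A hA
      obtain ⟨Φ, q, rfl⟩ := hroot D' A hA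
      refine ⟨Φ, List.mem_map.2 ⟨(Φ, q), List.mem_filterMap.2 ⟨Summand.root Φ q, List.mem_append_right _ ?_, rfl⟩,
        rfl⟩, q, rfl⟩
      exact (List.mem_filter.1 (List.mem_filter.1 hA).1).1
    · intro Φ
      rw [hf, hf]
      exact hE Φ

theorem directSum_det_ne (hchar : (2 : K) ≠ 0)
    (hR : ∀ Φ : FrobeniusBlock K, Φ.HasStarRoot → Φ.IsStarRoot (R Φ)) {D : List (Summand K)}
    (hD : IsCanonical D) (hJ : ∀ n, Summand.jordan n ∉ D) : (directSum R D).det ≠ 0 := by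
  obtain ⟨V, _, _, B, τ, τ', hm, hnd, -⟩ := exists_model hchar hR D hD hJ
  exact hm.nondeg_iff.1 hnd

theorem skewCount_eq_zero {D : List (Summand K)} (hD : IsCanonical D) {Φ : FrobeniusBlock K}
    (hΦ : Φ.HasStarRoot) : skewCount Φ D = 0 := by
  classical
  rw [skewCount, Nat.add_eq_zero_iff, List.count_eq_zero, List.count_eq_zero]
  constructor
  · intro h
    exact (hD _ (mem_filterMap_skewBlock?.1 h)).2 hΦ
  · intro h
    obtain ⟨Θ, hΘ, rfl⟩ := List.mem_map.1 h
    have h1 := hD _ (mem_filterMap_skewBlock?.1 hΘ)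
    have h0 := Θ.det_ne_iff.1 h1.1
    rw [FrobeniusBlock.dualOrSelf_eq h0] at hΦ
    exact FrobeniusBlock.not_hasStarRoot_dual h0 h1.2 hΦ

/-- The cosquare sees [Φ ⧹ I] only as the unordered pair Φ, Φ^∨, so the counts fix the multiset of
blocks together with its image under duality, and hence the blocks up to duality. -/
theorem sameSkew_of_skewCount_eq {D D' : List (Summand K)} (hD : IsCanonical D)
    (h : ∀ Φ, skewCount Φ D = skewCount Φ D') : SameSkew D D' := by
  classical
  have h1 : ((D.filterMap Summand.skewBlock? : List (FrobeniusBlock K)) : Multiset (FrobeniusBlock K)) +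
      Multiset.map FrobeniusBlock.dualOrSelf (D.filterMap Summand.skewBlock? : List _) =
      ((D'.filterMap Summand.skewBlock? : List (FrobeniusBlock K)) : Multiset (FrobeniusBlock K)) +
      Multiset.map FrobeniusBlock.dualOrSelf (D'.filterMap Summand.skewBlock? : List _) := by
    ext Φ
    have := h Φ
    simp only [skewCount] at this
    rw [Multiset.count_add, Multiset.count_add, Multiset.map_coe, Multiset.map_coe,
      Multiset.coe_count, Multiset.coe_count, Multiset.coe_count, Multiset.coe_count]
    convert this
  refine (rel_of_add_map_eq FrobeniusBlock.dualOrSelf_involutive h1).mono ?_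
  rintro Φ hΦ Ψ - (rfl | rfl)
  · exact Or.inl rfl
  · right
    have h0 := Φ.det_ne_iff.1 (hD _ (mem_filterMap_skewBlock?.1 (Multiset.mem_coe.1 hΦ))).1
    rw [FrobeniusBlock.dualOrSelf_eq h0, FrobeniusBlock.dual_χ]

/-- After the singular parts have been compared, the nonsingular parts of both sums are matrices of
one form. Both sets of invariants are then computed with the same cosquare, and this is what makes
them comparable. -/
theorem same_of_hasMatrix (hchar : (2 : K) ≠ 0) {V : Type*} [AddCommGroup V] [Module K V]
    {B : V →ₗ⋆[K] V →ₗ[K] K}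
    (hR : ∀ Φ : FrobeniusBlock K, Φ.HasStarRoot → Φ.IsStarRoot (R Φ)) {D D' : List (Summand K)}
    (hD : IsCanonical D) (hD' : IsCanonical D') (h : HasMatrix B (directSum R D))
    (h' : HasMatrix B (directSum R D')) :
    SameJordan D D' ∧ SameSkew D D' ∧ EquivalentRoot D D' := by
  have hN := directSum_det_ne hchar hR hD.nonsingularPart (jordan_notMem_nonsingularPart D)
  have hN' := directSum_det_ne hchar hR hD'.nonsingularPart (jordan_notMem_nonsingularPart D')
  obtain ⟨hJ, hM⟩ := singular_unique
    (fun i => hD _ (mem_filterMap_jordanSize?.1 (List.get_mem (D.filterMap Summand.jordanSize?) i)))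
    (fun i => hD' _ (mem_filterMap_jordanSize?.1 (List.get_mem (D'.filterMap Summand.jordanSize?) i)))
    hN hN' (h.congr (mcong_nonsingularPart R D)) (h'.congr (mcong_nonsingularPart R D'))
  have hB := matrixForm_hasMatrix (directSum R (nonsingularPart D))
  obtain ⟨τ, τ', hτ⟩ := (hB.nondeg_iff.2 hN).exists_cosqPair
  obtain ⟨hc, hr⟩ := hasInvariants hchar hR hD.nonsingularPart (jordan_notMem_nonsingularPart D) hB hτ
  obtain ⟨hc', hr'⟩ := hasInvariants hchar hR hD'.nonsingularPart (jordan_notMem_nonsingularPart D')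
    (hB.congr hM) hτ
  refine ⟨?_, ?_, fun Φ => ?_⟩
  · rw [SameJordan, ← Multiset.coe_eq_coe]
    simpa [Fin.univ_val_map] using hJ
  · have h1 : SameSkew (nonsingularPart D) (nonsingularPart D') := by
      refine sameSkew_of_skewCount_eq hD.nonsingularPart fun Φ => ?_
      by_cases hΦ : Φ.HasStarRoot
      · rw [skewCount_eq_zero hD.nonsingularPart hΦ, skewCount_eq_zero hD'.nonsingularPart hΦ]
      · exact (hc Φ hΦ).unique (hc' Φ hΦ)
    rwa [SameSkew, skewBlock?_nonsingularPart, skewBlock?_nonsingularPart] at h1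
  · rw [← rootFunction?_nonsingularPart Φ D, ← rootFunction?_nonsingularPart Φ D']
    by_cases hΦ : Φ.HasStarRoot
    · exact (hr Φ hΦ).hermEquivalent (hR Φ hΦ).nondegFun (hr' Φ hΦ)
    · have hnil : ∀ D : List (Summand K), IsCanonical D →
          D.filterMap (Summand.rootFunction? Φ) = [] := fun D hD =>
        List.eq_nil_iff_forall_not_mem.2 fun q hq =>
          hΦ (hD _ (mem_filterMap_rootFunction?.1 hq)).1
      rw [hnil _ hD.nonsingularPart, hnil _ hD'.nonsingularPart]
      exact hermEquivalent_nil Φ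

theorem hasMatrix_iff_same (hchar : (2 : K) ≠ 0) {V : Type*} [AddCommGroup V] [Module K V]
    {B : V →ₗ⋆[K] V →ₗ[K] K}
    (hR : ∀ Φ : FrobeniusBlock K, Φ.HasStarRoot → Φ.IsStarRoot (R Φ)) {D D' : List (Summand K)}
    (hD : IsCanonical D) (hD' : IsCanonical D') (h : HasMatrix B (directSum R D)) :
    HasMatrix B (directSum R D') ↔ SameJordan D D' ∧ SameSkew D D' ∧ EquivalentRoot D D' :=
  ⟨same_of_hasMatrix hchar hR hD hD' h,
    fun ⟨hJ, hS, hE⟩ => h.congr (mcong_of_same hchar hR hD hD' hJ hS hE)⟩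

end Uniqueness

/-! ### Restricting the functions that occur in the summands of type (iii) -/

section SpecialFunctions

variable {R : ∀ Φ : FrobeniusBlock K, Matrix (Fin Φ.dim) (Fin Φ.dim) K}

theorem rootData?_eq_some {A : Summand K} {x : FrobeniusBlock K × K[T;T⁻¹]} :
    Summand.rootData? A = some x ↔ A = Summand.root x.1 x.2 := by
  cases A <;> simp [Summand.rootData?, Prod.ext_iff]

open Classical in
theorem count_rootData? (Φ : FrobeniusBlock K) (q : K[T;T⁻¹]) (D : List (Summand K)) :
    (D.filterMap Summand.rootData?).count (Φ, q) =
      (D.filterMap (Summand.rootFunction? Φ)).count q := by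
  induction D with
  | nil => rfl
  | cons A D ih =>
    cases A with
    | root Ψ q' =>
      have h1 : Summand.rootData? (Summand.root Ψ q') = some (Ψ, q') := rfl
      rw [List.filterMap_cons_some h1, List.count_cons, ih]
      by_cases h : Ψ = Φ
      · subst h
        rw [List.filterMap_cons_some (rootFunction?_eq_some.2 rfl), List.count_cons]
        simp
      · rw [List.filterMap_cons_none (by simp [Summand.rootFunction?, h])]
        simp [h]
    | _ => exact ih

/-- Equal summands up to permutation and duality give congruent matrices. -/
theorem mcong_of_sameRoot {D D' : List (Summand K)} (hD : IsCanonical D) (hJ : SameJordan D D')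
    (hS : SameSkew D D') (hE : SameRoot D D') : MCong (directSum R D) (directSum R D') := by
  refine (directSum_perm R (perm_nonsingularPart D)).trans
    (MCong.trans (directSum_append_congr R (directSum_perm R (hJ.map _)) ?_)
      (directSum_perm R (perm_nonsingularPart D')).symm)
  have hp := fun D : List (Summand K) => directSum_perm R (perm_filterMap_append
    Summand.skewBlock? Summand.skew (fun A Φ hA => (skewBlock?_eq_some.1 hA).symm) D)
  refine (hp _).trans (MCong.trans (directSum_append_congr R ?_ ?_) (hp _).symm)
  · rw [skewBlock?_nonsingularPart, skewBlock?_nonsingularPart]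
    exact mcong_of_rel_skew hS _ _ rfl rfl fun Φ hΦ => (hD _ (mem_filterMap_skewBlock?.1 hΦ)).1
  · have hroot : ∀ D : List (Summand K), ((nonsingularPart D).filter
        fun A => (Summand.skewBlock? A).isNone).Perm
        ((D.filterMap Summand.rootData?).map fun x => Summand.root x.1 x.2) := by
      intro D
      have h1 := perm_filterMap_append Summand.rootData? (fun x => Summand.root x.1 x.2)
        (fun A x hA => (rootData?_eq_some.1 hA).symm)
        ((nonsingularPart D).filter fun A => (Summand.skewBlock? A).isNone)
      have h2 : (((nonsingularPart D).filter fun A => (Summand.skewBlock? A).isNone).filter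
          fun A => (Summand.rootData? A).isNone) = [] := by
        refine List.eq_nil_iff_forall_not_mem.2 fun A hA => ?_
        rw [List.mem_filter, List.mem_filter] at hA
        cases A with
        | jordan n => exact jordan_notMem_nonsingularPart D n hA.1.1
        | skew Φ => simp [Summand.skewBlock?] at hA
        | root Φ q => simp [Summand.rootData?] at hA
      rw [h2, List.append_nil,
        filterMap_filter_isNone (fun A n hA => by rw [skewBlock?_eq_some.1 hA]; rfl),
        nonsingularPart,
        filterMap_filter_isNone (fun A n hA => by rw [jordanSize?_eq_some.1 hA]; rfl)] at h1
      exact h1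
    exact directSum_perm R ((hroot D).trans ((hE.map _).trans (hroot D').symm))

theorem exists_directSum_with (hchar : (2 : K) ≠ 0)
    (hR : ∀ Φ : FrobeniusBlock K, Φ.HasStarRoot → Φ.IsStarRoot (R Φ)) {Q : Set K[T;T⁻¹]}
    (hQ : ∀ (Φ : FrobeniusBlock K) q, (Summand.root Φ q).Admissible →
      ∃ q' ∈ Q, (Summand.root Φ q').Admissible ∧ Φ.HermEquivalent [q] [q'])
    (D : List (Summand K)) (hD : IsCanonical D) :
    ∃ D', IsCanonicalWith Q D' ∧ MCong (directSum R D) (directSum R D') := by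
  induction D with
  | nil => exact ⟨[], ⟨hD, by simp⟩, MCong.refl _⟩
  | cons A D ih =>
    obtain ⟨D', ⟨hD', hQ'⟩, h⟩ := ih fun X hX => hD X (List.mem_cons_of_mem _ hX)
    have hA := hD A List.mem_cons_self
    have key : ∃ A' : Summand K, A'.Admissible ∧ (∀ Φ q, A' = Summand.root Φ q → q ∈ Q) ∧
        MCong (directSum R [A]) (directSum R [A']) := by
      cases A with
      | jordan n => exact ⟨_, hA, by simp, MCong.refl _⟩
      | skew Φ => exact ⟨_, hA, by simp, MCong.refl _⟩
      | root Φ q =>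
        obtain ⟨q', hq', hadm, he⟩ := hQ Φ q hA
        refine ⟨Summand.root Φ q', hadm, ?_, ?_⟩
        · rintro Ψ r hr
          rw [Summand.root.injEq] at hr
          rwa [← hr.2]
        · exact FrobeniusBlock.mcong_of_hermEquivalent hchar (hR Φ hA.1) (l := [q]) (l' := [q'])
            (by simpa using hA) (by simpa using hadm) he
    obtain ⟨A', hA', hQA, hm⟩ := key
    refine ⟨A' :: D', ⟨?_, ?_⟩, directSum_append_congr R hm h⟩
    · intro X hX
      rcases List.mem_cons.1 hX with rfl | hX
      · exact hA'
      · exact hD' X hX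
    · intro Φ q hX
      rcases List.mem_cons.1 hX with hX | hX
      · exact hQA Φ q hX.symm
      · exact hQ' Φ q hX

theorem sameRoot_of_equivalentRoot {Q : Set K[T;T⁻¹]}
    (hQ : ∀ Φ : FrobeniusBlock K, Φ.HasStarRoot → ∀ l l' : List K[T;T⁻¹], (∀ q ∈ l, q ∈ Q) →
      (∀ q ∈ l', q ∈ Q) → Φ.HermEquivalent l l' → l.Perm l')
    {D D' : List (Summand K)} (hD : IsCanonicalWith Q D) (hD' : IsCanonicalWith Q D')
    (h : EquivalentRoot D D') : SameRoot D D' := by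
  classical
  rw [SameRoot, List.perm_iff_count]
  rintro ⟨Φ, q⟩
  rw [count_rootData?, count_rootData?]
  by_cases hΦ : Φ.HasStarRoot
  · exact (hQ Φ hΦ _ _ (fun q hq => hD.2 Φ q (mem_filterMap_rootFunction?.1 hq))
      (fun q hq => hD'.2 Φ q (mem_filterMap_rootFunction?.1 hq)) (h Φ)).count_eq q
  · rw [List.count_eq_zero.2 fun hq => hΦ (hD.1 _ (mem_filterMap_rootFunction?.1 hq)).1,
      List.count_eq_zero.2 fun hq => hΦ (hD'.1 _ (mem_filterMap_rootFunction?.1 hq)).1]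

/-- A set of functions that represents every Hermitian form in a unique way gives a canonical form
with unique summands. -/
theorem canonicalWith_of_forall (hchar : (2 : K) ≠ 0)
    (hR : ∀ Φ : FrobeniusBlock K, Φ.HasStarRoot → Φ.IsStarRoot (R Φ)) {Q : Set K[T;T⁻¹]}
    (hQ : ∀ (Φ : FrobeniusBlock K) q, (Summand.root Φ q).Admissible →
      ∃ q' ∈ Q, (Summand.root Φ q').Admissible ∧ Φ.HermEquivalent [q] [q'])
    (hQ' : ∀ Φ : FrobeniusBlock K, Φ.HasStarRoot → ∀ l l' : List K[T;T⁻¹], (∀ q ∈ l, q ∈ Q) →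
      (∀ q ∈ l', q ∈ Q) → Φ.HermEquivalent l l' → l.Perm l')
    {V : Type*} [AddCommGroup V] [Module K V] [FiniteDimensional K V]
    (B : V →ₗ⋆[K] V →ₗ[K] K) :
    (∃ D, IsCanonicalWith Q D ∧ HasMatrix B (directSum R D)) ∧
      (∀ D D', IsCanonicalWith Q D → IsCanonicalWith Q D' → HasMatrix B (directSum R D) →
        (HasMatrix B (directSum R D') ↔ SameJordan D D' ∧ SameSkew D D' ∧ SameRoot D D')) := by
  constructor
  · obtain ⟨D, hD, hB⟩ := exists_directSum hchar hR B
    obtain ⟨D', hD', h⟩ := exists_directSum_with hchar hR hQ D hD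
    exact ⟨D', hD', hB.congr h⟩
  · intro D D' hD hD' hB
    constructor
    · intro hB'
      obtain ⟨hJ, hS, hE⟩ := same_of_hasMatrix hchar hR hD.1 hD'.1 hB hB'
      exact ⟨hJ, hS, sameRoot_of_equivalentRoot hQ' hD hD' hE⟩
    · rintro ⟨hJ, hS, hE⟩
      exact hB.congr (mcong_of_sameRoot hD.1 hJ hS hE)

end SpecialFunctions

/-- In even positive degree the index r is at least 1, so the top coefficient of a constant is 0,
which satisfies all three conditions. -/
theorem isStationaryFunction_C {p : K[X]} (hp : 0 < p.natDegree) {a : K} (ha : star a = a) :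
    IsStationaryFunction p (LaurentPolynomial.C a) := by
  have hC : ∀ i : ℤ, (LaurentPolynomial.C a).coeff i = if 0 = i then a else 0 := by
    intro i
    rw [← LaurentPolynomial.single_eq_C, AddMonoidAlgebra.coeff_single, Finsupp.single_apply]
  have h0 : ∀ i : ℤ, i ≠ 0 → (LaurentPolynomial.C a).coeff i = 0 := fun i hi => by
    rw [hC, if_neg hi.symm]
  have h1 : Even p.natDegree → (LaurentPolynomial.C a).coeff ((p.natDegree / 2 : ℕ) : ℤ) = 0 := by
    rintro ⟨k, hk⟩
    apply h0
    omega
  refine ⟨fun i => ?_, fun i hi => h0 i (by omega), fun h _ => h1 h, fun h _ _ => ?_, fun h _ _ => ?_⟩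
  · by_cases hi : i = 0
    · subst hi
      rw [neg_zero, hC, if_pos rfl, ha]
    · rw [h0 i hi, h0 (-i) (neg_ne_zero.2 hi), star_zero]
  · rw [h1 h, star_zero]
  · rw [h1 h, star_zero, neg_zero]

namespace FrobeniusBlock

variable {Φ : FrobeniusBlock K}

theorem evalKappa_one (h : Φ.SelfDual) : Φ.evalKappa 1 = 1 := by
  rw [evalKappa_eq h, map_one]

theorem evalKappa_neg_one (h : Φ.SelfDual) : Φ.evalKappa (-1) = -1 := by
  rw [evalKappa_eq h, map_neg, map_one]

theorem root_one_admissible (hΦ : Φ.HasStarRoot) : (Summand.root Φ 1).Admissible := by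
  refine ⟨hΦ, one_ne_zero, ?_⟩
  rw [← map_one LaurentPolynomial.C]
  exact isStationaryFunction_C Φ.natDegree_p_pos (star_one K)

theorem root_neg_one_admissible (hΦ : Φ.HasStarRoot) : (Summand.root Φ (-1)).Admissible := by
  refine ⟨hΦ, neg_ne_zero.2 one_ne_zero, ?_⟩
  rw [← map_one LaurentPolynomial.C, ← map_neg]
  exact isStationaryFunction_C Φ.natDegree_p_pos (by simp)

theorem hermEquivalent_singleton {q q' : K[T;T⁻¹]} {c : Φ.ResidueField} (hc : c ≠ 0)
    (h : Φ.evalKappa q = Φ.evalKappa q' * Φ.involution c * c) : Φ.HermEquivalent [q] [q'] := by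
  refine ⟨LinearEquiv.smulOfNeZero Φ.ResidueField (Fin 1 → Φ.ResidueField) c hc, fun x y => ?_⟩
  change ∑ i : Fin 1, Φ.evalKappa ([q'].get i) * Φ.involution (c • x i) * (c • y i) =
    ∑ i : Fin 1, Φ.evalKappa ([q].get i) * Φ.involution (x i) * y i
  rw [Fin.sum_univ_one, Fin.sum_univ_one]
  change Φ.evalKappa q' * _ * _ = Φ.evalKappa q * _ * _
  rw [h, smul_eq_mul, smul_eq_mul, map_mul]
  ring

theorem HermEquivalent.length_eq {l l' : List K[T;T⁻¹]} (h : Φ.HermEquivalent l l') :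
    l.length = l'.length := by
  obtain ⟨S, -⟩ := h
  have := S.finrank_eq
  rwa [Module.finrank_fin_fun, Module.finrank_fin_fun] at this

theorem HermEquivalent.symm {l l' : List K[T;T⁻¹]} (h : Φ.HermEquivalent l l') :
    Φ.HermEquivalent l' l := by
  obtain ⟨S, hS⟩ := h
  refine ⟨S.symm, fun x y => ?_⟩
  rw [← hS, S.apply_symm_apply, S.apply_symm_apply]

end FrobeniusBlock

/-! ### Positive involutions and the law of inertia -/

/-- Every fixed element is up to the sign of the form `c° c`, and the form `∑ xᵢ° xᵢ` is
anisotropic. -/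
structure IsPositiveInvolution {F : Type*} [Field F] (ν : F →+* F) : Prop where
  exists_norm : ∀ a, ν a = a → ∃ c, a = ν c * c ∨ a = -(ν c * c)
  anisotropic : ∀ (s : Multiset F), (s.map fun c => ν c * c).sum = 0 → ∀ c ∈ s, c = 0

/-- A square root i of -1 satisfies ν(i) = -i: if it were fixed, a square root z of a nonzero b -
ν(b) would satisfy ν(z) = ±iz and hence ν(ν(z)) = -z. As every element is a square, norms are
squares of fixed elements, and t² + u² = ν(t + iu)(t + iu) for fixed t, u, so sums of norms are
norms. A nontrivial zero of a sum of norms would make -1 the square of a fixed element, but its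
square roots ±i are not fixed. Finally, a fixed z² has ν(z) = ±z, so it is a norm up to sign. -/
theorem isPositiveInvolution_of_isSquare {F : Type*} [Field F] (h2 : (2 : F) ≠ 0) {ν : F →+* F}
    (hν : ∀ a, ν (ν a) = a) (hne : ∃ a, ν a ≠ a) (hsq : ∀ a : F, IsSquare a) :
    IsPositiveInvolution ν := by
  obtain ⟨i, hi⟩ := hsq (-1)
  have hself : ∀ z : F, z = -z → z = 0 := by
    intro z hz
    have : 2 * z = 0 := by linear_combination hz
    exact (mul_eq_zero.1 this).resolve_left h2
  have hi0 : i ≠ 0 := by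
    rintro rfl
    simp at hi
  have hνi : ν i = -i := by
    have h1 : ν i * ν i = i * i := by rw [← map_mul, ← hi, map_neg, map_one]
    rcases mul_self_eq_mul_self_iff.1 h1 with h1 | h1
    · exfalso
      obtain ⟨b, hb⟩ := hne
      obtain ⟨z, hz⟩ := hsq (b - ν b)
      have h3 : ν z * ν z = (i * z) * (i * z) := by
        rw [← map_mul, ← hz, map_sub, hν]
        linear_combination (z * z) * hi - hz
      have h4 : ν (ν z) = -z := by
        rcases mul_self_eq_mul_self_iff.1 h3 with h4 | h4
        · rw [h4, map_mul, h1, h4]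
          linear_combination -z * hi
        · rw [h4, map_neg, map_mul, h1, h4]
          linear_combination -z * hi
      rw [hν] at h4
      rw [hself z h4, mul_zero, sub_eq_zero] at hz
      exact hb hz.symm
    · exact h1
  have hnorm : ∀ c, ∃ t, ν t = t ∧ ν c * c = t * t := by
    intro c
    obtain ⟨w, hw⟩ := hsq c
    refine ⟨ν w * w, by rw [map_mul, hν, mul_comm], ?_⟩
    rw [hw, map_mul]
    ring
  have hadd : ∀ c d, ∃ e, ν c * c + ν d * d = ν e * e := by
    intro c d
    obtain ⟨t, ht, hct⟩ := hnorm c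
    obtain ⟨u, hu, hdu⟩ := hnorm d
    refine ⟨t + i * u, ?_⟩
    rw [hct, hdu, map_add, map_mul, ht, hu, hνi]
    linear_combination (-u * u) * hi
  have hsum : ∀ s : Multiset F, ∃ e, (s.map fun c => ν c * c).sum = ν e * e := by
    intro s
    induction s using Multiset.induction with
    | empty => exact ⟨0, by simp⟩
    | cons a s ih =>
      obtain ⟨e, he⟩ := ih
      rw [Multiset.map_cons, Multiset.sum_cons, he]
      exact hadd a e
  refine ⟨fun a ha => ?_, fun s hs c hc => ?_⟩
  · obtain ⟨z, rfl⟩ := hsq a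
    rw [map_mul] at ha
    refine ⟨z, ?_⟩
    rcases mul_self_eq_mul_self_iff.1 ha with h | h
    · left; rw [h]
    · right; rw [h]; ring
  · by_contra hc0
    obtain ⟨t, rfl⟩ := Multiset.exists_cons_of_mem hc
    obtain ⟨e, he⟩ := hsum t
    rw [Multiset.map_cons, Multiset.sum_cons, he] at hs
    obtain ⟨u, hu, hdu⟩ := hnorm (e / c)
    have h1 : u * u = i * i := by
      rw [← hdu, ← hi, map_div₀]
      have : ν c ≠ 0 := (map_ne_zero ν).2 hc0
      field_simp
      linear_combination hs
    rcases mul_self_eq_mul_self_iff.1 h1 with h | h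
    · rw [h] at hu
      exact hi0 (hself i (hu.symm.trans hνi))
    · rw [h, map_neg, hνi, neg_neg] at hu
      exact hi0 (hself i hu)

namespace FrobeniusBlock

variable {Φ : FrobeniusBlock K}

theorem card_get_eq {α : Type*} [DecidableEq α] (l : List α) (a : α) :
    Fintype.card {i : Fin l.length // l.get i = a} = l.count a := by
  have h1 : Multiset.map l.get Finset.univ.val = (l : Multiset α) := by
    rw [Fin.univ_val_map, List.ofFn_get]
  rw [← Multiset.coe_count, ← h1, Multiset.count_map, Fintype.card_subtype, Finset.card_def,
    Finset.filter_val]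
  congr 2
  funext i
  exact propext eq_comm

/-- Take a vector supported on the positive coordinates of the first form whose image has no
positive coordinates. Its length is at once a sum of norms and minus a sum of norms, so it is zero
by anisotropy. The positive part of the first space therefore embeds into that of the second. -/
theorem HermEquivalent.count_le [DecidableEq K[T;T⁻¹]] (hpos : IsPositiveInvolution Φ.involution) (h : Φ.SelfDual)
    {l l' : List K[T;T⁻¹]} (hl' : ∀ q ∈ l', q ∈ ({1, -1} : Set K[T;T⁻¹]))
    (he : Φ.HermEquivalent l l') : l.count 1 ≤ l'.count 1 := by
  obtain ⟨S, hS⟩ := he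
  rw [← card_get_eq, ← card_get_eq]
  let f : ({i : Fin l.length // l.get i = 1} → Φ.ResidueField) →ₗ[Φ.ResidueField]
      ({i : Fin l'.length // l'.get i = 1} → Φ.ResidueField) :=
    LinearMap.funLeft Φ.ResidueField Φ.ResidueField Subtype.val ∘ₗ S.toLinearMap ∘ₗ
      Function.ExtendByZero.linearMap Φ.ResidueField Subtype.val
  have hf : Function.Injective f := by
    rw [injective_iff_map_eq_zero]
    intro x hx
    obtain ⟨u, hu⟩ : ∃ u, u = Function.ExtendByZero.linearMap Φ.ResidueField
      (Subtype.val : {i : Fin l.length // l.get i = 1} → _) x := ⟨_, rfl⟩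
    have hux : ∀ i : {i : Fin l.length // l.get i = 1}, u i.1 = x i := by
      intro i
      rw [hu]
      exact Subtype.val_injective.extend_apply x 0 i
    have hu0 : ∀ i, l.get i ≠ 1 → u i = 0 := by
      intro i hi
      rw [hu]
      exact Function.extend_apply' _ _ _ (by rintro ⟨j, rfl⟩; exact hi j.2)
    have hw0 : ∀ i, l'.get i = 1 → S u i = 0 := by
      intro i hi
      have := congrFun hx ⟨i, hi⟩
      rw [hu]
      exact this
    have h1 : Φ.hermForm l u u = ∑ i, Φ.involution (u i) * u i := by
      refine Finset.sum_congr rfl fun i _ => ?_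
      by_cases hi : l.get i = 1
      · rw [hi, evalKappa_one h, one_mul]
      · rw [hu0 i hi, mul_zero, mul_zero]
    have h2 : Φ.hermForm l' (S u) (S u) = -∑ i, Φ.involution (S u i) * S u i := by
      rw [← Finset.sum_neg_distrib]
      refine Finset.sum_congr rfl fun i _ => ?_
      by_cases hi : l'.get i = 1
      · rw [hw0 i hi, mul_zero, mul_zero, neg_zero]
      · rw [show l'.get i = -1 from (hl' _ (List.get_mem _ _)).resolve_left hi,
          evalKappa_neg_one h]
        ring
    have h3 := hpos.anisotropic (Finset.univ.val.map u + Finset.univ.val.map (S u)) (by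
      have h4 := hS u u
      rw [h1, h2] at h4
      rw [Multiset.map_add, Multiset.sum_add, Multiset.map_map, Multiset.map_map]
      change ∑ i, Φ.involution (u i) * u i + ∑ i, Φ.involution (S u i) * S u i = 0
      rw [← h4, neg_add_cancel])
    funext i
    rw [← hux i]
    exact h3 _ (Multiset.mem_add.2 (Or.inl (Multiset.mem_map.2 ⟨i.1, by simp, rfl⟩)))
  have := LinearMap.finrank_le_finrank_of_injective hf
  rwa [Module.finrank_fintype_fun_eq_card, Module.finrank_fintype_fun_eq_card] at this

/-- The law of inertia. -/
theorem HermEquivalent.perm (hpos : IsPositiveInvolution Φ.involution) (h : Φ.SelfDual)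
    {l l' : List K[T;T⁻¹]} (hl : ∀ q ∈ l, q ∈ ({1, -1} : Set K[T;T⁻¹]))
    (hl' : ∀ q ∈ l', q ∈ ({1, -1} : Set K[T;T⁻¹])) (he : Φ.HermEquivalent l l') : l.Perm l' := by
  classical
  have h1 : l.count 1 = l'.count 1 :=
    le_antisymm (he.count_le hpos h hl') (he.symm.count_le hpos h hl)
  have key : ∀ l : List K[T;T⁻¹], (∀ q ∈ l, q ∈ ({1, -1} : Set K[T;T⁻¹])) →
      l.Perm (List.replicate (l.count 1) 1 ++ List.replicate (l.length - l.count 1) (-1)) := by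
    intro l hl
    have h2 := List.filter_append_perm (fun q => q = 1) l
    have h3 : l.filter (fun q => decide (q = 1)) = List.replicate (l.count 1) 1 := by
      rw [← List.filter_eq]
    have h4 : l.filter (fun q => !decide (q = 1)) = List.replicate (l.length - l.count 1) (-1) := by
      rw [List.eq_replicate_iff]
      constructor
      · have := h2.length_eq
        rw [List.length_append, h3, List.length_replicate] at this
        omega
      · intro q hq
        rw [List.mem_filter] at hq
        exact (hl q hq.1).resolve_left (by simpa using hq.2)
    rw [h3, h4] at h2
    exact h2.symm
  have h5 := key l' hl'
  rw [← h1, ← he.length_eq] at h5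
  exact (key l hl).trans h5.symm

theorem exists_sign_hermEquivalent (hchar : (2 : K) ≠ 0)
    (hpos : IsPositiveInvolution Φ.involution) {q : K[T;T⁻¹]}
    (hq : (Summand.root Φ q).Admissible) :
    ∃ q' ∈ ({1, -1} : Set K[T;T⁻¹]), (Summand.root Φ q').Admissible ∧
      Φ.HermEquivalent [q] [q'] := by
  have h := hq.1.selfDual
  have hq0 := evalKappa_ne_zero hchar h hq.2.1 hq.2.2
  obtain ⟨c, hc⟩ := hpos.exists_norm _ (involution_evalKappa h hq.2.2.symm)
  have hc0 : c ≠ 0 := by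
    rintro rfl
    apply hq0
    simpa using hc
  rcases hc with hc | hc
  · exact ⟨1, by simp, root_one_admissible hq.1,
      hermEquivalent_singleton hc0 (by rw [evalKappa_one h, one_mul, hc])⟩
  · exact ⟨-1, by simp, root_neg_one_admissible hq.1,
      hermEquivalent_singleton hc0 (by rw [evalKappa_neg_one h, hc]; ring)⟩

theorem of_surjective_of_isAlgClosed [IsAlgClosed K] (Φ : FrobeniusBlock K) :
    Function.Surjective (AdjoinRoot.of Φ.p) := by
  have : Module.Finite K Φ.ResidueField := Φ.monic.finite_adjoinRoot
  exact (IsAlgClosed.algebraMap_bijective_of_isIntegral (k := K) (K := Φ.ResidueField)).2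

theorem isPositiveInvolution_of_isAlgClosed [IsAlgClosed K] (hchar : (2 : K) ≠ 0)
    (hK : ¬ TrivialInvolution K) (h : Φ.SelfDual) : IsPositiveInvolution Φ.involution := by
  refine isPositiveInvolution_of_isSquare (two_ne_zero_residue hchar) (involution_involution h) ?_ ?_
  · obtain ⟨a, ha⟩ := not_forall.1 hK
    refine ⟨AdjoinRoot.of Φ.p a, fun h1 => ha ?_⟩
    rw [involution_of h] at h1
    exact (AdjoinRoot.of Φ.p).injective h1
  · intro a
    obtain ⟨b, rfl⟩ := Φ.of_surjective_of_isAlgClosed a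
    obtain ⟨c, hc⟩ := IsAlgClosed.exists_pow_nat_eq b (n := 2) two_pos
    exact ⟨AdjoinRoot.of Φ.p c, by rw [← map_mul, ← pow_two, hc]⟩

theorem hermEquivalent_one_of_isAlgClosed [IsAlgClosed K] (hchar : (2 : K) ≠ 0)
    (hK : TrivialInvolution K) {q : K[T;T⁻¹]} (hq : (Summand.root Φ q).Admissible) :
    Φ.HermEquivalent [q] [1] := by
  have h := hq.1.selfDual
  have hq0 := evalKappa_ne_zero hchar h hq.2.1 hq.2.2
  obtain ⟨b, hb⟩ := Φ.of_surjective_of_isAlgClosed (Φ.evalKappa q)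
  obtain ⟨c, hc⟩ := IsAlgClosed.exists_pow_nat_eq b (n := 2) two_pos
  have hqc : Φ.evalKappa q = AdjoinRoot.of Φ.p c * AdjoinRoot.of Φ.p c := by
    rw [← hb, ← hc, pow_two, map_mul]
  refine hermEquivalent_singleton (c := AdjoinRoot.of Φ.p c) ?_ ?_
  · intro h0
    exact hq0 (by rw [hqc, h0, zero_mul])
  · rw [evalKappa_one h, one_mul, involution_of h, hK c, hqc]

end FrobeniusBlock

/-! ### Finite extensions of real closed fields -/

section RealClosed

variable {K : Type u} [Field K]

/-- Dividing by the square of a nonzero term would present -1 as a sum of squares. -/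
theorem eq_zero_of_sum_mul_self_eq_zero [IsSemireal K] (s : Multiset K)
    (h : (s.map fun c => c * c).sum = 0) : ∀ c ∈ s, c = 0 := by
  intro c hc
  by_contra hc0
  obtain ⟨t, rfl⟩ := Multiset.exists_cons_of_mem hc
  rw [Multiset.map_cons, Multiset.sum_cons] at h
  have h1 : ∀ t : Multiset K, IsSumSq (t.map fun d => (d / c) * (d / c)).sum := by
    intro t
    induction t using Multiset.induction with
    | empty => simp
    | cons a t ih =>
      rw [Multiset.map_cons, Multiset.sum_cons]
      exact .sq_add _ ih
  refine IsSemireal.one_add_ne_zero (h1 t) ?_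
  have h2 : (t.map fun d => (d / c) * (d / c)).sum = (t.map fun d => d * d).sum / (c * c) := by
    rw [div_eq_mul_inv, ← Multiset.sum_map_mul_right]
    congr 1
    refine Multiset.map_congr rfl fun d _ => ?_
    field_simp
  rw [h2]
  generalize (t.map fun d => d * d).sum = w at h
  field_simp
  linear_combination h

theorem eq_zero_of_mul_self_add_mul_self [IsSemireal K] {a b : K} (h : a * a + b * b = 0) :
    a = 0 ∧ b = 0 := by
  have := eq_zero_of_sum_mul_self_eq_zero {a, b} (by simpa using h)
  exact ⟨this a (by simp), this b (by simp)⟩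

theorem isSquare_mul_self_add_mul_self [IsRealClosed K] (a b : K) : IsSquare (a * a + b * b) := by
  rcases IsRealClosed.isSquare_or_isSquare_neg (a * a + b * b) with h | ⟨t, ht⟩
  · exact h
  · have := eq_zero_of_sum_mul_self_eq_zero {a, b, t} (by
      simp only [Multiset.insert_eq_cons, Multiset.map_cons, Multiset.map_singleton,
        Multiset.sum_cons, Multiset.sum_singleton]
      linear_combination -ht)
    rw [this a (by simp), this b (by simp)]
    exact ⟨0, by simp⟩

/-- Every element of `K(√-1)` is a square. -/
theorem isSquare_add_mul_of_isRealClosed [IsRealClosed K] {M : Type*} [Field M] [Algebra K M]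
    {i : M} (hi : i * i = -1) (a b : K) : IsSquare (algebraMap K M a + algebraMap K M b * i) := by
  have h2 : (2 : K) ≠ 0 := two_ne_zero
  by_cases hb : b = 0
  · subst hb
    rw [map_zero, zero_mul, add_zero]
    rcases IsRealClosed.isSquare_or_isSquare_neg a with ⟨c, hc⟩ | ⟨c, hc⟩
    · exact ⟨algebraMap K M c, by rw [hc, map_mul]⟩
    · refine ⟨algebraMap K M c * i, ?_⟩
      have h1 := congrArg (algebraMap K M) hc
      rw [map_neg, map_mul] at h1
      linear_combination -h1 - (algebraMap K M c * algebraMap K M c) * hi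
  obtain ⟨r, hr⟩ := isSquare_mul_self_add_mul_self a b
  -- Half-angle formula: the root is c + di with c² = (a + r)/2 and d = b/(2c).
  have key : ∀ r : K, a * a + b * b = r * r → IsSquare ((a + r) / 2) →
      IsSquare (algebraMap K M a + algebraMap K M b * i) := by
    rintro r hr ⟨c, hc⟩
    have hc0 : c ≠ 0 := by
      rintro rfl
      have h1 : a + r = 0 := by
        rw [mul_zero, div_eq_zero_iff] at hc
        exact hc.resolve_right h2
      apply hb
      have : b * b = 0 := by linear_combination hr - (a - r) * h1
      exact mul_self_eq_zero.1 this
    have hr2 : r = 2 * (c * c) - a := by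
      field_simp at hc
      linear_combination hc
    obtain ⟨d, hd⟩ : ∃ d, b = 2 * c * d := ⟨b / (2 * c), by field_simp⟩
    have ha : a = c * c - d * d := by
      rw [hr2, hd] at hr
      have : (4 * (c * c)) * (a - (c * c - d * d)) = 0 := by linear_combination hr
      rcases mul_eq_zero.1 this with h3 | h3
      · exact absurd h3 (mul_ne_zero (by norm_num) (mul_ne_zero hc0 hc0))
      · linear_combination h3
    refine ⟨algebraMap K M c + algebraMap K M d * i, ?_⟩
    rw [ha, hd]
    simp only [map_sub, map_mul, map_ofNat]
    linear_combination (-(algebraMap K M d * algebraMap K M d)) * hi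
  -- One of (a + r)/2 and (a - r)/2 is a square. Otherwise both are negatives of squares, and their
  -- product -b²/4 would be a square although b is nonzero.
  rcases IsRealClosed.isSquare_or_isSquare_neg ((a + r) / 2) with h | ⟨t, ht⟩
  · exact key r hr h
  rcases IsRealClosed.isSquare_or_isSquare_neg ((a + -r) / 2) with h | ⟨u, hu⟩
  · exact key (-r) (by rw [hr]; ring) h
  exfalso
  apply hb
  have h1 : (2 * (t * u)) * (2 * (t * u)) + b * b = 0 := by
    have : (2 * (t * u)) * (2 * (t * u)) = 4 * ((t * t) * (u * u)) := by ring
    rw [this, ← ht, ← hu]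
    field_simp
    linear_combination 4 * hr
  exact (eq_zero_of_mul_self_add_mul_self h1).2

/-- The minimal polynomial of a primitive element has odd degree, so it has a root and, being
irreducible, is linear. -/
theorem finrank_eq_one_of_odd [IsRealClosed K] {L : Type*} [Field L] [Algebra K L]
    [FiniteDimensional K L] (h : Odd (Module.finrank K L)) : Module.finrank K L = 1 := by
  obtain ⟨α, hα⟩ := Field.exists_primitive_element K L
  have hdeg : (minpoly K α).natDegree = Module.finrank K L :=
    (Field.primitive_element_iff_minpoly_natDegree_eq K α).1 hα
  rw [← hdeg] at h ⊢
  obtain ⟨x, hx⟩ := IsRealClosed.exists_isRoot_of_odd_natDegree h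
  have := degree_eq_one_of_irreducible_of_root (minpoly.irreducible (Algebra.IsIntegral.isIntegral α)) hx
  exact natDegree_eq_of_degree_eq_some this

/-- The fixed field of a Sylow 2-subgroup of the Galois group has odd degree over the base and so
coincides with it; the whole group is then a 2-group. -/
theorem exists_finrank_eq_two_pow [IsRealClosed K] (M : Type*) [Field M] [Algebra K M]
    [FiniteDimensional K M] [IsGalois K M] : ∃ n, Module.finrank K M = 2 ^ n := by
  have : Fact (Nat.Prime 2) := ⟨Nat.prime_two⟩
  obtain ⟨P⟩ : Nonempty (Sylow 2 (M ≃ₐ[K] M)) := inferInstance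
  have h1 := IntermediateField.finrank_fixedField_eq_card (F := K) (E := M) (P : Subgroup (M ≃ₐ[K] M))
  have h2 := Module.finrank_mul_finrank K (IntermediateField.fixedField (P : Subgroup (M ≃ₐ[K] M))) M
  have h3 := IsGalois.card_aut_eq_finrank K M
  have h4 := Subgroup.card_mul_index (P : Subgroup (M ≃ₐ[K] M))
  have h5 : Module.finrank K (IntermediateField.fixedField (P : Subgroup (M ≃ₐ[K] M))) =
      (P : Subgroup (M ≃ₐ[K] M)).index := by
    have hpos : 0 < Nat.card (P : Subgroup (M ≃ₐ[K] M)) := Nat.card_pos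
    rw [h1, ← h3, ← h4, mul_comm] at h2
    exact Nat.eq_of_mul_eq_mul_left hpos h2
  have h6 : Odd (Module.finrank K (IntermediateField.fixedField (P : Subgroup (M ≃ₐ[K] M)))) := by
    rw [h5, ← Nat.not_even_iff_odd, even_iff_two_dvd]
    exact P.not_dvd_index
  rw [finrank_eq_one_of_odd h6, one_mul, h1] at h2
  rw [← h2]
  exact IsPGroup.iff_card.1 P.isPGroup'

/-- When discriminants are squares, the quadratic formula places every element of a quadratic
extension in the base field. -/
theorem finrank_ne_two_of_isSquare {C L : Type*} [Field C] [Field L] [Algebra C L]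
    [FiniteDimensional C L] (h2 : (2 : C) ≠ 0) (hsq : ∀ a : C, IsSquare a) :
    Module.finrank C L ≠ 2 := by
  intro hL
  have hsurj : Function.Surjective (algebraMap C L) := by
    intro θ
    have hle := minpoly.natDegree_le (A := C) θ
    have hint : IsIntegral C θ := Algebra.IsIntegral.isIntegral θ
    have hmonic := minpoly.monic hint
    have hpos := minpoly.natDegree_pos hint
    have haev := minpoly.aeval C θ
    have h2L : (2 : L) ≠ 0 := by
      rw [← map_ofNat (algebraMap C L) 2]
      exact (_root_.map_ne_zero _).2 h2
    rw [hL] at hle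
    rw [aeval_eq_sum_range] at haev
    obtain hd | hd : (minpoly C θ).natDegree = 1 ∨ (minpoly C θ).natDegree = 2 := by omega
    · have hc : (minpoly C θ).coeff 1 = 1 := by rw [← hd]; exact hmonic
      rw [hd, Finset.sum_range_succ, Finset.sum_range_one, hc, pow_zero, pow_one, one_smul,
        Algebra.smul_def, mul_one] at haev
      exact ⟨-(minpoly C θ).coeff 0, by rw [map_neg]; linear_combination -haev⟩
    · have hc : (minpoly C θ).coeff 2 = 1 := by rw [← hd]; exact hmonic
      rw [hd, Finset.sum_range_succ, Finset.sum_range_succ, Finset.sum_range_one, hc, pow_zero,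
        pow_one, one_smul, Algebra.smul_def, Algebra.smul_def, mul_one] at haev
      obtain ⟨d, hd⟩ := hsq ((minpoly C θ).coeff 1 * (minpoly C θ).coeff 1 - 4 * (minpoly C θ).coeff 0)
      have hd' := congrArg (algebraMap C L) hd
      simp only [map_sub, map_mul, map_ofNat] at hd'
      set b := algebraMap C L ((minpoly C θ).coeff 1)
      have h3 : (2 * θ + b) * (2 * θ + b) = algebraMap C L d * algebraMap C L d := by
        rw [← hd']
        linear_combination 4 * haev
      rcases mul_self_eq_mul_self_iff.1 h3 with h4 | h4
      · refine ⟨(d - (minpoly C θ).coeff 1) / 2, ?_⟩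
        rw [map_div₀, map_sub, map_ofNat, div_eq_iff h2L]
        linear_combination -h4
      · refine ⟨(-d - (minpoly C θ).coeff 1) / 2, ?_⟩
        rw [map_div₀, map_sub, map_neg, map_ofNat, div_eq_iff h2L]
        linear_combination -h4
  have := (LinearMap.range_eq_top (f := Algebra.linearMap C L)).2 hsurj
  have h5 := LinearMap.finrank_range_le (Algebra.linearMap C L)
  rw [this, finrank_top, hL, Module.finrank_self] at h5
  omega

/-- A nontrivial 2-group has a subgroup of index 2, whose fixed field would be a quadratic
extension. -/
theorem finrank_eq_one_of_isSquare {C M : Type*} [Field C] [Field M] [Algebra C M]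
    [FiniteDimensional C M] [IsGalois C M] (h2 : (2 : C) ≠ 0) (hsq : ∀ a : C, IsSquare a) {n : ℕ}
    (hn : Module.finrank C M = 2 ^ n) : Module.finrank C M = 1 := by
  rcases n with _ | n
  · simpa using hn
  exfalso
  have : Fact (Nat.Prime 2) := ⟨Nat.prime_two⟩
  have h3 := IsGalois.card_aut_eq_finrank C M
  obtain ⟨H, hH⟩ := Sylow.exists_subgroup_card_pow_prime (G := M ≃ₐ[C] M) 2 (n := n) (by
    rw [h3, hn, pow_succ]; exact dvd_mul_right _ _)
  have h1 := IntermediateField.finrank_fixedField_eq_card (F := C) (E := M) H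
  have h4 := Module.finrank_mul_finrank C (IntermediateField.fixedField H) M
  rw [h1, hH, hn, pow_succ, mul_comm] at h4
  exact finrank_ne_two_of_isSquare h2 hsq (Nat.eq_of_mul_eq_mul_left (by positivity) h4)

/-- A Galois extension of a real closed field that contains `√-1` is generated by it. -/
theorem exists_eq_add_mul_of_isRealClosed [IsRealClosed K] {M : Type*} [Field M] [Algebra K M]
    [FiniteDimensional K M] [IsGalois K M] {i : M} (hi : i * i = -1) (m : M) :
    ∃ a b : K, m = algebraMap K M a + algebraMap K M b * i := by
  have hmem : ∀ z ∈ IntermediateField.adjoin K {i}, ∃ a b : K,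
      z = algebraMap K M a + algebraMap K M b * i := by
    intro z hz
    rw [← IntermediateField.mem_toSubalgebra,
      IntermediateField.adjoin_simple_toSubalgebra_of_isAlgebraic (Algebra.IsAlgebraic.isAlgebraic i)]
      at hz
    induction hz using Algebra.adjoin_induction with
    | mem x hx => exact ⟨0, 1, by rw [Set.mem_singleton_iff.1 hx]; simp⟩
    | algebraMap r => exact ⟨r, 0, by simp⟩
    | add x y _ _ hx hy =>
      obtain ⟨a, b, rfl⟩ := hx
      obtain ⟨c, d, rfl⟩ := hy
      exact ⟨a + c, b + d, by simp only [map_add]; ring⟩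
    | mul x y _ _ hx hy =>
      obtain ⟨a, b, rfl⟩ := hx
      obtain ⟨c, d, rfl⟩ := hy
      refine ⟨a * c - b * d, a * d + b * c, ?_⟩
      simp only [map_add, map_mul, map_sub]
      linear_combination (algebraMap K M b * algebraMap K M d) * hi
  have hsq : ∀ z : IntermediateField.adjoin K {i}, IsSquare z := by
    rintro ⟨z, hz⟩
    obtain ⟨a, b, rfl⟩ := hmem z hz
    have hi' : (⟨i, IntermediateField.mem_adjoin_simple_self K i⟩ : IntermediateField.adjoin K {i}) *
        ⟨i, IntermediateField.mem_adjoin_simple_self K i⟩ = -1 := Subtype.ext hi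
    exact isSquare_add_mul_of_isRealClosed hi' a b
  obtain ⟨n, hn⟩ := exists_finrank_eq_two_pow (K := K) M
  have h1 := Module.finrank_mul_finrank K (IntermediateField.adjoin K {i}) M
  obtain ⟨j, -, hj⟩ := (Nat.dvd_prime_pow Nat.prime_two).1 (hn ▸ h1 ▸ dvd_mul_left _ _ :
    Module.finrank (IntermediateField.adjoin K {i}) M ∣ 2 ^ n)
  have h2 := finrank_eq_one_of_isSquare (two_ne_zero (α := IntermediateField.adjoin K {i})) hsq hj
  refine hmem m ?_
  have h3 := IntermediateField.finrank_eq_one_iff_eq_top.1 h2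
  rw [h3]
  exact IntermediateField.mem_top

/-- Every element of a proper finite extension of a real closed field is a square. -/
theorem isSquare_adjoinRoot_of_isRealClosed [IsRealClosed K] {p : K[X]} [Fact (Irreducible p)]
    (hm : p.Monic) (hp : 2 ≤ p.natDegree) (a : AdjoinRoot p) : IsSquare a := by
  -- The second factor puts a square root of -1 into the splitting field.
  let f : K[X] := p * (X ^ 2 + 1)
  let M := f.SplittingField
  have : IsGalois K M := { }
  have hX : (X ^ 2 + 1 : K[X]).natDegree = 2 := by compute_degree!
  have hX0 : (X ^ 2 + 1 : K[X]) ≠ 0 := ne_zero_of_natDegree_gt (n := 1) (by omega)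
  have hf0 : f.map (algebraMap K M) ≠ 0 := map_ne_zero (mul_ne_zero hm.ne_zero hX0)
  have hroot : ∀ g : K[X], g ∣ f → g.natDegree ≠ 0 → ∃ z : M, aeval z g = 0 := by
    intro g hg hdeg
    obtain ⟨z, hz⟩ := ((SplittingField.splits f).of_dvd hf0
      (map_dvd (algebraMap K M) hg)).exists_eval_eq_zero (by
        rw [degree_map]
        exact fun h => hdeg (natDegree_eq_of_degree_eq_some h))
    exact ⟨z, by rwa [eval_map_algebraMap] at hz⟩
  obtain ⟨i, hi⟩ := hroot (X ^ 2 + 1) (dvd_mul_left _ _) (by omega)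
  obtain ⟨z, hz⟩ := hroot p (dvd_mul_right _ _) (by omega)
  have hi' : i * i = -1 := by
    simp only [map_add, map_pow, aeval_X, map_one] at hi
    linear_combination hi
  have hgen := exists_eq_add_mul_of_isRealClosed (K := K) hi'
  let φ : AdjoinRoot p →ₐ[K] M := AdjoinRoot.liftAlgHom p (Algebra.ofId K M) z hz
  have hφ : Function.Injective φ := φ.toRingHom.injective
  have hdim : Module.finrank K M ≤ 2 := by
    let g : (Fin 2 → K) →ₗ[K] M := Fintype.linearCombination K ![1, i]
    have hg : Function.Surjective g := by
      intro m
      obtain ⟨a, b, rfl⟩ := hgen m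
      refine ⟨![a, b], ?_⟩
      simp [g, Fintype.linearCombination_apply, Algebra.smul_def]
    have := LinearMap.finrank_le_finrank_of_surjective hg
    rwa [Module.finrank_fin_fun] at this
  have hfin : Module.Finite K (AdjoinRoot p) := hm.finite_adjoinRoot
  have hdim' : Module.finrank K (AdjoinRoot p) = p.natDegree := by
    rw [(AdjoinRoot.powerBasis' hm).finrank, AdjoinRoot.powerBasis'_dim]
  -- The degrees satisfy 2 ≤ deg p ≤ [M : K] ≤ 2, so the embedding is onto.
  have hsurj : Function.Surjective φ := by
    refine (LinearMap.injective_iff_surjective_of_finrank_eq_finrank (f := φ.toLinearMap) ?_).1 hφ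
    have := LinearMap.finrank_le_finrank_of_injective (f := φ.toLinearMap) hφ
    omega
  obtain ⟨x, y, hxy⟩ := hgen (φ a)
  obtain ⟨w, hw⟩ := isSquare_add_mul_of_isRealClosed hi' x y
  obtain ⟨v, rfl⟩ := hsurj w
  exact ⟨v, hφ (by rw [map_mul, hxy, hw])⟩

end RealClosed

/-- The skew element a - ā or its negative is a square z², and then z² + z̄² = 0 forces z = 0. -/
theorem trivialInvolution_of_isRealClosed [IsRealClosed K] : TrivialInvolution K := by
  intro a
  by_contra ha
  have key : ∀ y : K, star y = -y → IsSquare y → y = 0 := by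
    rintro _ hy ⟨z, rfl⟩
    rw [star_mul'] at hy
    rw [(eq_zero_of_mul_self_add_mul_self (a := z) (b := star z) (by rw [hy]; ring)).1, zero_mul]
  apply ha
  rw [eq_comm, ← sub_eq_zero]
  rcases IsRealClosed.isSquare_or_isSquare_neg (a - star a) with h | h
  · exact key _ (by simp) h
  · exact neg_eq_zero.1 (key _ (by simp) h)

/-- In degree 1 the residue field is K with the identity, and positivity is that of sums of squares.
In higher degree every element is a square, and the involution is not the identity: κ = κ⁻¹ would
give κ = ±1 and make p linear. -/
theorem FrobeniusBlock.isPositiveInvolution_of_isRealClosed [IsRealClosed K] {Φ : FrobeniusBlock K}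
    (h : Φ.SelfDual) : IsPositiveInvolution Φ.involution := by
  have hchar : (2 : K) ≠ 0 := two_ne_zero
  have htriv := trivialInvolution_of_isRealClosed (K := K)
  have hpos := Φ.natDegree_p_pos
  obtain hd | hd : Φ.p.natDegree = 1 ∨ 2 ≤ Φ.p.natDegree := by omega
  · have hsurj : ∀ a, ∃ b, AdjoinRoot.of Φ.p b = a := by
      intro a
      obtain ⟨f, rfl⟩ := AdjoinRoot.mk_surjective a
      have h1 := natDegree_modByMonic_lt f Φ.monic (by intro h1; rw [h1] at hd; simp at hd)
      rw [hd, Nat.lt_one_iff] at h1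
      refine ⟨(f %ₘ Φ.p).coeff 0, ?_⟩
      have h2 : AdjoinRoot.mk Φ.p (C ((f %ₘ Φ.p).coeff 0)) = AdjoinRoot.mk Φ.p f := by
        rw [← eq_C_of_natDegree_eq_zero h1, AdjoinRoot.mk_eq_mk]
        exact ⟨-(f /ₘ Φ.p), by linear_combination modByMonic_add_div f Φ.p⟩
      rw [← h2, AdjoinRoot.mk_C]
    have hid : ∀ a, Φ.involution a = a := by
      intro a
      obtain ⟨b, rfl⟩ := hsurj a
      rw [involution_of h, htriv b]
    refine ⟨fun a _ => ?_, fun s hs c hc => ?_⟩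
    · obtain ⟨b, rfl⟩ := hsurj a
      rcases IsRealClosed.isSquare_or_isSquare_neg b with ⟨c, hc⟩ | ⟨c, hc⟩
      · exact ⟨AdjoinRoot.of Φ.p c, Or.inl (by rw [hid, ← map_mul, hc])⟩
      · exact ⟨AdjoinRoot.of Φ.p c, Or.inr (by rw [hid, ← map_mul, ← hc, map_neg, neg_neg])⟩
    · choose g hg using hsurj
      have h1 := eq_zero_of_sum_mul_self_eq_zero (s.map g) (by
        apply (AdjoinRoot.of Φ.p).injective
        rw [map_zero, ← hs, map_multiset_sum, Multiset.map_map, Multiset.map_map]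
        congr 1
        refine Multiset.map_congr rfl fun d _ => ?_
        simp only [Function.comp_apply, map_mul, hg, hid])
      rw [← hg c, h1 _ (Multiset.mem_map_of_mem g hc), map_zero]
  · refine isPositiveInvolution_of_isSquare (two_ne_zero_residue hchar) (involution_involution h) ?_
      (isSquare_adjoinRoot_of_isRealClosed Φ.monic hd)
    refine ⟨Φ.kappa, fun hκ => ?_⟩
    rw [involution_kappa h] at hκ
    have hκ0 : Φ.kappa ≠ 0 := by
      rw [← coe_kappaUnit h]
      exact Units.ne_zero _
    have h1 : Φ.kappa * Φ.kappa = 1 * 1 := by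
      nth_rewrite 1 [← hκ]
      rw [inv_mul_cancel₀ hκ0, mul_one]
    have key : ∀ c : K, Φ.kappa = AdjoinRoot.of Φ.p c → False := by
      intro c hc
      have h2 : AdjoinRoot.mk Φ.p (X - C c) = 0 := by
        rw [map_sub, AdjoinRoot.mk_X, AdjoinRoot.mk_C, ← hc, kappa, sub_self]
      have h3 := natDegree_le_of_dvd (AdjoinRoot.mk_eq_zero.1 h2) (X_sub_C_ne_zero c)
      rw [natDegree_X_sub_C] at h3
      omega
    rcases mul_self_eq_mul_self_iff.1 h1 with h2 | h2
    · exact key 1 (by rw [h2, map_one])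
    · exact key (-1) (by rw [h2, map_neg, map_one])

end SesqCanon

end

/-! ### The canonical form of a sesquilinear form -/

open SesqCanon in
theorem theorem3 {K V : Type*} [Field K] [StarRing K] (hchar : ringChar K ≠ 2)
    [AddCommGroup V] [Module K V] [FiniteDimensional K V]
    (B : V →ₗ⋆[K] V →ₗ[K] K)
    (R : ∀ Φ : FrobeniusBlock K, Matrix (Fin Φ.dim) (Fin Φ.dim) K)
    (hR : ∀ Φ : FrobeniusBlock K, Φ.HasStarRoot → Φ.IsStarRoot (R Φ)) :
    (∃ D, IsCanonical D ∧ HasMatrix B (directSum R D)) ∧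
    (∀ D D', IsCanonical D → IsCanonical D' → HasMatrix B (directSum R D) →
      (HasMatrix B (directSum R D') ↔
        SameJordan D D' ∧ SameSkew D D' ∧ EquivalentRoot D D')) ∧
    (IsAlgClosed K → TrivialInvolution K →
      (∃ D, IsCanonicalWith {1} D ∧ HasMatrix B (directSum R D)) ∧
      (∀ D D', IsCanonicalWith {1} D → IsCanonicalWith {1} D' → HasMatrix B (directSum R D) →
        (HasMatrix B (directSum R D') ↔
          SameJordan D D' ∧ SameSkew D D' ∧ SameRoot D D'))) ∧
    ((IsAlgClosed K ∧ ¬ TrivialInvolution K) ∨ IsRealClosed K →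
      (∃ D, IsCanonicalWith {1, -1} D ∧ HasMatrix B (directSum R D)) ∧
      (∀ D D', IsCanonicalWith {1, -1} D → IsCanonicalWith {1, -1} D' →
        HasMatrix B (directSum R D) →
        (HasMatrix B (directSum R D') ↔
          SameJordan D D' ∧ SameSkew D D' ∧ SameRoot D D'))) := by
  have h2 : (2 : K) ≠ 0 := Ring.two_ne_zero hchar
  refine ⟨exists_directSum h2 hR B, fun D D' hD hD' hB => hasMatrix_iff_same h2 hR hD hD' hB,
    fun _ htriv => ?_, fun hK => ?_⟩
  · refine canonicalWith_of_forall h2 hR (fun Φ q hq => ?_) (fun Φ hΦ l l' hl hl' he => ?_) B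
    · exact ⟨1, rfl, FrobeniusBlock.root_one_admissible hq.1,
        FrobeniusBlock.hermEquivalent_one_of_isAlgClosed h2 htriv hq⟩
    · rw [List.eq_replicate_of_mem hl, List.eq_replicate_of_mem hl', he.length_eq]
  · have hpos : ∀ Φ : FrobeniusBlock K, Φ.HasStarRoot → IsPositiveInvolution Φ.involution := by
      intro Φ hΦ
      rcases hK with ⟨_, hne⟩ | _
      · exact FrobeniusBlock.isPositiveInvolution_of_isAlgClosed h2 hne hΦ.selfDual
      · exact FrobeniusBlock.isPositiveInvolution_of_isRealClosed hΦ.selfDual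
    exact canonicalWith_of_forall h2 hR
      (fun Φ q hq => FrobeniusBlock.exists_sign_hermEquivalent h2 (hpos Φ hq.1) hq)
      (fun Φ hΦ l l' hl hl' he => he.perm (hpos Φ hΦ) hΦ.selfDual hl hl') B
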